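/- **Conventions.** A function $\varepsilon:\mathbb N\to\mathbb R$ is negligible if $\kappa^{c}\varepsilon(\kappa)\to 0$ for every $c\in\mathbb N$. Quantum circuits consist of single-qubit preparations in state $|0\rangle$, single-qubit measurements in the computational basis, and the gates $\mathsf X,\mathsf Z,\mathsf P,\mathsf H,\mathsf{CNOT}$ and $\mathsf R=\mathrm{diag}(1,e^{i\pi/4})$; wires that are not outputs are discarded, and $\Phi_{\mathsf C}$ is the channel induced by $\mathsf C$. A *stabilizer circuit* is one without $\mathsf R$ gates (Clifford gates together with preparations and measurements). Classical circuits are arithmetic circuits over $\mathbb F_2$. The size of a circuit is its number of inputs and of gates (including preparations, measurements, and random input bits). A quantum (resp. classical probabilistic) polynomial-time algorithm is a polynomial-time uniform family of quantum circuits (resp. of classical circuits with additional uniformly random input bits). A *classical homomorphic encryption scheme* $\mathsf{HE}$ consists of classical probabilistic polynomial-time algorithms $\mathsf{KeyGen}(1^\kappa)\to(pk,evk,sk)$, $\mathsf{Enc}_{pk}(\mu)$ for bits $\mu$, $\mathsf{Eval}^f_{evk}(c_1,\dots,c_\ell)$ for circuits $f:\{0,1\}^\ell\to\{0,1\}$,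 and $\mathsf{Dec}_{sk}(c)\in\{0,1\}$. It is *fully homomorphic* if (i) there is a polynomial $s$ such that, for all $\kappa$ and $f$, the circuit decrypting outputs of $\mathsf{Eval}^f$ has size at most $s(\kappa)$, and (ii) for every sequence of circuits $f_\kappa$ of size polynomial in $\kappa$ and all inputs $\mu^{(\kappa)}$, the probability that $\mathsf{Dec}_{sk}(\mathsf{Eval}^{f_\kappa}_{evk}(\mathsf{Enc}_{pk}(\mu_1),\dots,\mathsf{Enc}_{pk}(\mu_\ell)))\ne f_\kappa(\mu_1,\dots,\mu_\ell)$ is negligible. It is *q-IND-CPA secure* if for every quantum polynomial-time $\mathcal A$ the quantity $|\Pr[\mathcal A(pk,evk,\mathsf{Enc}_{pk}(0))=1]-\Pr[\mathcal A(pk,evk,\mathsf{Enc}_{pk}(1))=1]|$ is bounded by a negligible function. A *quantum homomorphic encryption scheme* $\mathsf{QHE}$ consists of quantum polynomial-time algorithms $\mathsf{KeyGen}(1^\kappa)\to(pk,sk,\rho_{evk})$ with $pk,sk$ classical, $\mathsf{Enc}_{pk}$ mapping a qubit to a cipher register $\mathcal C$, $\mathsf{Eval}^{\mathsf C}$ mapping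 $\rho_{evk}$ and $n$ cipher registers to $m$ registers $\mathcal C'$, for every quantum circuit $\mathsf C$ with $n$ input and $m$ output qubits, and $\mathsf{Dec}_{sk}$ mapping a register $\mathcal C'$ to a qubit. * It is *q-IND-CPA secure* if for every quantum polynomial-time adversary $(\mathcal A_1,\mathcal A_2)$ the probability of winning the following experiment is at most $\tfrac12$ plus a negligible function: $\mathcal A_1$ receives $(pk,\rho_{evk})$ and outputs a state of a message qubit and an environment; for a uniformly random bit $r$ the message is encrypted if $r=1$, and replaced by an encryption of $|0\rangle\langle 0|$ if $r=0$; $\mathcal A_2$ receives the ciphertext and the environment and wins if it outputs $r$. * It is *compact* if there is a polynomial $p$ such that, for all $\kappa$ and all quantum circuits $\mathsf C$, the circuit decrypting an output register of $\mathsf{Eval}^{\mathsf C}$ has size at most $p(\kappa)$. * It is *homomorphic for a class* $\mathscr C=\{\mathscr C_\kappa\}$ of quantum circuits if for every sequence $\mathsf C_\kappa\in\mathscr C_\kappa$ of circuits of size polynomial in $\kappa$, with $n(\kappa)$ inputs and $m(\kappa)$ outputs, and all states $\rho_\kappa$ of $n(\kappa)$ qubits and a finite-dimensional auxiliary system, the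 expected value over the keys $(pk,sk)$ of $$\Delta\Big(\mathsf{Dec}_{sk}^{\otimes m}\big(\mathsf{Eval}^{\mathsf C_\kappa}(\rho_{evk},\mathsf{Enc}_{pk}^{\otimes n}(\rho_\kappa))\big),\ \Phi_{\mathsf C_\kappa}(\rho_\kappa)\Big),\qquad \Delta(\rho,\sigma)=\mathrm{Tr}\sqrt{(\rho-\sigma)^\dagger(\rho-\sigma)},$$ is bounded by a negligible function. **Theorem.** Assume that there is a classical fully homomorphic encryption scheme that is q-IND-CPA secure. Then there is a quantum homomorphic encryption scheme that is q-IND-CPA secure, compact, and homomorphic for the class of stabilizer circuits (in particular, for Clifford circuits). -/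

import Mathlib

open Matrix
open scoped ComplexOrder

noncomputable section

namespace QHom

/-! ## Polynomial-time computation

A small imperative machine model with an explicit cost.  Programs act on binary trees.  Every
primitive step is charged at least the size of the tree that it produces, so that (unlike in a
unit-cost model with sharing) a run of time `t` can be simulated by a Turing machine in time
polynomial in `t` and the size of the input; conversely the tapes of a Turing machine are lists, hence trees, and one of its
steps costs at most linear time here.  The functions computable in polynomial time are therefore
the usual ones. -/

/-- Binary trees, the data of the machine. -/
inductive Data : Type
  | nil : Data
  | cons (l r : Data) : Data

namespace Data

/-- The number of nodes of a tree, leaves included. -/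
def size : Data → ℕ
  | nil => 1
  | cons l r => l.size + r.size + 1

/-- Natural numbers in unary. -/
def nat : ℕ → Data
  | 0 => nil
  | k + 1 => cons nil (nat k)

/-- Bits. -/
def bit (b : Bool) : Data := if b then nat 1 else nat 0

/-- Lists. -/
def list : List Data → Data
  | [] => nil
  | a :: l => cons a (list l)

end Data

/-- Programs: constant `nil`, identity, the two projections, pairing, composition
(`comp g f` is `g` after `f`), branching and while loops. -/
inductive Prog : Type
  | nil : Prog
  | id : Prog
  | left : Prog
  | right : Prog
  | pair (f g : Prog) : Prog
  | comp (g f : Prog) : Prog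
  | ite (c f g : Prog) : Prog
  | loop (c f : Prog) : Prog

/-- `Runs p x y t`: on input `x` the program `p` halts with output `y` after time `t`.
A test `c` counts as true if its output is not `nil`. -/
inductive Runs : Prog → Data → Data → ℕ → Prop
  | nil (x) : Runs .nil x .nil 1
  | id (x) : Runs .id x x x.size
  | left_nil : Runs .left .nil .nil 1
  | left_cons (a b) : Runs .left (.cons a b) a (Data.cons a b).size
  | right_nil : Runs .right .nil .nil 1
  | right_cons (a b) : Runs .right (.cons a b) b (Data.cons a b).size
  | pair {f g x y z s t} : Runs f x y s → Runs g x z t →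
      Runs (.pair f g) x (.cons y z) (s + t + 1)
  | comp {f g x y z s t} : Runs f x y s → Runs g y z t → Runs (.comp g f) x z (s + t + 1)
  | ite_true {c f g x u v y s t} : Runs c x (.cons u v) s → Runs f x y t →
      Runs (.ite c f g) x y (s + t + 1)
  | ite_false {c f g x y s t} : Runs c x .nil s → Runs g x y t →
      Runs (.ite c f g) x y (s + t + 1)
  | loop_stop {c f x s} : Runs c x .nil s → Runs (.loop c f) x x (s + x.size + 1)
  | loop_step {c f x u v y z r s t} : Runs c x (.cons u v) s → Runs f x y t →
      Runs (.loop c f) y z r → Runs (.loop c f) x z (s + t + r + 1)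

/-- One program computes `out i` from `inp i`, for every `i`, in time polynomial in the size of
`inp i`. -/
def PolyTime {ι : Type} (inp out : ι → Data) : Prop :=
  ∃ (p : Prog) (q : Polynomial ℕ), ∀ i, ∃ t ≤ q.eval (inp i).size, Runs p (inp i) (out i) t

/-- Negligible functions of the security parameter. -/
def Negligible (ε : ℕ → ℝ) : Prop :=
  Asymptotics.SuperpolynomialDecay Filter.atTop (fun κ : ℕ => (κ : ℝ)) ε

/-! ## Bit strings -/

/-- Bit strings of length `n`. -/
abbrev Bits (n : ℕ) : Type := Fin n → Bool

/-- The first `a` bits. -/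
def takeBits {a b : ℕ} (u : Bits (a + b)) : Bits a := fun i => u (Fin.castAdd b i)

/-- The last `b` bits. -/
def dropBits {a b : ℕ} (u : Bits (a + b)) : Bits b := fun i => u (Fin.natAdd a i)

/-- Concatenation of `n` blocks of length `k`. -/
def flat {n k : ℕ} (x : Fin n → Bits k) : Bits (n * k) :=
  fun i => x (finProdFinEquiv.symm i).1 (finProdFinEquiv.symm i).2

/-- Division into `n` blocks of length `k`. -/
def blocks {n k : ℕ} (y : Bits (n * k)) : Fin n → Bits k :=
  fun i j => y (finProdFinEquiv (i, j))

/-! ## Classical circuits -/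

/-- Gates of arithmetic circuits over `𝔽₂`.  Arguments are numbers of wires. -/
inductive ArithGate : Type
  | const (b : Bool) : ArithGate
  | add (i j : ℕ) : ArithGate
  | mul (i j : ℕ) : ArithGate

/-- The value of a gate when the existing wires carry the values `v` (a wire that does not exist
carries `0`). -/
def ArithGate.eval (v : List Bool) : ArithGate → Bool
  | const b => b
  | add i j => xor (v.getD i false) (v.getD j false)
  | mul i j => v.getD i false && v.getD j false

/-- Code of a gate. -/
def ArithGate.code : ArithGate → Data
  | const b => .cons (.nat 0) (.bit b)
  | add i j => .cons (.nat 1) (.cons (.nat i) (.nat j))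
  | mul i j => .cons (.nat 2) (.cons (.nat i) (.nat j))

/-- Arithmetic circuits over `𝔽₂` (Boolean circuits) with `n` inputs and `m` outputs.  The input
wires are `0, …, n - 1`, and each gate adds one wire. -/
structure ArithCircuit (n m : ℕ) where
  gates : List ArithGate
  out : Fin m → ℕ

namespace ArithCircuit

variable {n m : ℕ}

/-- The values of all wires on input `x`. -/
def wires (C : ArithCircuit n m) (x : Bits n) : List Bool :=
  C.gates.foldl (fun v g => v ++ [g.eval v]) (List.ofFn x)

/-- The function computed by the circuit. -/
def eval (C : ArithCircuit n m) (x : Bits n) : Bits m :=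
  fun k => (C.wires x).getD (C.out k) false

/-- Circuit size: number of inputs and gates. -/
def size (C : ArithCircuit n m) : ℕ := n + C.gates.length

/-- Code of a circuit. -/
def code (C : ArithCircuit n m) : Data :=
  .cons (.nat n) (.cons (.list (C.gates.map ArithGate.code))
    (.list (List.ofFn fun k => Data.nat (C.out k))))

end ArithCircuit

/-- Randomized circuits: circuits with additional inputs that are uniformly random bits. -/
structure RandCircuit (n m : ℕ) where
  coins : ℕ
  circuit : ArithCircuit (n + coins) m

namespace RandCircuit

variable {n m : ℕ}

/-- The probability that the output is `y` when the input is `x`. -/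
def prob (C : RandCircuit n m) (x : Bits n) (y : Bits m) : ℝ :=
  ((Finset.univ.filter fun s : Bits C.coins => C.circuit.eval (Fin.append x s) = y).card : ℝ) /
    2 ^ C.coins

/-- Circuit size: number of inputs, coins and gates. -/
def size (C : RandCircuit n m) : ℕ := C.circuit.size

/-- Code of a circuit. -/
def code (C : RandCircuit n m) : Data := .cons (.nat C.coins) C.circuit.code

end RandCircuit

/-! ## Operators and channels -/

/-- Linear operators on the space with orthonormal basis `α`. -/
abbrev Op (α : Type) : Type := Matrix α α ℂ

/-- Density operators. -/
def IsDensity {α : Type} [Fintype α] (ρ : Op α) : Prop := ρ.PosSemidef ∧ ρ.trace = 1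

/-- The pure state `|x⟩⟨x|`. -/
def ketbra {α : Type} [DecidableEq α] (x : α) : Op α := Matrix.single x x 1

/-- Tensor product of operators on two registers of qubits. -/
def tensor {a b : ℕ} (σ : Op (Bits a)) (ρ : Op (Bits b)) : Op (Bits (a + b)) :=
  Matrix.of fun u v => σ (takeBits u) (takeBits v) * ρ (dropBits u) (dropBits v)

/-- `Φ ⊗ id` on a system with an additional register `ε`, for a linear map `Φ` on operators. -/
def withEnv {α β : Type} (ε : Type) (Φ : Op α → Op β) (ρ : Op (α × ε)) : Op (β × ε) :=
  Matrix.of fun p q => Φ (Matrix.of fun a a' => ρ (a, p.2) (a', q.2)) p.1 q.1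

/-- `Φ^{⊗ n}`, for a linear map `Φ` on operators. -/
def tensorPow {α β : Type} [Fintype α] [DecidableEq α] (n : ℕ) (Φ : Op α → Op β)
    (ρ : Op (Fin n → α)) : Op (Fin n → β) :=
  Matrix.of fun b b' =>
    ∑ a, ∑ a', ρ a a' * ∏ i, Φ (Matrix.single (a i) (a' i) 1) (b i) (b' i)

/-- The trace norm `Tr √(A† A)`: the sum of the square roots of the eigenvalues of `A† A`. -/
def traceNorm {α : Type} [Fintype α] [DecidableEq α] (A : Op α) : ℝ :=
  ∑ i, Real.sqrt ((Matrix.isHermitian_conjTranspose_mul_self A).eigenvalues i)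

/-! ## Quantum circuits -/

/-- Pauli `X`. -/
def matX : Op Bool := Matrix.of fun a b => if a = b then 0 else 1

/-- Pauli `Z`. -/
def matZ : Op Bool := Matrix.diagonal fun b => if b then -1 else 1

/-- The phase gate. -/
def matP : Op Bool := Matrix.diagonal fun b => if b then Complex.I else 1

/-- The `π/8` gate. -/
def matR : Op Bool :=
  Matrix.diagonal fun b => if b then Complex.exp (Complex.I * Real.pi / 4) else 1

/-- The Hadamard gate. -/
def matH : Op Bool :=
  Matrix.of fun a b => if a && b then -(1 / (Real.sqrt 2 : ℂ)) else 1 / (Real.sqrt 2 : ℂ)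

/-- The single-qubit operator `u` on wire `i`. -/
def onWire {w : ℕ} (u : Op Bool) (i : Fin w) : Op (Bits w) :=
  Matrix.of fun x y => if ∀ j, j ≠ i → x j = y j then u (x i) (y i) else 0

/-- The controlled-not operator with control `i` and target `j`. -/
def onWires {w : ℕ} (i j : Fin w) : Op (Bits w) :=
  Matrix.of fun x y => if x = Function.update y j (xor (y i) (y j)) then 1 else 0

/-- Gates on `w` wires; `meas` is a measurement in the computational basis, whose result stays on
the wire. -/
inductive QGate (w : ℕ) : Type
  | X (i : Fin w) : QGate w
  | Z (i : Fin w) : QGate w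
  | P (i : Fin w) : QGate w
  | R (i : Fin w) : QGate w
  | H (i : Fin w) : QGate w
  | cnot (i j : Fin w) (h : i ≠ j) : QGate w
  | meas (i : Fin w) : QGate w

namespace QGate

variable {w : ℕ}

/-- The action of a gate on operators. -/
def apply (ρ : Op (Bits w)) : QGate w → Op (Bits w)
  | X i => onWire matX i * ρ * (onWire matX i)ᴴ
  | Z i => onWire matZ i * ρ * (onWire matZ i)ᴴ
  | P i => onWire matP i * ρ * (onWire matP i)ᴴ
  | R i => onWire matR i * ρ * (onWire matR i)ᴴ
  | H i => onWire matH i * ρ * (onWire matH i)ᴴ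
  | cnot i j _ => onWires i j * ρ * (onWires i j)ᴴ
  | meas i => Matrix.of fun x y => if x i = y i then ρ x y else 0

/-- All gates but the `π/8` gate are Clifford gates or measurements. -/
def IsStabilizer : QGate w → Prop
  | R _ => False
  | _ => True

/-- Code of a gate. -/
def code : QGate w → Data
  | X i => .cons (.nat 0) (.nat i)
  | Z i => .cons (.nat 1) (.nat i)
  | P i => .cons (.nat 2) (.nat i)
  | R i => .cons (.nat 3) (.nat i)
  | H i => .cons (.nat 4) (.nat i)
  | cnot i j _ => .cons (.nat 5) (.cons (.nat i) (.nat j))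
  | meas i => .cons (.nat 6) (.nat i)

end QGate

/-- Quantum circuits with `n` input qubits and `m` output qubits.  Wires `0, …, n - 1` are the
input, the `fresh` following wires are prepared in the state `|0⟩`, and all wires that are not
output wires are discarded at the end. -/
structure QCircuit (n m : ℕ) where
  fresh : ℕ
  gates : List (QGate (n + fresh))
  out : Fin m ↪ Fin (n + fresh)

namespace QCircuit

variable {n m : ℕ}

/-- The joint state of all wires after the last gate. -/
def run (C : QCircuit n m) (ρ : Op (Bits n)) : Op (Bits (n + C.fresh)) :=
  C.gates.foldl (fun σ g => g.apply σ) (tensor ρ (ketbra fun _ => false))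

/-- The channel induced by a circuit: the reduced state of the output wires. -/
def chan (C : QCircuit n m) (ρ : Op (Bits n)) : Op (Bits m) :=
  Matrix.of fun a b => ∑ x, ∑ y,
    if (∀ k, x (C.out k) = a k) ∧ (∀ k, y (C.out k) = b k) ∧
      (∀ j, (∀ k, C.out k ≠ j) → x j = y j) then C.run ρ x y else 0

/-- Circuit size: number of inputs, preparations, gates and measurements. -/
def size (C : QCircuit n m) : ℕ := n + C.fresh + C.gates.length

/-- Stabilizer circuits: Clifford gates, preparations and measurements. -/
def IsStabilizer (C : QCircuit n m) : Prop := ∀ g ∈ C.gates, g.IsStabilizer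

/-- Code of a circuit. -/
def code (C : QCircuit n m) : Data :=
  .cons (.nat n) (.cons (.nat C.fresh) (.cons (.list (C.gates.map QGate.code))
    (.list (List.ofFn fun k => Data.nat (C.out k)))))

end QCircuit

/-- The probability of the result `b` when the single output qubit of `C`, run on `ρ`, is
measured. -/
def QCircuit.prob {n : ℕ} (C : QCircuit n 1) (ρ : Op (Bits n)) (b : Bool) : ℝ :=
  (C.chan ρ (fun _ => b) (fun _ => b)).re

/-! ## Classical homomorphic encryption -/

/-- A classical (public-key, bitwise) homomorphic encryption scheme.  Its algorithms are
polynomial-time uniform families of randomized circuits.  The length of an evaluated ciphertext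
may depend on the evaluated circuit. -/
structure ClassicalHE where
  pkLen : ℕ → ℕ
  skLen : ℕ → ℕ
  evkLen : ℕ → ℕ
  ctLen : ℕ → ℕ
  evLen : (κ : ℕ) → {l : ℕ} → ArithCircuit l 1 → ℕ
  /-- outputs the public key, the secret key and the evaluation key -/
  keyGen : (κ : ℕ) → RandCircuit 0 (pkLen κ + skLen κ + evkLen κ)
  /-- takes the public key and a bit -/
  enc : (κ : ℕ) → RandCircuit (pkLen κ + 1) (ctLen κ)
  /-- takes the evaluation key and `l` ciphertexts -/
  eval : (κ : ℕ) → {l : ℕ} → (f : ArithCircuit l 1) →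
    RandCircuit (evkLen κ + l * ctLen κ) (evLen κ f)
  /-- takes the secret key and an evaluated ciphertext of length `L` -/
  dec : (κ L : ℕ) → RandCircuit (skLen κ + L) 1
  keyGen_poly : PolyTime Data.nat (fun κ => (keyGen κ).code)
  enc_poly : PolyTime Data.nat (fun κ => (enc κ).code)
  eval_poly : PolyTime
    (fun i : ℕ × (Σ l : ℕ, ArithCircuit l 1) => .cons (.nat i.1) i.2.2.code)
    (fun i => (eval i.1 i.2.2).code)
  dec_poly : PolyTime (fun i : ℕ × ℕ => .cons (.nat i.1) (.nat i.2))
    (fun i => (dec i.1 i.2).code)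

namespace ClassicalHE

variable (E : ClassicalHE)

/-- The probability that key generation outputs `(pk, sk, evk)`. -/
def keyProb (κ : ℕ) (pk : Bits (E.pkLen κ)) (sk : Bits (E.skLen κ)) (evk : Bits (E.evkLen κ)) :
    ℝ :=
  (E.keyGen κ).prob (fun i => i.elim0) (Fin.append (Fin.append pk sk) evk)

/-- The probability that `c` is output as an encryption of `μ`. -/
def encProb (κ : ℕ) (pk : Bits (E.pkLen κ)) (μ : Bool) (c : Bits (E.ctLen κ)) : ℝ :=
  (E.enc κ).prob (Fin.append pk fun _ => μ) c

/-- The probability that homomorphic evaluation of `f` on `c` outputs `c'`. -/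
def evalProb (κ : ℕ) {l : ℕ} (f : ArithCircuit l 1) (evk : Bits (E.evkLen κ))
    (c : Fin l → Bits (E.ctLen κ)) (c' : Bits (E.evLen κ f)) : ℝ :=
  (E.eval κ f).prob (Fin.append evk (flat c)) c'

/-- The probability that decryption of `c` outputs `μ`. -/
def decProb (κ : ℕ) {L : ℕ} (sk : Bits (E.skLen κ)) (c : Bits L) (μ : Bool) : ℝ :=
  (E.dec κ L).prob (Fin.append sk c) fun _ => μ

/-- The probability that encrypting `μ`, evaluating `f` and decrypting gives a bit other than
`f(μ)`. -/
def failProb (κ : ℕ) {l : ℕ} (f : ArithCircuit l 1) (μ : Bits l) : ℝ :=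
  ∑ pk, ∑ sk, ∑ evk, E.keyProb κ pk sk evk *
    ∑ c : Fin l → Bits (E.ctLen κ), (∏ i, E.encProb κ pk (μ i) (c i)) *
      ∑ c' : Bits (E.evLen κ f), E.evalProb κ f evk c c' * E.decProb κ sk c' (!(f.eval μ 0))

/-- Homomorphic for all arithmetic circuits over `𝔽₂`: for every sequence of circuits of
polynomial size and inputs the probability of a wrong result is negligible. -/
def Homomorphic : Prop :=
  ∀ (l : ℕ → ℕ) (f : ∀ κ, ArithCircuit (l κ) 1) (μ : ∀ κ, Bits (l κ)),
    (∃ p : Polynomial ℕ, ∀ κ, (f κ).size ≤ p.eval κ) →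
    ∃ ε, Negligible ε ∧ ∀ κ, E.failProb κ (f κ) (μ κ) ≤ ε κ

/-- The circuit complexity of decrypting the output of an evaluation is bounded by a polynomial in
the security parameter, whatever circuit is evaluated. -/
def Compact : Prop :=
  ∃ p : Polynomial ℕ, ∀ (κ l : ℕ) (f : ArithCircuit l 1),
    (E.dec κ (E.evLen κ f)).size ≤ p.eval κ

/-- Fully homomorphic. -/
def FullyHomomorphic : Prop := E.Compact ∧ E.Homomorphic

/-- The probability that `A`, given the public key, the evaluation key and an encryption of `μ`,
outputs `1`. -/
def acceptProb (κ : ℕ) (A : QCircuit (E.pkLen κ + E.evkLen κ + E.ctLen κ) 1) (μ : Bool) : ℝ :=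
  ∑ pk, ∑ sk, ∑ evk, E.keyProb κ pk sk evk * ∑ c, E.encProb κ pk μ c *
    A.prob (ketbra (Fin.append (Fin.append pk evk) c)) true

/-- Security against chosen plaintext attacks by quantum polynomial-time adversaries. -/
def QIndCPA : Prop :=
  ∀ A : ∀ κ, QCircuit (E.pkLen κ + E.evkLen κ + E.ctLen κ) 1,
    PolyTime Data.nat (fun κ => (A κ).code) →
    ∃ ε, Negligible ε ∧
      ∀ κ, |E.acceptProb κ (A κ) false - E.acceptProb κ (A κ) true| ≤ ε κ

end ClassicalHE

/-! ## Quantum homomorphic encryption -/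

/-- A (public-key, qubit-by-qubit) quantum homomorphic encryption scheme.  Its algorithms are
polynomial-time uniform families of quantum circuits.  The cipher space of the output of an
evaluation consists of `evLen κ C` qubits for each of the output qubits of the circuit `C`. -/
structure QuantumHE where
  pkLen : ℕ → ℕ
  skLen : ℕ → ℕ
  evkLen : ℕ → ℕ
  ctLen : ℕ → ℕ
  evLen : (κ : ℕ) → {n m : ℕ} → QCircuit n m → ℕ
  /-- outputs the public key, the secret key and the evaluation key; the first two are measured -/
  keyGen : (κ : ℕ) → QCircuit 0 (pkLen κ + skLen κ + evkLen κ)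
  /-- takes the public key and a qubit -/
  enc : (κ : ℕ) → QCircuit (pkLen κ + 1) (ctLen κ)
  /-- takes the evaluation key and `n` cipher registers -/
  eval : (κ : ℕ) → {n m : ℕ} → (C : QCircuit n m) →
    QCircuit (evkLen κ + n * ctLen κ) (m * evLen κ C)
  /-- takes the secret key and one evaluated cipher register of `L` qubits -/
  dec : (κ L : ℕ) → QCircuit (skLen κ + L) 1
  keyGen_poly : PolyTime Data.nat (fun κ => (keyGen κ).code)
  enc_poly : PolyTime Data.nat (fun κ => (enc κ).code)
  eval_poly : PolyTime
    (fun i : ℕ × (Σ n : ℕ, Σ m : ℕ, QCircuit n m) => .cons (.nat i.1) i.2.2.2.code)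
    (fun i => (eval i.1 i.2.2.2).code)
  dec_poly : PolyTime (fun i : ℕ × ℕ => .cons (.nat i.1) (.nat i.2))
    (fun i => (dec i.1 i.2).code)

namespace QuantumHE

variable (Q : QuantumHE)

/-- The state `ρ_evk` for given classical keys, multiplied with the probability of these keys. -/
def evkState (κ : ℕ) (pk : Bits (Q.pkLen κ)) (sk : Bits (Q.skLen κ)) : Op (Bits (Q.evkLen κ)) :=
  Matrix.of fun e e' => (Q.keyGen κ).chan 1
    (Fin.append (Fin.append pk sk) e) (Fin.append (Fin.append pk sk) e')

/-- The channel `Enc_pk`. -/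
def encChan (κ : ℕ) (pk : Bits (Q.pkLen κ)) (ρ : Op Bool) : Op (Bits (Q.ctLen κ)) :=
  (Q.enc κ).chan (tensor (ketbra pk) (ρ.submatrix (fun x => x 0) (fun x => x 0)))

/-- The channel `Eval^C`, with `σ` as the evaluation key. -/
def evalChan (κ : ℕ) {n m : ℕ} (C : QCircuit n m) (σ : Op (Bits (Q.evkLen κ)))
    (ρ : Op (Fin n → Bits (Q.ctLen κ))) : Op (Fin m → Bits (Q.evLen κ C)) :=
  ((Q.eval κ C).chan (tensor σ (ρ.submatrix blocks blocks))).submatrix flat flat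

/-- The channel `Dec_sk`. -/
def decChan (κ : ℕ) {L : ℕ} (sk : Bits (Q.skLen κ)) (ρ : Op (Bits L)) : Op Bool :=
  ((Q.dec κ L).chan (tensor (ketbra sk) ρ)).submatrix (fun b _ => b) (fun b _ => b)

/-- Encryption, evaluation and decryption with given classical keys, multiplied with the
probability of these keys. -/
def process (κ : ℕ) {n m : ℕ} (C : QCircuit n m) (pk : Bits (Q.pkLen κ)) (sk : Bits (Q.skLen κ))
    (ρ : Op (Bits n)) : Op (Bits m) :=
  tensorPow m (Q.decChan κ sk)
    (Q.evalChan κ C (Q.evkState κ pk sk) (tensorPow n (Q.encChan κ pk) ρ))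

/-- The expected value, over the choice of the keys, of the trace distance between the decrypted
result of the evaluation of `C` and the result of `C`, for an input that may be entangled with an
additional register of dimension `d`. -/
def evalError (κ : ℕ) {n m d : ℕ} (C : QCircuit n m) (ρ : Op (Bits n × Fin d)) : ℝ :=
  ∑ pk, ∑ sk, traceNorm
    (withEnv (Fin d) (Q.process κ C pk sk) ρ -
      (Q.evkState κ pk sk).trace • withEnv (Fin d) C.chan ρ)

/-- Homomorphic for the class `𝒞`: for every sequence of circuits of polynomial size from the class
and every sequence of input states the error is negligible. -/
def HomomorphicFor (𝒞 : (κ : ℕ) → (n m : ℕ) → Set (QCircuit n m)) : Prop :=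
  ∀ (n m d : ℕ → ℕ) (C : ∀ κ, QCircuit (n κ) (m κ)) (ρ : ∀ κ, Op (Bits (n κ) × Fin (d κ))),
    (∀ κ, C κ ∈ 𝒞 κ (n κ) (m κ)) →
    (∃ p : Polynomial ℕ, ∀ κ, (C κ).size ≤ p.eval κ) →
    (∀ κ, IsDensity (ρ κ)) →
    ∃ ε, Negligible ε ∧ ∀ κ, Q.evalError κ (C κ) (ρ κ) ≤ ε κ

/-- The circuit complexity of decrypting an output register of an evaluation is bounded by a
polynomial in the security parameter, whatever quantum circuit is evaluated. -/
def Compact : Prop :=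
  ∃ p : Polynomial ℕ, ∀ (κ n m : ℕ) (C : QCircuit n m),
    (Q.dec κ (Q.evLen κ C)).size ≤ p.eval κ

/-- Quantum polynomial-time adversaries in the indistinguishability experiment.  The first part
takes the public key and the evaluation key and outputs a message qubit and an environment
register; the second takes the cipher register and the environment and outputs a bit. -/
structure Adversary where
  envLen : ℕ → ℕ
  first : (κ : ℕ) → QCircuit (Q.pkLen κ + Q.evkLen κ) (1 + envLen κ)
  second : (κ : ℕ) → QCircuit (Q.ctLen κ + envLen κ) 1
  first_poly : PolyTime Data.nat (fun κ => (first κ).code)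
  second_poly : PolyTime Data.nat (fun κ => (second κ).code)

/-- The challenger: for `r = 1` the message is encrypted, for `r = 0` it is discarded and `|0⟩⟨0|`
is encrypted. -/
def challenge (κ : ℕ) (pk : Bits (Q.pkLen κ)) (r : Bool) (ρ : Op Bool) : Op (Bits (Q.ctLen κ)) :=
  if r then Q.encChan κ pk ρ else ρ.trace • Q.encChan κ pk (ketbra false)

/-- The state of message and environment that the first part of the adversary outputs, multiplied
with the probability of the public key. -/
def messageState (A : Q.Adversary) (κ : ℕ) (pk : Bits (Q.pkLen κ)) :
    Op (Bool × Bits (A.envLen κ)) :=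
  ((A.first κ).chan (tensor (ketbra pk) (∑ sk, Q.evkState κ pk sk))).submatrix
    (fun z => Fin.append (fun _ => z.1) z.2) (fun z => Fin.append (fun _ => z.1) z.2)

/-- The probability that the adversary wins: `r` is uniformly random and is guessed. -/
def winProb (A : Q.Adversary) (κ : ℕ) : ℝ :=
  ∑ r : Bool, 1 / 2 * ∑ pk, (A.second κ).prob
    ((withEnv (Bits (A.envLen κ)) (Q.challenge κ pk r) (Q.messageState A κ pk)).submatrix
      (fun u => (takeBits u, dropBits u)) (fun u => (takeBits u, dropBits u))) r

/-- Quantum indistinguishability under chosen plaintext attacks. -/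
def QIndCPA : Prop :=
  ∀ A : Q.Adversary, ∃ ε, Negligible ε ∧ ∀ κ, Q.winProb A κ ≤ 1 / 2 + ε κ

end QuantumHE

/-- The class of stabilizer circuits: all circuits that consist of Clifford gates, single-qubit
preparations and single-qubit measurements. -/
def stabilizerCircuits (_κ n m : ℕ) : Set (QCircuit n m) := {C | C.IsStabilizer}

end QHom

end

noncomputable section

namespace QHom

/-! ## Closure properties of polynomial-time functions -/

/-! The scheme combines the quantum one-time pad with the classical scheme. A qubit is encrypted by
applying `X^a Z^b` for uniformly random bits `a`, `b`, and the ciphertext consists of this qubit and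
of classical encryptions of `a` and `b`.

Evaluation rests on the fact that Clifford gates conjugate Pauli operators to Pauli operators. A
computational basis measurement is compatible with Pauli operators as well: `X` flips its result and
`Z` disappears. A stabilizer circuit can therefore be run directly on padded qubits. Its output is
the correct output up to a Pauli operator whose keys are linear functions over `𝔽₂` of the input
keys (`heis_pauliF` for a gate, `QCircuit.IsStabilizer.chan_pauli` for a circuit). The key transport
is a product of elementary additions, so the coefficients of one output key arise by applying the
transposed additions in reverse order to a unit vector (`dot_transport`, `dot_formVec`). Each of the
`2m` output keys is thus an inner product of the `2n` input keys with known coefficients. The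
evaluator encrypts the coefficients as well and evaluates the one circuit `ipCircuit (2 * n)`
homomorphically. For this the public key is made a part of the evaluation key. All evaluated
ciphertexts then have the same length, which depends on the evaluated circuit only through `n`.
Decryption consists of two classical decryptions and one Pauli operator, so compactness is inherited
(`compact_scheme`).

Correctness: by `process_apply`, encryption, evaluation and decryption together are exactly the
channel of the circuit followed by a random Pauli operator, whose keys are the differences between
the decrypted and the true output keys. This operator is trivial unless one of the `2m` classical
evaluations has failed. A union bound and the estimate of the trace norm of a difference of positive
operators (`traceNorm_sub_le`, `traceNorm_mixture`) give `evalError_le`.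

Security: if the two classical ciphertexts are replaced by encryptions of `0`, nothing but the
padded qubit depends on the pad, and averaging over the pad makes the two experiments coincide
(`sum_attackK`). The replacement takes two steps (`hybrid`), and each step changes the output
probability by half the advantage of an explicit attack on the classical scheme. This attack,
`attackCircuit`, plays the experiment by itself, with its challenge in the place of one of the two
ciphertexts. `winProb_le` collects the estimates.

All circuits are treated in the Heisenberg picture. A functional on operators is given by its values
on the matrix units `|u⟩⟨v|`, where `u` and `v` assign bits to infinitely many numbered wires, and a
gate pulls functionals back (`heisL`, tied to circuits by `QCircuit.chan_apply`). Renumbering of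
wires and inclusion of subcircuits are then identities between functions. The classical algorithms
are compiled to Toffoli gates, hence to circuits with `π/8` gates, which the algorithms of the
scheme may contain although the evaluated circuits may not. Nothing is uncomputed: the inputs of the
classical parts agree in `u` and `v`, so the garbage agrees too, and it is harmless for functionals
that trace out the wires with the garbage (`TracedOn`, `heisL_call`). Uniformity is proved with the
predicate `PF`, which is closed under the usual list operations. -/

theorem eval_mono_nat (q : Polynomial ℕ) {a b : ℕ} (h : a ≤ b) : q.eval a ≤ q.eval b := by
  rw [Polynomial.eval_eq_sum, Polynomial.eval_eq_sum]
  unfold Polynomial.sum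
  exact Finset.sum_le_sum fun n _ => Nat.mul_le_mul_left _ (Nat.pow_le_pow_left h n)

/-- Every primitive step is charged at least the size of what it produces. This is what makes
polynomial time closed under composition: the input of the second program is polynomially bounded.
-/
theorem Runs.size_le {p : Prog} {x y : Data} {t : ℕ} (h : Runs p x y t) : y.size ≤ t := by
  induction h <;> (try simp only [Data.size] at *) <;> omega

/-- Types with a representation as trees. -/
class Enc (α : Type) where
  enc : α → Data

open Enc

instance : Enc Data := ⟨fun d => d⟩
instance : Enc Unit := ⟨fun _ => .nil⟩
instance : Enc Bool := ⟨Data.bit⟩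
instance : Enc ℕ := ⟨Data.nat⟩
instance {α β : Type} [Enc α] [Enc β] : Enc (α × β) := ⟨fun p => .cons (enc p.1) (enc p.2)⟩
instance {α : Type} [Enc α] : Enc (List α) := ⟨fun l => Data.list (l.map enc)⟩

/-- The size of the representation. -/
def esize {α : Type} [Enc α] (a : α) : ℕ := (enc a).size

/-- Functions computable in polynomial time. -/
@[fun_prop]
def PF {α β : Type} [Enc α] [Enc β] (f : α → β) : Prop :=
  PolyTime (enc : α → Data) fun a => enc (f a)

/-! ### Sizes of encoded data. -/

section Enc

variable {α β : Type} [Enc α] [Enc β]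

@[simp] theorem enc_prod (a : α) (b : β) : enc (a, b) = Data.cons (enc a) (enc b) := rfl
@[simp] theorem enc_nil : enc ([] : List α) = Data.nil := rfl
@[simp] theorem enc_cons (a : α) (l : List α) : enc (a :: l) = Data.cons (enc a) (enc l) := rfl
@[simp] theorem enc_zero : enc (0 : ℕ) = Data.nil := rfl
@[simp] theorem enc_succ (n : ℕ) : enc (n + 1) = Data.cons .nil (enc n) := rfl
@[simp] theorem enc_unit : enc () = Data.nil := rfl
@[simp] theorem enc_true : enc true = Data.cons .nil .nil := rfl
@[simp] theorem enc_false : enc false = Data.nil := rfl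

@[simp] theorem esize_prod (a : α) (b : β) : esize (a, b) = esize a + esize b + 1 := rfl
@[simp] theorem esize_nil : esize ([] : List α) = 1 := rfl
@[simp] theorem esize_cons (a : α) (l : List α) : esize (a :: l) = esize a + esize l + 1 := rfl
@[simp] theorem esize_unit : esize () = 1 := rfl

@[simp] theorem esize_nat (n : ℕ) : esize n = 2 * n + 1 := by
  induction n with
  | zero => rfl
  | succ n ih =>
    have : esize (n + 1) = 1 + esize n + 1 := rfl
    omega

theorem esize_pos (a : α) : 1 ≤ esize a := by
  unfold esize
  cases enc a <;> simp [Data.size]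

theorem length_le_esize (l : List α) : l.length ≤ esize l := by
  induction l with
  | nil => simp
  | cons a l ih => simp; omega

/-- A list ends in a leaf, and only one of the two final leaves survives a concatenation; hence the
`+ 1`. -/
theorem esize_append (l l' : List α) : esize (l ++ l') + 1 = esize l + esize l' := by
  induction l with
  | nil => simp; omega
  | cons a l ih => simp; omega

theorem esize_reverse (l : List α) : esize l.reverse = esize l := by
  induction l with
  | nil => simp
  | cons a l ih =>
    have := esize_append l.reverse [a]
    simp at *
    omega

theorem esize_le_of_mem {l : List α} {a : α} (h : a ∈ l) : esize a ≤ esize l := by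
  induction l with
  | nil => simp at h
  | cons b l ih =>
    rcases List.mem_cons.1 h with rfl | h
    · simp; omega
    · have := ih h
      simp; omega

theorem esize_le_of_prefix {l l' : List α} (h : l <+: l') : esize l ≤ esize l' := by
  obtain ⟨m, rfl⟩ := h
  have := esize_append l m
  have := esize_pos m
  omega

theorem esize_le_of_forall {l : List α} {M : ℕ} (h : ∀ a ∈ l, esize a ≤ M) :
    esize l ≤ 1 + l.length * (M + 1) := by
  induction l with
  | nil => simp
  | cons a l ih =>
    have h1 := h a (by simp)
    have h2 := ih fun b hb => h b (by simp [hb])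
    simp
    nlinarith

end Enc

/-! ### Composition, branching and iteration in polynomial time. -/

namespace PF

variable {ξ α β γ δ : Type} [Enc ξ] [Enc α] [Enc β] [Enc γ] [Enc δ]

theorem size_bound {f : α → β} (hf : PF f) : ∃ q : Polynomial ℕ, ∀ a, esize (f a) ≤ q.eval (esize a) := by
  obtain ⟨p, q, h⟩ := hf
  refine ⟨q, fun a => ?_⟩
  obtain ⟨t, ht, hr⟩ := h a
  exact hr.size_le.trans ht

@[fun_prop]
theorem id' : PF (fun a : α => a) :=
  ⟨.id, Polynomial.X, fun a => ⟨_, by simp, .id _⟩⟩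

/-- A program sees only trees, so functions with the same encoded values are interchangeable even if
their types differ. Numbers are thus treated as lists, and records as tuples. -/
theorem congr_enc {f : α → β} {g : α → γ} (hf : PF f) (h : ∀ a, enc (f a) = enc (g a)) : PF g := by
  obtain ⟨p, q, hp⟩ := hf
  refine ⟨p, q, fun a => ?_⟩
  beta_reduce
  rw [← h]
  exact hp a

@[fun_prop]
theorem comp {g : β → γ} {f : α → β} (hg : PF g) (hf : PF f) : PF (fun a => g (f a)) := by
  obtain ⟨p, q, hp⟩ := hf
  obtain ⟨p', q', hp'⟩ := hg
  refine ⟨.comp p' p, q + q'.comp q + 1, fun a => ?_⟩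
  obtain ⟨t, ht, hr⟩ := hp a
  obtain ⟨t', ht', hr'⟩ := hp' (f a)
  refine ⟨_, ?_, .comp hr hr'⟩
  have := eval_mono_nat q' (hr.size_le.trans ht)
  simp at *
  omega

@[fun_prop]
theorem prodMk {f : α → β} {g : α → γ} (hf : PF f) (hg : PF g) : PF (fun a => (f a, g a)) := by
  obtain ⟨p, q, hp⟩ := hf
  obtain ⟨p', q', hp'⟩ := hg
  refine ⟨.pair p p', q + q' + 1, fun a => ?_⟩
  obtain ⟨t, ht, hr⟩ := hp a
  obtain ⟨t', ht', hr'⟩ := hp' a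
  refine ⟨_, ?_, .pair hr hr'⟩
  simp
  omega

theorem fst' : PF (fun p : α × β => p.1) :=
  ⟨.left, Polynomial.X, fun a => ⟨_, by simp [enc], .left_cons _ _⟩⟩

theorem snd' : PF (fun p : α × β => p.2) :=
  ⟨.right, Polynomial.X, fun a => ⟨_, by simp [enc], .right_cons _ _⟩⟩

@[fun_prop]
theorem fst {f : ξ → α × β} (hf : PF f) : PF (fun x => (f x).1) := fst'.comp hf

@[fun_prop]
theorem snd {f : ξ → α × β} (hf : PF f) : PF (fun x => (f x).2) := snd'.comp hf

@[fun_prop]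
theorem const (b : β) : PF (fun _ : α => b) := by
  suffices h : ∀ d : Data, ∃ (p : Prog) (t : ℕ), ∀ x, Runs p x d t by
    obtain ⟨p, t, h⟩ := h (enc b)
    exact ⟨p, Polynomial.C t, fun a => ⟨t, by simp, h _⟩⟩
  intro d
  induction d with
  | nil => exact ⟨.nil, 1, fun x => .nil x⟩
  | cons l r hl hr =>
    obtain ⟨p, t, h⟩ := hl
    obtain ⟨p', t', h'⟩ := hr
    exact ⟨.pair p p', _, fun x => .pair (h x) (h' x)⟩

theorem data {f : α → β} (hf : PF f) : PF (fun a => enc (f a)) := congr_enc hf fun _ => rfl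

/-- Branching on a computed tree. -/
theorem branch {c : α → Data} {f g : α → β} (hc : PF c) (hf : PF f) (hg : PF g) :
    PF (fun a => match c a with | .nil => g a | .cons _ _ => f a) := by
  obtain ⟨pc, qc, hc⟩ := hc
  obtain ⟨p, q, hp⟩ := hf
  obtain ⟨p', q', hp'⟩ := hg
  refine ⟨.ite pc p p', qc + q + q' + 1, fun a => ?_⟩
  obtain ⟨s, hs, hrs⟩ := hc a
  obtain ⟨t, ht, hr⟩ := hp a
  obtain ⟨t', ht', hr'⟩ := hp' a
  beta_reduce at *
  cases h : c a with
  | nil =>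
    rw [h] at hrs
    exact ⟨_, by simp; omega, .ite_false hrs hr'⟩
  | cons l r =>
    rw [h] at hrs
    exact ⟨_, by simp; omega, .ite_true hrs hr⟩

@[fun_prop]
theorem ite {c : α → Prop} [DecidablePred c] {f g : α → β} (hc : PF (fun a => decide (c a)))
    (hf : PF f) (hg : PF g) : PF (fun a => if c a then f a else g a) := by
  refine congr_enc (branch hc.data hf hg) fun a => ?_
  by_cases h : c a <;> simp [h]

@[fun_prop]
theorem cond {c : α → Bool} {f g : α → β} (hc : PF c)
    (hf : PF f) (hg : PF g) : PF (fun a => bif c a then f a else g a) := by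
  refine congr_enc (branch hc.data hf hg) fun a => ?_
  cases h : c a <;> simp

@[fun_prop]
theorem cons {f : ξ → α} {g : ξ → List α} (hf : PF f) (hg : PF g) : PF (fun x => f x :: g x) :=
  congr_enc (hf.prodMk hg) fun _ => rfl

/-- The tree of `(x, a :: l)` is literally the tree of `(x, a, l)`, and the empty list is the leaf.
The right projection serves as the test, and the nonempty branch needs no unpacking. -/
theorem listCases {L : ξ → List α} {f : ξ → β} {g : ξ × α × List α → β} (hL : PF L) (hf : PF f)
    (hg : PF g) : PF (fun x => match L x with | [] => f x | a :: l => g (x, a, l)) := by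
  have h1 : PF (fun x => (x, L x)) := by fun_prop
  refine comp (g := fun p : ξ × List α => match p.2 with | [] => f p.1 | a :: l => g (p.1, a, l))
    ?_ h1
  obtain ⟨p, q, hp⟩ := hg
  obtain ⟨p', q', hp'⟩ := hf
  refine ⟨.ite .right p (.comp p' .left), q + q' + 2 * Polynomial.X + 2, ?_⟩
  rintro ⟨x, _ | ⟨a, l⟩⟩
  · obtain ⟨t, ht, hr⟩ := hp' x
    refine ⟨_, ?_, .ite_false (.right_cons _ _) (.comp (.left_cons _ _) hr)⟩
    have := eval_mono_nat q' (show (enc x).size ≤ (enc (x, ([] : List α))).size by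
      simp [Data.size]; omega)
    simp [Data.size] at *
    omega
  · obtain ⟨t, ht, hr⟩ := hp (x, a, l)
    refine ⟨_, ?_, .ite_true (.right_cons _ _) hr⟩
    simp [Data.size] at *
    omega

@[fun_prop]
theorem tail {L : ξ → List α} (hL : PF L) : PF (fun x => (L x).tail) := by
  have h : PF (fun x => match L x with | [] => ([] : List α) | a :: l => (x, a, l).2.2) :=
    listCases (g := fun p : ξ × α × List α => p.2.2) hL (by fun_prop) (by fun_prop)
  refine congr_enc h fun x => ?_
  cases L x <;> rfl

@[fun_prop]
theorem headD {L : ξ → List α} {d : ξ → α} (hL : PF L) (hd : PF d) :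
    PF (fun x => (L x).headD (d x)) := by
  have h : PF (fun x => match L x with | [] => d x | a :: l => (x, a, l).2.1) :=
    listCases (g := fun p : ξ × α × List α => p.2.1) hL (by fun_prop) (by fun_prop)
  refine congr_enc h fun x => ?_
  cases L x <;> rfl

/-- The loop state is the triple of remaining list, accumulator and parameter, and the loop stops
when the remaining list is the leaf. `B` bounds the size of all states that occur and `K` the time
of the body on such states; one round costs at most `K + 2 * B + 1`. -/
theorem foldl_loop {p : Prog} {f : ξ → β → α → β} {x : ξ} {K B : ℕ} (l : List α) (b : β)
    (hp : ∀ a l b, esize (a :: l, b, x) ≤ B →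
      ∃ t ≤ K, Runs p (enc (a :: l, b, x)) (enc (l, f x b a, x)) t)
    (hB : ∀ l', l' <+: l → esize (l, l'.foldl (f x) b, x) ≤ B) :
    ∃ t ≤ (l.length + 1) * (K + 2 * B + 1),
      Runs (.loop .left p) (enc (l, b, x)) (enc (([] : List α), l.foldl (f x) b, x)) t := by
  induction l generalizing b with
  | nil =>
    refine ⟨_, ?_, Runs.loop_stop (.left_cons _ _)⟩
    have := hB [] (by simp)
    simp [esize] at *
    omega
  | cons a l ih =>
    obtain ⟨t, ht, hr⟩ := hp a l b (hB [] (by simp))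
    obtain ⟨r, hr1, hr2⟩ := ih (f x b a) fun l' hl' => by
      have := hB (a :: l') (by simpa using hl')
      simp at *
      omega
    refine ⟨_, ?_, .loop_step (.left_cons _ _) hr hr2⟩
    have := hB [] (by simp)
    simp only [List.length_cons, List.foldl_nil] at *
    change ((enc (a :: l, b, x)).size + t + r + 1) ≤ _
    change (enc (a :: l, b, x)).size ≤ B at this
    nlinarith

/-- Iteration over a list with polynomially bounded intermediate results. -/
theorem foldl {L : ξ → List α} {I : ξ → β} {f : ξ → β → α → β} (hL : PF L) (hI : PF I)
    (hf : PF (fun p : ξ × β × α => f p.1 p.2.1 p.2.2)) (r : Polynomial ℕ)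
    (hr : ∀ x l', l' <+: L x → esize (l'.foldl (f x) (I x)) ≤ r.eval (esize x)) :
    PF (fun x => (L x).foldl (f x) (I x)) := by
  have hbody : PF (fun s : List α × β × ξ =>
      match s.1 with
      | [] => s
      | a :: l => ((l, f s.2.2 s.2.1 a, s.2.2) : List α × β × ξ)) := by
    refine listCases (L := fun s : List α × β × ξ => s.1) (f := fun s => s)
      (g := fun q : (List α × β × ξ) × α × List α =>
        ((q.2.2, f q.1.2.2 q.1.2.1 q.2.1, q.1.2.2) : List α × β × ξ)) (by fun_prop) (by fun_prop) ?_
    have : PF (fun q : (List α × β × ξ) × α × List α => f q.1.2.2 q.1.2.1 q.2.1) :=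
      comp (f := fun q : (List α × β × ξ) × α × List α => (q.1.2.2, q.1.2.1, q.2.1)) hf
        (by fun_prop)
    fun_prop
  obtain ⟨qL, hqL⟩ := hL.size_bound
  obtain ⟨p, q, hp⟩ := hbody
  -- Size of a loop state: list, accumulator, parameter and the two nodes that join them.
  let Bp : Polynomial ℕ := qL + r + Polynomial.X + 2
  have hloop : PolyTime (fun x : ξ => enc (L x, I x, x))
      (fun x => enc (([] : List α), (L x).foldl (f x) (I x), x)) := by
    refine ⟨.loop .left p, (Polynomial.X + 1) * (q.comp (Bp.comp Polynomial.X) +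
      2 * Bp.comp Polynomial.X + 1), fun x => ?_⟩
    obtain ⟨t, ht, hrun⟩ := foldl_loop (p := p) (f := f) (x := x) (K := q.eval (Bp.eval (esize x)))
      (B := Bp.eval (esize x)) (L x) (I x) (fun a l b hB => by
        obtain ⟨t, ht, hrun⟩ := hp (a :: l, b, x)
        exact ⟨t, ht.trans (eval_mono_nat q hB), hrun⟩) (fun l' hl' => by
        have h1 := hr x l' hl'
        have h2 := hqL x
        simp [Bp] at *
        omega)
    refine ⟨t, ht.trans ?_, hrun⟩
    have h1 : esize x ≤ (enc (L x, I x, x)).size := by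
      change esize x ≤ esize (L x, I x, x)
      simp; omega
    have h2 : (L x).length ≤ (enc (L x, I x, x)).size := by
      change (L x).length ≤ esize (L x, I x, x)
      have := length_le_esize (L x)
      simp; omega
    have h3 := eval_mono_nat Bp h1
    have h4 := eval_mono_nat q h3
    simp only [Polynomial.eval_mul, Polynomial.eval_add, Polynomial.eval_X, Polynomial.eval_one,
      Polynomial.eval_comp, Polynomial.eval_ofNat]
    gcongr
  have hstart : PF (fun x => (L x, I x, x)) := by fun_prop
  have : PF (fun x => (([] : List α), (L x).foldl (f x) (I x), x)) := by
    obtain ⟨p1, q1, h1⟩ := hstart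
    obtain ⟨p2, q2, h2⟩ := hloop
    refine ⟨.comp p2 p1, q1 + q2.comp q1 + 1, fun x => ?_⟩
    obtain ⟨t, ht, hr⟩ := h1 x
    obtain ⟨t', ht', hr'⟩ := h2 x
    refine ⟨_, ?_, .comp hr hr'⟩
    have := eval_mono_nat q2 (hr.size_le.trans ht)
    simp at *
    omega
  exact this.snd.fst

@[fun_prop]
theorem reverse {L : ξ → List α} (hL : PF L) : PF (fun x => (L x).reverse) := by
  obtain ⟨q, hq⟩ := hL.size_bound
  have h := foldl (f := fun (_ : ξ) (acc : List α) a => a :: acc) hL (const ([] : List α))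
    (by fun_prop) q fun x l' hl' => by
      have := esize_le_of_prefix hl'
      have h2 := hq x
      simp only [List.foldl_flip_cons_eq_append, List.append_nil, List.map_id_fun', id_eq]
      rw [esize_reverse]
      omega
  refine congr_enc h fun x => ?_
  simp

@[fun_prop]
theorem append {L M : ξ → List α} (hL : PF L) (hM : PF M) : PF (fun x => L x ++ M x) := by
  obtain ⟨q, hq⟩ := hL.size_bound
  obtain ⟨q', hq'⟩ := hM.size_bound
  have h := foldl (f := fun (_ : ξ) (acc : List α) a => a :: acc) hL.reverse hM
    (by fun_prop) (q + q') fun x l' hl' => by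
      have := esize_le_of_prefix hl'
      have h2 := hq x
      have h3 := hq' x
      have h4 := esize_append l'.reverse (M x)
      rw [esize_reverse] at *
      simp only [List.foldl_flip_cons_eq_append, List.map_id_fun', id_eq, Polynomial.eval_add]
      omega
  refine congr_enc h fun x => ?_
  simp

theorem map {L : ξ → List α} {f : ξ → α → β} (hL : PF L) (hf : PF (fun p : ξ × α => f p.1 p.2)) :
    PF (fun x => (L x).map (f x)) := by
  obtain ⟨q, hq⟩ := hL.size_bound
  obtain ⟨q', hq'⟩ := hf.size_bound
  have hstep : PF (fun p : ξ × List β × α => f p.1 p.2.2 :: p.2.1) := by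
    have : PF (fun p : ξ × List β × α => f p.1 p.2.2) :=
      comp (f := fun p : ξ × List β × α => (p.1, p.2.2)) hf (by fun_prop)
    fun_prop
  have h := foldl (f := fun (x : ξ) (acc : List β) a => f x a :: acc) hL (const ([] : List β))
    hstep (1 + q * (q'.comp (Polynomial.X + q + 1) + 1)) fun x l' hl' => by
      have e : l'.foldl (fun acc a => f x a :: acc) [] = (l'.map (f x)).reverse := by
        rw [List.foldl_flip_cons_eq_append, List.append_nil]
      rw [e, esize_reverse]
      have h1 := esize_le_of_prefix hl'
      have h2 := hq x
      have h3 := length_le_esize l'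
      refine (esize_le_of_forall (M := q'.eval (esize x + q.eval (esize x) + 1)) ?_).trans ?_
      · intro b hb
        obtain ⟨a, ha, rfl⟩ := List.mem_map.1 hb
        refine (hq' (x, a)).trans (eval_mono_nat q' ?_)
        have := esize_le_of_mem ha
        simp
        omega
      · simp only [List.length_map, Polynomial.eval_add, Polynomial.eval_mul, Polynomial.eval_one,
          Polynomial.eval_comp, Polynomial.eval_X]
        gcongr
        omega
  refine congr_enc h.reverse fun x => ?_
  rw [List.foldl_flip_cons_eq_append, List.append_nil, List.reverse_reverse]

theorem flatten {L : ξ → List (List α)} (hL : PF L) : PF (fun x => (L x).flatten) := by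
  obtain ⟨q, hq⟩ := hL.size_bound
  have key : ∀ (l : List (List α)) (b : List α),
      l.foldl (fun acc a => acc ++ a) b = b ++ l.flatten := by
    intro l
    induction l with
    | nil => simp
    | cons a l ih => intro b; simp [ih]
  have key2 : ∀ l : List (List α), esize l.flatten ≤ esize l := by
    intro l
    induction l with
    | nil => simp
    | cons a l ih =>
      have := esize_append a l.flatten
      simp
      omega
  have h := foldl (f := fun (_ : ξ) (acc : List α) a => acc ++ a) hL (const ([] : List α))
    (by fun_prop) q fun x l' hl' => by
      rw [key, List.nil_append]
      exact (key2 _).trans ((esize_le_of_prefix hl').trans (hq x))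
  refine congr_enc h fun x => ?_
  rw [key, List.nil_append]

theorem flatMap {L : ξ → List α} {f : ξ → α → List β} (hL : PF L)
    (hf : PF (fun p : ξ × α => f p.1 p.2)) : PF (fun x => (L x).flatMap (f x)) := by
  simpa [List.flatMap] using flatten (map hL hf)

/-! ### Arithmetic -/

/-- Numbers are unary, so a number has the same tree as a list of units of that length. Arithmetic
becomes list processing. -/
theorem enc_replicate (n : ℕ) : enc (List.replicate n ()) = enc n := by
  induction n with
  | zero => rfl
  | succ n ih => simp [List.replicate_succ, ih]

@[fun_prop]
theorem replicate {f : ξ → ℕ} (hf : PF f) : PF (fun x => List.replicate (f x) ()) :=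
  congr_enc hf fun _ => (enc_replicate _).symm

@[fun_prop]
theorem length {L : ξ → List α} (hL : PF L) : PF (fun x => (L x).length) := by
  refine congr_enc (map (f := fun _ _ => ()) hL (by fun_prop)) fun x => ?_
  rw [List.map_const', enc_replicate]

@[fun_prop]
theorem add {f g : ξ → ℕ} (hf : PF f) (hg : PF g) : PF (fun x => f x + g x) := by
  refine congr_enc (append hf.replicate hg.replicate) fun x => ?_
  rw [List.replicate_append_replicate, enc_replicate]

@[fun_prop]
theorem mul {f g : ξ → ℕ} (hf : PF f) (hg : PF g) : PF (fun x => f x * g x) := by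
  have h : PF (fun x => (List.replicate (f x) ()).flatMap fun _ => List.replicate (g x) ()) :=
    flatMap (f := fun x _ => List.replicate (g x) ()) hf.replicate
      (by fun_prop)
  refine congr_enc h.length fun x => ?_
  simp

@[fun_prop]
theorem tsub {f g : ξ → ℕ} (hf : PF f) (hg : PF g) : PF (fun x => f x - g x) := by
  obtain ⟨q, hq⟩ := hf.size_bound
  have key : ∀ (l : List Unit) (a : List Unit),
      l.foldl (fun acc _ => acc.tail) a = a.drop l.length := by
    intro l
    induction l with
    | nil => simp
    | cons b l ih => intro a; rw [List.foldl_cons, ih]; simp [List.drop_tail]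
  have h := foldl (f := fun (_ : ξ) (acc : List Unit) (_ : Unit) => acc.tail) hg.replicate
    hf.replicate (by fun_prop) q fun x l' hl' => by
      rw [key, List.drop_replicate]
      have h1 := hq x
      have : esize (List.replicate (f x - l'.length) ()) = esize (f x - l'.length) :=
        congrArg Data.size (enc_replicate _)
      rw [this]
      simp at *
      omega
  refine congr_enc h fun x => ?_
  rw [key, List.drop_replicate, List.length_replicate, enc_replicate]

@[fun_prop]
theorem decide_ne_zero {f : ξ → ℕ} (hf : PF f) : PF (fun x => decide (f x ≠ 0)) := by
  refine congr_enc (branch hf.data (const true) (const false)) fun x => ?_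
  cases f x <;> simp

@[fun_prop]
theorem decide_lt {f g : ξ → ℕ} (hf : PF f) (hg : PF g) : PF (fun x => decide (f x < g x)) := by
  refine congr_enc (decide_ne_zero (hg.tsub hf)) fun x => ?_
  congr 1
  simp [Nat.sub_ne_zero_iff_lt]

@[fun_prop]
theorem not {f : ξ → Bool} (hf : PF f) : PF (fun x => !(f x)) := by
  refine congr_enc (cond hf (const false) (const true)) fun x => ?_
  cases f x <;> rfl

@[fun_prop]
theorem and {f g : ξ → Bool} (hf : PF f) (hg : PF g) : PF (fun x => f x && g x) := by
  refine congr_enc (cond hf hg (const false)) fun x => ?_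
  cases f x <;> rfl

@[fun_prop]
theorem decide_eq {f g : ξ → ℕ} (hf : PF f) (hg : PF g) : PF (fun x => decide (f x = g x)) := by
  refine congr_enc (and (not (decide_lt hf hg)) (not (decide_lt hg hf))) fun x => ?_
  congr 1
  rw [Bool.eq_iff_iff]
  simp
  omega

@[fun_prop]
theorem range {f : ξ → ℕ} (hf : PF f) : PF (fun x => List.range (f x)) := by
  obtain ⟨q, hq⟩ := hf.size_bound
  have key : ∀ (l : List Unit), l.foldl (fun acc (_ : Unit) => acc ++ [acc.length]) [] =
      List.range l.length := by
    intro l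
    induction l using List.reverseRecOn with
    | nil => simp
    | append_singleton l a ih => simp [ih, List.range_succ]
  have h := foldl (f := fun (_ : ξ) (acc : List ℕ) (_ : Unit) => acc ++ [acc.length]) hf.replicate
    (const ([] : List ℕ)) (by fun_prop) (1 + q * (q + 1)) fun x l' hl' => by
      rw [key]
      have h1 := hq x
      have h2 := hl'.length_le
      rw [List.length_replicate] at h2
      rw [esize_nat] at h1
      refine (esize_le_of_forall (M := q.eval (esize x)) ?_).trans ?_
      · intro b hb
        rw [List.mem_range] at hb
        simp
        omega
      · simp only [List.length_range, Polynomial.eval_add, Polynomial.eval_mul,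
          Polynomial.eval_one]
        gcongr
        omega
  refine congr_enc h fun x => ?_
  rw [key, List.length_replicate]

@[fun_prop]
theorem drop {L : ξ → List α} {f : ξ → ℕ} (hL : PF L) (hf : PF f) :
    PF (fun x => (L x).drop (f x)) := by
  obtain ⟨q, hq⟩ := hL.size_bound
  have key : ∀ (l : List Unit) (a : List α),
      l.foldl (fun acc _ => acc.tail) a = a.drop l.length := by
    intro l
    induction l with
    | nil => simp
    | cons b l ih => intro a; rw [List.foldl_cons, ih]; simp [List.drop_tail]
  have h := foldl (f := fun (_ : ξ) (acc : List α) (_ : Unit) => acc.tail) hf.replicate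
    hL (by fun_prop) q fun x l' hl' => by
      rw [key]
      refine le_trans ?_ (hq x)
      have := esize_append ((L x).take l'.length) ((L x).drop l'.length)
      rw [List.take_append_drop] at this
      have := esize_pos ((L x).take l'.length)
      omega
  refine congr_enc h fun x => ?_
  rw [key, List.length_replicate]

@[fun_prop]
theorem take {L : ξ → List α} {f : ξ → ℕ} (hL : PF L) (hf : PF f) :
    PF (fun x => (L x).take (f x)) := by
  have h : PF (fun x => ((L x).reverse.drop ((L x).length - f x)).reverse) := by fun_prop
  refine congr_enc h fun x => ?_
  congr 1
  rw [List.drop_reverse, List.reverse_reverse]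
  rcases le_total (f x) (L x).length with h | h
  · rw [Nat.sub_sub_self h]
  · rw [Nat.sub_eq_zero_of_le h, Nat.sub_zero, List.take_of_length_le h,
      List.take_of_length_le le_rfl]

@[fun_prop]
theorem getD {L : ξ → List α} {f : ξ → ℕ} {d : ξ → α} (hL : PF L) (hf : PF f) (hd : PF d) :
    PF (fun x => (L x).getD (f x) (d x)) := by
  have h : PF (fun x => ((L x).drop (f x)).headD (d x)) := by fun_prop
  refine congr_enc h fun x => ?_
  congr 1
  simp [List.getD_eq_getElem?_getD, List.headD_eq_head?_getD]

@[fun_prop]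
theorem div_two {f : ξ → ℕ} (hf : PF f) : PF (fun x => f x / 2) := by
  -- Half of a number, rounded down, is the number of `i` with `2 * i + 1` below it.
  have h : PF (fun x => ((List.range (f x)).flatMap fun i =>
      if i + i + 1 < f x then [()] else [])) :=
    flatMap (f := fun x i => if i + i + 1 < f x then [()] else []) hf.range (by fun_prop)
  refine congr_enc h.length fun x => ?_
  congr 1
  have : ∀ n k : ℕ, ((List.range k).flatMap fun i => if i + i + 1 < n then [()] else []).length
      = min k (n / 2) := by
    intro n k
    induction k with
    | zero => simp
    | succ k ih =>
      rw [List.range_succ, List.flatMap_append, List.length_append, ih]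
      simp
      split_ifs <;> simp <;> omega
  rw [this]
  omega

end PF

/-! ## Gates on numbered wires, in the Heisenberg picture -/

/-- Assignments of bits to all wires. -/
abbrev Mem : Type := ℕ → Bool

/-- The assignment that is `x` on the first wires and `0` elsewhere. -/
def mem {n : ℕ} (x : Bits n) : Mem := fun i => if h : i < n then x ⟨i, h⟩ else false

/-- The restriction to the first `n` wires. -/
def rest (n : ℕ) (u : Mem) : Bits n := fun i => u i

@[simp] theorem rest_mem {n : ℕ} (x : Bits n) : rest n (mem x) = x := by
  funext i; simp [rest, mem]

theorem mem_of_lt {n : ℕ} (x : Bits n) {i : ℕ} (h : i < n) : mem x i = x ⟨i, h⟩ := by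
  simp [mem, h]

theorem mem_of_le {n : ℕ} (x : Bits n) {i : ℕ} (h : n ≤ i) : mem x i = false := by
  simp [mem, h]

theorem mem_rest {n : ℕ} {u : Mem} (h : ∀ i, n ≤ i → u i = false) : mem (rest n u) = u := by
  funext i
  by_cases hi : i < n
  · simp [mem, rest, hi]
  · rw [mem_of_le _ (not_lt.1 hi), h i (not_lt.1 hi)]

theorem mem_injective (n : ℕ) : Function.Injective (mem : Bits n → Mem) := fun x y h => by
  rw [← rest_mem x, h, rest_mem]

theorem mem_update {n : ℕ} (x : Bits n) (i : Fin n) (s : Bool) :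
    mem (Function.update x i s) = Function.update (mem x) i s := by
  funext j
  by_cases hj : j < n
  · by_cases hji : j = i
    · subst hji; simp [mem]
    · have : (⟨j, hj⟩ : Fin n) ≠ i := fun h => hji (by rw [← h])
      simp [mem, hj, Function.update_of_ne, hji, this]
  · have : j ≠ i := by rintro rfl; exact hj i.2
    simp [mem, hj, Function.update_of_ne, this]

/-- One-qubit gates. -/
inductive OneQ : Type
  | X | Z | P | R | H

/-- The matrix of a one-qubit gate. -/
def OneQ.mat : OneQ → Op Bool
  | X => matX
  | Z => matZ
  | P => matP
  | R => matR
  | H => matH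

/-- Gates on wires that are numbered by arbitrary natural numbers. -/
inductive RGate : Type
  | one (g : OneQ) (i : ℕ) : RGate
  | cnot (i j : ℕ) : RGate
  | meas (i : ℕ) : RGate

/-- The action of a controlled-not on assignments. -/
def cx (i j : ℕ) (u : Mem) : Mem := Function.update u j (xor (u j) (u i))

namespace RGate

/-- The gate with renumbered wires. -/
def map (φ : ℕ → ℕ) : RGate → RGate
  | one g i => one g (φ i)
  | cnot i j => cnot (φ i) (φ j)
  | meas i => meas (φ i)

/-- All wires of the gate belong to `S`. -/
def On (S : Set ℕ) : RGate → Prop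
  | one _ i => i ∈ S
  | cnot i j => i ∈ S ∧ j ∈ S
  | meas i => i ∈ S

/-- Control and target are different. -/
def Proper : RGate → Prop
  | cnot i j => i ≠ j
  | _ => True

/-- The dual action of a gate on functionals on operators; a functional is given by its values on
the matrix units `|u⟩⟨v|`. -/
def heis (F : Mem → Mem → ℂ) : RGate → Mem → Mem → ℂ
  | one g i => fun u v => ∑ s, ∑ t, g.mat s (u i) * star (g.mat t (v i)) *
      F (Function.update u i s) (Function.update v i t)
  | cnot i j => fun u v => F (cx i j u) (cx i j v)
  | meas i => fun u v => if u i = v i then F u v else 0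

/-- The gate as a gate of a circuit with `w` wires. -/
def toQ (w : ℕ) : (g : RGate) → g.On (Set.Iio w) ∧ g.Proper → QGate w
  | one .X i, h => .X ⟨i, h.1⟩
  | one .Z i, h => .Z ⟨i, h.1⟩
  | one .P i, h => .P ⟨i, h.1⟩
  | one .R i, h => .R ⟨i, h.1⟩
  | one .H i, h => .H ⟨i, h.1⟩
  | cnot i j, h => .cnot ⟨i, h.1.1⟩ ⟨j, h.1.2⟩ (by simpa [Fin.ext_iff] using (show i ≠ j from h.2))
  | meas i, h => .meas ⟨i, h.1⟩

end RGate

/-- The numbers of the wires of a gate. -/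
def QGate.raw {w : ℕ} : QGate w → RGate
  | .X i => .one .X i
  | .Z i => .one .Z i
  | .P i => .one .P i
  | .R i => .one .R i
  | .H i => .one .H i
  | .cnot i j _ => .cnot i j
  | .meas i => .meas i

@[simp] theorem RGate.raw_toQ (w : ℕ) (g : RGate) (h) : (g.toQ w h).raw = g := by
  rcases g with ⟨_ | _ | _ | _ | _, i⟩ | ⟨i, j⟩ | i <;> rfl

theorem QGate.raw_valid {w : ℕ} (g : QGate w) : g.raw.On (Set.Iio w) ∧ g.raw.Proper := by
  cases g <;> simp [raw, RGate.On, RGate.Proper, Fin.val_inj]; assumption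

/-- The dual action of a list of gates, of which the first one is applied first. -/
def heisL (gs : List RGate) (F : Mem → Mem → ℂ) : Mem → Mem → ℂ :=
  gs.foldr (fun g G => g.heis G) F

@[simp] theorem heisL_nil (F) : heisL [] F = F := rfl

@[simp] theorem heisL_cons (g gs F) : heisL (g :: gs) F = g.heis (heisL gs F) := rfl

theorem heisL_append (gs gs' F) : heisL (gs ++ gs') F = heisL gs (heisL gs' F) := by
  simp [heisL]

/-! ### Relation with circuits -/

/-- This moves the conjugation by `U` from the operator to the functional. The inner sums run over
columns of `U`, which have at most two nonzero entries for a gate. -/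
theorem sum_conj_mul {α : Type} [Fintype α] (U σ : Op α) (F : α → α → ℂ) :
    ∑ x, ∑ y, (U * σ * Uᴴ) x y * F x y =
      ∑ x, ∑ y, σ x y * ∑ a, U a x * ∑ b, star (U b y) * F a b := by
  simp only [Matrix.mul_apply, Matrix.conjTranspose_apply, Finset.sum_mul, Finset.mul_sum]
  calc _ = ∑ a, ∑ y, ∑ b, ∑ x, U a x * σ x y * star (U b y) * F a b :=
        Finset.sum_congr rfl fun a _ => Finset.sum_comm
    _ = ∑ a, ∑ x, ∑ y, ∑ b, U a x * σ x y * star (U b y) * F a b := by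
        refine Finset.sum_congr rfl fun a _ => ?_
        rw [Finset.sum_congr rfl fun y _ => Finset.sum_comm, Finset.sum_comm]
    _ = ∑ x, ∑ a, ∑ y, ∑ b, U a x * σ x y * star (U b y) * F a b := Finset.sum_comm
    _ = _ := by
        refine Finset.sum_congr rfl fun x _ => ?_
        rw [Finset.sum_comm]
        refine Finset.sum_congr rfl fun y _ => Finset.sum_congr rfl fun a _ =>
          Finset.sum_congr rfl fun b _ => ?_
        ring

theorem sum_onWire_mul {w : ℕ} (U : Op Bool) (i : Fin w) (y : Bits w) (f : Bits w → ℂ) :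
    ∑ x, onWire U i x y * f x = ∑ s, U s (y i) * f (Function.update y i s) := by
  symm
  have hinj : Function.Injective fun s => Function.update y i s := Function.update_injective y i
  rw [← Finset.sum_subset (s₁ := Finset.univ.image fun s => Function.update y i s)
    (Finset.subset_univ _), Finset.sum_image fun a _ b _ h => hinj h]
  · refine Finset.sum_congr rfl fun s _ => ?_
    have : ∀ j, j ≠ i → Function.update y i s j = y j := fun j hj => Function.update_of_ne hj _ _
    simp only [onWire, Matrix.of_apply, if_pos this, Function.update_self]
  · intro x _ hx
    have : ¬ ∀ j, j ≠ i → x j = y j := fun h => hx (by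
      refine Finset.mem_image.2 ⟨x i, Finset.mem_univ _, ?_⟩
      funext j
      by_cases hj : j = i
      · subst hj; simp
      · rw [Function.update_of_ne hj, h j hj])
    simp only [onWire, Matrix.of_apply, if_neg this, zero_mul]

theorem sum_onWires_mul {w : ℕ} (i j : Fin w) (y : Bits w) (f : Bits w → ℂ) :
    ∑ x, onWires i j x y * f x = f (Function.update y j (xor (y i) (y j))) := by
  simp [onWires]

/-- Schrödinger and Heisenberg picture agree for one gate: applying the gate to the operator and
pulling back the functional give the same value. -/
theorem sum_apply {w : ℕ} (g : QGate w) (σ : Op (Bits w)) (F : Mem → Mem → ℂ) :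
    ∑ x, ∑ y, g.apply σ x y * F (mem x) (mem y) =
      ∑ x, ∑ y, σ x y * g.raw.heis F (mem x) (mem y) := by
  have hone : ∀ (q : OneQ) (i : Fin w),
      ∑ x, ∑ y, (onWire q.mat i * σ * (onWire q.mat i)ᴴ) x y * F (mem x) (mem y) =
        ∑ x, ∑ y, σ x y * (RGate.one q i).heis F (mem x) (mem y) := by
    intro q i
    rw [sum_conj_mul]
    refine Finset.sum_congr rfl fun x _ => Finset.sum_congr rfl fun y _ => ?_
    rw [sum_onWire_mul]
    simp only [RGate.heis]
    congr 1
    refine Finset.sum_congr rfl fun s _ => ?_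
    have : ∀ b, star (onWire q.mat i b y) = onWire (q.mat.map star) i b y := by
      intro b
      simp only [onWire, Matrix.of_apply, Matrix.map_apply]
      split_ifs <;> simp
    simp only [this]
    rw [sum_onWire_mul, Finset.mul_sum]
    refine Finset.sum_congr rfl fun t _ => ?_
    rw [mem_update, mem_update, mem_of_lt x i.2, mem_of_lt y i.2, Matrix.map_apply]
    ring
  cases g with
  | X i => exact hone .X i
  | Z i => exact hone .Z i
  | P i => exact hone .P i
  | R i => exact hone .R i
  | H i => exact hone .H i
  | cnot i j h =>
    simp only [QGate.apply]
    rw [sum_conj_mul]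
    refine Finset.sum_congr rfl fun x _ => Finset.sum_congr rfl fun y _ => ?_
    have : ∀ b, star (onWires i j b y) = onWires i j b y := by
      intro b
      simp only [onWires, Matrix.of_apply]
      split_ifs <;> simp
    simp only [this]
    rw [sum_onWires_mul, sum_onWires_mul]
    have : ∀ x : Bits w, mem (Function.update x j (xor (x i) (x j))) = cx i j (mem x) := by
      intro x
      rw [mem_update, cx, mem_of_lt x i.2, mem_of_lt x j.2, Bool.xor_comm]
    simp only [QGate.raw, RGate.heis, this]
  | meas i =>
    simp only [QGate.apply, QGate.raw, RGate.heis, Matrix.of_apply]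
    refine Finset.sum_congr rfl fun x _ => Finset.sum_congr rfl fun y _ => ?_
    rw [mem_of_lt x i.2, mem_of_lt y i.2]
    split_ifs <;> simp

theorem sum_foldl_apply {w : ℕ} (gs : List (QGate w)) (σ : Op (Bits w)) (F : Mem → Mem → ℂ) :
    ∑ x, ∑ y, (gs.foldl (fun σ g => g.apply σ) σ) x y * F (mem x) (mem y) =
      ∑ x, ∑ y, σ x y * heisL (gs.map QGate.raw) F (mem x) (mem y) := by
  induction gs generalizing σ with
  | nil => rfl
  | cons g gs ih => rw [List.foldl_cons, ih, sum_apply]; rfl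

open Classical in
/-- The functional that reads off a matrix entry of the reduced state of the wires `out`. -/
def obs {m : ℕ} (out : Fin m → ℕ) (a b : Bits m) : Mem → Mem → ℂ := fun u v =>
  if (∀ k, u (out k) = a k) ∧ (∀ k, v (out k) = b k) ∧ (∀ j, (∀ k, out k ≠ j) → u j = v j)
  then 1 else 0

/-- The bits of a longer string, first and last part. -/
def bitsAppendEquiv (n f : ℕ) : Bits n × Bits f ≃ Bits (n + f) := Fin.appendEquiv n f

/-- Wires beyond the length of a string carry `0` in its assignment, which is also the initial value
of fresh wires. Preparations therefore need no bookkeeping in the Heisenberg picture. -/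
theorem mem_append_zero {n f : ℕ} (x : Bits n) :
    mem (Fin.append x (fun _ : Fin f => false)) = mem x := by
  funext i
  by_cases hi : i < n
  · rw [mem_of_lt x hi, mem_of_lt _ (show i < n + f by omega)]
    exact Fin.append_left x _ ⟨i, hi⟩
  · rw [mem_of_le x (not_lt.1 hi)]
    by_cases hi2 : i < n + f
    · rw [mem_of_lt _ hi2]
      have : (⟨i, hi2⟩ : Fin (n + f)) = Fin.natAdd n ⟨i - n, by omega⟩ := by
        ext; simp; omega
      rw [this, Fin.append_right]
    · rw [mem_of_le _ (not_lt.1 hi2)]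

theorem sum_tensor_zero {n f : ℕ} (ρ : Op (Bits n)) (G : Bits (n + f) → Bits (n + f) → ℂ) :
    ∑ x, ∑ y, tensor ρ (ketbra fun _ => false) x y * G x y =
      ∑ x, ∑ y, ρ x y * G (Fin.append x fun _ => false) (Fin.append y fun _ => false) := by
  rw [← (bitsAppendEquiv n f).sum_comp, Fintype.sum_prod_type]
  refine Finset.sum_congr rfl fun x _ => ?_
  rw [Finset.sum_comm, ← (bitsAppendEquiv n f).sum_comp, Fintype.sum_prod_type]
  refine Finset.sum_congr rfl fun y _ => ?_
  have h1 : ∀ (x : Bits n) (z : Bits f), takeBits (bitsAppendEquiv n f (x, z)) = x := fun x z => by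
    funext i; simp [takeBits, bitsAppendEquiv]
  have h2 : ∀ (x : Bits n) (z : Bits f), dropBits (bitsAppendEquiv n f (x, z)) = z := fun x z => by
    funext i; simp [dropBits, bitsAppendEquiv]
  simp only [tensor, Matrix.of_apply, h1, h2]
  rw [Finset.sum_eq_single (fun _ => false), Finset.sum_eq_single (fun _ => false)]
  · simp only [ketbra, Matrix.single_apply_same, mul_one]
    rfl
  · intro b _ hb; simp [ketbra, Ne.symm hb]
  · simp
  · intro b _ hb
    refine Finset.sum_eq_zero fun c _ => ?_
    simp [ketbra, Ne.symm hb]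
  · simp

namespace QCircuit

variable {n m : ℕ}

/-- The gates of a circuit with numbers of wires. -/
def rawGates (C : QCircuit n m) : List RGate := C.gates.map QGate.raw

/-- The numbers of the output wires. -/
def rawOut (C : QCircuit n m) : Fin m → ℕ := fun k => C.out k

theorem rawGates_on (C : QCircuit n m) : ∀ g ∈ C.rawGates, g.On (Set.Iio (n + C.fresh)) := by
  intro g hg
  obtain ⟨g', _, rfl⟩ := List.mem_map.1 hg
  exact g'.raw_valid.1

theorem rawGates_proper (C : QCircuit n m) : ∀ g ∈ C.rawGates, g.Proper := by
  intro g hg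
  obtain ⟨g', _, rfl⟩ := List.mem_map.1 hg
  exact g'.raw_valid.2

theorem rawOut_lt (C : QCircuit n m) (k : Fin m) : C.rawOut k < n + C.fresh := (C.out k).2

theorem rawOut_injective (C : QCircuit n m) : Function.Injective C.rawOut :=
  Fin.val_injective.comp C.out.injective

/-- The bridge between circuits and functionals: an entry of the output is the functional that reads
it off, pulled back through all gates and paired with the input. Later statements about channels of
concrete circuits start here. -/
theorem chan_apply (C : QCircuit n m) (ρ : Op (Bits n)) (a b : Bits m) :
    C.chan ρ a b = ∑ x, ∑ y, ρ x y * heisL C.rawGates (obs C.rawOut a b) (mem x) (mem y) := by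
  have h : C.chan ρ a b = ∑ x, ∑ y, C.run ρ x y * obs C.rawOut a b (mem x) (mem y) := by
    simp only [chan, Matrix.of_apply]
    refine Finset.sum_congr rfl fun x _ => Finset.sum_congr rfl fun y _ => ?_
    have hiff : ((∀ k, x (C.out k) = a k) ∧ (∀ k, y (C.out k) = b k) ∧
        (∀ j, (∀ k, C.out k ≠ j) → x j = y j)) ↔ ((∀ k, mem x (C.rawOut k) = a k) ∧
        (∀ k, mem y (C.rawOut k) = b k) ∧
        (∀ j, (∀ k, C.rawOut k ≠ j) → mem x j = mem y j)) := by
      have e : ∀ (x : Bits (n + C.fresh)) k, mem x (C.rawOut k) = x (C.out k) := fun x k =>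
        mem_of_lt x (C.out k).2
      simp only [e]
      -- The functional compares all natural-numbered wires, the channel only existing ones; on the
      -- others both assignments are `0`.
      refine and_congr_right fun _ => and_congr_right fun _ => ⟨fun h j hj => ?_, fun h j hj => ?_⟩
      · by_cases hjw : j < n + C.fresh
        · rw [mem_of_lt _ hjw, mem_of_lt _ hjw]
          exact h ⟨j, hjw⟩ fun k hk => hj k (by simp [rawOut, hk])
        · rw [mem_of_le _ (not_lt.1 hjw), mem_of_le _ (not_lt.1 hjw)]
      · have := h j fun k hk => hj k (Fin.ext hk)
        rwa [mem_of_lt _ j.2, mem_of_lt _ j.2] at this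
    simp only [obs]
    split_ifs with h1 h2 h2
    · rw [mul_one]
    · exact absurd (hiff.1 h1) h2
    · exact absurd (hiff.2 h2) h1
    · rw [mul_zero]
  rw [h, run, sum_foldl_apply, sum_tensor_zero]
  simp only [mem_append_zero]
  rfl

/-- The circuit with given gates and output wires. -/
def ofRaw (f : ℕ) (gs : List RGate) (out : Fin m → ℕ)
    (hgs : ∀ g ∈ gs, g.On (Set.Iio (n + f)) ∧ g.Proper) (hout : ∀ k, out k < n + f)
    (hinj : Function.Injective out) : QCircuit n m where
  fresh := f
  gates := gs.pmap (fun g h => g.toQ _ h) hgs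
  out := ⟨fun k => ⟨out k, hout k⟩, fun i j h => hinj (by simpa using h)⟩

@[simp] theorem rawGates_ofRaw (f : ℕ) (gs : List RGate) (out : Fin m → ℕ) (hgs hout hinj) :
    (ofRaw (n := n) f gs out hgs hout hinj).rawGates = gs := by
  simp [rawGates, ofRaw, List.map_pmap]

@[simp] theorem rawOut_ofRaw (f : ℕ) (gs : List RGate) (out : Fin m → ℕ) (hgs hout hinj) :
    (ofRaw (n := n) f gs out hgs hout hinj).rawOut = out := rfl

end QCircuit

/-! ### Codes -/

/-- Number of a one-qubit gate. -/
def OneQ.tag : OneQ → ℕ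
  | X => 0 | Z => 1 | P => 2 | R => 3 | H => 4

instance : Enc OneQ := ⟨fun g => Enc.enc g.tag⟩

instance : Enc RGate := ⟨fun
  | .one g i => .cons (Enc.enc g) (.nat i)
  | .cnot i j => .cons (.nat 5) (.cons (.nat i) (.nat j))
  | .meas i => .cons (.nat 6) (.nat i)⟩

instance : Enc ArithGate := ⟨ArithGate.code⟩

/-- Number of inputs, number of fresh wires, gates, output wires. -/
abbrev RawQ : Type := ℕ × ℕ × List RGate × List ℕ

/-- Number of coins, number of inputs with coins, gates, output wires. -/
abbrev RawR : Type := ℕ × ℕ × List ArithGate × List ℕ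

/-- The data of a quantum circuit. -/
def QCircuit.raw {n m : ℕ} (C : QCircuit n m) : RawQ :=
  (n, C.fresh, C.rawGates, List.ofFn C.rawOut)

/-- The data of a randomized circuit. -/
def RandCircuit.raw {n m : ℕ} (C : RandCircuit n m) : RawR :=
  (C.coins, n + C.coins, C.circuit.gates, List.ofFn C.circuit.out)

theorem QGate.enc_raw {w : ℕ} (g : QGate w) : Enc.enc g.raw = g.code := by
  cases g <;> rfl

theorem QCircuit.enc_raw {n m : ℕ} (C : QCircuit n m) : Enc.enc C.raw = C.code := by
  have h1 : (C.rawGates.map Enc.enc) = C.gates.map QGate.code := by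
    simp only [rawGates, List.map_map]
    exact List.map_congr_left fun g _ => g.enc_raw
  have h2 : (List.ofFn C.rawOut).map Enc.enc = List.ofFn fun k => Data.nat (C.out k) := by
    rw [List.map_ofFn]; rfl
  simp only [raw, code, enc_prod]
  congr 3
  · exact congrArg Data.list h1
  · exact congrArg Data.list h2

theorem RandCircuit.enc_raw {n m : ℕ} (C : RandCircuit n m) : Enc.enc C.raw = C.code := by
  have h2 : (List.ofFn C.circuit.out).map Enc.enc =
      List.ofFn fun k => Data.nat (C.circuit.out k) := by
    rw [List.map_ofFn]; rfl
  simp only [raw, code, enc_prod, ArithCircuit.code]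
  congr 3
  exact congrArg Data.list h2

/-- The left subtree. -/
def Data.fst : Data → Data
  | nil => nil
  | cons l _ => l

/-- The right subtree. -/
def Data.snd : Data → Data
  | nil => nil
  | cons _ r => r

/-! ### Gates and circuits as data. -/

namespace PF

variable {ξ β : Type} [Enc ξ] [Enc β]

@[fun_prop]
theorem one {f : ξ → ℕ} (g : OneQ) (hf : PF f) : PF (fun x => RGate.one g (f x)) :=
  congr_enc ((const g).prodMk hf) fun _ => rfl

@[fun_prop]
theorem meas {f : ξ → ℕ} (hf : PF f) : PF (fun x => RGate.meas (f x)) :=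
  congr_enc ((const 6).prodMk hf) fun _ => rfl

@[fun_prop]
theorem cnot {f g : ξ → ℕ} (hf : PF f) (hg : PF g) : PF (fun x => RGate.cnot (f x) (g x)) :=
  congr_enc ((const 5).prodMk (hf.prodMk hg)) fun _ => rfl

@[fun_prop]
theorem arithMul {f g : ξ → ℕ} (hf : PF f) (hg : PF g) : PF (fun x => ArithGate.mul (f x) (g x)) :=
  congr_enc ((const 2).prodMk (hf.prodMk hg)) fun _ => rfl

@[fun_prop]
theorem arithAdd {f g : ξ → ℕ} (hf : PF f) (hg : PF g) : PF (fun x => ArithGate.add (f x) (g x)) :=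
  congr_enc ((const 1).prodMk (hf.prodMk hg)) fun _ => rfl

/-- Change of the representation of the input. -/
theorem of_repr {α γ : Type} [Enc α] [Enc γ] {ι : Type} {f : α → β} (hf : PF f) (i : ι → α)
    (o : ι → γ) (h : ∀ x, Enc.enc (f (i x)) = Enc.enc (o x)) :
    PolyTime (fun x => Enc.enc (i x)) (fun x => Enc.enc (o x)) := by
  obtain ⟨p, q, hp⟩ := hf
  refine ⟨p, q, fun x => ?_⟩
  have := hp (i x)
  beta_reduce at *
  rwa [h] at this

theorem data_fst : PF Data.fst := by
  refine ⟨.left, Polynomial.X, fun a => ?_⟩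
  cases a with
  | nil => exact ⟨1, by simp [Enc.enc, Data.size], .left_nil⟩
  | cons l r => exact ⟨_, by simp [Enc.enc], .left_cons l r⟩

theorem data_snd : PF Data.snd := by
  refine ⟨.right, Polynomial.X, fun a => ?_⟩
  cases a with
  | nil => exact ⟨1, by simp [Enc.enc, Data.size], .right_nil⟩
  | cons l r => exact ⟨_, by simp [Enc.enc], .right_cons l r⟩

theorem rgateCases {f₁ : ξ × OneQ × ℕ → β} {f₂ : ξ × ℕ × ℕ → β} {f₃ : ξ × ℕ → β} (h₁ : PF f₁)
    (h₂ : PF f₂) (h₃ : PF f₃) : PF (fun p : ξ × RGate => match p.2 with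
      | .one g i => f₁ (p.1, g, i)
      | .cnot i j => f₂ (p.1, i, j)
      | .meas i => f₃ (p.1, i)) := by
  have k₂ : PF (fun q : ξ × ℕ × ℕ × ℕ => f₂ (q.1, q.2.2.1, q.2.2.2)) :=
    h₂.comp (f := fun q : ξ × ℕ × ℕ × ℕ => (q.1, q.2.2.1, q.2.2.2)) (by fun_prop)
  have k₃ : PF (fun q : ξ × ℕ × ℕ => f₃ (q.1, q.2.2)) :=
    h₃.comp (f := fun q : ξ × ℕ × ℕ => (q.1, q.2.2)) (by fun_prop)
  -- The tag of a gate lowered by four: tags `0` to `4` are one-qubit gates, `5` is the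
  -- controlled-not and `6` the measurement. One more step down leaves a nonzero value only for the
  -- measurement.
  have ht : PF (fun q : ξ × RGate => (Enc.enc q.2).fst.snd.snd.snd.snd) :=
    data_snd.comp <| data_snd.comp <| data_snd.comp <| data_snd.comp <|
      data_fst.comp <| data (by fun_prop)
  have ht' := data_snd.comp ht
  obtain ⟨c, qc, hc⟩ := ht
  obtain ⟨c', qc', hc'⟩ := ht'
  obtain ⟨p₁, q₁, h₁⟩ := h₁
  obtain ⟨p₂, q₂, h₂⟩ := k₂
  obtain ⟨p₃, q₃, h₃⟩ := k₃
  refine ⟨.ite c (.ite c' p₃ p₂) p₁, qc + qc' + q₁ + q₂ + q₃ + 2, ?_⟩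
  rintro ⟨x, g⟩
  obtain ⟨s, hs, hrs⟩ := hc (x, g)
  obtain ⟨s', hs', hrs'⟩ := hc' (x, g)
  rcases g with ⟨g, i⟩ | ⟨i, j⟩ | i
  · obtain ⟨t, ht, hr⟩ := h₁ (x, g, i)
    refine ⟨_, ?_, .ite_false (by cases g <;> exact hrs) hr⟩
    simp only [Polynomial.eval_add, Polynomial.eval_ofNat] at *
    change t ≤ q₁.eval (Enc.enc (x, RGate.one g i)).size at ht
    omega
  · obtain ⟨t, ht, hr⟩ := h₂ (x, 5, i, j)
    refine ⟨_, ?_, .ite_true (u := .nil) (v := .nil) hrs (.ite_false hrs' hr)⟩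
    simp only [Polynomial.eval_add, Polynomial.eval_ofNat] at *
    change t ≤ q₂.eval (Enc.enc (x, RGate.cnot i j)).size at ht
    omega
  · obtain ⟨t, ht, hr⟩ := h₃ (x, 6, i)
    refine ⟨_, ?_, .ite_true (u := .nil) (v := .cons .nil .nil) hrs (.ite_true (u := .nil) (v := .nil) hrs' hr)⟩
    simp only [Polynomial.eval_add, Polynomial.eval_ofNat] at *
    change t ≤ q₃.eval (Enc.enc (x, RGate.meas i)).size at ht
    omega

theorem arithCases {f₁ : ξ × Bool → β} {f₂ f₃ : ξ × ℕ × ℕ → β} (h₁ : PF f₁)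
    (h₂ : PF f₂) (h₃ : PF f₃) : PF (fun p : ξ × ArithGate => match p.2 with
      | .const b => f₁ (p.1, b)
      | .add i j => f₂ (p.1, i, j)
      | .mul i j => f₃ (p.1, i, j)) := by
  have k₁ : PF (fun q : ξ × ℕ × Bool => f₁ (q.1, q.2.2)) :=
    h₁.comp (f := fun q : ξ × ℕ × Bool => (q.1, q.2.2)) (by fun_prop)
  have k₂ : PF (fun q : ξ × ℕ × ℕ × ℕ => f₂ (q.1, q.2.2.1, q.2.2.2)) :=
    h₂.comp (f := fun q : ξ × ℕ × ℕ × ℕ => (q.1, q.2.2.1, q.2.2.2)) (by fun_prop)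
  have k₃ : PF (fun q : ξ × ℕ × ℕ × ℕ => f₃ (q.1, q.2.2.1, q.2.2.2)) :=
    h₃.comp (f := fun q : ξ × ℕ × ℕ × ℕ => (q.1, q.2.2.1, q.2.2.2)) (by fun_prop)
  have ht : PF (fun q : ξ × ArithGate => (Enc.enc q.2).fst) :=
    data_fst.comp <| data (by fun_prop)
  have ht' := data_snd.comp ht
  obtain ⟨c, qc, hc⟩ := ht
  obtain ⟨c', qc', hc'⟩ := ht'
  obtain ⟨p₁, q₁, h₁⟩ := k₁
  obtain ⟨p₂, q₂, h₂⟩ := k₂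
  obtain ⟨p₃, q₃, h₃⟩ := k₃
  refine ⟨.ite c (.ite c' p₃ p₂) p₁, qc + qc' + q₁ + q₂ + q₃ + 2, ?_⟩
  rintro ⟨x, g⟩
  obtain ⟨s, hs, hrs⟩ := hc (x, g)
  obtain ⟨s', hs', hrs'⟩ := hc' (x, g)
  rcases g with b | ⟨i, j⟩ | ⟨i, j⟩
  · obtain ⟨t, ht, hr⟩ := h₁ (x, 0, b)
    refine ⟨_, ?_, .ite_false hrs hr⟩
    simp only [Polynomial.eval_add, Polynomial.eval_ofNat] at *
    change t ≤ q₁.eval (Enc.enc (x, ArithGate.const b)).size at ht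
    omega
  · obtain ⟨t, ht, hr⟩ := h₂ (x, 1, i, j)
    refine ⟨_, ?_, .ite_true (u := .nil) (v := .nil) hrs (.ite_false hrs' hr)⟩
    simp only [Polynomial.eval_add, Polynomial.eval_ofNat] at *
    change t ≤ q₂.eval (Enc.enc (x, ArithGate.add i j)).size at ht
    omega
  · obtain ⟨t, ht, hr⟩ := h₃ (x, 2, i, j)
    refine ⟨_, ?_, .ite_true (u := .nil) (v := .cons .nil .nil) hrs
      (.ite_true (u := .nil) (v := .nil) hrs' hr)⟩
    simp only [Polynomial.eval_add, Polynomial.eval_ofNat] at *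
    change t ≤ q₃.eval (Enc.enc (x, ArithGate.mul i j)).size at ht
    omega

@[fun_prop]
theorem rgateMap {φ : ξ → ℕ → ℕ} {g : ξ → RGate} (hφ : PF (fun p : ξ × ℕ => φ p.1 p.2))
    (hg : PF g) : PF (fun x => (g x).map (φ x)) := by
  have h1 : PF (fun p : ξ × OneQ × ℕ => RGate.one p.2.1 (φ p.1 p.2.2)) := by
    have : PF (fun p : ξ × OneQ × ℕ => (p.2.1, φ p.1 p.2.2)) :=
      (by fun_prop : PF (fun p : ξ × OneQ × ℕ => p.2.1)).prodMk
        (hφ.comp (f := fun p : ξ × OneQ × ℕ => (p.1, p.2.2)) (by fun_prop))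
    exact congr_enc this fun _ => rfl
  have h2 : PF (fun p : ξ × ℕ × ℕ => RGate.cnot (φ p.1 p.2.1) (φ p.1 p.2.2)) :=
    cnot (hφ.comp (f := fun p : ξ × ℕ × ℕ => (p.1, p.2.1)) (by fun_prop))
      (hφ.comp (f := fun p : ξ × ℕ × ℕ => (p.1, p.2.2)) (by fun_prop))
  have h3 : PF (fun p : ξ × ℕ => RGate.meas (φ p.1 p.2)) := meas hφ
  have := (rgateCases h1 h2 h3).comp (f := fun x => (x, g x)) (by fun_prop)
  refine congr_enc this fun x => ?_
  cases h : g x <;> simp [RGate.map]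

end PF

/-! ## Properties of the dual action -/

/-- The assignments agree outside `S`. -/
def AgreeOff (S : Set ℕ) (u v : Mem) : Prop := ∀ i, i ∉ S → u i = v i

theorem AgreeOff.update {S : Set ℕ} {u v : Mem} (h : AgreeOff S u v) {i : ℕ} (hi : i ∈ S)
    (b : Bool) : AgreeOff S (Function.update u i b) v := by
  intro j hj
  have : j ≠ i := by rintro rfl; exact hj hi
  rw [Function.update_of_ne this, h j hj]

theorem RGate.heis_congr {S : Set ℕ} {g : RGate} (hg : g.On S) {F F' : Mem → Mem → ℂ} {u v : Mem}
    (h : ∀ u' v', AgreeOff S u' u → AgreeOff S v' v → F u' v' = F' u' v') :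
    g.heis F u v = g.heis F' u v := by
  have hr : ∀ u : Mem, AgreeOff S u u := fun u i _ => rfl
  cases g with
  | one g i =>
    simp only [heis]
    exact Finset.sum_congr rfl fun s _ => Finset.sum_congr rfl fun t _ => by
      rw [h _ _ ((hr u).update hg s) ((hr v).update hg t)]
  | cnot i j => exact h _ _ ((hr u).update hg.2 _) ((hr v).update hg.2 _)
  | meas i => simp only [heis]; rw [h _ _ (hr u) (hr v)]

theorem AgreeOff.trans {S : Set ℕ} {u v w : Mem} (h : AgreeOff S u v) (h' : AgreeOff S v w) :
    AgreeOff S u w := fun i hi => (h i hi).trans (h' i hi)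

/-- Gates on `S` change assignments only inside `S`, so the pulled-back value at `u`, `v` uses the
functional only at assignments that agree with them outside `S`. -/
theorem heisL_congr {S : Set ℕ} {gs : List RGate} (hg : ∀ g ∈ gs, g.On S) {F F' : Mem → Mem → ℂ}
    {u v : Mem} (h : ∀ u' v', AgreeOff S u' u → AgreeOff S v' v → F u' v' = F' u' v') :
    heisL gs F u v = heisL gs F' u v := by
  induction gs generalizing u v with
  | nil => exact h u v (fun _ _ => rfl) (fun _ _ => rfl)
  | cons g gs ih =>
    refine RGate.heis_congr (hg g (by simp)) fun u' v' hu hv => ?_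
    exact ih (fun g hg' => hg g (by simp [hg'])) fun u'' v'' hu' hv' =>
      h u'' v'' (hu'.trans hu) (hv'.trans hv)

/-- The functional depends on the wires in `S` only through a partial trace. -/
def TracedOn (S : Set ℕ) (F : Mem → Mem → ℂ) : Prop :=
  ∀ u v u' v', (∀ i, u i ≠ u' i ∨ v i ≠ v' i → i ∈ S ∧ u i = v i ∧ u' i = v' i) →
    F u v = F u' v'

theorem TracedOn.mono {S S' : Set ℕ} {F : Mem → Mem → ℂ} (h : TracedOn S F) (hs : S' ⊆ S) :
    TracedOn S' F := fun u v u' v' hi => h u v u' v' fun i hd => ⟨hs (hi i hd).1, (hi i hd).2⟩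

theorem tracedOn_update {S : Set ℕ} {u v u' v' : Mem} {j : ℕ} (hj : j ∉ S) (s t : Bool)
    (h : ∀ i, u i ≠ u' i ∨ v i ≠ v' i → i ∈ S ∧ u i = v i ∧ u' i = v' i) :
    ∀ i, Function.update u j s i ≠ Function.update u' j s i ∨
      Function.update v j t i ≠ Function.update v' j t i →
      i ∈ S ∧ Function.update u j s i = Function.update v j t i ∧
        Function.update u' j s i = Function.update v' j t i := by
  intro i hi
  by_cases hij : i = j
  · subst hij; simp at hi
  · simp only [Function.update_of_ne hij] at hi ⊢
    exact h i hi

/-- A gate away from `S` commutes with the partial trace over `S`. -/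
theorem TracedOn.heis {S : Set ℕ} {F : Mem → Mem → ℂ} (h : TracedOn S F) {g : RGate}
    (hg : g.On Sᶜ) : TracedOn S (g.heis F) := by
  intro u v u' v' hi
  have hu : ∀ i, i ∉ S → u i = u' i := fun i hiS => by
    by_contra hne; exact hiS (hi i (.inl hne)).1
  have hv : ∀ i, i ∉ S → v i = v' i := fun i hiS => by
    by_contra hne; exact hiS (hi i (.inr hne)).1
  cases g with
  | one g i =>
    simp only [RGate.heis]
    refine Finset.sum_congr rfl fun s _ => Finset.sum_congr rfl fun t _ => ?_
    rw [hu i hg, hv i hg, h _ _ _ _ (tracedOn_update hg s t hi)]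
  | cnot i j =>
    simp only [RGate.heis, cx]
    rw [hu i hg.1, hv i hg.1, hu j hg.2, hv j hg.2]
    exact h _ _ _ _ (tracedOn_update hg.2 _ _ hi)
  | meas i =>
    simp only [RGate.heis]
    rw [hu i hg, hv i hg, h _ _ _ _ hi]

theorem TracedOn.heisL {S : Set ℕ} {F : Mem → Mem → ℂ} (h : TracedOn S F) {gs : List RGate}
    (hg : ∀ g ∈ gs, g.On Sᶜ) : TracedOn S (heisL gs F) := by
  induction gs with
  | nil => exact h
  | cons g gs ih => exact (ih fun g hg' => hg g (by simp [hg'])).heis (hg g (by simp))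

/-- On a discarded wire the observable only tests whether the two assignments agree, not which bit
they carry. -/
theorem tracedOn_obs {m : ℕ} (out : Fin m → ℕ) (a b : Bits m) :
    TracedOn (Set.range out)ᶜ (obs out a b) := by
  intro u v u' v' h
  have hu : ∀ k, u (out k) = u' (out k) := fun k => by
    by_contra hne; exact (h _ (.inl hne)).1 ⟨k, rfl⟩
  have hv : ∀ k, v (out k) = v' (out k) := fun k => by
    by_contra hne; exact (h _ (.inr hne)).1 ⟨k, rfl⟩
  have hj : ∀ j, u j = v j ↔ u' j = v' j := by
    intro j
    by_cases hd : u j ≠ u' j ∨ v j ≠ v' j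
    · exact iff_of_true (h j hd).2.1 (h j hd).2.2
    · push Not at hd
      rw [hd.1, hd.2]
  classical
  unfold obs
  exact if_congr (by simp only [hu, hv, hj]) rfl rfl

theorem heisL_sum {ι : Type*} (s : Finset ι) (gs : List RGate) (c : ι → ℂ)
    (F : ι → Mem → Mem → ℂ) (u v : Mem) :
    heisL gs (fun u v => ∑ i ∈ s, c i * F i u v) u v = ∑ i ∈ s, c i * heisL gs (F i) u v := by
  induction gs generalizing u v with
  | nil => rfl
  | cons g gs ih =>
    have ih' : heisL gs (fun u v => ∑ i ∈ s, c i * F i u v) =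
      fun u v => ∑ i ∈ s, c i * heisL gs (F i) u v := by funext u v; exact ih u v
    rw [heisL_cons, ih']
    cases g with
    | one g i =>
      simp only [RGate.heis, heisL_cons, Finset.mul_sum]
      calc _ = ∑ x, ∑ j ∈ s, ∑ y, g.mat x (u i) * star (g.mat y (v i)) *
            (c j * heisL gs (F j) (Function.update u i x) (Function.update v i y)) :=
            Finset.sum_congr rfl fun x _ => Finset.sum_comm
        _ = _ := by
          rw [Finset.sum_comm]
          refine Finset.sum_congr rfl fun j _ => Finset.sum_congr rfl fun x _ =>
            Finset.sum_congr rfl fun y _ => ?_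
          ring
    | cnot i j => rfl
    | meas i =>
      simp only [RGate.heis, heisL_cons]
      split_ifs <;> simp

/-! ### Renumbering -/

theorem extend_update_base {φ : ℕ → ℕ} (a u : Mem) (i : ℕ) (s : Bool) :
    Function.extend φ a (Function.update u (φ i) s) = Function.extend φ a u := by
  funext j
  by_cases hj : ∃ k, φ k = j
  · simp only [Function.extend, hj, dite_true]
  · rw [Function.extend_apply' _ _ _ hj, Function.extend_apply' _ _ _ hj,
      Function.update_of_ne]
    rintro rfl
    exact hj ⟨i, rfl⟩

theorem update_comp_renumber {φ : ℕ → ℕ} (hφ : Function.Injective φ) (u : Mem) (i : ℕ) (s : Bool) :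
    Function.update u (φ i) s ∘ φ = Function.update (u ∘ φ) i s := by
  funext j
  by_cases hj : j = i
  · subst hj; simp
  · simp [Function.update_of_ne hj, Function.update_of_ne (hφ.ne hj)]

/-- Renumbered gates act on `u ∘ φ`, and all wires outside the range of `φ` are spectators:
`Function.extend φ a u` puts `a` on the range and keeps `u` elsewhere. -/
theorem heisL_map {φ : ℕ → ℕ} (hφ : Function.Injective φ) (gs : List RGate)
    (F : Mem → Mem → ℂ) (u v : Mem) :
    heisL (gs.map (RGate.map φ)) F u v =
      heisL gs (fun a b => F (Function.extend φ a u) (Function.extend φ b v)) (u ∘ φ) (v ∘ φ) := by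
  induction gs generalizing u v with
  | nil =>
    have : ∀ u : Mem, Function.extend φ (u ∘ φ) u = u := by
      intro u
      funext j
      by_cases hj : ∃ k, φ k = j
      · obtain ⟨k, rfl⟩ := hj; rw [hφ.extend_apply]; rfl
      · rw [Function.extend_apply' _ _ _ hj]
    simp [this]
  | cons g gs ih =>
    rw [List.map_cons, heisL_cons, heisL_cons]
    cases g with
    | one g i =>
      simp only [RGate.map, RGate.heis, ih, update_comp_renumber hφ, extend_update_base]
      rfl
    | cnot i j =>
      simp only [RGate.map, RGate.heis, ih, cx, update_comp_renumber hφ, extend_update_base]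
      rfl
    | meas i => simp only [RGate.map, RGate.heis, ih]; rfl

/-- Only the matrix unit indexed by the actual values on the output wires contributes, so a
functional of the reduced state can be evaluated pointwise. -/
theorem sum_obs_mul {m : ℕ} (out : Fin m → ℕ) (K : Bits m → Bits m → ℂ) (u v : Mem) 
    [Decidable (∀ j, (∀ k, out k ≠ j) → u j = v j)] :
    ∑ p : Bits m × Bits m, K p.1 p.2 * obs out p.1 p.2 u v =
      if ∀ j, (∀ k, out k ≠ j) → u j = v j then K (u ∘ out) (v ∘ out) else 0 := by
  rw [Finset.sum_eq_single (u ∘ out, v ∘ out)]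
  · simp only [obs]
    split_ifs with h1 h2 h2
    · simp
    · exact absurd h1.2.2 h2
    · exact absurd ⟨fun _ => rfl, fun _ => rfl, h2⟩ h1
    · simp
  · rintro ⟨a, b⟩ _ hne
    simp only [obs]
    rw [if_neg, mul_zero]
    rintro ⟨h1, h2, _⟩
    refine hne (Prod.ext ?_ ?_) <;> funext k
    · exact (h1 k).symm
    · exact (h2 k).symm
  · simp

theorem QCircuit.chan_single {n m : ℕ} (C : QCircuit n m) (x y : Bits n) (a b : Bits m) :
    C.chan (Matrix.single x y 1) a b = heisL C.rawGates (obs C.rawOut a b) (mem x) (mem y) := by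
  rw [chan_apply, Finset.sum_eq_single x, Finset.sum_eq_single y]
  · simp
  · intro b _ hb; simp [Matrix.single, Ne.symm hb]
  · simp
  · intro b _ hb; simp [Matrix.single, Ne.symm hb]
  · simp

theorem QCircuit.chan_eq_sum {n m : ℕ} (C : QCircuit n m) (ρ : Op (Bits n)) (a b : Bits m) :
    C.chan ρ a b = ∑ x, ∑ y, ρ x y * C.chan (Matrix.single x y 1) a b := by
  rw [chan_apply]
  simp only [chan_single]

open Classical in
/-- A circuit as a part of a larger circuit whose remaining part discards the non-output wires. -/
theorem heisL_subcircuit {n m : ℕ} (C : QCircuit n m) {φ : ℕ → ℕ} (hφ : Function.Injective φ)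
    (F : Mem → Mem → ℂ) (K : Bits m → Bits m → ℂ) (u v : Mem)
    (hu : ∀ i, n ≤ i → u (φ i) = false) (hv : ∀ i, n ≤ i → v (φ i) = false)
    (hF : ∀ a b : Mem, (∀ i, n + C.fresh ≤ i → a i = false) → (∀ i, n + C.fresh ≤ i → b i = false) →
      F (Function.extend φ a u) (Function.extend φ b v) =
        if ∀ j, (∀ k, C.rawOut k ≠ j) → a j = b j then K (a ∘ C.rawOut) (b ∘ C.rawOut) else 0) :
    heisL (C.rawGates.map (RGate.map φ)) F u v =
      ∑ a, ∑ b, C.chan (Matrix.single (rest n (u ∘ φ)) (rest n (v ∘ φ)) 1) a b * K a b := by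
  rw [heisL_map hφ]
  -- The subcircuit never leaves its own wires, so only assignments that are `0` beyond them matter.
  -- This is why `hF` is needed only for those.
  have h0 : ∀ {u : Mem}, (∀ i, n ≤ i → u (φ i) = false) → ∀ {a : Mem},
      AgreeOff (Set.Iio (n + C.fresh)) a (u ∘ φ) → ∀ i, n + C.fresh ≤ i → a i = false := by
    intro u hu a ha i hi
    rw [ha i (by simpa using hi)]
    exact hu i (by omega)
  rw [heisL_congr C.rawGates_on (F' := fun u v => ∑ p : Bits m × Bits m,
    K p.1 p.2 * obs C.rawOut p.1 p.2 u v), heisL_sum, Fintype.sum_prod_type]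
  · simp only [QCircuit.chan_single]
    rw [mem_rest (u := u ∘ φ) hu, mem_rest (u := v ∘ φ) hv]
    refine Finset.sum_congr rfl fun a _ => Finset.sum_congr rfl fun b _ => mul_comm _ _
  · intro a b ha hb
    rw [hF a b (h0 hu ha) (h0 hv hb), sum_obs_mul]

/-! ### Preservation of the trace -/

/-- Unitarity: the columns of each one-qubit matrix are orthonormal. -/
theorem OneQ.sum_mat_mul_star (g : OneQ) (a b : Bool) :
    ∑ s, g.mat s a * star (g.mat s b) = if a = b then 1 else 0 := by
  have h2 : ((Real.sqrt 2 : ℝ) : ℂ)⁻¹ * ((Real.sqrt 2 : ℝ) : ℂ)⁻¹ = 1 / 2 := by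
    rw [← mul_inv, ← Complex.ofReal_mul, Real.mul_self_sqrt (by norm_num)]
    norm_num
  have h3 : Complex.exp (Complex.I * Real.pi / 4) *
      (starRingEnd ℂ) (Complex.exp (Complex.I * Real.pi / 4)) = 1 := by
    rw [← Complex.exp_conj, ← Complex.exp_add]
    simp [Complex.conj_ofNat]
    ring_nf
    simp
  cases g <;> cases a <;> cases b <;>
    simp [mat, matX, matZ, matP, matR, matH, Matrix.diagonal, h2, h3]
  norm_num

-- The trace is the functional with value `1` if `u = v` and `0` otherwise. Unitary gates preserve
-- it, a proper controlled-not because it is injective on assignments, and a measurement because it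
-- removes only off-diagonal entries.
open Classical in
theorem RGate.heis_trace {g : RGate} (hg : g.Proper) (u v : Mem) :
    g.heis (fun u v => if u = v then 1 else 0) u v = if u = v then 1 else 0 := by
  cases g with
  | one g i =>
    simp only [heis]
    by_cases h : AgreeOff {i} u v
    · have h1 : ∀ s t, Function.update u i s = Function.update v i t ↔ s = t := by
        intro s t
        constructor
        · intro e; simpa using congrFun e i
        · rintro rfl
          funext j
          by_cases hj : j = i
          · subst hj; simp
          · simp [Function.update_of_ne hj, h j hj]
      have h2 : u = v ↔ u i = v i := by
        constructor
        · rintro rfl; rfl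
        · intro e
          funext j
          by_cases hj : j = i
          · subst hj; exact e
          · exact h j hj
      simp only [h1, h2, mul_ite, mul_one, mul_zero, Finset.sum_ite_eq, Finset.mem_univ, if_true]
      exact g.sum_mat_mul_star _ _
    · have h1 : ∀ s t, Function.update u i s ≠ Function.update v i t := by
        intro s t e
        refine h fun j hj => ?_
        have := congrFun e j
        rwa [Function.update_of_ne hj, Function.update_of_ne hj] at this
      have h2 : u ≠ v := by rintro rfl; exact h fun _ _ => rfl
      simp [h1, h2]
  | cnot i j =>
    have hij : i ≠ j := hg
    have : Function.Involutive (cx i j) := by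
      intro u
      funext k
      by_cases hk : k = j
      · subst hk; simp [cx, Function.update_of_ne hij]
      · simp [cx, Function.update_of_ne hk]
    simp only [heis, this.injective.eq_iff]
  | meas i =>
    simp only [heis]
    by_cases h : u = v
    · subst h; simp
    · simp [h]

open Classical in
theorem heisL_trace {gs : List RGate} (hg : ∀ g ∈ gs, g.Proper) :
    heisL gs (fun u v => if u = v then 1 else 0) = fun u v => if u = v then 1 else 0 := by
  induction gs with
  | nil => rfl
  | cons g gs ih =>
    rw [heisL_cons, ih fun g hg' => hg g (by simp [hg'])]
    funext u v
    exact RGate.heis_trace (hg g (by simp)) u v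

/-- The observables of the diagonal output entries add up to the trace functional, which is
invariant under all gates. -/
theorem QCircuit.trace_chan {n m : ℕ} (C : QCircuit n m) (ρ : Op (Bits n)) :
    (C.chan ρ).trace = ρ.trace := by
  classical
  simp only [Matrix.trace, Matrix.diag, chan_apply]
  have h : ∀ u v : Mem, ∑ a : Bits m, obs C.rawOut a a u v = if u = v then 1 else 0 := by
    intro u v
    have := sum_obs_mul C.rawOut (fun a b => if a = b then 1 else 0) u v
    rw [Fintype.sum_prod_type] at this
    simp only [ite_mul, one_mul, zero_mul, Finset.sum_ite_eq, Finset.mem_univ, if_true] at this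
    rw [this]
    split_ifs with h1 h2 h3 h3 h3
    · rfl
    · refine absurd ?_ h3
      funext j
      by_cases hj : ∃ k, C.rawOut k = j
      · obtain ⟨k, rfl⟩ := hj; exact congrFun h2 k
      · exact h1 j fun k hk => hj ⟨k, hk⟩
    · exact absurd (by rw [h3]) h2
    · rfl
    · exact absurd (fun j _ => by rw [h3]) h1
    · rfl
  have key : ∀ x y : Bits n, ∑ a : Bits m, heisL C.rawGates (obs C.rawOut a a) (mem x) (mem y) =
      if x = y then 1 else 0 := by
    intro x y
    have h1 := heisL_sum Finset.univ C.rawGates (fun _ : Bits m => 1)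
      (fun a => obs C.rawOut a a) (mem x) (mem y)
    simp only [one_mul] at h1
    rw [← h1]
    have : (fun u v => ∑ a : Bits m, obs C.rawOut a a u v) = fun u v => if u = v then 1 else 0 := by
      funext u v; exact h u v
    rw [this, heisL_trace C.rawGates_proper]
    simp only [(mem_injective n).eq_iff]
  rw [Finset.sum_comm]
  refine Finset.sum_congr rfl fun x _ => ?_
  rw [Finset.sum_comm]
  simp only [← Finset.mul_sum, key]
  simp

/-! ### Gadgets -/

/-- The sign of a bit. -/
def sg (b : Bool) : ℂ := if b then -1 else 1

@[simp] theorem sg_false : sg false = 1 := rfl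
@[simp] theorem sg_true : sg true = -1 := rfl

@[simp] theorem heis_cnot (i j : ℕ) (F : Mem → Mem → ℂ) :
    (RGate.cnot i j).heis F = fun u v => F (cx i j u) (cx i j v) := rfl

@[simp] theorem heis_meas (i : ℕ) (F : Mem → Mem → ℂ) :
    (RGate.meas i).heis F = fun u v => if u i = v i then F u v else 0 := rfl

theorem heis_X (i : ℕ) (F : Mem → Mem → ℂ) (u v : Mem) :
    (RGate.one .X i).heis F u v = F (Function.update u i (!u i)) (Function.update v i (!v i)) := by
  simp only [RGate.heis, OneQ.mat, matX, Matrix.of_apply, Fintype.sum_bool]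
  cases u i <;> cases v i <;> simp

theorem heis_diag (g : OneQ) (d : Bool → ℂ) (hg : g.mat = Matrix.diagonal d) (i : ℕ)
    (F : Mem → Mem → ℂ) (u v : Mem) :
    (RGate.one g i).heis F u v = d (u i) * star (d (v i)) * F u v := by
  simp only [RGate.heis, hg]
  rw [Finset.sum_eq_single (u i), Finset.sum_eq_single (v i)]
  · simp
  · intro t _ ht; simp [Matrix.diagonal, ht]
  · simp
  · intro t _ ht; simp [Matrix.diagonal, ht]
  · simp

theorem heis_H (i : ℕ) (F : Mem → Mem → ℂ) (u v : Mem) :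
    (RGate.one .H i).heis F u v = 1 / 2 * ∑ s, ∑ t, sg (s && u i) * sg (t && v i) *
      F (Function.update u i s) (Function.update v i t) := by
  have h2 : (1 / (Real.sqrt 2 : ℂ)) * star (1 / (Real.sqrt 2 : ℂ)) = 1 / 2 := by
    simp only [one_div, star_inv₀, RCLike.star_def, Complex.conj_ofReal]
    rw [← mul_inv, ← Complex.ofReal_mul, Real.mul_self_sqrt (by norm_num)]
    norm_num
  have hm : ∀ s a, matH s a = sg (s && a) * (1 / (Real.sqrt 2 : ℂ)) := by
    intro s a
    simp only [matH, Matrix.of_apply]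
    cases s <;> cases a <;> simp
  have hs : ∀ b, star (sg b) = sg b := by intro b; cases b <;> simp
  simp only [RGate.heis, OneQ.mat, hm, star_mul', hs, Finset.mul_sum]
  refine Finset.sum_congr rfl fun s _ => Finset.sum_congr rfl fun t _ => ?_
  rw [← h2]
  ring

/-- A uniformly random bit. -/
def coinGates (i : ℕ) : List RGate := [.one .H i, .meas i]

/-- The Hadamard gate makes an equal superposition, and the measurement removes the terms with
different bits in `u` and `v`. What is left is the classical mixture of the two values. -/
theorem heisL_coin (i : ℕ) (F : Mem → Mem → ℂ) (u v : Mem) (hu : u i = false) (hv : v i = false) :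
    heisL (coinGates i) F u v =
      1 / 2 * ∑ b, F (Function.update u i b) (Function.update v i b) := by
  simp [coinGates, heis_H, hu, hv]

/-- The Pauli operator `X^a Z^b` on wire `q`, where `a` and `b` are the values of two wires. -/
def pauliGates (xw zw q : ℕ) : List RGate :=
  [.cnot xw q, .one .H q, .cnot zw q, .one .H q]

/-- A controlled-not between two Hadamard gates on its target is a controlled `Z`. The controls
carry the same bits in `u` and `v`, so the operator is a fixed Pauli operator, and the two signs
combine to one that depends only on whether `u q` and `v q` differ. The order of `X` and `Z` does
not matter for that reason. -/
theorem heisL_pauli {xw zw q : ℕ} (hz : zw ≠ q) (F : Mem → Mem → ℂ) (u v : Mem)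
    (h1 : u xw = v xw) (h2 : u zw = v zw) :
    heisL (pauliGates xw zw q) F u v = sg (u zw && xor (u q) (v q)) *
      F (Function.update u q (xor (u q) (u xw))) (Function.update v q (xor (v q) (u xw))) := by
  simp only [pauliGates, heisL_cons, heisL_nil, heis_cnot, heis_H, Fintype.sum_bool, cx,
    Function.update_self, Function.update_of_ne hz,
    Function.update_idem, ← h1, ← h2]
  generalize u zw = z
  generalize u xw = x
  generalize u q = a
  generalize v q = b
  cases z <;> cases x <;> cases a <;> cases b <;> simp <;> ring

/-- The inverse of the `π/8` gate. -/
def tdg (i : ℕ) : List RGate := [.one .R i, .one .P i, .one .Z i]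

/-- The doubly controlled `Z` gate. -/
def cczGates (a b t : ℕ) : List RGate :=
  (.cnot b t :: tdg t) ++ [.cnot a t, .one .R t] ++ (.cnot b t :: tdg t) ++
    [.cnot a t, .one .R t, .one .R b, .cnot a b] ++ tdg b ++ [.one .R a, .cnot a b]

/-- The Toffoli gate. -/
def toffoli (a b t : ℕ) : List RGate := .one .H t :: (cczGates a b t ++ [.one .H t])

/-- The phase of the `π/8` gate. -/
def ph (b : Bool) : ℂ := if b then Complex.exp (Complex.I * Real.pi / 4) else 1

theorem ph_sq : ph true * ph true = Complex.I := by
  simp only [ph, if_true]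
  rw [← Complex.exp_add, show Complex.I * (Real.pi : ℂ) / 4 + Complex.I * Real.pi / 4 =
    Real.pi / 2 * Complex.I by ring, Complex.exp_pi_div_two_mul_I]

/-- This is `4abt = a + b + t - (a ⊕ b) - (a ⊕ t) - (b ⊕ t) + (a ⊕ b ⊕ t)` in the exponent of
`e^{iπ/4}`, whose fourth power is `-1`. The function `d` is the inverse phase, since `P` and `Z`
after `R` multiply by `-i`. Only `p true * p true = i` is used. -/
theorem ccz_phase {p d : Bool → ℂ} (h0 : p false = 1) (h1 : p true * p true = Complex.I)
    (hd : ∀ x, d x = p x * (if x then Complex.I else 1) * sg x) (a b t : Bool) :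
    d (xor t b) * p (xor (xor t b) a) * d (xor (xor (xor t b) a) b) *
      p (xor (xor (xor (xor t b) a) b) a) * p b * d (xor b a) * p a = sg (a && b && t) := by
  have hI := Complex.I_mul_I
  cases a <;> cases b <;> cases t <;> simp [hd, h0] <;> grind

theorem heisL_ccz {a b t : ℕ} (hab : a ≠ b) (hat : a ≠ t) (hbt : b ≠ t) (F : Mem → Mem → ℂ)
    (u v : Mem) : heisL (cczGates a b t) F u v =
      sg (u a && u b && u t) * sg (v a && v b && v t) * F u v := by
  have hR : ∀ i F u v, (RGate.one .R i).heis F u v = ph (u i) * star (ph (v i)) * F u v :=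
    fun i F u v => heis_diag .R ph rfl i F u v
  have hP : ∀ i F u v, (RGate.one .P i).heis F u v =
      (if u i then Complex.I else 1) * star (if v i then Complex.I else 1) * F u v :=
    fun i F u v => heis_diag .P _ rfl i F u v
  have hZ : ∀ i F u v, (RGate.one .Z i).heis F u v = sg (u i) * star (sg (v i)) * F u v :=
    fun i F u v => heis_diag .Z sg rfl i F u v
  have hC : ∀ i j F u v, (RGate.cnot i j).heis F u v = F (cx i j u) (cx i j v) :=
    fun _ _ _ _ _ => rfl
  -- The controlled-nots cancel altogether, so the sequence is diagonal and only the phases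
  -- collected on the way remain.
  have hcc : ∀ w : Mem, cx a b (cx a b (cx a t (cx b t (cx a t (cx b t w))))) = w := by
    intro w
    funext k
    simp only [cx, Function.update_apply]
    by_cases hk : k = b
    · subst hk
      simp [hab, hat, hbt]
    · by_cases hk' : k = t
      · subst hk'
        simp only [hat, hbt, if_true, if_false]
        cases w k <;> cases w a <;> cases w b <;> simp [hk]
      · simp [hk, hk']
  let d : Bool → ℂ := fun x => ph x * (if x then Complex.I else 1) * sg x
  let A : Bool → Bool → Bool → ℂ := fun a b t =>
    d (xor t b) * ph (xor (xor t b) a) * d (xor (xor (xor t b) a) b) *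
      ph (xor (xor (xor (xor t b) a) b) a) * ph b * d (xor b a) * ph a
  have hA : ∀ a b t, A a b t = sg (a && b && t) := fun a b t =>
    ccz_phase rfl ph_sq (fun _ => rfl) a b t
  have hstar : ∀ b, star (sg b) = sg b := by intro b; cases b <;> simp
  have key : heisL (cczGates a b t) F u v =
      A (u a) (u b) (u t) * star (A (v a) (v b) (v t)) * F u v := by
    simp only [cczGates, tdg, List.cons_append, List.nil_append, heisL_cons, heisL_nil, hR, hP, hZ,
      hC, hcc]
    simp only [cx, Function.update_apply, if_true, if_neg hab, if_neg hat, if_neg hbt,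
      A, d, star_mul']
    ring
  rw [key, hA, hA, hstar]

/-- Hadamard gates on the target turn a doubly controlled `Z` into a doubly controlled `X`. The rest
is a check over the four bits involved. -/
theorem heisL_toffoli {a b t : ℕ} (hab : a ≠ b) (hat : a ≠ t) (hbt : b ≠ t) (F : Mem → Mem → ℂ)
    (u v : Mem) : heisL (toffoli a b t) F u v =
      F (Function.update u t (xor (u t) (u a && u b)))
        (Function.update v t (xor (v t) (v a && v b))) := by
  simp only [toffoli, heisL_cons, heisL_append, heisL_nil, heis_H, heisL_ccz hab hat hbt,
    Fintype.sum_bool, Function.update_self, Function.update_of_ne hat, Function.update_of_ne hbt,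
    Function.update_idem]
  generalize (u a && u b) = x
  generalize (v a && v b) = y
  generalize u t = p
  generalize v t = q
  cases x <;> cases y <;> cases p <;> cases q <;> simp <;> ring

/-! ## Quantum gates for randomized circuits -/

/-- Overwriting a block of wires. -/
def wrL (u : Mem) (o : ℕ) (l : List Bool) : Mem := fun j =>
  if o ≤ j ∧ j < o + l.length then l.getD (j - o) false else u j

theorem wrL_of_lt (u : Mem) {o j : ℕ} (l : List Bool) (h : j < o) : wrL u o l j = u j := by
  rw [wrL, if_neg (by omega)]

theorem wrL_of_le (u : Mem) {o j : ℕ} (l : List Bool) (h : o + l.length ≤ j) :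
    wrL u o l j = u j := by
  rw [wrL, if_neg (by omega)]

theorem wrL_add (u : Mem) (o : ℕ) {i : ℕ} (l : List Bool) (h : i < l.length) :
    wrL u o l (o + i) = l.getD i false := by
  rw [wrL, if_pos (by omega), Nat.add_sub_cancel_left]

@[simp] theorem wrL_nil (u : Mem) (o : ℕ) : wrL u o [] = u := by
  funext j
  rw [wrL, if_neg (by simp)]

theorem wrL_append (u : Mem) (o : ℕ) (l l' : List Bool) :
    wrL (wrL u o l) (o + l.length) l' = wrL u o (l ++ l') := by
  funext j
  rcases lt_or_ge j o with h | h
  · rw [wrL_of_lt _ _ (by omega), wrL_of_lt _ _ h, wrL_of_lt _ _ h]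
  · obtain ⟨i, rfl⟩ := Nat.exists_eq_add_of_le h
    rcases lt_or_ge i l.length with h1 | h1
    · rw [wrL_of_lt _ _ (by omega), wrL_add _ _ _ h1,
        wrL_add _ _ _ (by rw [List.length_append]; omega), List.getD_append _ _ _ _ h1]
    · obtain ⟨k, rfl⟩ := Nat.exists_eq_add_of_le h1
      rcases lt_or_ge k l'.length with h2 | h2
      · rw [← Nat.add_assoc, wrL_add _ _ _ h2, Nat.add_assoc,
          wrL_add _ _ _ (by rw [List.length_append]; omega), List.getD_append_right _ _ _ _ h1,
          Nat.add_sub_cancel_left]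
      · rw [wrL_of_le _ _ (by omega), wrL_of_le _ _ (by omega),
          wrL_of_le _ _ (by rw [List.length_append]; omega)]

theorem wrL_singleton (u : Mem) (o : ℕ) (b : Bool) : wrL u o [b] = Function.update u o b := by
  funext j
  by_cases h : j = o
  · subst h
    simp [wrL]
  · rw [Function.update_of_ne h]
    rcases lt_or_ge j o with h1 | h1
    · exact wrL_of_lt _ _ h1
    · exact wrL_of_le _ _ (by simp; omega)

theorem update_wrL (u : Mem) (o : ℕ) (l : List Bool) (b : Bool) :
    Function.update (wrL u o l) (o + l.length) b = wrL u o (l ++ [b]) := by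
  rw [← wrL_append, wrL_singleton]

/-- Copying bits to a block of wires. -/
def copyGates (n : ℕ) (src : ℕ → ℕ) (o : ℕ) : List RGate :=
  (List.range n).map fun i => .cnot (src i) (o + i)

/-- A block of random bits. -/
def coinsGates (c o : ℕ) : List RGate := (List.range c).flatMap fun i => coinGates (o + i)

/-- A gate of an arithmetic circuit, computed on wire `t` of the block that starts at `o`. -/
def arithGates (o t : ℕ) : ArithGate → List RGate
  | .const b => bif b then [.one .X (o + t)] else []
  | .add i j => (if i < t then [.cnot (o + i) (o + t)] else []) ++
      (if j < t then [.cnot (o + j) (o + t)] else [])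
  -- Arguments that point to wires not yet computed count as `0`, so no gate is needed. For `i = j`
  -- the product is the bit itself; a Toffoli gate requires distinct controls.
  | .mul i j => if i < t then
      (if j < t then (if i = j then [.cnot (o + i) (o + t)] else toffoli (o + i) (o + j) (o + t))
        else []) else []

/-- All gates of an arithmetic circuit with `N` inputs. -/
def allArithGates (o N : ℕ) (gs : List ArithGate) : List RGate :=
  (List.range gs.length).flatMap fun t => arithGates o (N + t) (gs.getD t (.const false))

/-- Copying the output of an arithmetic circuit with `N` wires. -/
def outGates (oWork N : ℕ) (outs : List ℕ) (oOut : ℕ) : List RGate :=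
  (List.range outs.length).flatMap fun k =>
    if outs.getD k 0 < N then [.cnot (oWork + outs.getD k 0) (oOut + k)] else []

/-- The number of wires of a randomized circuit. -/
def RawR.work (R : RawR) : ℕ := R.2.1 + R.2.2.1.length

/-- The gates for a run of a randomized circuit on the wires `src`. -/
def callGates (R : RawR) (src : ℕ → ℕ) (oOut oWork : ℕ) : List RGate :=
  copyGates (R.2.1 - R.1) src oWork ++ (coinsGates R.1 (oWork + (R.2.1 - R.1)) ++
    (allArithGates oWork R.2.1 R.2.2.1 ++ outGates oWork R.work R.2.2.2 oOut))

/-- The gates for `J` runs of a randomized circuit. -/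
def callsGates (R : RawR) (J : ℕ) (src : ℕ → ℕ → ℕ) (oOut oWork : ℕ) : List RGate :=
  (List.range J).flatMap fun j =>
    callGates R (src j) (oOut + j * R.2.2.2.length) (oWork + j * R.work)

/-! ### Action of the compiled randomized circuits. -/

theorem RandCircuit.work_raw {n m : ℕ} (R : RandCircuit n m) :
    RawR.work R.raw = n + R.coins + R.circuit.gates.length := rfl

theorem copyGates_succ (n : ℕ) (src : ℕ → ℕ) (o : ℕ) :
    copyGates (n + 1) src o = .cnot (src 0) o :: copyGates n (fun i => src (i + 1)) (o + 1) := by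
  simp only [copyGates, List.range_succ_eq_map, List.map_cons, List.map_map]
  congr 1
  refine List.map_congr_left fun i _ => ?_
  simp only [Function.comp, Nat.succ_eq_add_one]
  congr 1
  omega

/-- The state is described as the original assignment overwritten from `o` on by the list `l` of the
bits written so far. Each elementary step appends a bit, and keeping `l` general carries the
induction. The lemmas for coins, gates and outputs have the same form, so that they can be chained.
-/
theorem heisL_copy {n : ℕ} {src : ℕ → ℕ} {o : ℕ} (x : Fin n → Bool) (u v : Mem) (l : List Bool)
    (F : Mem → Mem → ℂ)
    (hs : ∀ i < n, src i < o) (hu : ∀ i : Fin n, u (src i) = x i) (hv : ∀ i : Fin n, v (src i) = x i)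
    (hu0 : ∀ i, o ≤ i → u i = false) (hv0 : ∀ i, o ≤ i → v i = false) :
    heisL (copyGates n src (o + l.length)) F (wrL u o l) (wrL v o l) =
      F (wrL u o (l ++ List.ofFn x)) (wrL v o (l ++ List.ofFn x)) := by
  induction n generalizing l src with
  | zero => simp [copyGates]
  | succ n ih =>
    have key : ∀ w : Mem, w (src 0) = x 0 → (∀ i, o ≤ i → w i = false) →
        cx (src 0) (o + l.length) (wrL w o l) = wrL w o (l ++ [x 0]) := by
      intro w hw hw0
      rw [cx, wrL_of_le _ _ le_rfl, wrL_of_lt _ _ (hs 0 (by omega)), hw,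
        hw0 _ (by omega), Bool.false_xor, update_wrL]
    rw [copyGates_succ, heisL_cons, heis_cnot]
    beta_reduce
    rw [key u (hu 0) hu0, key v (hv 0) hv0]
    have h1 := ih (src := fun i => src (i + 1)) (fun i => x i.succ) (l ++ [x 0])
      (fun i hi => hs (i + 1) (by omega)) (fun i => hu i.succ) (fun i => hv i.succ)
    rw [List.length_append, List.length_singleton, ← Nat.add_assoc] at h1
    rw [h1, List.ofFn_succ, List.append_assoc]
    rfl

theorem coinsGates_succ (c o : ℕ) :
    coinsGates (c + 1) o = coinGates o ++ coinsGates c (o + 1) := by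
  simp only [coinsGates, List.range_succ_eq_map, List.flatMap_cons, List.flatMap_map]
  congr 1
  refine List.flatMap_congr fun i _ => ?_
  congr 1
  simp only [Nat.succ_eq_add_one]
  omega

theorem heisL_coins (c : ℕ) {o : ℕ} (u v : Mem) (l : List Bool) (F : Mem → Mem → ℂ)
    (hu0 : ∀ i, o ≤ i → u i = false) (hv0 : ∀ i, o ≤ i → v i = false) :
    heisL (coinsGates c (o + l.length)) F (wrL u o l) (wrL v o l) =
      (1 / 2 ^ c) * ∑ s : Bits c, F (wrL u o (l ++ List.ofFn s)) (wrL v o (l ++ List.ofFn s)) := by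
  induction c generalizing l with
  | zero => simp [coinsGates]
  | succ c ih =>
    rw [coinsGates_succ, heisL_append, heisL_coin _ _ _ _
      (by rw [wrL_of_le _ _ le_rfl]; exact hu0 _ (by omega))
      (by rw [wrL_of_le _ _ le_rfl]; exact hv0 _ (by omega))]
    simp only [update_wrL]
    have h1 : ∀ b, heisL (coinsGates c (o + l.length + 1)) F (wrL u o (l ++ [b]))
        (wrL v o (l ++ [b])) = (1 / 2 ^ c) * ∑ s : Bits c,
          F (wrL u o (l ++ [b] ++ List.ofFn s)) (wrL v o (l ++ [b] ++ List.ofFn s)) := by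
      intro b
      have := ih (l ++ [b])
      rwa [List.length_append, List.length_singleton, ← Nat.add_assoc] at this
    simp only [h1]
    rw [← (Fin.consEquiv fun _ : Fin (c + 1) => Bool).sum_comp, Fintype.sum_prod_type,
      ← Finset.mul_sum, ← mul_assoc]
    congr 1
    · rw [pow_succ]; field_simp
    · refine Finset.sum_congr rfl fun b _ => Finset.sum_congr rfl fun s _ => ?_
      simp [Fin.consEquiv, List.ofFn_succ]

theorem heisL_arith {o : ℕ} (g : ArithGate) (u v : Mem) (l : List Bool) (F : Mem → Mem → ℂ)
    (hu0 : ∀ i, o ≤ i → u i = false) (hv0 : ∀ i, o ≤ i → v i = false) :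
    heisL (arithGates o l.length g) F (wrL u o l) (wrL v o l) =
      F (wrL u o (l ++ [g.eval l])) (wrL v o (l ++ [g.eval l])) := by
  have hlast : ∀ w : Mem, (∀ i, o ≤ i → w i = false) → wrL w o l (o + l.length) = false :=
    fun w hw => by rw [wrL_of_le _ _ le_rfl]; exact hw _ (by omega)
  have hget : ∀ (w : Mem) i, i < l.length → wrL w o l (o + i) = l.getD i false :=
    fun w i hi => wrL_add _ _ _ hi
  have hnot : ∀ i, ¬ i < l.length → l.getD i false = false := fun i hi =>
    List.getD_eq_default _ _ (not_lt.1 hi)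
  -- The next wire still carries `0`, so appending the value `0` costs no gate.
  have hskip : ∀ w : Mem, (∀ i, o ≤ i → w i = false) → wrL w o l = wrL w o (l ++ [false]) := by
    intro w hw
    rw [← update_wrL, ← hlast w hw, Function.update_eq_self]
  have hcx : ∀ (w : Mem) (i : ℕ) (b : Bool), i < l.length →
      cx (o + i) (o + l.length) (wrL w o (l ++ [b])) = wrL w o (l ++ [xor b (l.getD i false)]) := by
    intro w i b hi
    rw [cx, wrL_add _ _ _ (by simp), wrL_add _ _ _ (by simp; omega), List.getD_append _ _ _ _ hi,
      ← update_wrL, Function.update_idem, update_wrL]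
    simp
  cases g with
  | const b =>
    cases b
    · simp only [arithGates, cond_false, heisL_nil, ArithGate.eval]
      rw [← hskip u hu0, ← hskip v hv0]
    · simp only [arithGates, cond_true, heisL_cons, heisL_nil, heis_X, ArithGate.eval]
      rw [hlast u hu0, hlast v hv0, update_wrL, update_wrL]
      rfl
  | add i j =>
    simp only [arithGates, ArithGate.eval, heisL_append]
    rw [hskip u hu0, hskip v hv0]
    split_ifs with hi hj hj
    · simp [hcx _ _ _ hi, hcx _ _ _ hj]
    · simp only [heisL_cons, heis_cnot, heisL_nil, hcx _ _ _ hi, hnot _ hj, Bool.false_xor,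
        Bool.xor_false]
    · simp only [heisL_cons, heis_cnot, heisL_nil, hcx _ _ _ hj, hnot _ hi, Bool.false_xor]
    · simp only [heisL_nil, hnot _ hj, hnot _ hi, Bool.false_xor]
  | mul i j =>
    simp only [arithGates, ArithGate.eval]
    split_ifs with hi hj hij
    · subst hij
      rw [hskip u hu0, hskip v hv0]
      simp [hcx _ _ _ hi]
    · rw [heisL_toffoli (by omega) (by omega) (by omega), hlast u hu0, hlast v hv0, hget _ _ hi,
        hget _ _ hi, hget _ _ hj, hget _ _ hj, update_wrL, update_wrL, Bool.false_xor]
    · rw [hnot _ hj, Bool.and_false, ← hskip u hu0, ← hskip v hv0]; rfl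
    · rw [hnot _ hi, Bool.false_and, ← hskip u hu0, ← hskip v hv0]; rfl

theorem allArithGates_cons (o N : ℕ) (g : ArithGate) (gs : List ArithGate) :
    allArithGates o N (g :: gs) = arithGates o N g ++ allArithGates o (N + 1) gs := by
  simp only [allArithGates, List.length_cons, List.range_succ_eq_map, List.flatMap_cons,
    List.flatMap_map]
  congr 1
  refine List.flatMap_congr fun i _ => ?_
  simp only [Nat.succ_eq_add_one, List.getD_cons_succ]
  congr 1
  omega

theorem heisL_allArith {o : ℕ} (gs : List ArithGate) (u v : Mem) (l : List Bool)
    (F : Mem → Mem → ℂ) (hu0 : ∀ i, o ≤ i → u i = false) (hv0 : ∀ i, o ≤ i → v i = false) :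
    heisL (allArithGates o l.length gs) F (wrL u o l) (wrL v o l) =
      F (wrL u o (gs.foldl (fun v g => v ++ [g.eval v]) l))
        (wrL v o (gs.foldl (fun v g => v ++ [g.eval v]) l)) := by
  induction gs generalizing l with
  | nil => simp [allArithGates]
  | cons g gs ih =>
    rw [allArithGates_cons, heisL_append, heisL_arith g u v l _ hu0 hv0]
    have := ih (l ++ [g.eval l])
    rw [List.length_append, List.length_singleton] at this
    rw [this, List.foldl_cons]

theorem outGates_cons (oWork N : ℕ) (k : ℕ) (outs : List ℕ) (oOut : ℕ) :
    outGates oWork N (k :: outs) oOut = (if k < N then [.cnot (oWork + k) oOut] else []) ++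
      outGates oWork N outs (oOut + 1) := by
  simp only [outGates, List.length_cons, List.range_succ_eq_map, List.flatMap_cons,
    List.flatMap_map]
  congr 1
  refine List.flatMap_congr fun i _ => ?_
  simp only [Nat.succ_eq_add_one, List.getD_cons_succ]
  congr 3
  omega

theorem heisL_out {o oWork : ℕ} (outs : List ℕ) (u v : Mem) (l w : List Bool)
    (F : Mem → Mem → ℂ) (ho : o + l.length + outs.length ≤ oWork)
    (hu : ∀ i < w.length, u (oWork + i) = w.getD i false)
    (hv : ∀ i < w.length, v (oWork + i) = w.getD i false)
    (hu0 : ∀ i, o ≤ i → i < oWork → u i = false) (hv0 : ∀ i, o ≤ i → i < oWork → v i = false) :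
    heisL (outGates oWork w.length outs (o + l.length)) F (wrL u o l) (wrL v o l) =
      F (wrL u o (l ++ outs.map fun k => w.getD k false))
        (wrL v o (l ++ outs.map fun k => w.getD k false)) := by
  induction outs generalizing l with
  | nil => simp [outGates]
  | cons k outs ih =>
    rw [List.length_cons] at ho
    have key : ∀ y : Mem, (∀ i < w.length, y (oWork + i) = w.getD i false) →
        (∀ i, o ≤ i → i < oWork → y i = false) →
        (k < w.length → cx (oWork + k) (o + l.length) (wrL y o l) =
          wrL y o (l ++ [w.getD k false])) ∧
        (¬ k < w.length → wrL y o l = wrL y o (l ++ [w.getD k false])) := by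
      intro y hy hy0
      have hlast : wrL y o l (o + l.length) = false := by
        rw [wrL_of_le _ _ le_rfl]; exact hy0 _ (by omega) (by omega)
      constructor
      · intro hk
        rw [cx, hlast, wrL_of_le _ _ (by omega), hy k hk, Bool.false_xor, update_wrL]
      · intro hk
        rw [List.getD_eq_default _ _ (not_lt.1 hk), ← update_wrL, ← hlast,
          Function.update_eq_self]
    have h1 := ih (l ++ [w.getD k false]) (by simp; omega)
    rw [List.length_append, List.length_singleton, ← Nat.add_assoc] at h1
    rw [outGates_cons, heisL_append, List.map_cons, List.append_cons]
    rw [← h1]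
    split_ifs with hk
    · rw [heisL_cons, heis_cnot, heisL_nil]
      beta_reduce
      rw [(key u hu hu0).1 hk, (key v hv hv0).1 hk]
    · rw [heisL_nil, (key u hu hu0).2 hk, (key v hv hv0).2 hk]

theorem ArithCircuit.length_wires {n m : ℕ} (C : ArithCircuit n m) (x : Bits n) :
    (C.wires x).length = n + C.gates.length := by
  have : ∀ (gs : List ArithGate) (l : List Bool),
      (gs.foldl (fun v g => v ++ [g.eval v]) l).length = l.length + gs.length := by
    intro gs
    induction gs with
    | nil => simp
    | cons g gs ih => intro l; rw [List.foldl_cons, ih]; simp; omega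
  rw [wires, this, List.length_ofFn]

/-- Grouping the coin strings by the output they lead to: an expectation over outputs is an average
over coins, which is what the compiled circuit produces. -/
theorem RandCircuit.sum_prob_mul {n m : ℕ} (R : RandCircuit n m) (x : Bits n) (f : Bits m → ℂ) :
    ∑ y, (R.prob x y : ℂ) * f y =
      1 / 2 ^ R.coins * ∑ s : Bits R.coins, f (R.circuit.eval (Fin.append x s)) := by
  rw [← Finset.sum_fiberwise Finset.univ (fun s => R.circuit.eval (Fin.append x s)),
    Finset.mul_sum]
  refine Finset.sum_congr rfl fun y _ => ?_
  rw [Finset.sum_congr rfl (g := fun _ => f y) fun s hs => by rw [(Finset.mem_filter.1 hs).2],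
    Finset.sum_const, nsmul_eq_mul, prob]
  push_cast
  ring

/-- The compiled circuit copies its input to the work wires, tosses coins, computes and copies the
result to the output block. It leaves garbage on the work wires. As the input `x` is the same in `u`
and `v`, the garbage is too, and `F` traces these wires out, so they may be treated as untouched. -/
theorem heisL_call {n m : ℕ} (R : RandCircuit n m) {src : ℕ → ℕ} {oOut oWork : ℕ} (x : Bits n)
    (u v : Mem) (F : Mem → Mem → ℂ) (hs : ∀ i < n, src i < oOut) (ho : oOut + m ≤ oWork)
    (hu : ∀ i : Fin n, u (src i) = x i) (hv : ∀ i : Fin n, v (src i) = x i)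
    (hu0 : ∀ i, oOut ≤ i → u i = false) (hv0 : ∀ i, oOut ≤ i → v i = false)
    (hF : TracedOn (Set.Ico oWork (oWork + RawR.work R.raw)) F) :
    heisL (callGates R.raw src oOut oWork) F u v =
      ∑ y : Bits m, (R.prob x y : ℂ) *
        F (wrL u oOut (List.ofFn y)) (wrL v oOut (List.ofFn y)) := by
  have hu1 : ∀ i, oWork ≤ i → u i = false := fun i hi => hu0 i (by omega)
  have hv1 : ∀ i, oWork ≤ i → v i = false := fun i hi => hv0 i (by omega)
  rw [RandCircuit.sum_prob_mul, callGates, heisL_append, heisL_append, heisL_append]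
  simp only [RandCircuit.raw, Nat.add_sub_cancel]
  have h1 := heisL_copy (src := src) (o := oWork) x u v [] (heisL (coinsGates R.coins (oWork + n))
    (heisL (allArithGates oWork (n + R.coins) R.circuit.gates)
      (heisL (outGates oWork (RawR.work R.raw) (List.ofFn R.circuit.out) oOut) F)))
    (fun i hi => (hs i hi).trans_le (by omega)) hu hv hu1 hv1
  simp only [List.length_nil, Nat.add_zero, wrL_nil, List.nil_append, RandCircuit.raw] at h1
  rw [h1]
  have h2 := heisL_coins R.coins u v (List.ofFn x) (heisL (allArithGates oWork (n + R.coins)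
    R.circuit.gates) (heisL (outGates oWork (RawR.work R.raw) (List.ofFn R.circuit.out) oOut) F))
    hu1 hv1
  rw [List.length_ofFn] at h2
  rw [RandCircuit.raw] at h2
  rw [h2]
  congr 1
  refine Finset.sum_congr rfl fun s _ => ?_
  rw [← List.ofFn_fin_append]
  have h3 := heisL_allArith R.circuit.gates u v (List.ofFn (Fin.append x s))
    (heisL (outGates oWork (RawR.work R.raw) (List.ofFn R.circuit.out) oOut) F) hu1 hv1
  rw [List.length_ofFn] at h3
  rw [RandCircuit.raw] at h3
  rw [h3]
  change heisL _ F (wrL u oWork (R.circuit.wires (Fin.append x s)))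
    (wrL v oWork (R.circuit.wires (Fin.append x s))) = _
  set w := R.circuit.wires (Fin.append x s) with hw
  have hwl : w.length = RawR.work R.raw := R.circuit.length_wires _
  have h4 := heisL_out (o := oOut) (oWork := oWork) (List.ofFn R.circuit.out) (wrL u oWork w)
    (wrL v oWork w) [] w F (by simpa using ho) (fun i hi => wrL_add _ _ _ hi)
    (fun i hi => wrL_add _ _ _ hi)
    (fun i hi hi' => by rw [wrL_of_lt _ _ hi']; exact hu0 i hi)
    (fun i hi hi' => by rw [wrL_of_lt _ _ hi']; exact hv0 i hi)
  simp only [wrL_nil, List.length_nil, Nat.add_zero, List.nil_append, hwl] at h4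
  rw [RandCircuit.raw] at h4
  rw [h4]
  have h5 : (List.ofFn R.circuit.out).map (fun k => w.getD k false) =
      List.ofFn (R.circuit.eval (Fin.append x s)) := by
    rw [List.map_ofFn]; rfl
  rw [h5]
  set l := List.ofFn (R.circuit.eval (Fin.append x s)) with hl
  have hll : l.length = m := by rw [hl, List.length_ofFn]
  have key : ∀ (y : Mem) i, wrL (wrL y oWork w) oOut l i ≠ wrL y oOut l i →
      oWork ≤ i ∧ i < oWork + w.length := by
    intro y i hi
    by_contra hcon
    refine hi ?_
    simp only [wrL] at *
    rw [if_neg hcon]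
  have key2 : ∀ (y : Mem) i, oWork ≤ i → i < oWork + w.length →
      wrL (wrL y oWork w) oOut l i = w.getD (i - oWork) false := by
    intro y i h1 h2
    rw [wrL_of_le _ _ (by omega), wrL, if_pos ⟨h1, h2⟩]
  -- The garbage is removed here: the two assignments differ from the clean ones only on work wires,
  -- and agree with each other there before and after.
  refine hF _ _ _ _ fun i hi => ?_
  have hi' : oWork ≤ i ∧ i < oWork + w.length := by
    rcases hi with hi | hi
    · exact key u i hi
    · exact key v i hi
  rw [hwl] at hi'
  refine ⟨hi', ?_, ?_⟩
  · rw [key2 _ _ hi'.1 (by omega), key2 _ _ hi'.1 (by omega)]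
  · rw [wrL_of_le _ _ (by omega), wrL_of_le _ _ (by omega), hu1 i hi'.1, hv1 i hi'.1]

/-! ### Wires of the gates -/

theorem RGate.On.mono {S T : Set ℕ} (h : S ⊆ T) {g : RGate} (hg : g.On S) : g.On T := by
  cases g with
  | one g i => exact h hg
  | cnot i j => exact ⟨h hg.1, h hg.2⟩
  | meas i => exact h hg

/-- All wires of the gates belong to `S`, and the gates are well-formed. -/
def GoodOn (S : Set ℕ) (gs : List RGate) : Prop := ∀ g ∈ gs, g.On S ∧ g.Proper

theorem GoodOn.on {S : Set ℕ} {gs : List RGate} (h : GoodOn S gs) : ∀ g ∈ gs, g.On S :=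
  fun g hg => (h g hg).1

theorem GoodOn.mono {S T : Set ℕ} (h : S ⊆ T) {gs : List RGate} (hg : GoodOn S gs) : GoodOn T gs :=
  fun g hg' => ⟨(hg g hg').1.mono h, (hg g hg').2⟩

theorem GoodOn.append {S : Set ℕ} {gs gs' : List RGate} (h : GoodOn S gs) (h' : GoodOn S gs') :
    GoodOn S (gs ++ gs') := fun g hg => (List.mem_append.1 hg).elim (h g) (h' g)

theorem GoodOn.flatMap {ι : Type*} {S : Set ℕ} {l : List ι} {f : ι → List RGate}
    (h : ∀ i ∈ l, GoodOn S (f i)) : GoodOn S (l.flatMap f) := fun g hg => by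
  obtain ⟨i, hi, hg⟩ := List.mem_flatMap.1 hg
  exact h i hi g hg

theorem goodOn_coin {S : Set ℕ} {i : ℕ} (hi : i ∈ S) : GoodOn S (coinGates i) := by
  simp [GoodOn, coinGates, RGate.On, RGate.Proper, hi]

theorem goodOn_toffoli {S : Set ℕ} {a b t : ℕ} (ha : a ∈ S) (hb : b ∈ S) (ht : t ∈ S) (hab : a ≠ b)
    (hat : a ≠ t) (hbt : b ≠ t) : GoodOn S (toffoli a b t) := by
  simp [GoodOn, toffoli, cczGates, tdg, RGate.On, RGate.Proper, ha, hb, ht, hab, hat, hbt]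

theorem goodOn_pauli {S : Set ℕ} {a b q : ℕ} (ha : a ∈ S) (hb : b ∈ S) (hq : q ∈ S)
    (haq : a ≠ q) (hbq : b ≠ q) : GoodOn S (pauliGates a b q) := by
  simp [GoodOn, pauliGates, RGate.On, RGate.Proper, ha, hb, hq, haq, hbq]

theorem goodOn_copy {S : Set ℕ} {n o : ℕ} {src : ℕ → ℕ} (h1 : ∀ i < n, src i ∈ S)
    (h2 : ∀ i < n, o + i ∈ S) (h3 : ∀ i < n, src i ≠ o + i) : GoodOn S (copyGates n src o) := by
  intro g hg
  obtain ⟨i, hi, rfl⟩ := List.mem_map.1 hg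
  rw [List.mem_range] at hi
  exact ⟨⟨h1 i hi, h2 i hi⟩, h3 i hi⟩

theorem goodOn_arith {S : Set ℕ} {o t : ℕ} (g : ArithGate) (h : ∀ i ≤ t, o + i ∈ S) :
    GoodOn S (arithGates o t g) := by
  cases g with
  | const b =>
    cases b
    · simp [GoodOn, arithGates]
    · simp [GoodOn, arithGates, RGate.On, RGate.Proper, h]
  | add i j =>
    refine GoodOn.append ?_ ?_
    · split_ifs with hi
      · simp [GoodOn, RGate.On, RGate.Proper, h, hi.le, hi.ne]
      · simp [GoodOn]
    · split_ifs with hi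
      · simp [GoodOn, RGate.On, RGate.Proper, h, hi.le, hi.ne]
      · simp [GoodOn]
  | mul i j =>
    simp only [arithGates]
    split_ifs with hi hj hij
    · simp [GoodOn, RGate.On, RGate.Proper, h, hi.le, hi.ne]
    · exact goodOn_toffoli (h _ hi.le) (h _ hj.le) (h _ le_rfl) (by omega) (by omega) (by omega)
    · simp [GoodOn]
    · simp [GoodOn]

/-- The wires used by a call. -/
theorem goodOn_call {n m : ℕ} (R : RandCircuit n m) {src : ℕ → ℕ} {oOut oWork : ℕ} {S : Set ℕ}
    (hs : ∀ i < n, src i < oOut) (ho : oOut + m ≤ oWork) (h1 : ∀ i < n, src i ∈ S)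
    (h2 : Set.Ico oOut (oOut + m) ⊆ S) (h3 : Set.Ico oWork (oWork + RawR.work R.raw) ⊆ S) :
    GoodOn S (callGates R.raw src oOut oWork) := by
  rw [RandCircuit.work_raw] at h3
  have h3' : ∀ i < n + R.coins + R.circuit.gates.length, oWork + i ∈ S := fun i hi =>
    h3 ⟨by omega, by omega⟩
  simp only [callGates, RandCircuit.raw, Nat.add_sub_cancel]
  refine GoodOn.append ?_ (GoodOn.append ?_ (GoodOn.append ?_ ?_))
  · exact goodOn_copy h1 (fun i hi => h3' i (by omega)) (fun i hi => by have := hs i hi; omega)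
  · refine GoodOn.flatMap fun i hi => goodOn_coin ?_
    rw [List.mem_range] at hi
    rw [Nat.add_assoc]
    exact h3' _ (by omega)
  · refine GoodOn.flatMap fun i hi => goodOn_arith _ fun k hk => ?_
    rw [List.mem_range] at hi
    exact h3' _ (by omega)
  · refine GoodOn.flatMap fun i hi => ?_
    rw [List.mem_range, List.length_ofFn] at hi
    split_ifs with hk
    · have hw : RawR.work (R.coins, n + R.coins, R.circuit.gates, List.ofFn R.circuit.out) =
        n + R.coins + R.circuit.gates.length := rfl
      rw [hw] at hk
      have ha := h3' _ hk
      have hb : oOut + i ∈ S := h2 ⟨by omega, by omega⟩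
      simp only [GoodOn, List.mem_singleton, forall_eq, RGate.On, RGate.Proper]
      exact ⟨⟨ha, hb⟩, by omega⟩
    · simp [GoodOn]

theorem goodOn_calls {n m : ℕ} (R : RandCircuit n m) (J : ℕ) {src : ℕ → ℕ → ℕ} {oOut oWork : ℕ}
    {S : Set ℕ} (hs : ∀ j < J, ∀ i < n, src j i < oOut) (ho : oOut + J * m ≤ oWork)
    (h1 : ∀ j < J, ∀ i < n, src j i ∈ S) (h2 : Set.Ico oOut (oOut + J * m) ⊆ S)
    (h3 : Set.Ico oWork (oWork + J * RawR.work R.raw) ⊆ S) :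
    GoodOn S (callsGates R.raw J src oOut oWork) := by
  refine GoodOn.flatMap fun j hj => ?_
  rw [List.mem_range] at hj
  have e : R.raw.2.2.2.length = m := List.length_ofFn
  have hb : ∀ k, (j + 1) * k ≤ J * k := fun k => Nat.mul_le_mul_right k hj
  have hm := hb m
  have hw := hb (RawR.work R.raw)
  rw [Nat.succ_mul] at hm hw
  rw [e]
  refine goodOn_call R (fun i hi => (hs j hj i hi).trans_le (by omega)) (by omega) (h1 j hj) ?_ ?_
  · exact (Set.Ico_subset_Ico (by omega) (by omega)).trans h2
  · exact (Set.Ico_subset_Ico (by omega) (by omega)).trans h3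

/-! ### Several independent runs of a randomized circuit. -/

theorem ofFn_flat {J m : ℕ} (y : Fin J → Bits m) :
    List.ofFn (flat y) = (List.ofFn fun j => List.ofFn (y j)).flatten := by
  rw [List.ofFn_mul]
  congr 2
  funext j
  congr 1
  funext i
  simp only [flat]
  have : (⟨j * m + i, by
      calc _ < (j + 1) * m := by rw [Nat.succ_mul]; omega
        _ ≤ J * m := Nat.mul_le_mul_right m j.2⟩ : Fin (J * m)) = finProdFinEquiv (j, i) := by
    ext; simp [finProdFinEquiv]; ring
  rw [this, Equiv.symm_apply_apply]

theorem ofFn_flat_snoc {J m : ℕ} (y : Fin J → Bits m) (z : Bits m) :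
    List.ofFn (flat (Fin.snoc y z : Fin (J + 1) → Bits m)) = List.ofFn (flat y) ++ List.ofFn z := by
  rw [ofFn_flat, ofFn_flat, List.ofFn_succ']
  simp

/-- Every run has its own output block and its own work wires and reads only wires below the first
output block. The runs are therefore independent, and the probabilities multiply. -/
theorem heisL_calls {n m : ℕ} (R : RandCircuit n m) (J : ℕ) {src : ℕ → ℕ → ℕ} {oOut oWork : ℕ}
    (x : Fin J → Bits n) (u v : Mem) (F : Mem → Mem → ℂ) (hs : ∀ j < J, ∀ i < n, src j i < oOut)
    (ho : oOut + J * m ≤ oWork)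
    (hu : ∀ (j : Fin J) (i : Fin n), u (src j i) = x j i)
    (hv : ∀ (j : Fin J) (i : Fin n), v (src j i) = x j i)
    (hu0 : ∀ i, oOut ≤ i → u i = false) (hv0 : ∀ i, oOut ≤ i → v i = false)
    (hF : TracedOn (Set.Ico oWork (oWork + J * RawR.work R.raw)) F) :
    heisL (callsGates R.raw J src oOut oWork) F u v =
      ∑ y : Fin J → Bits m, (∏ j, (R.prob (x j) (y j) : ℂ)) *
        F (wrL u oOut (List.ofFn (flat y))) (wrL v oOut (List.ofFn (flat y))) := by
  have e : R.raw.2.2.2.length = m := List.length_ofFn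
  induction J generalizing F with
  | zero => simp [callsGates]
  | succ J ih =>
    rw [Nat.succ_mul] at ho hF
    have hsplit : callsGates R.raw (J + 1) src oOut oWork = callsGates R.raw J src oOut oWork ++
        callGates R.raw (src J) (oOut + J * m) (oWork + J * RawR.work R.raw) := by
      simp [callsGates, List.range_succ, e]
    rw [hsplit, heisL_append, ih (fun j => x j.castSucc) _ (fun j hj => hs j (by omega)) (by omega)
      (fun j i => hu j.castSucc i) (fun j i => hv j.castSucc i)]
    · rw [← (Fin.snocEquiv fun _ : Fin (J + 1) => Bits m).sum_comp, Fintype.sum_prod_type,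
        Finset.sum_comm]
      refine Finset.sum_congr rfl fun y _ => ?_
      have hlen : (List.ofFn (flat y)).length = J * m := List.length_ofFn
      rw [heisL_call R (x (Fin.last J)) _ _ F
        (fun i hi => (hs J (by omega) i hi).trans_le (by omega)) (by omega)
        (fun i => by rw [wrL_of_lt _ _ (hs J (by omega) i i.2)]; exact hu (Fin.last J) i)
        (fun i => by rw [wrL_of_lt _ _ (hs J (by omega) i i.2)]; exact hv (Fin.last J) i)
        (fun i hi => by rw [wrL_of_le _ _ (by omega)]; exact hu0 i (by omega))
        (fun i hi => by rw [wrL_of_le _ _ (by omega)]; exact hv0 i (by omega))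
        (hF.mono (Set.Ico_subset_Ico (by omega) (by omega))), Finset.mul_sum]
      refine Finset.sum_congr rfl fun z _ => ?_
      have e1 : (Fin.snocEquiv fun _ : Fin (J + 1) => Bits m) (z, y) = Fin.snoc y z := rfl
      rw [e1, ofFn_flat_snoc, Fin.prod_univ_castSucc, Fin.snoc_last]
      simp only [Fin.snoc_castSucc]
      rw [← wrL_append, ← wrL_append, hlen, mul_assoc]
    -- The last run does not touch the work wires of the earlier ones, so these are still traced out
    -- when the induction hypothesis is applied.
    · refine TracedOn.heisL (hF.mono (Set.Ico_subset_Ico le_rfl (by omega))) (GoodOn.on ?_)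
      refine goodOn_call R (fun i hi => (hs J (by omega) i hi).trans_le (by omega)) (by omega)
        ?_ ?_ ?_
      · intro i hi
        have := hs J (by omega) i hi
        simp only [Set.mem_compl_iff, Set.mem_Ico]
        omega
      · intro i hi
        simp only [Set.mem_compl_iff, Set.mem_Ico] at *
        omega
      · intro i hi
        simp only [Set.mem_compl_iff, Set.mem_Ico] at *
        omega

/-! ### Polynomial time -/

namespace PF

variable {ξ : Type} [Enc ξ]

@[fun_prop]
theorem copyGates {n o : ξ → ℕ} {src : ξ → ℕ → ℕ} (hn : PF n) (ho : PF o)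
    (hs : PF (fun p : ξ × ℕ => src p.1 p.2)) : PF (fun x => QHom.copyGates (n x) (src x) (o x)) := by
  refine map (f := fun x i => RGate.cnot (src x i) (o x + i)) hn.range ?_
  have := ho.comp (fst' (α := ξ) (β := ℕ))
  fun_prop

@[fun_prop]
theorem coinGates {o : ξ → ℕ} (ho : PF o) : PF (fun x => QHom.coinGates (o x)) := by
  unfold QHom.coinGates
  fun_prop

@[fun_prop]
theorem coinsGates {n o : ξ → ℕ} (hn : PF n) (ho : PF o) :
    PF (fun x => QHom.coinsGates (n x) (o x)) := by
  refine flatMap (f := fun x i => QHom.coinGates (o x + i)) hn.range ?_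
  have := ho.comp (fst' (α := ξ) (β := ℕ))
  fun_prop

@[fun_prop]
theorem toffoli {a b c : ξ → ℕ} (ha : PF a) (hb : PF b) (hc : PF c) :
    PF (fun x => QHom.toffoli (a x) (b x) (c x)) := by
  unfold QHom.toffoli cczGates tdg
  fun_prop

@[fun_prop]
theorem pauliGates {a b c : ξ → ℕ} (ha : PF a) (hb : PF b) (hc : PF c) :
    PF (fun x => QHom.pauliGates (a x) (b x) (c x)) := by
  unfold QHom.pauliGates
  fun_prop

@[fun_prop]
theorem arithGates {o t : ξ → ℕ} {g : ξ → ArithGate} (ho : PF o) (ht : PF t) (hg : PF g) :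
    PF (fun x => QHom.arithGates (o x) (t x) (g x)) := by
  have h1 : PF (fun q : (ℕ × ℕ) × Bool => bif q.2 then [RGate.one .X (q.1.1 + q.1.2)] else []) := by
    fun_prop
  have h2 : PF (fun q : (ℕ × ℕ) × ℕ × ℕ =>
      (if q.2.1 < q.1.2 then [RGate.cnot (q.1.1 + q.2.1) (q.1.1 + q.1.2)] else []) ++
      (if q.2.2 < q.1.2 then [RGate.cnot (q.1.1 + q.2.2) (q.1.1 + q.1.2)] else [])) := by
    fun_prop
  have h3 : PF (fun q : (ℕ × ℕ) × ℕ × ℕ => if q.2.1 < q.1.2 then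
      (if q.2.2 < q.1.2 then (if q.2.1 = q.2.2 then [RGate.cnot (q.1.1 + q.2.1) (q.1.1 + q.1.2)]
        else QHom.toffoli (q.1.1 + q.2.1) (q.1.1 + q.2.2) (q.1.1 + q.1.2))
        else []) else []) := by
    fun_prop
  refine congr_enc ((arithCases h1 h2 h3).comp (f := fun x => ((o x, t x), g x)) (by fun_prop))
    fun x => ?_
  cases h : g x <;> simp [QHom.arithGates]

@[fun_prop]
theorem work {R : ξ → RawR} (hR : PF R) : PF (fun x => RawR.work (R x)) := by
  unfold RawR.work
  fun_prop

@[fun_prop]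
theorem callGates {R : ξ → RawR} {src : ξ → ℕ → ℕ} {oOut oWork : ξ → ℕ} (hR : PF R)
    (hs : PF (fun p : ξ × ℕ => src p.1 p.2)) (ho : PF oOut) (hw : PF oWork) :
    PF (fun x => QHom.callGates (R x) (src x) (oOut x) (oWork x)) := by
  unfold QHom.callGates allArithGates outGates
  refine append (copyGates (by fun_prop) hw hs) (append (by fun_prop) (append ?_ ?_))
  · refine flatMap (f := fun x t => QHom.arithGates (oWork x) ((R x).2.1 + t)
      ((R x).2.2.1.getD t (.const false))) (by fun_prop) ?_
    have h1 := hR.comp (fst' (α := ξ) (β := ℕ))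
    have h2 := hw.comp (fst' (α := ξ) (β := ℕ))
    fun_prop
  · refine flatMap (f := fun x k => if (R x).2.2.2.getD k 0 < RawR.work (R x) then
      [RGate.cnot (oWork x + (R x).2.2.2.getD k 0) (oOut x + k)] else []) (by fun_prop) ?_
    have h1 := hR.comp (fst' (α := ξ) (β := ℕ))
    have h2 := hw.comp (fst' (α := ξ) (β := ℕ))
    have h3 := ho.comp (fst' (α := ξ) (β := ℕ))
    fun_prop

theorem callsGates {R : ξ → RawR} {J : ξ → ℕ} {src : ξ → ℕ → ℕ → ℕ} {oOut oWork : ξ → ℕ}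
    (hR : PF R) (hJ : PF J) (hs : PF (fun p : (ξ × ℕ) × ℕ => src p.1.1 p.1.2 p.2)) (ho : PF oOut)
    (hw : PF oWork) : PF (fun x => QHom.callsGates (R x) (J x) (src x) (oOut x) (oWork x)) := by
  refine flatMap (f := fun x j => QHom.callGates (R x) (src x j) (oOut x + j * (R x).2.2.2.length)
    (oWork x + j * RawR.work (R x))) hJ.range ?_
  have h1 := hR.comp (fst' (α := ξ) (β := ℕ))
  have h2 := hw.comp (fst' (α := ξ) (β := ℕ))
  have h3 := ho.comp (fst' (α := ξ) (β := ℕ))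
  refine callGates h1 hs (by fun_prop) (by fun_prop)

end PF

/-! ## The quantum scheme: circuits -/

theorem PolyTime.trans {ι : Type} {a b c : ι → Data} (h1 : PolyTime a b) (h2 : PolyTime b c) :
    PolyTime a c := by
  obtain ⟨p1, q1, h1⟩ := h1
  obtain ⟨p2, q2, h2⟩ := h2
  refine ⟨.comp p2 p1, q1 + q2.comp q1 + 1, fun x => ?_⟩
  obtain ⟨t, ht, hr⟩ := h1 x
  obtain ⟨t', ht', hr'⟩ := h2 x
  refine ⟨_, ?_, .comp hr hr'⟩
  have := eval_mono_nat q2 (hr.size_le.trans ht)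
  simp at *
  omega

namespace PF

variable {ξ : Type} [Enc ξ]

@[fun_prop]
theorem div {f g : ξ → ℕ} (hf : PF f) (hg : PF g) : PF (fun x => f x / g x) := by
  -- The quotient counts the `i` with `(i + 1) * g ≤ f`. The inner test yields `0` for the divisor
  -- `0`, in agreement with division of natural numbers.
  have h : PF (fun x => ((List.range (f x)).flatMap fun i =>
      if (i + 1) * g x < f x + 1 then (if g x ≠ 0 then [()] else []) else [])) := by
    refine flatMap (f := fun x i => if (i + 1) * g x < f x + 1 then
      (if g x ≠ 0 then [()] else []) else []) hf.range ?_
    have h1 := hf.comp (fst' (α := ξ) (β := ℕ))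
    have h2 := hg.comp (fst' (α := ξ) (β := ℕ))
    fun_prop
  refine congr_enc h.length fun x => ?_
  congr 1
  have : ∀ n b k : ℕ, 0 < b → ((List.range k).flatMap fun i =>
      if (i + 1) * b < n + 1 then (if b ≠ 0 then [()] else []) else []).length
      = min k (n / b) := by
    intro n b k hb
    induction k with
    | zero => simp
    | succ k ih =>
      rw [List.range_succ, List.flatMap_append, List.length_append, ih]
      have h1 : (k + 1) * b < n + 1 ↔ k + 1 ≤ n / b := by
        rw [Nat.le_div_iff_mul_le hb]; omega
      simp only [List.flatMap_cons, List.flatMap_nil, List.append_nil, h1, if_pos hb.ne']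
      split_ifs <;> simp <;> omega
  rcases Nat.eq_zero_or_pos (g x) with h0 | h0
  · simp [h0]
  · rw [this _ _ _ h0]
    exact min_eq_right (Nat.div_le_self _ _)

@[fun_prop]
theorem mod {f g : ξ → ℕ} (hf : PF f) (hg : PF g) : PF (fun x => f x % g x) := by
  have h : PF (fun x => f x - g x * (f x / g x)) := by fun_prop
  refine congr_enc h fun x => ?_
  congr 1
  have := Nat.mod_add_div (f x) (g x)
  omega

end PF

/-! ### Inner products -/

/-- The circuit for the inner product of two vectors of length `l`. -/
def ipCircuit (l : ℕ) : ArithCircuit (l + l) 1 where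
  -- Wires `2l` to `3l - 1` carry the products, wire `3l` the constant `0`, and wire `3l + i` the
  -- sum of the first `i` products; the result is on wire `4l`.
  gates := (List.range l).map (fun i => .mul i (l + i)) ++
    .const false :: (List.range l).map fun i => .add (l + l + l + i) (l + l + i)
  out := fun _ => l + l + l + l

theorem ipCircuit_size (l : ℕ) : (ipCircuit l).size = 4 * l + 1 := by
  simp [ArithCircuit.size, ipCircuit]
  omega

/-- The inner product modulo 2 of the first `l` bits. -/
def dot (l : ℕ) (s k : Mem) : Bool :=
  match l with
  | 0 => false
  | l + 1 => xor (dot l s k) (s l && k l)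

theorem foldl_eval_map_mul (l : ℕ) (x : Bits (l + l)) : ∀ k ≤ l,
    ((List.range k).map fun i => ArithGate.mul i (l + i)).foldl (fun v g => v ++ [g.eval v])
      (List.ofFn x) = List.ofFn x ++ (List.range k).map fun i => mem x i && mem x (l + i) := by
  intro k hk
  induction k with
  | zero => simp
  | succ k ih =>
    rw [List.range_succ, List.map_append, List.foldl_append, ih (by omega)]
    have h : ∀ i < l + l, ∀ t : List Bool, (List.ofFn x ++ t).getD i false = mem x i := by
      intro i hi t
      rw [List.getD_append _ _ _ _ (by simpa using hi), mem_of_lt x hi]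
      simp [List.getD_eq_getElem?_getD, hi]
    simp only [List.map_cons, List.map_nil, List.foldl_cons, List.foldl_nil, ArithGate.eval]
    rw [h _ (by omega), h _ (by omega)]
    simp

theorem ipCircuit_eval (l : ℕ) (x : Bits (l + l)) (i : Fin 1) :
    (ipCircuit l).eval x i = dot l (mem x) fun k => mem x (l + k) := by
  set P := List.ofFn x ++ (List.range l).map fun i => mem x i && mem x (l + i) with hP
  have hPl : P.length = l + l + l := by simp [hP]
  have hPg : ∀ i < l, ∀ t : List Bool, (P ++ t).getD (l + l + i) false =
      (mem x i && mem x (l + i)) := by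
    intro i hi t
    rw [List.getD_append _ _ _ _ (by omega), hP, List.getD_append_right _ _ _ _ (by simp)]
    simp [List.getD_eq_getElem?_getD, hi]
  have key : ∀ k ≤ l, ((List.range k).map fun i => ArithGate.add (l + l + l + i) (l + l + i)).foldl
      (fun v g => v ++ [g.eval v]) (P ++ [false]) =
      P ++ (List.range (k + 1)).map fun i => dot i (mem x) fun k => mem x (l + k) := by
    intro k hk
    induction k with
    | zero => simp [dot]
    | succ k ih =>
      rw [List.range_succ, List.map_append, List.foldl_append, ih (by omega)]
      simp only [List.map_cons, List.map_nil, List.foldl_cons, List.foldl_nil, ArithGate.eval]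
      rw [hPg k (by omega), List.getD_append_right _ _ _ _ (by omega), hPl]
      rw [List.range_succ (n := k + 1), List.map_append]
      simp [List.getD_eq_getElem?_getD, dot]
  have hw : (ipCircuit l).wires x =
      P ++ (List.range (l + 1)).map fun i => dot i (mem x) fun k => mem x (l + k) := by
    rw [ArithCircuit.wires, ipCircuit, List.foldl_append, foldl_eval_map_mul l x l le_rfl,
      List.foldl_cons]
    exact key l le_rfl
  rw [ArithCircuit.eval, hw, ipCircuit, List.getD_append_right _ _ _ _ (by simp; omega), hPl]
  simp [List.getD_eq_getElem?_getD]

/-! ### Transport of Pauli keys -/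

/-- The additions by which a gate changes the Pauli keys; the key of `X` on wire `i` has number
`2 * i` and the key of `Z` has number `2 * i + 1`. -/
def keyPairs : RGate → List (ℕ × ℕ)
  -- A pair `(a, b)` adds key `a` to key `b`. The phase gate turns `X` into `XZ` up to a phase. The
  -- Hadamard gate exchanges the two keys, which takes three additions. A controlled-not propagates
  -- `X` from control to target and `Z` from target to control. Pauli gates commute with Pauli
  -- operators up to a sign.
  | .one .P i => [(2 * i, 2 * i + 1)]
  | .one .H i => [(2 * i, 2 * i + 1), (2 * i + 1, 2 * i), (2 * i, 2 * i + 1)]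
  | .one _ _ => []
  | .cnot i j => [(2 * i, 2 * j), (2 * j + 1, 2 * i + 1)]
  | .meas _ => []

/-- Gates that transport a linear form on the keys backwards through a list of gates. -/
def formGates (o : ℕ) (gs : List RGate) : List RGate :=
  -- Transposing a product of additions reverses the order and exchanges source and target of each.
  (gs.flatMap keyPairs).reverse.map fun ab => .cnot (o + ab.2) (o + ab.1)

namespace PF

variable {ξ : Type} [Enc ξ]

theorem tag : PF OneQ.tag := congr_enc (f := fun g : OneQ => g) id' fun _ => rfl

theorem keyPairs : PF QHom.keyPairs := by
  have h1 : PF (fun p : Unit × OneQ × ℕ => if p.2.1.tag = 2 then [(2 * p.2.2, 2 * p.2.2 + 1)] else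
      if p.2.1.tag = 4 then [(2 * p.2.2, 2 * p.2.2 + 1), (2 * p.2.2 + 1, 2 * p.2.2),
        (2 * p.2.2, 2 * p.2.2 + 1)] else []) := by
    have : PF (fun p : Unit × OneQ × ℕ => p.2.1.tag) := tag.comp (by fun_prop)
    fun_prop
  have h2 : PF (fun p : Unit × ℕ × ℕ =>
      [(2 * p.2.1, 2 * p.2.2), (2 * p.2.2 + 1, 2 * p.2.1 + 1)]) := by fun_prop
  have h3 : PF (fun _ : Unit × ℕ => ([] : List (ℕ × ℕ))) := by fun_prop
  refine congr_enc ((rgateCases h1 h2 h3).comp (f := fun g => ((), g)) (by fun_prop)) fun g => ?_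
  rcases g with ⟨_ | _ | _ | _ | _, i⟩ | ⟨i, j⟩ | i <;> rfl

@[fun_prop]
theorem formGates {o : ξ → ℕ} {gs : ξ → List RGate} (ho : PF o) (hg : PF gs) :
    PF (fun x => QHom.formGates (o x) (gs x)) := by
  have h : PF (fun x => (gs x).flatMap QHom.keyPairs) :=
    flatMap (f := fun _ g => QHom.keyPairs g) hg (keyPairs.comp (by fun_prop))
  refine map (f := fun x (ab : ℕ × ℕ) => RGate.cnot (o x + ab.2) (o x + ab.1)) h.reverse ?_
  have h2 := ho.comp (fst' (α := ξ) (β := ℕ × ℕ))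
  fun_prop

end PF

/-! ### Encryption -/

/-- The gates for encryption with `R` as classical encryption: `p` is the length of the public key,
`c` the length of classical ciphertexts. -/
def encGates (R : RawR) (p c : ℕ) : List RGate :=
  -- Wire `p` is the qubit, wires `p + 1` and `p + 2` hold its `X` and `Z` keys, and the two
  -- ciphertexts start at `p + 3`.
  coinsGates 2 (p + 1) ++ (callsGates R 2 (fun j i => if i < p then i else p + 1 + j) (p + 3)
    (p + 3 + 2 * c) ++ pauliGates (p + 1) (p + 2) p)

/-- The output wires of encryption. -/
def encOut (p k : ℕ) : ℕ := if k = 0 then p else p + 2 + k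

/-! ### Decryption -/

/-- The gates for decryption with `R` as classical decryption: `s` is the length of the secret key,
`L` the length of the cipher register. -/
def decGates (R : RawR) (s L : ℕ) : List RGate :=
  -- The register is the qubit on wire `s` followed by two ciphertexts of length `(L - 1) / 2`. The
  -- decrypted keys start at `s + L + 1` and not at `s + L`, so that wire `s` stays distinct from
  -- them also for the degenerate length `L = 0`.
  callsGates R 2 (fun j i => if i < s then i else s + 1 + j * ((L - 1) / 2) + (i - s)) (s + L + 1)
    (s + L + 3) ++ pauliGates (s + L + 1) (s + L + 2) s

/-! ### Evaluation -/

/-- The data for the evaluation circuit: the lengths of public key, evaluation key and ciphertexts,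
classical encryption and evaluation, the circuit. -/
structure EvalArgs where
  p : ℕ
  e : ℕ
  c : ℕ
  Re : RawR
  Rv : RawR
  C : RawQ

namespace EvalArgs

/-- The data as a tuple. -/
def tuple (t : EvalArgs) : ℕ × ℕ × ℕ × RawR × RawR × RawQ := (t.p, t.e, t.c, t.Re, t.Rv, t.C)

instance : Enc EvalArgs := ⟨fun t => Enc.enc t.tuple⟩

variable (t : EvalArgs)

/-- Number of input qubits. -/
def n : ℕ := t.C.1
/-- Number of fresh wires. -/
def f : ℕ := t.C.2.1
/-- Number of output qubits. -/
def m : ℕ := t.C.2.2.2.length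
/-- Length of an input register. -/
def D : ℕ := 1 + 2 * t.c
/-- Number of input wires. -/
def N : ℕ := t.p + t.e + t.n * t.D
/-- Number of the first linear form. -/
def S : ℕ := t.N + t.f
/-- Length of a linear form. -/
def w2 : ℕ := 2 * (t.n + t.f)
/-- First output wire of the encryptions. -/
def O1 : ℕ := t.S + 2 * t.m * t.w2
/-- Number of encryptions. -/
def J1 : ℕ := 2 * t.m * (2 * t.n)
/-- First auxiliary wire of the encryptions. -/
def W1 : ℕ := t.O1 + t.J1 * t.c
/-- First output wire of the evaluations. -/
def O2 : ℕ := t.W1 + t.J1 * t.Re.work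
/-- Length of evaluated ciphertexts. -/
def l : ℕ := t.Rv.2.2.2.length
/-- First auxiliary wire of the evaluations. -/
def W2 : ℕ := t.O2 + 2 * t.m * t.l
/-- Number of all wires. -/
def total : ℕ := t.W2 + 2 * t.m * t.Rv.work

/-- The wires of the evaluated circuit. -/
def phi (i : ℕ) : ℕ := if i < t.n then t.p + t.e + i * t.D else t.N + (i - t.n)

/-- The key that the `j`-th evaluation computes. -/
def target (j : ℕ) : ℕ := 2 * t.C.2.2.2.getD (j / 2) 0 + j % 2

/-- The input wires of the encryptions. -/
def src1 (a i : ℕ) : ℕ :=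
  -- Encryption number `a` takes coefficient `a % (2 * n)` of the form `a / (2 * n)`. The
  -- coefficients at the fresh wires are not encrypted: a wire prepared in `|0⟩` has trivial keys.
  if i < t.p then i else t.S + (a / (2 * t.n) * t.w2 + a % (2 * t.n))

/-- The input wires of the evaluations. -/
def src2 (j i : ℕ) : ℕ :=
  -- First the classical evaluation key, then the `2n` ciphertexts of input keys, two in each
  -- register behind its qubit, and then the `2n` encrypted coefficients of the `j`-th form.
  if i < t.e then t.p + i else
    if i - t.e < 2 * t.n * t.c then
      t.p + t.e + (i - t.e) / (2 * t.c) * t.D + 1 + (i - t.e) % (2 * t.c)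
    else t.O1 + (j * (2 * t.n * t.c) + (i - t.e - 2 * t.n * t.c))

/-- The preparation of the linear forms. -/
def formsGates : List RGate := (List.range (2 * t.m)).flatMap fun j =>
  -- The unit vector of the wanted output key is written first and then pulled back through the
  -- evaluated circuit.
  .one .X (t.S + j * t.w2 + t.target j) :: formGates (t.S + j * t.w2) t.C.2.2.1

/-- All gates. -/
def gates : List RGate :=
  t.C.2.2.1.map (RGate.map t.phi) ++ (t.formsGates ++ (callsGates t.Re t.J1 t.src1 t.O1 t.W1 ++
    callsGates t.Rv (2 * t.m) t.src2 t.O2 t.W2))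

/-- The output wires. -/
def out (k : ℕ) : ℕ :=
  if k % (1 + 2 * t.l) = 0 then t.phi (t.C.2.2.2.getD (k / (1 + 2 * t.l)) 0)
  else t.O2 + (k / (1 + 2 * t.l) * (2 * t.l) + (k % (1 + 2 * t.l) - 1))

/-- The evaluation circuit. -/
def raw : RawQ := (t.N, t.total - t.N, t.gates, (List.range (t.m * (1 + 2 * t.l))).map t.out)

end EvalArgs

namespace PF

variable {ξ : Type} [Enc ξ]

theorem tuple {h : ξ → EvalArgs} (hh : PF h) : PF (fun x => (h x).tuple) :=
  congr_enc hh fun _ => rfl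

@[fun_prop]
theorem evalArgs_p {h : ξ → EvalArgs} (hh : PF h) : PF (fun x => (h x).p) := hh.tuple.fst
@[fun_prop]
theorem evalArgs_e {h : ξ → EvalArgs} (hh : PF h) : PF (fun x => (h x).e) := hh.tuple.snd.fst
@[fun_prop]
theorem evalArgs_c {h : ξ → EvalArgs} (hh : PF h) : PF (fun x => (h x).c) := hh.tuple.snd.snd.fst
@[fun_prop]
theorem evalArgs_Re {h : ξ → EvalArgs} (hh : PF h) : PF (fun x => (h x).Re) :=
  hh.tuple.snd.snd.snd.fst
@[fun_prop]
theorem evalArgs_Rv {h : ξ → EvalArgs} (hh : PF h) : PF (fun x => (h x).Rv) :=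
  hh.tuple.snd.snd.snd.snd.fst
@[fun_prop]
theorem evalArgs_C {h : ξ → EvalArgs} (hh : PF h) : PF (fun x => (h x).C) :=
  hh.tuple.snd.snd.snd.snd.snd

@[fun_prop]
theorem evalArgs {p e c : ξ → ℕ} {Re Rv : ξ → RawR} {C : ξ → RawQ} (hp : PF p) (he : PF e)
    (hc : PF c) (hRe : PF Re) (hRv : PF Rv) (hC : PF C) :
    PF (fun x => EvalArgs.mk (p x) (e x) (c x) (Re x) (Rv x) (C x)) :=
  congr_enc (hp.prodMk (he.prodMk (hc.prodMk (hRe.prodMk (hRv.prodMk hC))))) fun _ => rfl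

variable {h : ξ → EvalArgs}

@[fun_prop]
theorem evalArgs_n (hh : PF h) : PF (fun x => (h x).n) := by unfold EvalArgs.n; fun_prop
@[fun_prop]
theorem evalArgs_f (hh : PF h) : PF (fun x => (h x).f) := by unfold EvalArgs.f; fun_prop
@[fun_prop]
theorem evalArgs_m (hh : PF h) : PF (fun x => (h x).m) := by unfold EvalArgs.m; fun_prop
@[fun_prop]
theorem evalArgs_D (hh : PF h) : PF (fun x => (h x).D) := by unfold EvalArgs.D; fun_prop
@[fun_prop]
theorem evalArgs_N (hh : PF h) : PF (fun x => (h x).N) := by unfold EvalArgs.N; fun_prop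
@[fun_prop]
theorem evalArgs_S (hh : PF h) : PF (fun x => (h x).S) := by unfold EvalArgs.S; fun_prop
@[fun_prop]
theorem evalArgs_w2 (hh : PF h) : PF (fun x => (h x).w2) := by unfold EvalArgs.w2; fun_prop
@[fun_prop]
theorem evalArgs_O1 (hh : PF h) : PF (fun x => (h x).O1) := by unfold EvalArgs.O1; fun_prop
@[fun_prop]
theorem evalArgs_J1 (hh : PF h) : PF (fun x => (h x).J1) := by unfold EvalArgs.J1; fun_prop
@[fun_prop]
theorem evalArgs_W1 (hh : PF h) : PF (fun x => (h x).W1) := by unfold EvalArgs.W1; fun_prop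
@[fun_prop]
theorem evalArgs_O2 (hh : PF h) : PF (fun x => (h x).O2) := by unfold EvalArgs.O2; fun_prop
@[fun_prop]
theorem evalArgs_l (hh : PF h) : PF (fun x => (h x).l) := by unfold EvalArgs.l; fun_prop
@[fun_prop]
theorem evalArgs_W2 (hh : PF h) : PF (fun x => (h x).W2) := by unfold EvalArgs.W2; fun_prop
@[fun_prop]
theorem evalArgs_total (hh : PF h) : PF (fun x => (h x).total) := by unfold EvalArgs.total; fun_prop
@[fun_prop]
theorem evalArgs_phi {i : ξ → ℕ} (hh : PF h) (hi : PF i) : PF (fun x => (h x).phi (i x)) := by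
  unfold EvalArgs.phi; fun_prop
@[fun_prop]
theorem evalArgs_target {i : ξ → ℕ} (hh : PF h) (hi : PF i) : PF (fun x => (h x).target (i x)) := by
  unfold EvalArgs.target; fun_prop
@[fun_prop]
theorem evalArgs_src1 {i j : ξ → ℕ} (hh : PF h) (hi : PF i) (hj : PF j) :
    PF (fun x => (h x).src1 (i x) (j x)) := by
  unfold EvalArgs.src1; fun_prop
@[fun_prop]
theorem evalArgs_src2 {i j : ξ → ℕ} (hh : PF h) (hi : PF i) (hj : PF j) :
    PF (fun x => (h x).src2 (i x) (j x)) := by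
  unfold EvalArgs.src2; fun_prop
@[fun_prop]
theorem evalArgs_out {i : ξ → ℕ} (hh : PF h) (hi : PF i) : PF (fun x => (h x).out (i x)) := by
  unfold EvalArgs.out; fun_prop

theorem evalArgs_raw : PF EvalArgs.raw := by
  have hforms : PF EvalArgs.formsGates := by
    refine flatMap (f := fun (t : EvalArgs) j => RGate.one .X (t.S + j * t.w2 + t.target j) ::
      QHom.formGates (t.S + j * t.w2) t.C.2.2.1) (by fun_prop) (by fun_prop)
  have h1 : PF (fun t : EvalArgs => t.C.2.2.1.map (RGate.map t.phi)) :=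
    map (f := fun (t : EvalArgs) g => RGate.map t.phi g) (by fun_prop)
      (rgateMap (φ := fun x : EvalArgs × RGate => x.1.phi) (by fun_prop) (by fun_prop))
  have h2 : PF (fun t : EvalArgs => QHom.callsGates t.Re t.J1 t.src1 t.O1 t.W1) :=
    callsGates (by fun_prop) (by fun_prop) (by fun_prop) (by fun_prop) (by fun_prop)
  have h3 : PF (fun t : EvalArgs => QHom.callsGates t.Rv (2 * t.m) t.src2 t.O2 t.W2) :=
    callsGates (by fun_prop) (by fun_prop) (by fun_prop) (by fun_prop) (by fun_prop)
  have h4 : PF (fun t : EvalArgs => (List.range (t.m * (1 + 2 * t.l))).map t.out) :=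
    map (f := fun (t : EvalArgs) => t.out) (by fun_prop) (by fun_prop)
  have h5 : PF EvalArgs.gates := h1.append (hforms.append (h2.append h3))
  have h6 : PF (fun t : EvalArgs => t.N) := by fun_prop
  have h7 : PF (fun t : EvalArgs => t.total - t.N) := by fun_prop
  exact h6.prodMk (h7.prodMk (h5.prodMk h4))

end PF

theorem block_lt {q a r b : ℕ} (hq : q < a) (hr : r < b) : q * b + r < a * b :=
  calc q * b + r < q * b + b := by omega
    _ = (q + 1) * b := (Nat.succ_mul q b).symm
    _ ≤ a * b := Nat.mul_le_mul_right b hq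

theorem ofFn_val_eq_map {α : Type*} (n : ℕ) (f : ℕ → α) :
    List.ofFn (fun k : Fin n => f k) = (List.range n).map f := by
  apply List.ext_getElem <;> simp

theorem QCircuit.raw_ofRaw {n m : ℕ} (f : ℕ) (gs : List RGate) (out : Fin m → ℕ) (hgs hout hinj) :
    (ofRaw (n := n) f gs out hgs hout hinj).raw = (n, f, gs, List.ofFn out) := by
  rw [raw, rawGates_ofRaw, rawOut_ofRaw]
  rfl

/-! ## The quantum scheme: well-formedness -/

theorem RGate.On.map {S T : Set ℕ} {φ : ℕ → ℕ} (h : ∀ i ∈ S, φ i ∈ T) {g : RGate} (hg : g.On S) :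
    (g.map φ).On T := by
  cases g with
  | one g i => exact h _ hg
  | cnot i j => exact ⟨h _ hg.1, h _ hg.2⟩
  | meas i => exact h _ hg

theorem goodOn_map {S T : Set ℕ} {φ : ℕ → ℕ} (hφ : Function.Injective φ) (h : ∀ i ∈ S, φ i ∈ T)
    {gs : List RGate} (hg : GoodOn S gs) : GoodOn T (gs.map (RGate.map φ)) := by
  intro g hg'
  obtain ⟨g, hmem, rfl⟩ := List.mem_map.1 hg'
  refine ⟨(hg g hmem).1.map h, ?_⟩
  have := (hg g hmem).2
  cases g with
  | cnot i j => exact hφ.ne this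
  | _ => trivial

theorem QCircuit.goodOn {n m : ℕ} (C : QCircuit n m) : GoodOn (Set.Iio (n + C.fresh)) C.rawGates :=
  fun g hg => ⟨C.rawGates_on g hg, C.rawGates_proper g hg⟩

theorem keyPairs_lt {w : ℕ} {g : RGate} (hg : g.On (Set.Iio w) ∧ g.Proper) :
    ∀ ab ∈ keyPairs g, ab.1 < 2 * w ∧ ab.2 < 2 * w ∧ ab.1 ≠ ab.2 := by
  rcases g with ⟨_ | _ | _ | _ | _, i⟩ | ⟨i, j⟩ | i <;>
    simp [keyPairs, RGate.On, RGate.Proper] at * <;> omega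

theorem goodOn_form {S : Set ℕ} {w o : ℕ} {gs : List RGate} (hg : GoodOn (Set.Iio w) gs)
    (h : ∀ i < 2 * w, o + i ∈ S) : GoodOn S (formGates o gs) := by
  intro g hg'
  obtain ⟨ab, hmem, rfl⟩ := List.mem_map.1 hg'
  obtain ⟨g, hgs, hab⟩ := List.mem_flatMap.1 (List.mem_reverse.1 hmem)
  have := keyPairs_lt (hg g hgs) ab hab
  exact ⟨⟨h _ this.2.1, h _ this.1⟩, by simp only [RGate.Proper]; omega⟩

/-! ### The circuits for key generation, encryption, decryption and evaluation. -/

variable (E : ClassicalHE)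

/-- The key generation circuit, with a second copy of the public key. -/
def keyGenCircuit (κ : ℕ) :
    RandCircuit 0 (E.pkLen κ + E.skLen κ + (E.pkLen κ + E.evkLen κ)) where
  coins := (E.keyGen κ).coins
  circuit := ⟨(E.keyGen κ).circuit.gates,
    let o := (E.keyGen κ).circuit.out
    Fin.append (fun i => o (Fin.castAdd _ i)) (Fin.append
      (fun i => o (Fin.castAdd _ (Fin.castAdd _ i))) fun i => o (Fin.natAdd _ i))⟩

/-- A randomized circuit without input as a quantum circuit. -/
def ofRand {m : ℕ} (R : RandCircuit 0 m) : QCircuit 0 m :=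
  QCircuit.ofRaw (m + R.raw.work) (callGates R.raw (fun i => i) 0 m) (fun k => k)
    (by
      rw [Nat.zero_add]
      refine goodOn_call R (by simp) (by simp) (by simp) ?_ ?_ <;> intro i hi <;>
        simp only [Set.mem_Ico, Set.mem_Iio] at * <;> omega)
    (fun k => by omega) Fin.val_injective

theorem ofRand_raw {m : ℕ} (R : RandCircuit 0 m) : (ofRand R).raw =
    (0, m + R.raw.work, callGates R.raw (fun i => i) 0 m, List.ofFn fun k : Fin m => (k : ℕ)) :=
  QCircuit.raw_ofRaw ..

theorem ofRand_rawGates {m : ℕ} (R : RandCircuit 0 m) :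
    (ofRand R).rawGates = callGates R.raw (fun i => i) 0 m := QCircuit.rawGates_ofRaw ..

theorem ofRand_rawOut {m : ℕ} (R : RandCircuit 0 m) : (ofRand R).rawOut = fun k : Fin m => (k : ℕ) := rfl

/-- The encryption circuit. -/
def encCircuit (κ : ℕ) : QCircuit (E.pkLen κ + 1) (1 + 2 * E.ctLen κ) :=
  QCircuit.ofRaw (2 + 2 * E.ctLen κ + 2 * (E.enc κ).raw.work)
    (encGates (E.enc κ).raw (E.pkLen κ) (E.ctLen κ)) (fun k => encOut (E.pkLen κ) k)
    (by
      refine GoodOn.append ?_ (GoodOn.append ?_ ?_)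
      · refine GoodOn.flatMap fun i hi => goodOn_coin ?_
        rw [List.mem_range] at hi
        simp only [Set.mem_Iio]; omega
      · refine goodOn_calls (E.enc κ) 2 ?_ le_rfl ?_ ?_ ?_
        · intro j hj i hi; split_ifs <;> omega
        · intro j hj i hi
          simp only [Set.mem_Iio]; split_ifs <;> omega
        · intro i hi; simp only [Set.mem_Ico, Set.mem_Iio] at *; omega
        · intro i hi; simp only [Set.mem_Ico, Set.mem_Iio] at *; omega
      · refine goodOn_pauli ?_ ?_ ?_ (by omega) (by omega) <;> simp only [Set.mem_Iio] <;> omega)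
    (fun k => by simp only [encOut]; split_ifs <;> omega)
    (fun i j h => by
      simp only [encOut] at h
      ext
      split_ifs at h <;> omega)

theorem encCircuit_raw (κ : ℕ) : (encCircuit E κ).raw =
    (E.pkLen κ + 1, 2 + 2 * E.ctLen κ + 2 * (E.enc κ).raw.work,
      encGates (E.enc κ).raw (E.pkLen κ) (E.ctLen κ),
      List.ofFn fun k : Fin (1 + 2 * E.ctLen κ) => encOut (E.pkLen κ) k) :=
  QCircuit.raw_ofRaw ..

theorem encCircuit_rawGates (κ : ℕ) : (encCircuit E κ).rawGates =
    encGates (E.enc κ).raw (E.pkLen κ) (E.ctLen κ) := QCircuit.rawGates_ofRaw ..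

theorem encCircuit_rawOut (κ : ℕ) : (encCircuit E κ).rawOut =
    fun k : Fin (1 + 2 * E.ctLen κ) => encOut (E.pkLen κ) k := rfl

/-- The decryption circuit. -/
def decCircuit (κ L : ℕ) : QCircuit (E.skLen κ + L) 1 :=
  QCircuit.ofRaw (3 + 2 * (E.dec κ ((L - 1) / 2)).raw.work)
    (decGates (E.dec κ ((L - 1) / 2)).raw (E.skLen κ) L) (fun _ => E.skLen κ)
    (by
      have hsrc : ∀ j < 2, ∀ i < E.skLen κ + (L - 1) / 2, (if i < E.skLen κ then i else
          E.skLen κ + 1 + j * ((L - 1) / 2) + (i - E.skLen κ)) < E.skLen κ + L + 1 := by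
        intro j hj i hi
        split_ifs
        · omega
        · interval_cases j <;> omega
      refine GoodOn.append ?_ ?_
      · refine goodOn_calls (E.dec κ ((L - 1) / 2)) 2 hsrc (by omega) ?_ ?_ ?_
        · intro j hj i hi
          have := hsrc j hj i hi
          simp only [Set.mem_Iio]
          omega
        · intro i hi; simp only [Set.mem_Ico, Set.mem_Iio] at *; omega
        · intro i hi; simp only [Set.mem_Ico, Set.mem_Iio] at *; omega
      · refine goodOn_pauli ?_ ?_ ?_ (by omega) (by omega) <;> simp only [Set.mem_Iio] <;> omega)
    (fun k => by omega) (fun i j _ => Subsingleton.elim i j)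

theorem decCircuit_raw (κ L : ℕ) : (decCircuit E κ L).raw =
    (E.skLen κ + L, 3 + 2 * (E.dec κ ((L - 1) / 2)).raw.work,
      decGates (E.dec κ ((L - 1) / 2)).raw (E.skLen κ) L, [E.skLen κ]) :=
  QCircuit.raw_ofRaw ..

theorem decCircuit_rawGates (κ L : ℕ) : (decCircuit E κ L).rawGates =
    decGates (E.dec κ ((L - 1) / 2)).raw (E.skLen κ) L := QCircuit.rawGates_ofRaw ..

theorem decCircuit_rawOut (κ L : ℕ) : (decCircuit E κ L).rawOut = fun _ => E.skLen κ := rfl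

section Eval

variable (κ : ℕ) {n m : ℕ} (C : QCircuit n m)

/-- The data of the evaluation circuit. -/
def evalArgs : EvalArgs where
  p := E.pkLen κ
  e := E.evkLen κ
  c := E.ctLen κ
  Re := (E.enc κ).raw
  Rv := (E.eval κ (ipCircuit (2 * n))).raw
  C := C.raw

/-- The length of the evaluated classical ciphertexts. -/
abbrev ipLen (n : ℕ) : ℕ := E.evLen κ (ipCircuit (2 * n))

@[simp] theorem evalArgs_p : (evalArgs E κ C).p = E.pkLen κ := rfl
@[simp] theorem evalArgs_e : (evalArgs E κ C).e = E.evkLen κ := rfl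
@[simp] theorem evalArgs_c : (evalArgs E κ C).c = E.ctLen κ := rfl
@[simp] theorem evalArgs_n : (evalArgs E κ C).n = n := rfl

@[simp] theorem evalArgs_m : (evalArgs E κ C).m = m := List.length_ofFn
@[simp] theorem evalArgs_l : (evalArgs E κ C).l = ipLen E κ n := List.length_ofFn

@[simp] theorem evalArgs_Re : (evalArgs E κ C).Re = (E.enc κ).raw := rfl
@[simp] theorem evalArgs_Rv : (evalArgs E κ C).Rv = (E.eval κ (ipCircuit (2 * n))).raw := rfl

theorem evalArgs_getD (k : ℕ) (hk : k < m) :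
    (evalArgs E κ C).C.2.2.2.getD k 0 = C.rawOut ⟨k, hk⟩ := by
  simp [evalArgs, QCircuit.raw, List.getD_eq_getElem?_getD, hk]

theorem evalArgs_N : (evalArgs E κ C).N = E.pkLen κ + E.evkLen κ + n * (1 + 2 * E.ctLen κ) := rfl

theorem evalArgs_S : (evalArgs E κ C).S = (evalArgs E κ C).N + C.fresh := rfl

theorem evalArgs_w2 : (evalArgs E κ C).w2 = 2 * (n + C.fresh) := rfl

theorem evalArgs_O1 :
    (evalArgs E κ C).O1 = (evalArgs E κ C).S + 2 * m * (evalArgs E κ C).w2 := by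
  simp [EvalArgs.O1]

theorem evalArgs_J1 : (evalArgs E κ C).J1 = 2 * m * (2 * n) := by
  simp [EvalArgs.J1]

theorem evalArgs_W1 :
    (evalArgs E κ C).W1 = (evalArgs E κ C).O1 + 2 * m * (2 * n) * E.ctLen κ := by
  simp [EvalArgs.W1, evalArgs_J1]

theorem evalArgs_O2 : (evalArgs E κ C).O2 =
    (evalArgs E κ C).W1 + 2 * m * (2 * n) * (E.enc κ).raw.work := by
  simp [EvalArgs.O2, evalArgs_J1]

theorem evalArgs_W2 :
    (evalArgs E κ C).W2 = (evalArgs E κ C).O2 + 2 * m * ipLen E κ n := by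
  simp [EvalArgs.W2]

theorem evalArgs_total : (evalArgs E κ C).total = (evalArgs E κ C).W2 +
    2 * m * (E.eval κ (ipCircuit (2 * n))).raw.work := by
  simp [EvalArgs.total]

theorem evalArgs_order : (evalArgs E κ C).N ≤ (evalArgs E κ C).S ∧
    (evalArgs E κ C).S ≤ (evalArgs E κ C).O1 ∧ (evalArgs E κ C).O1 ≤ (evalArgs E κ C).W1 ∧
    (evalArgs E κ C).W1 ≤ (evalArgs E κ C).O2 ∧ (evalArgs E κ C).O2 ≤ (evalArgs E κ C).W2 ∧
    (evalArgs E κ C).W2 ≤ (evalArgs E κ C).total :=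
  ⟨Nat.le_add_right _ _, Nat.le_add_right _ _, Nat.le_add_right _ _, Nat.le_add_right _ _,
    Nat.le_add_right _ _, Nat.le_add_right _ _⟩

theorem evalArgs_phi_input {i : ℕ} (hi : i < n) :
    (evalArgs E κ C).phi i = E.pkLen κ + E.evkLen κ + i * (1 + 2 * E.ctLen κ) := by
  simp [EvalArgs.phi, hi, EvalArgs.D]

theorem evalArgs_phi_fresh {i : ℕ} (hi : n ≤ i) :
    (evalArgs E κ C).phi i = (evalArgs E κ C).N + (i - n) := by
  rw [EvalArgs.phi, if_neg (by rw [evalArgs_n]; omega), evalArgs_n]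

theorem evalArgs_phi_lt_N {i : ℕ} (hi : i < n) :
    (evalArgs E κ C).phi i < (evalArgs E κ C).N := by
  rw [evalArgs_phi_input E κ C hi, evalArgs_N]
  have := block_lt (b := 1 + 2 * E.ctLen κ) (r := 0) hi (by omega)
  omega

theorem evalArgs_phi_injective : Function.Injective (evalArgs E κ C).phi := by
  intro i j h
  rcases lt_or_ge i n with hi | hi <;> rcases lt_or_ge j n with hj | hj
  · rw [evalArgs_phi_input E κ C hi, evalArgs_phi_input E κ C hj] at h
    exact Nat.eq_of_mul_eq_mul_right (by omega) (Nat.add_left_cancel h)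
  · have := evalArgs_phi_lt_N E κ C hi
    rw [h, evalArgs_phi_fresh E κ C hj] at this
    omega
  · have := evalArgs_phi_lt_N E κ C hj
    rw [← h, evalArgs_phi_fresh E κ C hi] at this
    omega
  · rw [evalArgs_phi_fresh E κ C hi, evalArgs_phi_fresh E κ C hj] at h
    omega

theorem evalArgs_phi_lt {i : ℕ} (hi : i < n + C.fresh) :
    (evalArgs E κ C).phi i < (evalArgs E κ C).S := by
  rcases lt_or_ge i n with h | h
  · exact (evalArgs_phi_lt_N E κ C h).trans_le (Nat.le_add_right _ _)
  · rw [evalArgs_phi_fresh E κ C h, evalArgs_S]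
    omega

theorem evalArgs_target_lt {j : ℕ} (hj : j < 2 * m) :
    (evalArgs E κ C).target j < (evalArgs E κ C).w2 := by
  rw [EvalArgs.target, evalArgs_getD E κ C (j / 2) (by omega), evalArgs_w2]
  have := C.rawOut_lt ⟨j / 2, by omega⟩
  omega

theorem goodOn_forms {T : Set ℕ} (h : Set.Ico (evalArgs E κ C).S (evalArgs E κ C).O1 ⊆ T) :
    GoodOn T (evalArgs E κ C).formsGates := by
  refine GoodOn.flatMap fun j hj => ?_
  rw [List.mem_range, evalArgs_m] at hj
  have hmem : ∀ i < (evalArgs E κ C).w2,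
      (evalArgs E κ C).S + j * (evalArgs E κ C).w2 + i ∈ T := by
    intro i hi
    have := block_lt hj hi
    rw [evalArgs_O1] at h
    exact h ⟨by omega, by omega⟩
  intro g hg
  rcases List.mem_cons.1 hg with rfl | hg
  · exact ⟨hmem _ (evalArgs_target_lt E κ C hj), trivial⟩
  · exact goodOn_form (w := n + C.fresh) C.goodOn (fun i hi => hmem i hi) g hg

theorem evalArgs_src1_lt {a i : ℕ} (ha : a < (evalArgs E κ C).J1) :
    (evalArgs E κ C).src1 a i < (evalArgs E κ C).O1 := by
  have h1 := evalArgs_N E κ C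
  have h2 := evalArgs_S E κ C
  have h3 := evalArgs_O1 E κ C
  rw [evalArgs_J1] at ha
  by_cases h : i < (evalArgs E κ C).p
  · rw [EvalArgs.src1, if_pos h]
    rw [evalArgs_p] at h
    omega
  · rw [EvalArgs.src1, if_neg h, evalArgs_n]
    rcases Nat.eq_zero_or_pos (2 * n) with h0 | h0
    · simp [h0] at ha
    · have h4 : a / (2 * n) < 2 * m := Nat.div_lt_of_lt_mul (by rwa [Nat.mul_comm])
      have h5 : a % (2 * n) < (evalArgs E κ C).w2 := by
        have := Nat.mod_lt a h0
        rw [evalArgs_w2]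
        omega
      have := block_lt h4 h5
      omega

theorem evalArgs_src2_input {j i : ℕ} (h1 : ¬ i < E.evkLen κ)
    (h2 : i - E.evkLen κ < 2 * n * E.ctLen κ) :
    (evalArgs E κ C).src2 j i = E.pkLen κ + E.evkLen κ +
      (i - E.evkLen κ) / (2 * E.ctLen κ) * (1 + 2 * E.ctLen κ) + 1 +
        (i - E.evkLen κ) % (2 * E.ctLen κ) ∧ (i - E.evkLen κ) / (2 * E.ctLen κ) < n ∧
      (i - E.evkLen κ) % (2 * E.ctLen κ) < 2 * E.ctLen κ := by
  have h2' : i - E.evkLen κ < 2 * E.ctLen κ * n := by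
    calc _ < _ := h2
      _ = _ := by ring
  have hc : 0 < 2 * E.ctLen κ := Nat.pos_of_ne_zero fun h0 => by simp [h0] at h2'
  refine ⟨?_, Nat.div_lt_of_lt_mul h2', Nat.mod_lt _ hc⟩
  simp [EvalArgs.src2, h1, h2, EvalArgs.D]

/-- The evaluations read input wires and freshly made ciphertexts only, never the work wires of the
encryptions or the linear forms. That makes the garbage of the encryptions irrelevant. -/
theorem evalArgs_src2_lt {j i : ℕ} (hj : j < 2 * m)
    (hi : i < E.evkLen κ + (2 * n + 2 * n) * E.ctLen κ) :
    (evalArgs E κ C).src2 j i < (evalArgs E κ C).N ∨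
      (evalArgs E κ C).O1 ≤ (evalArgs E κ C).src2 j i ∧
      (evalArgs E κ C).src2 j i < (evalArgs E κ C).W1 := by
  have hN := evalArgs_N E κ C
  have hW := evalArgs_W1 E κ C
  by_cases h1 : i < E.evkLen κ
  · left
    simp only [EvalArgs.src2, evalArgs_e, h1, if_true, evalArgs_p]
    omega
  · by_cases h2 : i - E.evkLen κ < 2 * n * E.ctLen κ
    · left
      obtain ⟨h3, h4, h5⟩ := evalArgs_src2_input E κ C (j := j) h1 h2
      have := block_lt (r := 1 + (i - E.evkLen κ) % (2 * E.ctLen κ)) (b := 1 + 2 * E.ctLen κ) h4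
        (by omega)
      omega
    · right
      simp only [EvalArgs.src2, evalArgs_e, h1, if_false, evalArgs_n, evalArgs_c, h2]
      rw [Nat.add_mul] at hi
      have := block_lt (r := i - E.evkLen κ - 2 * n * E.ctLen κ) (b := 2 * n * E.ctLen κ) hj
        (by omega)
      rw [Nat.mul_assoc (2 * m)] at hW
      omega

theorem evalArgs_out_lt {k : ℕ} (hk : k < m * (1 + 2 * ipLen E κ n)) :
    (k % (1 + 2 * ipLen E κ n) = 0 ∧ ∃ h : k / (1 + 2 * ipLen E κ n) < m,
      (evalArgs E κ C).out k = (evalArgs E κ C).phi (C.rawOut ⟨k / (1 + 2 * ipLen E κ n), h⟩)) ∨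
    (k % (1 + 2 * ipLen E κ n) ≠ 0 ∧ (evalArgs E κ C).out k =
      (evalArgs E κ C).O2 + (k / (1 + 2 * ipLen E κ n) * (2 * ipLen E κ n) +
        (k % (1 + 2 * ipLen E κ n) - 1)) ∧
      (evalArgs E κ C).out k < (evalArgs E κ C).W2) := by
  have h1 : k / (1 + 2 * ipLen E κ n) < m :=
    Nat.div_lt_of_lt_mul (by rwa [Nat.mul_comm])
  have h2 : k % (1 + 2 * ipLen E κ n) < 1 + 2 * ipLen E κ n := Nat.mod_lt _ (by omega)
  by_cases h : k % (1 + 2 * ipLen E κ n) = 0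
  · refine .inl ⟨h, h1, ?_⟩
    rw [EvalArgs.out, evalArgs_l, if_pos h, evalArgs_getD E κ C _ h1]
  · right
    rw [EvalArgs.out, evalArgs_l, if_neg h]
    refine ⟨h, rfl, ?_⟩
    have := block_lt (r := k % (1 + 2 * ipLen E κ n) - 1) (b := 2 * ipLen E κ n) h1 (by omega)
    rw [evalArgs_W2]
    have e : m * (2 * ipLen E κ n) = 2 * m * ipLen E κ n := by ring
    omega

/-- The evaluation circuit. -/
def evalCircuit :
    QCircuit (E.pkLen κ + E.evkLen κ + n * (1 + 2 * E.ctLen κ)) (m * (1 + 2 * ipLen E κ n)) :=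
  QCircuit.ofRaw ((evalArgs E κ C).total - (evalArgs E κ C).N) (evalArgs E κ C).gates
    (fun k => (evalArgs E κ C).out k)
    (by
      obtain ⟨h1, h2, h3, h4, h5, h6⟩ := evalArgs_order E κ C
      rw [← evalArgs_N E κ C, Nat.add_sub_cancel' (by omega)]
      have hIco : ∀ {a b : ℕ}, b ≤ (evalArgs E κ C).total →
          Set.Ico a b ⊆ Set.Iio (evalArgs E κ C).total := by
        intro a b hb i hi
        simp only [Set.mem_Ico, Set.mem_Iio] at *
        omega
      refine GoodOn.append ?_ (GoodOn.append ?_ (GoodOn.append ?_ ?_))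
      · refine goodOn_map (evalArgs_phi_injective E κ C) (fun i hi => ?_) C.goodOn
        have := evalArgs_phi_lt E κ C hi
        simp only [Set.mem_Iio]
        omega
      · exact goodOn_forms E κ C (hIco (by omega))
      · refine goodOn_calls (E.enc κ) _ (fun j hj i hi => evalArgs_src1_lt E κ C hj) ?_ ?_ ?_ ?_
        · rw [evalArgs_W1, evalArgs_J1]
        · intro j hj i hi
          have := evalArgs_src1_lt E κ C (i := i) hj
          simp only [Set.mem_Iio]
          omega
        · refine hIco ?_
          rw [evalArgs_J1, ← evalArgs_W1]
          omega
        · refine hIco ?_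
          rw [evalArgs_J1, ← evalArgs_O2]
          omega
      · rw [evalArgs_m]
        have hsrc : ∀ j < 2 * m, ∀ i < E.evkLen κ + (2 * n + 2 * n) * E.ctLen κ,
            (evalArgs E κ C).src2 j i < (evalArgs E κ C).O2 := by
          intro j hj i hi
          rcases evalArgs_src2_lt E κ C hj hi with h | h <;> omega
        refine goodOn_calls (E.eval κ (ipCircuit (2 * n))) _ hsrc ?_ ?_ ?_ ?_
        · exact (evalArgs_W2 E κ C).ge
        · intro j hj i hi
          have := hsrc j hj i hi
          simp only [Set.mem_Iio]
          omega
        · exact hIco (((evalArgs_W2 E κ C).ge).trans h6)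
        · exact hIco (evalArgs_total E κ C).ge)
    (fun k => by
      obtain ⟨h1, h2, h3, h4, h5, h6⟩ := evalArgs_order E κ C
      rw [← evalArgs_N E κ C, Nat.add_sub_cancel' (by omega)]
      rcases evalArgs_out_lt E κ C k.2 with ⟨_, h, e⟩ | ⟨_, _, h⟩
      · have := evalArgs_phi_lt E κ C (C.rawOut_lt ⟨_, h⟩)
        omega
      · omega)
    (fun i j hij => by
      obtain ⟨h1, h2, h3, h4, h5, h6⟩ := evalArgs_order E κ C
      have hi := Nat.div_add_mod (i : ℕ) (1 + 2 * ipLen E κ n)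
      have hj := Nat.div_add_mod (j : ℕ) (1 + 2 * ipLen E κ n)
      have hri : (i : ℕ) % (1 + 2 * ipLen E κ n) < 1 + 2 * ipLen E κ n := Nat.mod_lt _ (by omega)
      have hrj : (j : ℕ) % (1 + 2 * ipLen E κ n) < 1 + 2 * ipLen E κ n := Nat.mod_lt _ (by omega)
      ext
      replace hij : (evalArgs E κ C).out i = (evalArgs E κ C).out j := hij
      rcases evalArgs_out_lt E κ C i.2 with ⟨hi0, hi1, ei⟩ | ⟨hi0, ei, hi1⟩ <;>
        rcases evalArgs_out_lt E κ C j.2 with ⟨hj0, hj1, ej⟩ | ⟨hj0, ej, hj1⟩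
      · have := evalArgs_phi_injective E κ C (ei.symm.trans (hij.trans ej))
        have := C.rawOut_injective this
        rw [Fin.mk.injEq] at this
        rw [← hi, ← hj, this, hi0, hj0]
      · have := evalArgs_phi_lt E κ C (C.rawOut_lt ⟨_, hi1⟩)
        omega
      · have := evalArgs_phi_lt E κ C (C.rawOut_lt ⟨_, hj1⟩)
        omega
      · set q := (i : ℕ) / (1 + 2 * ipLen E κ n)
        set q' := (j : ℕ) / (1 + 2 * ipLen E κ n)
        have hpos : 0 < 2 * ipLen E κ n := by omega
        have e : q * (2 * ipLen E κ n) + (i % (1 + 2 * ipLen E κ n) - 1) =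
            q' * (2 * ipLen E κ n) + (j % (1 + 2 * ipLen E κ n) - 1) := by
          omega
        have hq : q = q' := by
          have h := congrArg (· / (2 * ipLen E κ n)) e
          simp only [Nat.mul_comm _ (2 * ipLen E κ n), Nat.mul_add_div hpos] at h
          rwa [Nat.div_eq_of_lt (by omega), Nat.div_eq_of_lt (by omega)] at h
        rw [hq] at e hi
        omega)

theorem evalCircuit_raw : (evalCircuit E κ C).raw =
    ((evalArgs E κ C).N, (evalArgs E κ C).total - (evalArgs E κ C).N, (evalArgs E κ C).gates,
      List.ofFn fun k : Fin (m * (1 + 2 * ipLen E κ n)) => (evalArgs E κ C).out k) :=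
  QCircuit.raw_ofRaw ..

theorem evalCircuit_rawGates : (evalCircuit E κ C).rawGates = (evalArgs E κ C).gates :=
  QCircuit.rawGates_ofRaw ..

theorem evalCircuit_rawOut : (evalCircuit E κ C).rawOut =
    fun k : Fin (m * (1 + 2 * ipLen E κ n)) => (evalArgs E κ C).out k := rfl

theorem evalArgs_raw : (evalArgs E κ C).raw = (evalCircuit E κ C).raw := by
  rw [evalCircuit_raw, ofFn_val_eq_map _ (evalArgs E κ C).out, EvalArgs.raw,
    evalArgs_m, evalArgs_l]

end Eval

/-! ### Polynomial time -/

namespace PF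

theorem keyGen_raw : PF (fun κ => (E.keyGen κ).raw) := by
  have := E.keyGen_poly
  simp only [← RandCircuit.enc_raw] at this
  exact this

theorem enc_raw : PF (fun κ => (E.enc κ).raw) := by
  have := E.enc_poly
  simp only [← RandCircuit.enc_raw] at this
  exact this

theorem dec_raw : PF (fun i : ℕ × ℕ => (E.dec i.1 i.2).raw) := by
  have := E.dec_poly
  simp only [← RandCircuit.enc_raw] at this
  exact this

/-- The inner product circuit is produced from its length in polynomial time, and the uniformity of
the classical evaluation is applied to its code. -/
theorem eval_raw : PF (fun i : ℕ × ℕ => (E.eval i.1 (ipCircuit (2 * i.2))).raw) := by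
  have h := E.eval_poly
  simp only [← RandCircuit.enc_raw] at h
  have h2 : PF (fun i : ℕ × ℕ => (i.1, 2 * i.2 + 2 * i.2,
      (List.range (2 * i.2)).map (fun k => ArithGate.mul k (2 * i.2 + k)) ++
        ArithGate.const false :: (List.range (2 * i.2)).map (fun k =>
          ArithGate.add (2 * i.2 + 2 * i.2 + 2 * i.2 + k) (2 * i.2 + 2 * i.2 + k)),
      [2 * i.2 + 2 * i.2 + 2 * i.2 + 2 * i.2])) := by
    have h1 : PF (fun i : ℕ × ℕ =>
        (List.range (2 * i.2)).map (fun k => ArithGate.mul k (2 * i.2 + k))) :=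
      map (f := fun (i : ℕ × ℕ) k => ArithGate.mul k (2 * i.2 + k)) (by fun_prop) (by fun_prop)
    have h2 : PF (fun i : ℕ × ℕ => (List.range (2 * i.2)).map (fun k =>
        ArithGate.add (2 * i.2 + 2 * i.2 + 2 * i.2 + k) (2 * i.2 + 2 * i.2 + k))) :=
      map (f := fun (i : ℕ × ℕ) k => ArithGate.add (2 * i.2 + 2 * i.2 + 2 * i.2 + k)
        (2 * i.2 + 2 * i.2 + k)) (by fun_prop) (by fun_prop)
    have h3 := const (α := ℕ × ℕ) (ArithGate.const false)
    fun_prop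
  refine PolyTime.trans (b := fun i : ℕ × ℕ => .cons (.nat i.1) (ipCircuit (2 * i.2)).code) ?_ ?_
  · exact h2
  · obtain ⟨p, q, h⟩ := h
    exact ⟨p, q, fun i => h ⟨i.1, _, ipCircuit (2 * i.2)⟩⟩

/-- The length functions are not assumed to be computable. They are read off from the circuits that
the uniform families produce, here from the number of inputs of encryption. -/
theorem pkLen : PF E.pkLen := by
  have h : ∀ R : ℕ → RawR, PF R → PF (fun κ => (R κ).2.1 - (R κ).1 - 1) := fun R hR => by
    fun_prop
  refine congr_enc (h _ (enc_raw E)) fun κ => ?_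
  simp only [RandCircuit.raw, Nat.add_sub_cancel]

theorem ctLen : PF E.ctLen := by
  have h : ∀ R : ℕ → RawR, PF R → PF (fun κ => (R κ).2.2.2.length) := fun R hR => by fun_prop
  refine congr_enc (h _ (enc_raw E)) fun κ => ?_
  simp only [RandCircuit.raw, List.length_ofFn]

theorem skLen : PF E.skLen := by
  have h1 : PF (fun κ => (E.dec κ 0).raw) := (dec_raw E).comp (f := fun κ => (κ, 0)) (by fun_prop)
  have h : ∀ R : ℕ → RawR, PF R → PF (fun κ => (R κ).2.1 - (R κ).1) := fun R hR => by fun_prop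
  refine congr_enc (h _ h1) fun κ => ?_
  simp only [RandCircuit.raw, Nat.add_sub_cancel, Nat.add_zero]

theorem evkLen : PF E.evkLen := by
  have h2 := pkLen E
  have h3 := skLen E
  have h : ∀ R : ℕ → RawR, PF R →
      PF (fun κ => (R κ).2.2.2.length - (E.pkLen κ + E.skLen κ)) := fun R hR => by fun_prop
  refine congr_enc (h _ (keyGen_raw E)) fun κ => ?_
  simp only [RandCircuit.raw, List.length_ofFn, Nat.add_sub_cancel_left]

theorem keyGenCircuit_raw : PF (fun κ => (keyGenCircuit E κ).raw) := by
  have h2 := pkLen E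
  have h3 := skLen E
  have h : ∀ R : ℕ → RawR, PF R → PF (fun κ => ((R κ).1, (R κ).2.1, (R κ).2.2.1,
      (R κ).2.2.2.take (E.pkLen κ + E.skLen κ) ++ ((R κ).2.2.2.take (E.pkLen κ) ++
        (R κ).2.2.2.drop (E.pkLen κ + E.skLen κ)))) := fun R hR => by fun_prop
  refine congr_enc (h _ (keyGen_raw E)) fun κ => ?_
  congr 1
  simp only [RandCircuit.raw, keyGenCircuit, List.ofFn_fin_append]
  set o := (E.keyGen κ).circuit.out
  have e : o = Fin.append (Fin.append (fun i => o (Fin.castAdd _ (Fin.castAdd _ i)))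
      (fun i => o (Fin.castAdd _ (Fin.natAdd _ i)))) (fun i => o (Fin.natAdd _ i)) := by
    funext i
    induction i using Fin.addCases with
    | left i =>
      rw [Fin.append_left]
      induction i using Fin.addCases with
      | left i => rw [Fin.append_left]
      | right i => rw [Fin.append_right]
    | right i => rw [Fin.append_right]
  have e1 : (fun i => o (Fin.castAdd (E.evkLen κ) i)) =
      Fin.append (fun i => o (Fin.castAdd _ (Fin.castAdd _ i)))
      (fun i => o (Fin.castAdd _ (Fin.natAdd _ i))) := by
    funext i
    induction i using Fin.addCases with
    | left i => rw [Fin.append_left]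
    | right i => rw [Fin.append_right]
  have e2 : List.ofFn o = List.ofFn (fun i => o (Fin.castAdd _ (Fin.castAdd _ i))) ++
      List.ofFn (fun i => o (Fin.castAdd _ (Fin.natAdd _ i))) ++
        List.ofFn (fun i => o (Fin.natAdd _ i)) := by
    conv_lhs => rw [e]
    rw [List.ofFn_fin_append, List.ofFn_fin_append]
  rw [e1, List.ofFn_fin_append, e2]
  set A := List.ofFn (fun i => o (Fin.castAdd (E.evkLen κ) (Fin.castAdd (E.skLen κ) i)))
  set B := List.ofFn (fun i => o (Fin.castAdd (E.evkLen κ) (Fin.natAdd (E.pkLen κ) i)))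
  set Z := List.ofFn (fun i => o (Fin.natAdd (E.pkLen κ + E.skLen κ) i))
  have hA : A.length = E.pkLen κ := List.length_ofFn
  have hB : B.length = E.skLen κ := List.length_ofFn
  rw [List.take_left' (by rw [List.length_append, hA, hB]), List.append_assoc A B Z,
    List.take_left' hA, ← List.append_assoc A B Z,
    List.drop_left' (by rw [List.length_append, hA, hB])]

/-- The input is mapped to the input of the circuit family. -/
theorem _root_.QHom.PF.code {ι : Type} [Enc ι] {n m : ι → ℕ} {C : ∀ i, QCircuit (n i) (m i)}
    (h : PF (fun i => (C i).raw)) : PolyTime (Enc.enc : ι → Data) (fun i => (C i).code) := by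
  simp only [← QCircuit.enc_raw]
  exact h

end PF

/-- The quantum homomorphic encryption scheme. -/
def scheme : QuantumHE where
  pkLen := E.pkLen
  skLen := E.skLen
  -- Evaluation has to encrypt coefficients and receives no public key of its own, so the evaluation
  -- key contains a copy.
  evkLen κ := E.pkLen κ + E.evkLen κ
  ctLen κ := 1 + 2 * E.ctLen κ
  -- The evaluated circuit enters as encrypted data, so the length depends only on its number of
  -- inputs.
  evLen κ n _ _ := 1 + 2 * ipLen E κ n
  keyGen κ := ofRand (keyGenCircuit E κ)
  enc := encCircuit E
  eval κ _ _ C := evalCircuit E κ C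
  dec := decCircuit E
  keyGen_poly := by
    refine PF.code ?_
    have h : ∀ R : ℕ → RawR, PF R → PF (fun κ => ((0, (R κ).2.2.2.length + (R κ).work,
        callGates (R κ) (fun i => i) 0 (R κ).2.2.2.length,
        List.range (R κ).2.2.2.length) : RawQ)) := fun R hR => by fun_prop
    refine PF.congr_enc (h _ (PF.keyGenCircuit_raw E)) fun κ => ?_
    have e : (keyGenCircuit E κ).raw.2.2.2.length =
      E.pkLen κ + E.skLen κ + (E.pkLen κ + E.evkLen κ) := List.length_ofFn
    rw [ofRand_raw, ofFn_val_eq_map _ (fun k => k), List.map_id', e]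
  enc_poly := by
    refine PF.code ?_
    have h1 := PF.enc_raw E
    have h2 := PF.pkLen E
    have h3 := PF.ctLen E
    have h4 : PF (fun κ => encGates (E.enc κ).raw (E.pkLen κ) (E.ctLen κ)) := by
      refine PF.append (by fun_prop) (PF.append (PF.callsGates h1 (by fun_prop) ?_ (by fun_prop)
        (by fun_prop)) (by fun_prop))
      fun_prop
    have h5 : PF (fun κ => (List.range (1 + 2 * E.ctLen κ)).map fun k => encOut (E.pkLen κ) k) := by
      refine PF.map (f := fun κ k => encOut (E.pkLen κ) k) (by fun_prop) ?_
      unfold encOut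
      fun_prop
    have h : PF (fun κ => ((E.pkLen κ + 1, 2 + 2 * E.ctLen κ + 2 * (E.enc κ).raw.work,
      encGates (E.enc κ).raw (E.pkLen κ) (E.ctLen κ),
      (List.range (1 + 2 * E.ctLen κ)).map fun k => encOut (E.pkLen κ) k) : RawQ)) := by fun_prop
    refine PF.congr_enc h fun κ => ?_
    rw [encCircuit_raw, ofFn_val_eq_map _ (encOut (E.pkLen κ))]
  eval_poly := by
    have h1 := PF.enc_raw E
    have h2 := PF.pkLen E
    have h3 := PF.ctLen E
    have h4 := PF.evkLen E
    have h5 : PF (fun p : ℕ × RawQ => (E.eval p.1 (ipCircuit (2 * p.2.1))).raw) :=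
      (PF.eval_raw E).comp (f := fun p : ℕ × RawQ => (p.1, p.2.1)) (by fun_prop)
    have h6 : PF (fun p : ℕ × RawQ => EvalArgs.raw ⟨E.pkLen p.1, E.evkLen p.1, E.ctLen p.1,
        (E.enc p.1).raw, (E.eval p.1 (ipCircuit (2 * p.2.1))).raw, p.2⟩) :=
      PF.evalArgs_raw.comp (PF.evalArgs (h2.comp PF.fst') (h4.comp PF.fst') (h3.comp PF.fst')
        (h1.comp PF.fst') h5 PF.snd')
    have h := PF.of_repr h6
      (fun i : ℕ × (Σ n : ℕ, Σ m : ℕ, QCircuit n m) => (i.1, i.2.2.2.raw))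
      (fun i => (evalCircuit E i.1 i.2.2.2).raw) fun i => by
        rw [← evalArgs_raw E i.1 i.2.2.2]
        rfl
    simp only [QCircuit.enc_raw, enc_prod] at h
    exact h
  dec_poly := by
    refine PF.code (C := fun i : ℕ × ℕ => decCircuit E i.1 i.2) ?_
    have h1 : PF (fun i : ℕ × ℕ => (E.dec i.1 ((i.2 - 1) / 2)).raw) :=
      (PF.dec_raw E).comp (f := fun i : ℕ × ℕ => (i.1, (i.2 - 1) / 2)) (by fun_prop)
    have h2 : PF (fun i : ℕ × ℕ => E.skLen i.1) := (PF.skLen E).comp PF.fst'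
    have h : ∀ R : ℕ × ℕ → RawR, PF R → PF (fun i : ℕ × ℕ => ((E.skLen i.1 + i.2,
        3 + 2 * (R i).work, decGates (R i) (E.skLen i.1) i.2, [E.skLen i.1]) : RawQ)) := by
      intro R hR
      have h3 : PF (fun i : ℕ × ℕ => decGates (R i) (E.skLen i.1) i.2) := by
        refine PF.append (PF.callsGates hR (by fun_prop) ?_ (by fun_prop) (by fun_prop))
          (by fun_prop)
        have h4 : PF (fun p : ((ℕ × ℕ) × ℕ) × ℕ => E.skLen p.1.1.1) :=
          (PF.skLen E).comp (f := fun p : ((ℕ × ℕ) × ℕ) × ℕ => p.1.1.1) (by fun_prop)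
        fun_prop
      fun_prop
    refine PF.congr_enc (h _ h1) fun i => ?_
    rw [decCircuit_raw]

/-! ## Key generation, encryption and decryption -/

theorem obs_of_agree {m : ℕ} {out : Fin m → ℕ} (a b : Bits m) {u v : Mem}
    (h : ∀ j, (∀ k, out k ≠ j) → u j = v j) :
    obs out a b u v = if u ∘ out = a ∧ v ∘ out = b then 1 else 0 := by
  have e : ((∀ k, u (out k) = a k) ∧ (∀ k, v (out k) = b k) ∧
      (∀ j, (∀ k, out k ≠ j) → u j = v j)) ↔ (u ∘ out = a ∧ v ∘ out = b) := by
    rw [funext_iff, funext_iff]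
    exact ⟨fun h' => ⟨h'.1, h'.2.1⟩, fun h' => ⟨h'.1, h'.2, h⟩⟩
  simp only [obs, e]

theorem wrL_ofFn {n : ℕ} (u : Mem) (o : ℕ) (y : Bits n) (i : Fin n) :
    wrL u o (List.ofFn y) (o + i) = y i := by
  rw [wrL_add _ _ _ (by simp)]
  simp [List.getD_eq_getElem?_getD]

theorem wrL_ofFn_of_le {n : ℕ} (u : Mem) (o : ℕ) (y : Bits n) {j : ℕ} (h : o + n ≤ j) :
    wrL u o (List.ofFn y) j = u j := wrL_of_le _ _ (by simpa using h)

/-- All the wires outside the output are traced out, and each run writes the same string on both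
sides of a matrix unit. The output is thus diagonal, with the classical probabilities as entries. -/
theorem chan_ofRand {m : ℕ} (R : RandCircuit 0 m) (a b : Bits m) :
    (ofRand R).chan 1 a b = if a = b then (R.prob (fun i => i.elim0) a : ℂ) else 0 := by
  have h1 : (1 : Op (Bits 0)) = Matrix.single (fun i => i.elim0) (fun i => i.elim0) 1 := by
    ext x y
    rw [Subsingleton.elim x y, Subsingleton.elim y (fun i => i.elim0)]
    simp
  have h0 : ∀ i, mem (fun i : Fin 0 => i.elim0) i = false := fun i => mem_of_le _ (Nat.zero_le i)
  rw [h1, QCircuit.chan_single, ofRand_rawGates, ofRand_rawOut,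
    heisL_call R (fun i => i.elim0) _ _ _ (by simp) (by simp) (fun i => i.elim0) (fun i => i.elim0)
      (fun i _ => h0 i) (fun i _ => h0 i)]
  · have h2 : ∀ (y : Bits m) (u : Mem), wrL u 0 (List.ofFn y) ∘ (fun k : Fin m => (k : ℕ)) = y := by
      intro y u
      funext k
      have := wrL_add u 0 (List.ofFn y) (i := k) (by simp)
      simpa [List.getD_eq_getElem?_getD] using this
    simp only [obs_of_agree a b (fun j _ => rfl), h2]
    split_ifs with h
    · subst h
      rw [Finset.sum_eq_single a] <;> simp +contextual
    · refine Finset.sum_eq_zero fun y _ => ?_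
      rw [if_neg (fun h' => h (h'.1.symm.trans h'.2)), mul_zero]
  · refine (tracedOn_obs _ _ _).mono ?_
    rintro i hi ⟨k, hk⟩
    have h1 := hi.1
    have h2 := k.2
    simp only at hk
    omega

variable (E : ClassicalHE)

theorem append_eq_append_iff {a b : ℕ} {x x' : Bits a} {y y' : Bits b} :
    Fin.append x y = Fin.append x' y' ↔ x = x' ∧ y = y' := by
  refine ⟨fun h => ⟨funext fun i => ?_, funext fun i => ?_⟩, fun h => by rw [h.1, h.2]⟩
  · simpa using congrFun h (Fin.castAdd b i)
  · simpa using congrFun h (Fin.natAdd a i)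

@[simp] theorem takeBits_append {a b : ℕ} (x : Bits a) (y : Bits b) :
    takeBits (Fin.append x y) = x := by
  funext i; simp [takeBits]

@[simp] theorem dropBits_append {a b : ℕ} (x : Bits a) (y : Bits b) :
    dropBits (Fin.append x y) = y := by
  funext i; simp [dropBits]

theorem append_take_drop {a b : ℕ} (z : Bits (a + b)) :
    Fin.append (takeBits z) (dropBits z) = z := by
  funext i
  induction i using Fin.addCases with
  | left i => rw [Fin.append_left]; rfl
  | right i => rw [Fin.append_right]; rfl

theorem keyGenCircuit_prob (κ : ℕ) (pk pk' : Bits (E.pkLen κ)) (sk : Bits (E.skLen κ))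
    (evk : Bits (E.evkLen κ)) :
    (keyGenCircuit E κ).prob (fun i => i.elim0)
      (Fin.append (Fin.append pk sk) (Fin.append pk' evk)) =
      if pk' = pk then E.keyProb κ pk sk evk else 0 := by
  have he : ∀ x, (keyGenCircuit E κ).circuit.eval x =
      let z := (E.keyGen κ).circuit.eval x
      Fin.append (takeBits z) (Fin.append (takeBits (takeBits z)) (dropBits z)) := by
    intro x
    funext k
    change ((E.keyGen κ).circuit.wires x).getD ((keyGenCircuit E κ).circuit.out k) false = _
    simp only [keyGenCircuit]
    induction k using Fin.addCases with
    | left i => rw [Fin.append_left, Fin.append_left]; rfl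
    | right i =>
      rw [Fin.append_right, Fin.append_right]
      induction i using Fin.addCases with
      | left i => rw [Fin.append_left, Fin.append_left]; rfl
      | right i => rw [Fin.append_right, Fin.append_right]; rfl
  have hz : ∀ z : Bits (E.pkLen κ + E.skLen κ + E.evkLen κ),
      Fin.append (takeBits z) (Fin.append (takeBits (takeBits z)) (dropBits z)) =
        Fin.append (Fin.append pk sk) (Fin.append pk' evk) ↔
      z = Fin.append (Fin.append pk sk) evk ∧ pk' = pk := by
    intro z
    rw [append_eq_append_iff, append_eq_append_iff]
    constructor
    · rintro ⟨h1, h2, h3⟩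
      rw [h1, takeBits_append] at h2
      exact ⟨by rw [← append_take_drop z, h1, h3], h2.symm⟩
    · rintro ⟨rfl, rfl⟩
      simp
  simp only [RandCircuit.prob, ClassicalHE.keyProb, he, hz]
  split_ifs with h
  · simp only [h, and_true]
    rfl
  · simp [h]

theorem evkState_scheme (κ : ℕ) (pk : Bits (E.pkLen κ)) (sk : Bits (E.skLen κ))
    (pk₁ pk₂ : Bits (E.pkLen κ)) (e₁ e₂ : Bits (E.evkLen κ)) :
    (scheme E).evkState κ pk sk (Fin.append pk₁ e₁) (Fin.append pk₂ e₂) =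
      if pk₁ = pk ∧ pk₂ = pk ∧ e₁ = e₂ then (E.keyProb κ pk sk e₁ : ℂ) else 0 := by
  have h : (ofRand (keyGenCircuit E κ)).chan 1 (Fin.append (Fin.append pk sk) (Fin.append pk₁ e₁))
      (Fin.append (Fin.append pk sk) (Fin.append pk₂ e₂)) =
      if pk₁ = pk ∧ pk₂ = pk ∧ e₁ = e₂ then (E.keyProb κ pk sk e₁ : ℂ) else 0 := by
    rw [chan_ofRand, keyGenCircuit_prob]
    simp only [append_eq_append_iff, true_and]
    split_ifs <;> simp_all
  exact h

theorem tensor_ketbra_single {a b : ℕ} (x : Bits a) (y y' : Bits b) :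
    tensor (ketbra x) (Matrix.single y y' 1) =
      Matrix.single (Fin.append x y) (Fin.append x y') 1 := by
  ext u v
  rw [← append_take_drop u, ← append_take_drop v]
  simp only [tensor, ketbra, Matrix.of_apply, takeBits_append, dropBits_append, Matrix.single_apply,
    append_eq_append_iff]
  split_ifs <;> grind

/-- A qubit together with two classical strings. -/
def pack {l : ℕ} (q : Bool) (y : Fin 2 → Bits l) : Bits (1 + 2 * l) :=
  Fin.append (fun _ => q) (flat y)

/-- Four equally likely keys, then two independent classical encryptions of the key bits, then the
Pauli operator. The two sides `s` and `s'` share all classical values and differ only in the qubit,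
so the operator contributes a shift on each side and a common sign. -/
theorem heisL_encGates {p l : ℕ} (R : RandCircuit (p + 1) l) (pk : Bits p) (s s' : Bool)
    (c c' : Bits (1 + 2 * l)) :
    heisL (encGates R.raw p l) (obs (fun k : Fin (1 + 2 * l) => encOut p k) c c')
      (mem (Fin.append pk fun _ : Fin 1 => s)) (mem (Fin.append pk fun _ : Fin 1 => s')) =
      ∑ k : Bits 2, ∑ y : Fin 2 → Bits l,
        1 / 4 * (∏ j, (R.prob (Fin.append pk fun _ => k j) (y j) : ℂ)) * sg (k 1 && xor s s') *
          if pack (xor s (k 0)) y = c ∧ pack (xor s' (k 0)) y = c' then 1 else 0 := by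
  rw [encGates, heisL_append, heisL_append]
  set F := heisL (pauliGates (p + 1) (p + 2) p)
    (obs (fun k : Fin (1 + 2 * l) => encOut p k) c c')
  set m : Bool → Mem := fun s => mem (Fin.append pk fun _ : Fin 1 => s)
  have hm0 : ∀ s i, p + 1 ≤ i → m s i = false := fun s i hi => mem_of_le _ hi
  have hmp : ∀ s (i : Fin p), m s i = pk i := fun s i => by
    simp only [m]
    rw [mem_of_lt _ (by omega : (i : ℕ) < p + 1)]
    exact Fin.append_left pk _ i
  have hms : ∀ s, m s p = s := fun s => by
    simp only [m]
    rw [mem_of_lt _ (by omega : p < p + 1)]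
    exact Fin.append_right pk (fun _ : Fin 1 => s) 0
  have hcoin := heisL_coins 2 (o := p + 1) (m s) (m s') [] (heisL (callsGates R.raw 2
    (fun j i => if i < p then i else p + 1 + j) (p + 3) (p + 3 + 2 * l)) F) (hm0 s)
    (hm0 s')
  simp only [List.length_nil, Nat.add_zero, wrL_nil, List.nil_append] at hcoin
  rw [hcoin, Finset.mul_sum]
  refine Finset.sum_congr rfl fun k _ => ?_
  have hk0 : ∀ s, wrL (m s) (p + 1) (List.ofFn k) (p + 1) = k 0 := fun s => wrL_ofFn _ _ k 0
  have hk1 : ∀ s, wrL (m s) (p + 1) (List.ofFn k) (p + 2) = k 1 := fun s => wrL_ofFn _ _ k 1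
  have hkl : ∀ s i, i < p + 1 → wrL (m s) (p + 1) (List.ofFn k) i = m s i := fun s i hi =>
    wrL_of_lt _ _ hi
  have hkz : ∀ s i, p + 3 ≤ i → wrL (m s) (p + 1) (List.ofFn k) i = false := fun s i hi => by
    rw [wrL_ofFn_of_le _ _ _ (by omega)]
    exact hm0 s i (by omega)
  have hsrc : ∀ s (j : Fin 2) (i : Fin (p + 1)), wrL (m s) (p + 1) (List.ofFn k)
      (if (i : ℕ) < p then i else p + 1 + j) = Fin.append pk (fun _ : Fin 1 => k j) i := by
    intro s j i
    induction i using Fin.addCases with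
    | left i =>
      rw [Fin.append_left, if_pos (by simp), Fin.val_castAdd, hkl s _ (by omega), hmp]
    | right i =>
      rw [Fin.append_right, if_neg (by simp)]
      fin_cases j
      · exact hk0 s
      · exact hk1 s
  rw [heisL_calls R 2 (fun j => Fin.append pk fun _ => k j) _ _ F
    (fun j hj i hi => by split_ifs <;> omega) le_rfl (hsrc s) (hsrc s') (hkz s) (hkz s')
    (((tracedOn_obs _ _ _).mono (by
      rintro i hi ⟨k, hk⟩
      have h1 := hi.1
      have h2 := k.2
      simp only [encOut] at hk
      split_ifs at hk <;> omega)).heisL fun g hg => (goodOn_pauli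
        (by simp only [Set.mem_compl_iff, Set.mem_Ico]; omega)
        (by simp only [Set.mem_compl_iff, Set.mem_Ico]; omega)
        (by simp only [Set.mem_compl_iff, Set.mem_Ico]; omega) (by omega) (by omega) g hg).1),
    Finset.mul_sum]
  refine Finset.sum_congr rfl fun y _ => ?_
  set M : Bool → Mem := fun s => wrL (wrL (m s) (p + 1) (List.ofFn k)) (p + 3) (List.ofFn (flat y))
  have hMl : ∀ s i, i < p + 3 → M s i = wrL (m s) (p + 1) (List.ofFn k) i := fun s i hi =>
    wrL_of_lt _ _ hi
  change _ * (_ * F (M s) (M s')) = _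
  simp only [F]
  rw [heisL_pauli (by omega) _ _ _ (by rw [hMl _ _ (by omega), hMl _ _ (by omega), hk0, hk0])
    (by rw [hMl _ _ (by omega), hMl _ _ (by omega), hk1, hk1])]
  have hMp : ∀ s, M s p = s := fun s => by
    rw [hMl _ _ (by omega), hkl _ _ (by omega), hms]
  have hM0 : ∀ s, M s (p + 1) = k 0 := fun s => by rw [hMl _ _ (by omega), hk0]
  have hM1 : ∀ s, M s (p + 2) = k 1 := fun s => by rw [hMl _ _ (by omega), hk1]
  have hout : ∀ s, Function.update (M s) p (xor s (k 0)) ∘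
      (fun k : Fin (1 + 2 * l) => encOut p k) = pack (xor s (k 0)) y := by
    intro s
    funext i
    induction i using Fin.addCases with
    | left i =>
      rw [pack, Fin.append_left, Function.comp_apply]
      simp only [encOut, Fin.val_castAdd, Fin.val_eq_zero, if_true, Function.update_self]
    | right i =>
      rw [pack, Fin.append_right, Function.comp_apply, Function.update_of_ne]
      · simp only [encOut, Fin.val_natAdd]
        rw [if_neg (by omega), show p + 2 + (1 + (i : ℕ)) = p + 3 + i by omega]
        exact wrL_ofFn _ _ _ _
      · simp only [encOut, Fin.val_natAdd]
        split_ifs <;> omega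
  -- The discarded wires hold the public key, the two key bits and zeros, equal on both sides, so
  -- discarding them contributes the factor `1`.
  have hag : ∀ j, (∀ k : Fin (1 + 2 * l), encOut p k ≠ j) →
      Function.update (M s) p (xor s (k 0)) j = Function.update (M s') p (xor s' (k 0)) j := by
    intro j hj
    have h0 : j ≠ p := fun h => hj ⟨0, by omega⟩ (by simp [encOut, h])
    rw [Function.update_of_ne h0, Function.update_of_ne h0]
    rcases lt_or_ge j (p + 3) with h1 | h1
    · rw [hMl _ _ h1, hMl _ _ h1]
      rcases lt_or_ge j (p + 1) with h2 | h2
      · rw [hkl _ _ h2, hkl _ _ h2]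
        exact (hmp s ⟨j, by omega⟩).trans (hmp s' ⟨j, by omega⟩).symm
      · obtain rfl | rfl : j = p + 1 ∨ j = p + 2 := by omega
        · rw [hk0, hk0]
        · rw [hk1, hk1]
    · rcases lt_or_ge j (p + 3 + 2 * l) with h2 | h2
      · exact absurd (by simp only [encOut]; split_ifs <;> omega)
          (hj ⟨j - (p + 2), by omega⟩)
      · simp only [M]
        rw [wrL_ofFn_of_le _ _ _ h2, wrL_ofFn_of_le _ _ _ h2, hkz _ _ h1, hkz _ _ h1]
  rw [hMp, hMp, hM0, hM1, obs_of_agree _ _ hag, hout, hout]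
  split_ifs <;> norm_num
  ring

/-- A Pauli operator maps matrix units to signed matrix units. Encryption of a matrix unit is
therefore an explicit mixture over keys and ciphertexts. -/
theorem encChan_single (κ : ℕ) (pk : Bits (E.pkLen κ)) (s s' : Bool) :
    (scheme E).encChan κ pk (Matrix.single s s' 1) =
      ∑ k : Bits 2, ∑ y : Fin 2 → Bits (E.ctLen κ),
        (1 / 4 * (∏ j, (E.encProb κ pk (k j) (y j) : ℂ)) * sg (k 1 && xor s s')) •
          Matrix.single (pack (xor s (k 0)) y) (pack (xor s' (k 0)) y) 1 := by
  have h : (encCircuit E κ).chan (Matrix.single (Fin.append pk fun _ => s)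
      (Fin.append pk fun _ => s') 1) = ∑ k : Bits 2, ∑ y : Fin 2 → Bits (E.ctLen κ),
        (1 / 4 * (∏ j, (E.encProb κ pk (k j) (y j) : ℂ)) * sg (k 1 && xor s s')) •
          Matrix.single (pack (xor s (k 0)) y) (pack (xor s' (k 0)) y) 1 := by
    ext c c'
    rw [QCircuit.chan_single, encCircuit_rawGates, encCircuit_rawOut, heisL_encGates]
    simp only [Matrix.sum_apply, Matrix.smul_apply, Matrix.single_apply, smul_eq_mul]
    rfl
  rw [← h]
  have e : (Matrix.single s s' (1 : ℂ)).submatrix (fun x : Bits 1 => x 0) (fun x : Bits 1 => x 0) =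
      Matrix.single (fun _ => s) (fun _ => s') 1 := by
    apply Matrix.ext
    intro x y
    have : ∀ (s : Bool) (x : Bits 1), s = x 0 ↔ (fun _ => s) = x := fun s x =>
      ⟨fun h => by funext i; rw [Subsingleton.elim i 0]; exact h, fun h => by rw [← h]⟩
    simp only [Matrix.submatrix_apply, Matrix.single_apply, this]
  rw [← tensor_ketbra_single, ← e]
  rfl

/-- Both sides carry the same two ciphertexts, so the decrypted bits are common classical randomness
and the Pauli operator applied at the end is the same on both sides. -/
theorem heisL_decGates {p l : ℕ} (R : RandCircuit (p + l) 1) (sk : Bits p) (q q' : Bool)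
    (y : Fin 2 → Bits l) (c c' : Bits 1) :
    heisL (decGates R.raw p (1 + 2 * l)) (obs (fun _ : Fin 1 => p) c c')
      (mem (Fin.append sk (pack q y))) (mem (Fin.append sk (pack q' y))) =
      ∑ k : Bits 2, (∏ j, (R.prob (Fin.append sk (y j)) (fun _ => k j) : ℂ)) *
        sg (k 1 && xor q q') *
          if (fun _ => xor q (k 0)) = c ∧ (fun _ => xor q' (k 0)) = c' then 1 else 0 := by
  have hl : (1 + 2 * l - 1) / 2 = l := by omega
  rw [decGates, heisL_append, hl]
  set o := p + (1 + 2 * l)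
  set F := heisL (pauliGates (o + 1) (o + 2) p) (obs (fun _ : Fin 1 => p) c c')
  set m : Bool → Mem := fun q => mem (Fin.append sk (pack q y))
  have hm0 : ∀ q i, o ≤ i → m q i = false := fun q i hi => mem_of_le _ hi
  have hms : ∀ q (i : Fin p), m q i = sk i := fun q i => by
    simp only [m]
    rw [mem_of_lt _ (by omega : (i : ℕ) < p + (1 + 2 * l))]
    exact Fin.append_left sk _ i
  have hmq : ∀ q, m q p = q := fun q => by
    simp only [m]
    rw [mem_of_lt _ (by omega : p < p + (1 + 2 * l))]
    exact (Fin.append_right sk (pack q y) (Fin.castAdd (2 * l) 0)).trans (Fin.append_left _ _ _)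
  have hmy : ∀ q (i : Fin (2 * l)), m q (p + 1 + i) = flat y i := fun q i => by
    simp only [m]
    rw [mem_of_lt _ (by omega : p + 1 + (i : ℕ) < p + (1 + 2 * l))]
    have := (Fin.append_right sk (pack q y) (Fin.natAdd 1 i)).trans (Fin.append_right _ _ _)
    rw [← this]
    congr 1
    ext
    simp only [Fin.val_natAdd]
    omega
  have hsrc : ∀ q (j : Fin 2) (i : Fin (p + l)), m q (if (i : ℕ) < p then (i : ℕ) else
      p + 1 + j * l + (i - p)) = Fin.append sk (y j) i := by
    intro q j i
    induction i using Fin.addCases with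
    | left i => rw [Fin.append_left, if_pos (by simp), Fin.val_castAdd, hms]
    | right i =>
      rw [Fin.append_right, if_neg (by simp)]
      have := hmy q (finProdFinEquiv (j, i))
      simp only [flat, Equiv.symm_apply_apply, finProdFinEquiv_apply_val] at this
      rw [← this, Fin.val_natAdd]
      congr 1
      rw [Nat.mul_comm l]
      omega
  rw [heisL_calls R 2 (fun j => Fin.append sk (y j)) _ _ F
    (fun j hj i hi => by
      split_ifs
      · omega
      · interval_cases j <;> omega) (by omega) (hsrc q) (hsrc q')
    (fun i hi => hm0 q i (by omega)) (fun i hi => hm0 q' i (by omega))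
    (((tracedOn_obs _ _ _).mono (by
      rintro i hi ⟨k, hk⟩
      have h1 := hi.1
      simp only at hk
      omega)).heisL fun g hg => (goodOn_pauli
        (by simp only [Set.mem_compl_iff, Set.mem_Ico]; omega)
        (by simp only [Set.mem_compl_iff, Set.mem_Ico]; omega)
        (by simp only [Set.mem_compl_iff, Set.mem_Ico]; omega) (by omega) (by omega) g hg).1)]
  -- The two runs output strings of length one; these are identified with the two key bits.
  refine Fintype.sum_equiv (Equiv.piCongrRight fun _ => Equiv.funUnique (Fin 1) Bool) _ _ fun z => ?_
  set k : Bits 2 := Equiv.piCongrRight (fun _ => Equiv.funUnique (Fin 1) Bool) z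
  have hk : ∀ j, z j = fun _ => k j := fun j => funext fun i => by
    rw [Subsingleton.elim i 0]; rfl
  set M : Bool → Mem := fun q => wrL (m q) (o + 1) (List.ofFn (flat z))
  have hM0 : ∀ q, M q (o + 1) = k 0 := fun q => wrL_ofFn (m q) (o + 1) (flat z) 0
  have hM1 : ∀ q, M q (o + 2) = k 1 := fun q => wrL_ofFn (m q) (o + 1) (flat z) 1
  have hMl : ∀ q i, i < o + 1 → M q i = m q i := fun q i hi => wrL_of_lt _ _ hi
  change _ * F (M q) (M q') = _
  simp only [F]
  rw [heisL_pauli (by omega) _ _ _ (by rw [hM0, hM0]) (by rw [hM1, hM1]), hM0, hM1,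
    hMl _ _ (by omega), hMl _ _ (by omega), hmq, hmq]
  have hag : ∀ j, (∀ k : Fin 1, p ≠ j) →
      Function.update (M q) p (xor q (k 0)) j = Function.update (M q') p (xor q' (k 0)) j := by
    intro j hj
    have h0 : j ≠ p := fun h => hj 0 h.symm
    rw [Function.update_of_ne h0, Function.update_of_ne h0]
    rcases lt_or_ge j (o + 1) with h1 | h1
    · rw [hMl _ _ h1, hMl _ _ h1]
      rcases lt_or_ge j p with h2 | h2
      · exact (hms q ⟨j, h2⟩).trans (hms q' ⟨j, h2⟩).symm
      · obtain ⟨i, rfl⟩ := Nat.exists_eq_add_of_le (show p + 1 ≤ j by omega)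
        rcases lt_or_ge i (2 * l) with h3 | h3
        · exact (hmy q ⟨i, h3⟩).trans (hmy q' ⟨i, h3⟩).symm
        · rw [hm0 _ _ (by omega), hm0 _ _ (by omega)]
    · obtain ⟨i, rfl⟩ := Nat.exists_eq_add_of_le h1
      rcases lt_or_ge i 2 with h3 | h3
      · exact (wrL_ofFn (m q) (o + 1) (flat z) ⟨i, h3⟩).trans
          (wrL_ofFn (m q') (o + 1) (flat z) ⟨i, h3⟩).symm
      · simp only [M]
        rw [wrL_ofFn_of_le _ _ _ (by omega), wrL_ofFn_of_le _ _ _ (by omega), hm0 _ _ (by omega),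
          hm0 _ _ (by omega)]
  rw [obs_of_agree _ _ hag]
  have hout : ∀ b : Bool, ∀ u : Mem,
      Function.update u p b ∘ (fun _ : Fin 1 => p) = fun _ => b := fun b u => by
    funext i; simp
  rw [hout, hout]
  simp only [hk]
  ring

theorem decChan_single (κ : ℕ) {l : ℕ} (sk : Bits (E.skLen κ)) (q q' : Bool) (y : Fin 2 → Bits l) :
    (scheme E).decChan κ sk (Matrix.single (pack q y) (pack q' y) 1) =
      ∑ k : Bits 2, ((∏ j, (E.decProb κ sk (y j) (k j) : ℂ)) * sg (k 1 && xor q q')) •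
        Matrix.single (xor q (k 0)) (xor q' (k 0)) 1 := by
  have h : (decCircuit E κ (1 + 2 * l)).chan (Matrix.single (Fin.append sk (pack q y))
      (Fin.append sk (pack q' y)) 1) = ∑ k : Bits 2, ((∏ j, (E.decProb κ sk (y j) (k j) : ℂ)) *
        sg (k 1 && xor q q')) •
          Matrix.single (fun _ => xor q (k 0)) (fun _ => xor q' (k 0)) 1 := by
    ext c c'
    have hl : (1 + 2 * l - 1) / 2 = l := by omega
    rw [QCircuit.chan_single, decCircuit_rawGates, decCircuit_rawOut, hl, heisL_decGates]
    simp only [Matrix.sum_apply, Matrix.smul_apply, Matrix.single_apply, smul_eq_mul]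
    rfl
  have h2 : (scheme E).decChan κ sk (Matrix.single (pack q y) (pack q' y) 1) =
      ((decCircuit E κ (1 + 2 * l)).chan (Matrix.single (Fin.append sk (pack q y))
      (Fin.append sk (pack q' y)) 1)).submatrix (fun b _ => b) (fun b _ => b) := by
    rw [← tensor_ketbra_single]
    rfl
  rw [h2, h]
  ext b b'
  simp only [Matrix.submatrix_apply, Matrix.sum_apply, Matrix.smul_apply, Matrix.single_apply]
  have : ∀ b c : Bool, ((fun _ : Fin 1 => b) = fun _ => c) ↔ b = c := fun b c =>
    ⟨fun h => congrFun h 0, fun h => by rw [h]⟩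
  simp only [this]

/-! ## Pauli operators and stabilizer circuits -/

/-- The sign of the `Z` part of a Pauli operator on the first `w` wires. -/
def signZ (w : ℕ) (k u : Mem) : ℂ := ∏ i ∈ Finset.range w, sg (k (2 * i + 1) && u i)

/-- The `X` part of a Pauli operator. -/
def shiftX (k u : Mem) : Mem := fun i => xor (u i) (k (2 * i))

/-- The dual action of a Pauli operator on functionals. -/
def pauliF (w : ℕ) (k : Mem) (F : Mem → Mem → ℂ) : Mem → Mem → ℂ := fun u v =>
  signZ w k u * signZ w k v * F (shiftX k u) (shiftX k v)

theorem signZ_update {w : ℕ} (k u : Mem) {i : ℕ} (hi : i < w) (s : Bool) :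
    signZ w k (Function.update u i s) = signZ w k u * sg (k (2 * i + 1) && xor (u i) s) := by
  have hm : i ∈ Finset.range w := Finset.mem_range.2 hi
  rw [signZ, signZ, ← Finset.mul_prod_erase _ _ hm, ← Finset.mul_prod_erase (a := i) _ _ hm,
    Function.update_self]
  have : ∀ j ∈ (Finset.range w).erase i, sg (k (2 * j + 1) && Function.update u i s j) =
      sg (k (2 * j + 1) && u j) := fun j hj => by
    rw [Function.update_of_ne (Finset.ne_of_mem_erase hj)]
  rw [Finset.prod_congr rfl this]
  cases k (2 * i + 1) <;> cases u i <;> cases s <;> simp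

theorem signZ_update_odd {w : ℕ} (k u : Mem) {i : ℕ} (hi : i < w) (s : Bool) :
    signZ w (Function.update k (2 * i + 1) s) u =
      signZ w k u * sg (xor (k (2 * i + 1)) s && u i) := by
  have hm : i ∈ Finset.range w := Finset.mem_range.2 hi
  rw [signZ, signZ, ← Finset.mul_prod_erase _ _ hm, ← Finset.mul_prod_erase (a := i) _ _ hm,
    Function.update_self]
  have : ∀ j ∈ (Finset.range w).erase i, sg (Function.update k (2 * i + 1) s (2 * j + 1) && u j) =
      sg (k (2 * j + 1) && u j) := fun j hj => by
    rw [Function.update_of_ne]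
    have := Finset.ne_of_mem_erase hj
    omega
  rw [Finset.prod_congr rfl this]
  cases k (2 * i + 1) <;> cases u i <;> cases s <;> simp

theorem signZ_update_even {w : ℕ} (k u : Mem) (i : ℕ) (s : Bool) :
    signZ w (Function.update k (2 * i) s) u = signZ w k u := by
  refine Finset.prod_congr rfl fun j _ => ?_
  rw [Function.update_of_ne (by omega)]

theorem shiftX_update (k u : Mem) (i : ℕ) (s : Bool) :
    shiftX k (Function.update u i s) = Function.update (shiftX k u) i (xor s (k (2 * i))) := by
  funext j
  by_cases h : j = i
  · subst h; simp [shiftX]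
  · simp [shiftX, Function.update_of_ne h]

theorem shiftX_update_even (k u : Mem) (i : ℕ) (s : Bool) :
    shiftX (Function.update k (2 * i) s) u = Function.update (shiftX k u) i (xor (u i) s) := by
  funext j
  by_cases h : j = i
  · subst h; simp [shiftX]
  · have : 2 * j ≠ 2 * i := by omega
    simp [shiftX, Function.update_of_ne h, this]

theorem shiftX_update_odd (k u : Mem) (i : ℕ) (s : Bool) :
    shiftX (Function.update k (2 * i + 1) s) u = shiftX k u := by
  funext j
  have : 2 * j ≠ 2 * i + 1 := by omega
  simp [shiftX, this]

theorem shiftX_apply (k u : Mem) (i : ℕ) : shiftX k u i = xor (u i) (k (2 * i)) := rfl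

/-- The transport of keys along additions. -/
def transport (l : List (ℕ × ℕ)) (k : Mem) : Mem := l.foldl (fun k ab => cx ab.1 ab.2 k) k

/-- All gates but the `π/8` gate. -/
def RGate.Stab : RGate → Prop
  | .one .R _ => False
  | _ => True

/-- The reason why stabilizer circuits can be run on padded qubits: a Pauli operator before the gate
equals the transported Pauli operator after it. The phases that arise cancel, since they occur on
both sides of `|u⟩⟨v|`. For a measurement, `X` changes both compared bits, and the sign of `Z` is
`1` when they agree. As only the bits of the touched wires and their keys enter, the proof is a
finite check. -/
theorem heis_pauliF {w : ℕ} {g : RGate} (hg : g.On (Set.Iio w) ∧ g.Proper) (hs : g.Stab) (k : Mem)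
    (F : Mem → Mem → ℂ) :
    g.heis (pauliF w (transport (keyPairs g) k) F) = pauliF w k (g.heis F) := by
  funext u v
  have h1 : ∀ i : ℕ, 2 * i ≠ 2 * i + 1 := fun i => by omega
  have h2 : ∀ i : ℕ, 2 * i + 1 ≠ 2 * i := fun i => by omega
  rcases g with ⟨_ | _ | _ | _ | _, i⟩ | ⟨i, j⟩ | i
  · have hi : i < w := hg.1
    simp only [heis_X, keyPairs, transport, List.foldl_nil, pauliF, signZ_update _ _ hi,
      shiftX_update, shiftX_apply]
    cases u i <;> cases v i <;> cases k (2 * i) <;> cases k (2 * i + 1) <;> simp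
  · have hZ := heis_diag .Z _ rfl i
    simp only [hZ, keyPairs, transport, List.foldl_nil, pauliF, shiftX_apply]
    rcases Bool.eq_false_or_eq_true (u i) with h3 | h3 <;>
      rcases Bool.eq_false_or_eq_true (v i) with h4 | h4 <;>
        rcases Bool.eq_false_or_eq_true (k (2 * i)) with h5 | h5 <;> simp [h3, h4, h5]
  · have hi : i < w := hg.1
    have hP := heis_diag .P _ rfl i
    simp only [hP, keyPairs, transport, List.foldl_nil, List.foldl_cons, cx, pauliF,
      signZ_update_odd _ _ hi, shiftX_update_odd, shiftX_apply]
    rcases Bool.eq_false_or_eq_true (u i) with h3 | h3 <;>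
      rcases Bool.eq_false_or_eq_true (v i) with h4 | h4 <;>
        rcases Bool.eq_false_or_eq_true (k (2 * i)) with h5 | h5 <;>
          cases k (2 * i + 1) <;> simp [h3, h4, h5] <;> ring
  · exact hs.elim
  · have hi : i < w := hg.1
    simp only [heis_H, keyPairs, transport, List.foldl_nil, List.foldl_cons, cx, pauliF,
      signZ_update_odd _ _ hi, signZ_update_even, shiftX_update_odd, shiftX_update_even,
      shiftX_apply, Function.update_self, Function.update_of_ne (h1 i), Function.update_of_ne (h2 i),
      signZ_update _ _ hi, shiftX_update, Function.update_idem, Fintype.sum_bool]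
    cases u i <;> cases v i <;> cases k (2 * i) <;> cases k (2 * i + 1) <;> simp <;> ring
  · have hi : i < w := hg.1.1
    have hj : j < w := hg.1.2
    have hij : i ≠ j := hg.2
    have h3 : 2 * j + 1 ≠ 2 * j := by omega
    have h4 : 2 * j + 1 ≠ 2 * i := by omega
    have h5 : 2 * i ≠ 2 * j := by omega
    have h6 : 2 * i + 1 ≠ 2 * j := by omega
    have h7 : 2 * i + 1 ≠ 2 * j + 1 := by omega
    have h8 : 2 * j ≠ 2 * i + 1 := by omega
    simp only [heis_cnot, keyPairs, transport, List.foldl_nil, List.foldl_cons, cx, pauliF,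
      signZ_update_odd _ _ hi, signZ_update_even, shiftX_update_odd, shiftX_update_even,
      shiftX_apply, Function.update_self, Function.update_of_ne h3, Function.update_of_ne h6,
      Function.update_of_ne hij, signZ_update _ _ hj, shiftX_update, Function.update_idem,
      Function.update_of_ne h8]
    cases u i <;> cases v i <;> cases u j <;> cases v j <;> cases k (2 * i) <;> cases k (2 * j) <;>
      cases k (2 * i + 1) <;> cases k (2 * j + 1) <;> simp
  · simp only [heis_meas, keyPairs, transport, List.foldl_nil, pauliF, shiftX_apply]
    rcases Bool.eq_false_or_eq_true (u i) with h3 | h3 <;>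
      rcases Bool.eq_false_or_eq_true (v i) with h4 | h4 <;>
        rcases Bool.eq_false_or_eq_true (k (2 * i)) with h5 | h5 <;> simp [h3, h4, h5]

theorem heisL_pauliF {w : ℕ} {gs : List RGate} (hg : GoodOn (Set.Iio w) gs)
    (hs : ∀ g ∈ gs, g.Stab) (k : Mem) (F : Mem → Mem → ℂ) :
    heisL gs (pauliF w (transport (gs.flatMap keyPairs) k) F) = pauliF w k (heisL gs F) := by
  induction gs generalizing k with
  | nil => rfl
  | cons g gs ih =>
    rw [List.flatMap_cons, transport, List.foldl_append, heisL_cons, heisL_cons,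
      ← heis_pauliF (hg g (by simp)) (hs g (by simp))]
    congr 1
    exact ih (fun g hg' => hg g (by simp [hg'])) (fun g hg' => hs g (by simp [hg'])) _

/-! ### Duality between keys and linear forms. -/

theorem dot_update_right {l : ℕ} (s k : Mem) {b : ℕ} (hb : b < l) (x : Bool) :
    dot l s (Function.update k b x) = xor (dot l s k) (s b && xor (k b) x) := by
  induction l with
  | zero => omega
  | succ l ih =>
    rw [dot, dot]
    rcases eq_or_ne b l with rfl | h
    · have : ∀ l ≤ b, dot l s (Function.update k b x) = dot l s k := by
        intro l hl
        induction l with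
        | zero => rfl
        | succ l ih => rw [dot, dot, ih (by omega), Function.update_of_ne (by omega)]
      rw [this b le_rfl, Function.update_self]
      cases s b <;> cases k b <;> cases x <;> simp
    · rw [ih (by omega), Function.update_of_ne h.symm]
      rw [Bool.xor_assoc, Bool.xor_assoc, Bool.xor_comm (s b && xor (k b) x)]

theorem dot_comm (l : ℕ) (s k : Mem) : dot l s k = dot l k s := by
  induction l with
  | zero => rfl
  | succ l ih => rw [dot, dot, ih, Bool.and_comm]

/-- The transpose of adding coordinate `a` to `b` is adding coordinate `b` to `a`. -/
theorem dot_cx {l a b : ℕ} (ha : a < l) (hb : b < l) (s k : Mem) :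
    dot l s (cx a b k) = dot l (cx b a s) k := by
  rw [dot_comm l (cx b a s), cx, cx, dot_update_right _ _ hb, dot_update_right _ _ ha, dot_comm]
  cases s a <;> cases s b <;> cases k a <;> cases k b <;> rfl

/-- Evaluating a form on transported keys is evaluating the pulled-back form on the original keys.
The form thus depends on the circuit alone and can be computed without knowing any key. -/
theorem dot_transport {l : ℕ} (L : List (ℕ × ℕ)) (hL : ∀ ab ∈ L, ab.1 < l ∧ ab.2 < l) (s k : Mem) :
    dot l s (transport L k) =
      dot l (L.reverse.foldl (fun s ab => cx ab.2 ab.1 s) s) k := by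
  induction L generalizing k with
  | nil => rfl
  | cons p L ih =>
    have h := ih (fun ab hab => hL ab (by simp [hab])) (cx p.1 p.2 k)
    rw [List.reverse_cons, List.foldl_append, List.foldl_cons, List.foldl_nil]
    rw [← dot_cx (hL p (by simp)).1 (hL p (by simp)).2]
    exact h

/-! ## Complete positivity and the trace norm -/

section LinearAlgebra

variable {α β : Type} [Fintype α] [Fintype β]

/-- Maps on operators with an operator-sum representation. -/
def HasKraus (Φ : Op α → Op β) : Prop :=
  ∃ (r : Type) (_ : Fintype r) (M : r → Matrix β α ℂ), ∀ ρ, Φ ρ = ∑ i, M i * ρ * (M i)ᴴ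

theorem HasKraus.comp {γ : Type} {Φ : Op α → Op β} {Ψ : Op β → Op γ} (h' : HasKraus Ψ) (h : HasKraus Φ) :
    HasKraus fun ρ => Ψ (Φ ρ) := by
  obtain ⟨r, _, M, hM⟩ := h
  obtain ⟨r', _, M', hM'⟩ := h'
  refine ⟨r' × r, inferInstance, fun i => M' i.1 * M i.2, fun ρ => ?_⟩
  beta_reduce
  rw [hM', hM, Fintype.sum_prod_type]
  refine Finset.sum_congr rfl fun i _ => ?_
  rw [Matrix.mul_sum, Matrix.sum_mul]
  refine Finset.sum_congr rfl fun j _ => ?_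
  rw [Matrix.conjTranspose_mul]
  simp only [Matrix.mul_assoc]

/-- Complete positivity: tensoring the Kraus operators with the identity gives an operator-sum
representation of the extended map. -/
theorem HasKraus.withEnv {Φ : Op α → Op β} (h : HasKraus Φ) (ε : Type) [Fintype ε] [DecidableEq ε]
    {ρ : Op (α × ε)} (hρ : ρ.PosSemidef) : (withEnv ε Φ ρ).PosSemidef := by
  obtain ⟨r, _, M, hM⟩ := h
  have : QHom.withEnv ε Φ ρ = ∑ i, Matrix.kronecker (M i) (1 : Matrix ε ε ℂ) * ρ *
      (Matrix.kronecker (M i) (1 : Matrix ε ε ℂ))ᴴ := by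
    ext p q
    simp only [QHom.withEnv, Matrix.of_apply, hM, Matrix.sum_apply]
    refine Finset.sum_congr rfl fun i _ => ?_
    simp only [Matrix.mul_apply, Matrix.conjTranspose_apply, Matrix.kronecker,
      Matrix.kroneckerMap_apply, Fintype.sum_prod_type, Matrix.one_apply, Finset.sum_mul, Matrix.of_apply, mul_ite, ite_mul,
      mul_one, mul_zero, zero_mul, Finset.sum_ite_eq, Finset.mem_univ, if_true, apply_ite star,
      star_zero]
  rw [this]
  exact Matrix.posSemidef_sum _ fun i _ => hρ.mul_mul_conjTranspose_same _

theorem trace_withEnv {Φ : Op α → Op β} (h : ∀ ρ, (Φ ρ).trace = ρ.trace) {ε : Type} [Fintype ε]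
    (ρ : Op (α × ε)) : (withEnv ε Φ ρ).trace = ρ.trace := by
  simp only [Matrix.trace, Fintype.sum_prod_type, Matrix.diag] at *
  rw [Finset.sum_comm, Finset.sum_comm (γ := α)]
  refine Finset.sum_congr rfl fun e _ => ?_
  exact h (Matrix.of fun a a' => ρ (a, e) (a', e))

/-- `A† A` is `A²`, whose characteristic polynomial has the squared eigenvalues of `A` as its roots.
Comparing multisets of roots avoids matching the two enumerations of eigenvalues. -/
theorem traceNorm_eq [DecidableEq α] {A : Op α} (hA : A.IsHermitian) : traceNorm A = ∑ i, |hA.eigenvalues i| := by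
  set hB := Matrix.isHermitian_conjTranspose_mul_self A
  have h1 : (Aᴴ * A).charpoly =
      ∏ i, (Polynomial.X - Polynomial.C (((hA.eigenvalues i) ^ 2 : ℝ) : ℂ)) := by
    rw [hA.eq]
    have h := congrArg (fun A => A * A) hA.spectral_theorem
    beta_reduce at h
    rw [h, ← map_mul, Unitary.conjStarAlgAut_apply, Matrix.charpoly_mul_comm, ← mul_assoc]
    simp [Matrix.charpoly_diagonal, pow_two]
  have h2 := hB.roots_charpoly_eq_eigenvalues
  rw [h1, Polynomial.roots_prod _ _ (Finset.prod_ne_zero_iff.2 fun i _ =>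
    Polynomial.X_sub_C_ne_zero _)] at h2
  simp only [Polynomial.roots_X_sub_C, Multiset.bind_singleton] at h2
  have h3 := congrArg (fun s => (s.map fun z : ℂ => Real.sqrt z.re).sum) h2
  simp only [Multiset.map_map, Function.comp_def, Complex.ofReal_re, Real.sqrt_sq_eq_abs] at h3
  exact h3.symm

/-- In an orthonormal eigenbasis of `P - N`, each eigenvalue is a difference of two nonnegative
diagonal entries, so its absolute value is at most their sum. The sums are the traces. -/
theorem traceNorm_sub_le [DecidableEq α] {P N : Op α} (hP : P.PosSemidef) (hN : N.PosSemidef) :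
    traceNorm (P - N) ≤ P.trace.re + N.trace.re := by
  have hA : (P - N).IsHermitian := hP.1.sub hN.1
  rw [traceNorm_eq hA]
  set U : Op α := hA.eigenvectorUnitary.1
  have hU : U * Uᴴ = 1 := (Matrix.mem_unitaryGroup_iff).1 hA.eigenvectorUnitary.2
  -- The trace may be computed in the eigenbasis, by cyclicity and unitarity of the change of basis.
  have key : ∀ M : Op α, M.trace = ∑ i, star (⇑(hA.eigenvectorBasis i)) ⬝ᵥ
      (M *ᵥ ⇑(hA.eigenvectorBasis i)) := by
    intro M
    have : M.trace = (Uᴴ * (M * U)).trace := by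
      rw [Matrix.trace_mul_comm, Matrix.mul_assoc, hU, Matrix.mul_one]
    rw [this]
    rfl
  rw [key P, key N, Complex.re_sum, Complex.re_sum, ← Finset.sum_add_distrib]
  refine Finset.sum_le_sum fun i _ => ?_
  have h1 := (Complex.le_def.1 (hP.dotProduct_mulVec_nonneg ⇑(hA.eigenvectorBasis i))).1
  have h2 := (Complex.le_def.1 (hN.dotProduct_mulVec_nonneg ⇑(hA.eigenvectorBasis i))).1
  rw [hA.eigenvalues_eq, Matrix.sub_mulVec, dotProduct_sub]
  simp only [Complex.zero_re, map_sub, RCLike.re_to_complex] at *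
  rw [abs_le]
  constructor <;> linarith

/-! ### Circuits -/

theorem hasKraus_gate {w : ℕ} (g : QGate w) : HasKraus fun ρ => g.apply ρ := by
  have hone : ∀ U : Op (Bits w), HasKraus fun ρ => U * ρ * Uᴴ := fun U =>
    ⟨Unit, inferInstance, fun _ => U, fun ρ => by simp⟩
  cases g with
  | meas i =>
    refine ⟨Bool, inferInstance, fun b => Matrix.diagonal fun x => if x i = b then 1 else 0,
      fun ρ => ?_⟩
    ext x y
    simp only [QGate.apply, Matrix.of_apply, Matrix.sum_apply, Matrix.diagonal_conjTranspose,
      Matrix.mul_diagonal, Matrix.diagonal_mul, Fintype.sum_bool, Pi.star_apply]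
    cases x i <;> cases y i <;> simp
  | _ => exact hone _

theorem hasKraus_foldl {w : ℕ} (gs : List (QGate w)) :
    HasKraus fun ρ => gs.foldl (fun σ g => g.apply σ) ρ := by
  induction gs with
  | nil => exact ⟨Unit, inferInstance, fun _ => 1, fun ρ => by simp⟩
  | cons g gs ih => exact ih.comp (hasKraus_gate g)

/-- Preparation of fresh wires is conjugation by an isometry, gates are unitary or, for
measurements, given by two projections, and discarding wires has one Kraus operator for every value
of the discarded wires. -/
theorem QCircuit.hasKraus {n m : ℕ} (C : QCircuit n m) : HasKraus C.chan := by
  classical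
  have h1 : HasKraus fun ρ : Op (Bits n) =>
      tensor ρ (ketbra fun _ : Fin C.fresh => false) := by
    refine ⟨Unit, inferInstance, fun _ => Matrix.of fun u x =>
      if u = Fin.append x fun _ => false then 1 else 0, fun ρ => ?_⟩
    ext u v
    rw [← append_take_drop u, ← append_take_drop v]
    simp only [tensor, ketbra, Matrix.of_apply, takeBits_append, dropBits_append,
      Matrix.single_apply, Finset.univ_unique, Finset.sum_singleton, Matrix.mul_apply,
      Matrix.conjTranspose_apply, append_eq_append_iff]
    by_cases hu : dropBits u = fun _ => false <;> by_cases hv : dropBits v = fun _ => false <;>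
      simp [hu, hv, eq_comm (a := fun _ : Fin C.fresh => false)]
  have h2 : HasKraus fun σ : Op (Bits (n + C.fresh)) => (Matrix.of fun a b => ∑ x, ∑ y,
      if (∀ k, x (C.out k) = a k) ∧ (∀ k, y (C.out k) = b k) ∧
      (∀ j, (∀ k, C.out k ≠ j) → x j = y j) then σ x y else 0 : Op (Bits m)) := by
    -- Values of the discarded wires, represented by strings that are `0` on the output wires.
    refine ⟨{z : Bits (n + C.fresh) // ∀ k, z (C.out k) = false}, inferInstance, fun z =>
      Matrix.of fun a x => if (∀ k, x (C.out k) = a k) ∧ (∀ j, (∀ k, C.out k ≠ j) → x j = z.1 j)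
        then 1 else 0, fun σ => ?_⟩
    ext a b
    have hs : ∀ x : Bits (n + C.fresh), ∃ z₀ : {z : Bits (n + C.fresh) // ∀ k, z (C.out k) = false},
        ∀ z : {z : Bits (n + C.fresh) // ∀ k, z (C.out k) = false},
          (∀ j, (∀ k, C.out k ≠ j) → x j = z.1 j) ↔ z₀ = z := by
      intro x
      refine ⟨⟨fun j => if ∀ k, C.out k ≠ j then x j else false, fun k => by simp⟩, fun z => ?_⟩
      rw [Subtype.ext_iff, funext_iff]
      refine forall_congr' fun j => ?_
      by_cases hj : ∀ k, C.out k ≠ j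
      · simp [hj]
      · have : z.1 j = false := by
          push Not at hj
          obtain ⟨k, rfl⟩ := hj
          exact z.2 k
        simp only [hj, false_imp_iff, if_false, this]
    choose f hf using hs
    have hff : ∀ x y, (∀ j, (∀ k, C.out k ≠ j) → x j = y j) ↔ f y = f x := by
      intro x y
      rw [← hf]
      have h := (hf x (f x)).2 rfl
      exact forall_congr' fun j => imp_congr_right fun hj => by rw [← h j hj, eq_comm]
    simp only [Matrix.of_apply, Matrix.sum_apply, Matrix.mul_apply, Matrix.conjTranspose_apply,
      Finset.sum_mul, hf]
    rw [Finset.sum_comm (s := (Finset.univ : Finset {z : Bits (n + C.fresh) // _}))]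
    rw [Finset.sum_comm]
    refine Finset.sum_congr rfl fun y _ => ?_
    rw [Finset.sum_comm (s := (Finset.univ : Finset {z : Bits (n + C.fresh) // _}))]
    refine Finset.sum_congr rfl fun x _ => ?_
    rw [Finset.sum_eq_single (f x)]
    · simp only [hff]
      by_cases h1 : ∀ k, x (C.out k) = a k <;> by_cases h2 : ∀ k, y (C.out k) = b k <;>
        simp [h1, h2]
    · intro z _ hz
      simp [Ne.symm hz]
    · simp
  exact (h2.comp (hasKraus_foldl C.gates)).comp h1

/-! ### Pauli operators -/

/-- Conjugation by Pauli operators: `X ^ t k 0 * Z ^ t k 1` on the qubit `k`. -/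
def pauliOp {m : ℕ} (t : Fin m → Bits 2) (ρ : Op (Bits m)) : Op (Bits m) :=
  Matrix.of fun b b' => (∏ k, sg (t k 1 && xor (b k) (b' k))) *
    ρ (fun k => xor (b k) (t k 0)) (fun k => xor (b' k) (t k 0))

@[simp] theorem pauliOp_zero {m : ℕ} (ρ : Op (Bits m)) : pauliOp (fun _ _ => false) ρ = ρ := by
  ext b b'; simp [pauliOp]

theorem trace_pauliOp {m : ℕ} (t : Fin m → Bits 2) (ρ : Op (Bits m)) :
    (pauliOp t ρ).trace = ρ.trace := by
  have hinv : Function.Involutive fun (b : Bits m) k => xor (b k) (t k 0) := fun b => by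
    funext k; simp
  simp only [Matrix.trace, Matrix.diag, pauliOp, Matrix.of_apply, Bool.xor_self, Bool.and_false,
    sg_false, Finset.prod_const_one, one_mul]
  exact hinv.bijective.sum_comp fun b => ρ b b

theorem hasKraus_pauliOp {m : ℕ} (t : Fin m → Bits 2) : HasKraus (pauliOp t) := by
  refine ⟨Unit, inferInstance, fun _ => Matrix.of fun b x =>
    if (fun k => xor (b k) (t k 0)) = x then ∏ k, sg (t k 1 && b k) else 0, fun ρ => ?_⟩
  ext b b'
  have hsg : ∀ b, star (sg b) = sg b := fun b => by cases b <;> simp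
  simp only [pauliOp, Matrix.of_apply, Finset.univ_unique, Finset.sum_singleton, Matrix.mul_apply,
    Matrix.conjTranspose_apply, apply_ite star, star_zero, star_prod, hsg, ite_mul, zero_mul,
    mul_ite, mul_zero, Finset.sum_ite_eq, Finset.mem_univ, if_true]
  rw [mul_right_comm, ← Finset.prod_mul_distrib]
  congr 1
  refine Finset.prod_congr rfl fun k _ => ?_
  cases t k 1 <;> cases b k <;> cases b' k <;> simp

/-- In the difference, the terms with trivial Pauli operator cancel against the same share of `T •
C.chan`. What remains is a difference of two positive operators whose traces are both the
probability of a nontrivial operator, whence the factor `2`. -/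
theorem traceNorm_mixture {Ω : Type} [Fintype Ω] {n m d : ℕ} {q : Ω → ℝ} (hq : ∀ ω, 0 ≤ q ω)
    {t : Ω → Fin m → Bits 2} {Φ : Op (Bits n) → Op (Bits m)} (C : QCircuit n m)
    (hΦ : ∀ ρ, Φ ρ = ∑ ω, (q ω : ℂ) • pauliOp (t ω) (C.chan ρ)) {T : ℂ} (hT : T = ∑ ω, (q ω : ℂ))
    {ρ : Op (Bits n × Fin d)} (hρ : IsDensity ρ) :
    traceNorm (withEnv (Fin d) Φ ρ - T • withEnv (Fin d) C.chan ρ) ≤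
      2 * ∑ ω, if t ω = fun _ _ => false then 0 else q ω := by
  classical
  set σ := withEnv (Fin d) C.chan ρ
  set τ : Ω → Op (Bits m × Fin d) := fun ω =>
    withEnv (Fin d) (fun ρ => pauliOp (t ω) (C.chan ρ)) ρ
  have hσ : σ.PosSemidef := C.hasKraus.withEnv _ hρ.1
  have hτ : ∀ ω, (τ ω).PosSemidef := fun ω =>
    ((hasKraus_pauliOp (t ω)).comp C.hasKraus).withEnv _ hρ.1
  have hσt : σ.trace = 1 := (trace_withEnv C.trace_chan ρ).trans hρ.2
  have hτt : ∀ ω, (τ ω).trace = 1 := fun ω =>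
    (trace_withEnv (fun ρ => (trace_pauliOp _ _).trans (C.trace_chan ρ)) ρ).trans hρ.2
  set r : Ω → ℝ := fun ω => if t ω = fun _ _ => false then 0 else q ω
  have hr : ∀ ω, 0 ≤ r ω := fun ω => by
    simp only [r]; split_ifs <;> simp [hq]
  -- `r` keeps only the weights of the nontrivial Pauli operators.
  have hE : withEnv (Fin d) Φ ρ - T • σ = ∑ ω, (r ω : ℂ) • τ ω - ∑ ω, (r ω : ℂ) • σ := by
    have h1 : withEnv (Fin d) Φ ρ = ∑ ω, (q ω : ℂ) • τ ω := by
      ext x y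
      simp only [withEnv, Matrix.of_apply, hΦ, Matrix.sum_apply, Matrix.smul_apply, τ]
    rw [h1, hT, Finset.sum_smul, ← Finset.sum_sub_distrib, ← Finset.sum_sub_distrib]
    refine Finset.sum_congr rfl fun ω _ => ?_
    simp only [r]
    split_ifs with h
    · have : τ ω = σ := by
        simp only [τ, h, pauliOp_zero]
        rfl
      simp [this]
    · rfl
  have hsmul : ∀ (x : ℝ) (A : Op (Bits m × Fin d)), 0 ≤ x → A.PosSemidef →
      ((x : ℂ) • A).PosSemidef := fun x A hx hA => hA.smul (by exact_mod_cast hx)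
  rw [hE]
  refine (traceNorm_sub_le (Matrix.posSemidef_sum _ fun ω _ => hsmul _ _ (hr ω) (hτ ω))
    (Matrix.posSemidef_sum _ fun ω _ => hsmul _ _ (hr ω) hσ)).trans_eq ?_
  simp only [Matrix.trace_sum, Matrix.trace_smul, hτt, hσt, smul_eq_mul, mul_one, Complex.re_sum,
    Complex.ofReal_re]
  ring

end LinearAlgebra

/-! ## Evaluation -/

/-- The functional `K` on the reduced state of the wires `out`. -/
def obsK {m : ℕ} (out : Fin m → ℕ) (K : Bits m → Bits m → ℂ) : Mem → Mem → ℂ := fun u v =>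
  ∑ p : Bits m × Bits m, K p.1 p.2 * obs out p.1 p.2 u v

open Classical in
theorem obsK_apply {m : ℕ} (out : Fin m → ℕ) (K : Bits m → Bits m → ℂ) (u v : Mem) :
    obsK out K u v = if ∀ j, (∀ k, out k ≠ j) → u j = v j then K (u ∘ out) (v ∘ out) else 0 :=
  sum_obs_mul out K u v

theorem tracedOn_obsK {m : ℕ} (out : Fin m → ℕ) (K : Bits m → Bits m → ℂ) :
    TracedOn (Set.range out)ᶜ (obsK out K) := fun u v u' v' h =>
  Finset.sum_congr rfl fun p _ => by rw [tracedOn_obs out p.1 p.2 u v u' v' h]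

theorem heisL_obsK {m : ℕ} (gs : List RGate) (out : Fin m → ℕ) (K : Bits m → Bits m → ℂ)
    (u v : Mem) :
    heisL gs (obsK out K) u v = ∑ a, ∑ b, K a b * heisL gs (obs out a b) u v := by
  rw [← Fintype.sum_prod_type']
  exact heisL_sum Finset.univ gs (fun p : Bits m × Bits m => K p.1 p.2)
    (fun p => obs out p.1 p.2) u v

/-- The linear form on the keys before a list of gates whose value is the key `tg` after it. -/
def formVec (gs : List RGate) (tg : ℕ) : Mem :=
  (gs.flatMap keyPairs).reverse.foldl (fun s ab => cx ab.2 ab.1 s)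
    (Function.update (fun _ => false) tg true)

theorem heisL_cnots (L : List (ℕ × ℕ)) (F : Mem → Mem → ℂ) (u v : Mem) :
    heisL (L.map fun ab => RGate.cnot ab.2 ab.1) F u v =
      F (L.foldl (fun s ab => cx ab.2 ab.1 s) u) (L.foldl (fun s ab => cx ab.2 ab.1 s) v) := by
  induction L generalizing u v with
  | nil => rfl
  | cons p L ih => rw [List.map_cons, heisL_cons, heis_cnot]; exact ih _ _

theorem heisL_form {o tg : ℕ} (gs : List RGate) (F : Mem → Mem → ℂ) (u v : Mem)
    (hu : ∀ i, o ≤ i → u i = false) (hv : ∀ i, o ≤ i → v i = false) :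
    heisL (.one .X (o + tg) :: formGates o gs) F u v =
      F (Function.extend (o + ·) (formVec gs tg) u) (Function.extend (o + ·) (formVec gs tg) v) := by
  have hφ : Function.Injective (o + · : ℕ → ℕ) := fun i j h => Nat.add_left_cancel h
  have e : RGate.one .X (o + tg) :: formGates o gs = (RGate.one .X tg ::
      (gs.flatMap keyPairs).reverse.map fun ab => RGate.cnot ab.2 ab.1).map (RGate.map (o + ·)) := by
    simp only [formGates, List.map_cons, List.map_map]
    rfl
  have h0 : ∀ u : Mem, (∀ i, o ≤ i → u i = false) → u ∘ (o + ·) = fun _ => false := fun u hu =>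
    funext fun i => hu _ (Nat.le_add_right _ _)
  rw [e, heisL_map hφ, heisL_cons, heis_X, heisL_cnots, h0 u hu, h0 v hv]
  rfl

theorem formVec_of_le {w : ℕ} {gs : List RGate} (hg : GoodOn (Set.Iio w) gs) {tg : ℕ}
    (ht : tg < 2 * w) {i : ℕ} (hi : 2 * w ≤ i) : formVec gs tg i = false := by
  have : ∀ (L : List (ℕ × ℕ)) (s : Mem), (∀ ab ∈ L, ab.1 < 2 * w) → s i = false →
      L.foldl (fun s ab => cx ab.2 ab.1 s) s i = false := by
    intro L
    induction L with
    | nil => exact fun s _ h => h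
    | cons p L ih =>
      intro s hL hs
      refine ih _ (fun ab hab => hL ab (by simp [hab])) ?_
      have := hL p (by simp)
      exact (Function.update_of_ne (by omega) _ _).trans hs
  refine this _ _ (fun ab hab => ?_) ?_
  · obtain ⟨g, hgs, hab⟩ := List.mem_flatMap.1 (List.mem_reverse.1 hab)
    exact (keyPairs_lt (hg g hgs) ab hab).1
  · rw [Function.update_of_ne (by omega)]

theorem dot_single {l : ℕ} {tg : ℕ} (ht : tg < l) (k : Mem) :
    dot l (Function.update (fun _ => false) tg true) k = k tg := by
  rw [dot_comm, dot_update_right _ _ ht]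
  have : ∀ l, dot l k (fun _ => false) = false := fun l => by
    induction l with
    | zero => rfl
    | succ l ih => simp [dot, ih]
  simp [this]

/-- The coefficients obtained by pulling back a unit vector express one transported key by the
original keys. This is what the homomorphic inner product computes. -/
theorem dot_formVec {w : ℕ} {gs : List RGate} (hg : GoodOn (Set.Iio w) gs) {tg : ℕ}
    (ht : tg < 2 * w) (k : Mem) :
    dot (2 * w) (formVec gs tg) k = transport (gs.flatMap keyPairs) k tg := by
  rw [formVec, ← dot_transport, dot_single ht]
  intro ab hab
  obtain ⟨g, hgs, hab⟩ := List.mem_flatMap.1 hab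
  exact ⟨(keyPairs_lt (hg g hgs) ab hab).1, (keyPairs_lt (hg g hgs) ab hab).2.1⟩

/-- The memory after the preparation of `J` linear forms of length `w` from wire `o` on. -/
def formsMem (o w : ℕ) (f : ℕ → Mem) (J : ℕ) (u : Mem) : Mem := fun i =>
  if o ≤ i ∧ i < o + J * w then f ((i - o) / w) ((i - o) % w) else u i

theorem formsMem_add {o w J j i : ℕ} (hj : j < J) (hi : i < w) (f : ℕ → Mem) (u : Mem) :
    formsMem o w f J u (o + (j * w + i)) = f j i := by
  have h := block_lt hj hi
  have hw : 0 < w := by omega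
  rw [formsMem, if_pos ⟨by omega, by omega⟩, Nat.add_sub_cancel_left, Nat.mul_comm,
    Nat.mul_add_div hw, Nat.mul_add_mod, Nat.div_eq_of_lt hi, Nat.mod_eq_of_lt hi, Nat.add_zero]

theorem formsMem_of_lt {o w J i : ℕ} (hi : i < o) (f : ℕ → Mem) (u : Mem) :
    formsMem o w f J u i = u i := if_neg (by omega)

theorem formsMem_of_le {o w J i : ℕ} (hi : o + J * w ≤ i) (f : ℕ → Mem) (u : Mem) :
    formsMem o w f J u i = u i := if_neg (by omega)

/-- The forms are written deterministically to disjoint zero blocks and do not depend on the memory,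
so both sides of a matrix unit receive the same bits. -/
theorem heisL_forms {o w : ℕ} (J : ℕ) {gs : List RGate} (hg : GoodOn (Set.Iio w) gs) (tg : ℕ → ℕ)
    (ht : ∀ j < J, tg j < 2 * w) (F : Mem → Mem → ℂ) (u v : Mem)
    (hu : ∀ i, o ≤ i → u i = false) (hv : ∀ i, o ≤ i → v i = false) :
    heisL ((List.range J).flatMap fun j =>
      .one .X (o + j * (2 * w) + tg j) :: formGates (o + j * (2 * w)) gs) F u v =
      F (formsMem o (2 * w) (fun j => formVec gs (tg j)) J u)
        (formsMem o (2 * w) (fun j => formVec gs (tg j)) J v) := by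
  induction J generalizing F with
  | zero =>
    have : ∀ u, formsMem o (2 * w) (fun j => formVec gs (tg j)) 0 u = u := fun u => by
      funext i; exact if_neg (by omega)
    simp [this]
  | succ J ih =>
    have h0 : ∀ u : Mem, (∀ i, o ≤ i → u i = false) → ∀ i, o + J * (2 * w) ≤ i →
        formsMem o (2 * w) (fun j => formVec gs (tg j)) J u i = false := fun u hu i hi => by
      rw [formsMem_of_le hi]; exact hu i (by omega)
    have h1 : ∀ u : Mem, (∀ i, o ≤ i → u i = false) →
        Function.extend (o + J * (2 * w) + ·) (formVec gs (tg J))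
          (formsMem o (2 * w) (fun j => formVec gs (tg j)) J u) =
        formsMem o (2 * w) (fun j => formVec gs (tg j)) (J + 1) u := by
      intro u hu
      have hs : (J + 1) * (2 * w) = J * (2 * w) + 2 * w := Nat.succ_mul _ _
      have hφ : Function.Injective (o + J * (2 * w) + · : ℕ → ℕ) := fun i j h =>
        Nat.add_left_cancel h
      funext i
      rcases lt_or_ge i (o + J * (2 * w)) with hi | hi
      · rw [Function.extend_apply' _ _ _ (by rintro ⟨k, hk⟩; omega)]
        rcases lt_or_ge i o with hio | hio
        · rw [formsMem_of_lt hio, formsMem_of_lt hio]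
        · rw [formsMem, formsMem, if_pos ⟨hio, hi⟩, if_pos ⟨hio, by omega⟩]
      · obtain ⟨r, rfl⟩ := Nat.exists_eq_add_of_le hi
        rw [hφ.extend_apply]
        rcases lt_or_ge r (2 * w) with hr | hr
        · rw [Nat.add_assoc, formsMem_add (by omega) hr]
        · rw [formsMem_of_le (by omega), formVec_of_le hg (ht J (by omega)) hr]
          exact (hu _ (by omega)).symm
    rw [List.range_succ, List.flatMap_append, heisL_append, ih (fun j hj => ht j (by omega)),
      List.flatMap_cons, List.flatMap_nil, List.append_nil, heisL_form _ _ _ _ (h0 u hu) (h0 v hv),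
      h1 u hu, h1 v hv]

/-- A family indexed by `2 * n` numbers from a family of pairs. -/
def pairs {n : ℕ} {β : Type} (f : Fin n → Fin 2 → β) : Fin (2 * n) → β := fun i =>
  f ⟨i / 2, by omega⟩ ⟨i % 2, by omega⟩

/-- The inverse of `pairs`. -/
def unpairs {n : ℕ} {β : Type} (f : Fin (2 * n) → β) : Fin n → Fin 2 → β := fun i j =>
  f ⟨2 * i + j, by omega⟩

theorem pairs_unpairs {n : ℕ} {β : Type} (f : Fin (2 * n) → β) : pairs (unpairs f) = f := by
  funext i
  simp only [pairs, unpairs]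
  congr 1
  ext
  simp only
  omega

theorem unpairs_pairs {n : ℕ} {β : Type} (f : Fin n → Fin 2 → β) : unpairs (pairs f) = f := by
  funext i j
  simp only [pairs, unpairs]
  congr 1
  · ext; simp only; omega
  · ext; simp only; omega

section Eval

variable (E : ClassicalHE) (κ : ℕ) {n m : ℕ} (C : QCircuit n m)

/-- The selector for the key that the `j`-th evaluation computes. -/
def evalForm (j : ℕ) : Mem := formVec C.rawGates ((evalArgs E κ C).target j)

/-- The classical part of the input of the evaluation circuit is on its wires. -/
def HoldsInput (pk : Bits (E.pkLen κ)) (e : Bits (E.evkLen κ))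
    (y : Fin n → Fin 2 → Bits (E.ctLen κ)) (u : Mem) : Prop :=
  (∀ i, u i.1 = Fin.append pk e i) ∧ ∀ (i : Fin n) (r : Fin (2 * E.ctLen κ)),
    u (E.pkLen κ + E.evkLen κ + i * (1 + 2 * E.ctLen κ) + 1 + r) = flat (y i) r

/-- The classical part of evaluation reads only wires that agree in `u` and `v`, so it produces
common random values: encryptions `ys` of the coefficients and evaluated ciphertexts `z`. The
quantum wires are spectators and may differ between `u` and `v`. -/
theorem heisL_evalTail {pk : Bits (E.pkLen κ)} {e : Bits (E.evkLen κ)}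
    {y : Fin n → Fin 2 → Bits (E.ctLen κ)} {u v : Mem} (hu : HoldsInput E κ pk e y u)
    (hv : HoldsInput E κ pk e y v) (hu0 : ∀ i, (evalArgs E κ C).S ≤ i → u i = false)
    (hv0 : ∀ i, (evalArgs E κ C).S ≤ i → v i = false) (F : Mem → Mem → ℂ)
    (hF1 : TracedOn (Set.Ico (evalArgs E κ C).W1 (evalArgs E κ C).O2) F)
    (hF2 : TracedOn (Set.Ico (evalArgs E κ C).W2 (evalArgs E κ C).total) F) :
    heisL ((evalArgs E κ C).formsGates ++
      (callsGates (evalArgs E κ C).Re (evalArgs E κ C).J1 (evalArgs E κ C).src1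
        (evalArgs E κ C).O1 (evalArgs E κ C).W1 ++
      callsGates (evalArgs E κ C).Rv (2 * (evalArgs E κ C).m) (evalArgs E κ C).src2
        (evalArgs E κ C).O2 (evalArgs E κ C).W2)) F u v =
      ∑ ys : Fin (2 * m) → Fin (2 * n) → Bits (E.ctLen κ),
        (∏ j : Fin (2 * m), ∏ i : Fin (2 * n),
          (E.encProb κ pk (evalForm E κ C j i) (ys j i) : ℂ)) *
        ∑ z : Fin (2 * m) → Bits (ipLen E κ n),
          (∏ j, (E.evalProb κ (ipCircuit (2 * n)) e (Fin.append (pairs y) (ys j)) (z j) : ℂ)) *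
          F (wrL (wrL (formsMem (evalArgs E κ C).S (evalArgs E κ C).w2 (evalForm E κ C) (2 * m) u)
              (evalArgs E κ C).O1 (List.ofFn (flat fun a => ys a.divNat a.modNat)))
              (evalArgs E κ C).O2 (List.ofFn (flat z)))
            (wrL (wrL (formsMem (evalArgs E κ C).S (evalArgs E κ C).w2 (evalForm E κ C) (2 * m) v)
              (evalArgs E κ C).O1 (List.ofFn (flat fun a => ys a.divNat a.modNat)))
              (evalArgs E κ C).O2 (List.ofFn (flat z))) := by
  obtain ⟨o1, o2, o3, o4, o5, o6⟩ := evalArgs_order E κ C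
  have eS : E.pkLen κ + E.evkLen κ + n * (1 + 2 * E.ctLen κ) ≤ (evalArgs E κ C).S := o1
  have eO1 := evalArgs_O1 E κ C
  have eW1 := evalArgs_W1 E κ C
  have eO2 := evalArgs_O2 E κ C
  have eW2 := evalArgs_W2 E κ C
  have ef : (evalArgs E κ C).formsGates = (List.range (2 * m)).flatMap fun j =>
      .one .X ((evalArgs E κ C).S + j * (2 * (n + C.fresh)) + (evalArgs E κ C).target j) ::
        formGates ((evalArgs E κ C).S + j * (2 * (n + C.fresh))) C.rawGates := by
    rw [EvalArgs.formsGates, evalArgs_m]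
    rfl
  rw [heisL_append, ef, heisL_forms (2 * m) C.goodOn (evalArgs E κ C).target
    (fun j hj => evalArgs_target_lt E κ C hj) _ _ _ hu0 hv0]
  set f := formsMem (evalArgs E κ C).S (2 * (n + C.fresh))
    (fun j => formVec C.rawGates ((evalArgs E κ C).target j)) (2 * m)
  have hf0 : ∀ u : Mem, (∀ i, (evalArgs E κ C).S ≤ i → u i = false) →
      ∀ i, (evalArgs E κ C).O1 ≤ i → f u i = false := by
    intro u hu i hi
    simp only [f]
    rw [formsMem_of_le (by rw [eO1] at hi; exact hi)]
    exact hu i (o2.trans hi)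
  have hf1 : ∀ u : Mem, HoldsInput E κ pk e y u → ∀ (a : Fin (2 * m * (2 * n)))
      (i : Fin (E.pkLen κ + 1)), f u ((evalArgs E κ C).src1 a i) =
        Fin.append pk (fun _ : Fin 1 => evalForm E κ C a.divNat a.modNat) i := by
    intro u hu a i
    induction i using Fin.addCases with
    | left i =>
      have hi := i.2
      rw [EvalArgs.src1, if_pos (by exact hi), Fin.append_left]
      simp only [f]
      rw [Fin.val_castAdd, formsMem_of_lt (by omega), ← Fin.append_left pk e i]
      exact hu.1 (Fin.castAdd _ i)
    | right i =>
      rw [EvalArgs.src1, if_neg (by simp), Fin.append_right]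
      refine formsMem_add a.divNat.2 ?_ _ _
      have := a.modNat.2
      rw [Fin.coe_modNat] at this
      rw [evalArgs_n]
      omega
  rw [heisL_append, evalArgs_J1, evalArgs_Re, heisL_calls (E.enc κ) (2 * m * (2 * n))
    (fun a => Fin.append pk fun _ => evalForm E κ C a.divNat a.modNat) _ _ _
    (fun j hj i hi => evalArgs_src1_lt E κ C (by rwa [evalArgs_J1])) eW1.ge (hf1 u hu) (hf1 v hv)
    (hf0 u hu0) (hf0 v hv0) (by
      rw [← eO2]
      -- The evaluations that follow avoid the work wires of the encryptions, so these are still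
      -- traced out.
      refine hF1.heisL fun g hg => ?_
      refine (goodOn_calls (S := (Set.Ico (evalArgs E κ C).W1 (evalArgs E κ C).O2)ᶜ)
        (E.eval κ (ipCircuit (2 * n))) (2 * m) (src := (evalArgs E κ C).src2)
        (oOut := (evalArgs E κ C).O2) (oWork := (evalArgs E κ C).W2) ?_ eW2.ge ?_ ?_ ?_ g
        (by rw [evalArgs_m] at hg; exact hg)).1
      · intro j hj i hi
        rcases evalArgs_src2_lt E κ C hj hi with h | h <;> omega
      · intro j hj i hi
        simp only [Set.mem_compl_iff, Set.mem_Ico]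
        rcases evalArgs_src2_lt E κ C hj hi with h | h <;> omega
      · intro i hi
        have := hi.1
        simp only [Set.mem_compl_iff, Set.mem_Ico]
        omega
      · intro i hi
        have := hi.1
        simp only [Set.mem_compl_iff, Set.mem_Ico]
        omega)]
  -- The encryptions are numbered consecutively on the wires and indexed by form and coefficient in
  -- the statement.
  let eY : (Fin (2 * m * (2 * n)) → Bits (E.ctLen κ)) ≃
      (Fin (2 * m) → Fin (2 * n) → Bits (E.ctLen κ)) :=
    (Equiv.arrowCongr finProdFinEquiv.symm (Equiv.refl _)).trans (Equiv.curry _ _ _)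
  refine Fintype.sum_equiv eY _ _ fun ys => ?_
  have hys : (fun a : Fin (2 * m * (2 * n)) => eY ys a.divNat a.modNat) = ys := by
    funext a
    exact congrArg ys (finProdFinEquiv.apply_symm_apply a)
  have hys2 : ∀ j i, eY ys j i = ys (finProdFinEquiv (j, i)) := fun j i => rfl
  rw [hys]
  congr 1
  · rw [← finProdFinEquiv.prod_comp, Fintype.prod_prod_type]
    refine Finset.prod_congr rfl fun j _ => Finset.prod_congr rfl fun i _ => ?_
    have h := finProdFinEquiv.symm_apply_apply (j, i)
    have h1 : (finProdFinEquiv (j, i)).divNat = j := congrArg Prod.fst h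
    have h2 : (finProdFinEquiv (j, i)).modNat = i := congrArg Prod.snd h
    rw [h1, h2]
    rfl
  set g : Mem → Mem := fun u => wrL (f u) (evalArgs E κ C).O1 (List.ofFn (flat ys))
  have hg0 : ∀ u : Mem, (∀ i, (evalArgs E κ C).S ≤ i → u i = false) →
      ∀ i, (evalArgs E κ C).O2 ≤ i → g u i = false := by
    intro u hu i hi
    simp only [g]
    rw [wrL_ofFn_of_le _ _ _ (by rw [← eW1]; omega)]
    exact hf0 u hu i (by omega)
  have hgl : ∀ u : Mem, ∀ i, i < (evalArgs E κ C).S → g u i = u i := by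
    intro u i hi
    simp only [g]
    rw [wrL_of_lt _ _ (by omega)]
    exact formsMem_of_lt hi _ _
  have hg1 : ∀ u : Mem, HoldsInput E κ pk e y u → ∀ (j : Fin (2 * m))
      (i : Fin (E.evkLen κ + (2 * n + 2 * n) * E.ctLen κ)), g u ((evalArgs E κ C).src2 j i) =
        Fin.append e (flat (Fin.append (pairs y) (eY ys j))) i := by
    intro u hu j i
    induction i using Fin.addCases with
    | left i =>
      have hi := i.2
      rw [EvalArgs.src2, if_pos (by exact hi), Fin.append_left, evalArgs_p, Fin.val_castAdd,
        hgl _ _ (by omega), ← Fin.append_right pk e i]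
      exact hu.1 (Fin.natAdd _ i)
    | right i =>
      obtain ⟨⟨k, r⟩, rfl⟩ := finProdFinEquiv.surjective i
      have hr := r.2
      rw [Fin.append_right]
      have hflat : flat (Fin.append (pairs y) (eY ys j)) (finProdFinEquiv (k, r)) =
          Fin.append (pairs y) (eY ys j) k r := by
        simp only [flat, Equiv.symm_apply_apply]
      rw [hflat]
      have hval : ((Fin.natAdd (E.evkLen κ) (finProdFinEquiv (k, r)) : Fin _) : ℕ) - E.evkLen κ =
          r + E.ctLen κ * k := by
        rw [Fin.val_natAdd, Nat.add_sub_cancel_left, finProdFinEquiv_apply_val]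
      have hval2 : ¬ ((Fin.natAdd (E.evkLen κ) (finProdFinEquiv (k, r)) : Fin _) : ℕ) <
          E.evkLen κ := by
        rw [Fin.val_natAdd]; omega
      induction k using Fin.addCases with
      | left k =>
        have hk := k.2
        rw [Fin.append_left]
        rw [Fin.val_castAdd] at hval
        have hlt : (r : ℕ) + E.ctLen κ * k < 2 * n * E.ctLen κ := by
          have := block_lt hk hr
          rw [Nat.mul_comm (E.ctLen κ)]
          omega
        obtain ⟨h1, h2, h3⟩ := evalArgs_src2_input E κ C (j := j) hval2 (by rw [hval]; exact hlt)
        rw [h1, hval]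
        have hs : (r : ℕ) + E.ctLen κ * (k % 2) < 2 * E.ctLen κ := by
          have := block_lt (Nat.mod_lt k.1 (by omega : 2 > 0)) hr
          rw [Nat.mul_comm (E.ctLen κ)]
          omega
        -- Ciphertext number `k` is the ciphertext `k % 2` of the input register `k / 2`.
        have hdm : (r : ℕ) + E.ctLen κ * k =
            (r + E.ctLen κ * (k % 2)) + 2 * E.ctLen κ * (k / 2) := by
          have := Nat.div_add_mod k.1 2
          conv_lhs => rw [← this]
          ring
        have hd : ((r : ℕ) + E.ctLen κ * k) / (2 * E.ctLen κ) = k / 2 := by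
          rw [hdm, Nat.add_mul_div_left _ _ (by omega), Nat.div_eq_of_lt hs, Nat.zero_add]
        have hm : ((r : ℕ) + E.ctLen κ * k) % (2 * E.ctLen κ) = r + E.ctLen κ * (k % 2) := by
          rw [hdm, Nat.add_mul_mod_self_left, Nat.mod_eq_of_lt hs]
        rw [hd, hm]
        have hkn : (k : ℕ) / 2 < n := by omega
        have h4 := hu.2 ⟨k / 2, hkn⟩ (finProdFinEquiv (⟨k % 2, Nat.mod_lt _ (by omega)⟩, r))
        simp only [flat, Equiv.symm_apply_apply, finProdFinEquiv_apply_val] at h4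
        have := block_lt (r := 1 + (r + E.ctLen κ * (k % 2))) (b := 1 + 2 * E.ctLen κ) hkn
          (by omega)
        rw [hgl _ _ (by omega), h4]
        rfl
      | right k =>
        have hk := k.2
        rw [Fin.append_right, hys2]
        have hk' : ((Fin.natAdd (2 * n) k : Fin (2 * n + 2 * n)) : ℕ) = 2 * n + k := rfl
        rw [hk', Nat.mul_add] at hval
        have hge : ¬ (r : ℕ) + (E.ctLen κ * (2 * n) + E.ctLen κ * k) < 2 * n * E.ctLen κ := by
          rw [Nat.mul_comm (2 * n)]
          omega
        rw [EvalArgs.src2, if_neg (by exact hval2), evalArgs_n, evalArgs_c, evalArgs_e, hval,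
          if_neg hge]
        have h5 := wrL_ofFn (f u) (evalArgs E κ C).O1 (flat ys)
          (finProdFinEquiv (finProdFinEquiv (j, k), r))
        rw [finProdFinEquiv_apply_val, finProdFinEquiv_apply_val] at h5
        have h6 : j * (2 * n * E.ctLen κ) + ((r : ℕ) + (E.ctLen κ * (2 * n) + E.ctLen κ * k) -
            2 * n * E.ctLen κ) = r + E.ctLen κ * (k + 2 * n * j) := by
          rw [Nat.mul_comm (2 * n) (E.ctLen κ), show (r : ℕ) + (E.ctLen κ * (2 * n) +
            E.ctLen κ * k) - E.ctLen κ * (2 * n) = r + E.ctLen κ * k by omega]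
          ring
        rw [h6]
        refine h5.trans ?_
        simp only [flat, Equiv.symm_apply_apply]
  change heisL _ F (g u) (g v) = _
  rw [evalArgs_m, evalArgs_Rv, heisL_calls (E.eval κ (ipCircuit (2 * n))) (2 * m)
    (fun j => Fin.append e (flat (Fin.append (pairs y) (eY ys j)))) _ _ F
    (fun j hj i hi => by rcases evalArgs_src2_lt E κ C hj hi with h | h <;> omega) eW2.ge
    (hg1 u hu) (hg1 v hv) (hg0 u hu0) (hg0 v hv0) (by rw [← evalArgs_total]; exact hF2)]
  rfl

end Eval

theorem tracedOn_obsK_of {m : ℕ} {out : Fin m → ℕ} (K : Bits m → Bits m → ℂ) {S : Set ℕ}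
    (h : ∀ k, out k ∉ S) : TracedOn S (obsK out K) :=
  (tracedOn_obsK out K).mono fun i hi => by
    rintro ⟨k, rfl⟩
    exact h k hi

section Eval

variable (E : ClassicalHE) (κ : ℕ) {n m : ℕ} (C : QCircuit n m)

/-- The input of the evaluation circuit. -/
def evalInput {p e c : ℕ} (pk : Bits p) (evk : Bits e) (x : Bits n) (y : Fin n → Fin 2 → Bits c) :
    Bits (p + e + n * (1 + 2 * c)) :=
  Fin.append (Fin.append pk evk) (flat fun i => pack (x i) (y i))

theorem mem_evalInput_key {p e c : ℕ} (pk : Bits p) (evk : Bits e) (x : Bits n)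
    (y : Fin n → Fin 2 → Bits c) (i : Fin (p + e)) :
    mem (evalInput pk evk x y) i = Fin.append pk evk i := by
  rw [mem_of_lt _ (by omega), ← Fin.append_left (Fin.append pk evk) (flat fun i => pack (x i) (y i))]
  rfl

theorem mem_evalInput_pack {p e c : ℕ} (pk : Bits p) (evk : Bits e) (x : Bits n)
    (y : Fin n → Fin 2 → Bits c) (i : Fin n) (r : Fin (1 + 2 * c)) :
    mem (evalInput pk evk x y) (p + e + i * (1 + 2 * c) + r) = pack (x i) (y i) r := by
  have := block_lt i.2 r.2
  have h := Fin.append_right (Fin.append pk evk) (flat fun i => pack (x i) (y i))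
    (finProdFinEquiv (i, r))
  simp only [flat, Equiv.symm_apply_apply] at h
  rw [mem_of_lt _ (by omega), ← h]
  refine congrArg (evalInput pk evk x y) (Fin.ext ?_)
  simp only [Fin.val_natAdd, finProdFinEquiv_apply_val]
  ring

/-- The memory before the output is read. -/
def evalFinal (ys : Fin (2 * m) → Fin (2 * n) → Bits (E.ctLen κ))
    (z : Fin (2 * m) → Bits (ipLen E κ n)) (u : Mem) : Mem :=
  wrL (wrL (formsMem (evalArgs E κ C).S (evalArgs E κ C).w2 (evalForm E κ C) (2 * m) u)
    (evalArgs E κ C).O1 (List.ofFn (flat fun a => ys a.divNat a.modNat)))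
    (evalArgs E κ C).O2 (List.ofFn (flat z))

theorem evalFinal_of_lt (ys : Fin (2 * m) → Fin (2 * n) → Bits (E.ctLen κ))
    (z : Fin (2 * m) → Bits (ipLen E κ n)) (u : Mem) {i : ℕ} (hi : i < (evalArgs E κ C).S) :
    evalFinal E κ C ys z u i = u i := by
  obtain ⟨h1, h2, h3, h4, h5, h6⟩ := evalArgs_order E κ C
  rw [evalFinal, wrL_of_lt _ _ (by omega), wrL_of_lt _ _ (by omega), formsMem_of_lt hi]

theorem wrL_congr {u v : Mem} {o : ℕ} {l : List Bool} {i : ℕ} (h : u i = v i) :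
    wrL u o l i = wrL v o l i := by
  rcases lt_or_ge i o with h1 | h1
  · rwa [wrL_of_lt _ _ h1, wrL_of_lt _ _ h1]
  rcases lt_or_ge i (o + l.length) with h2 | h2
  · obtain ⟨k, rfl⟩ := Nat.exists_eq_add_of_le h1
    rw [wrL_add _ _ _ (by omega), wrL_add _ _ _ (by omega)]
  · rwa [wrL_of_le _ _ h2, wrL_of_le _ _ h2]

theorem evalFinal_congr (ys : Fin (2 * m) → Fin (2 * n) → Bits (E.ctLen κ))
    (z : Fin (2 * m) → Bits (ipLen E κ n)) {u v : Mem} {i : ℕ} (h : u i = v i) :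
    evalFinal E κ C ys z u i = evalFinal E κ C ys z v i := by
  refine wrL_congr (wrL_congr ?_)
  rw [formsMem, formsMem, h]

theorem evalFinal_out (ys : Fin (2 * m) → Fin (2 * n) → Bits (E.ctLen κ))
    (z : Fin (2 * m) → Bits (ipLen E κ n)) (u : Mem) :
    evalFinal E κ C ys z u ∘ (evalCircuit E κ C).rawOut =
      flat fun k => pack (u ((evalArgs E κ C).phi (C.rawOut k))) (unpairs z k) := by
  funext k
  obtain ⟨⟨k, r⟩, rfl⟩ := finProdFinEquiv.surjective k
  simp only [flat, Equiv.symm_apply_apply]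
  rw [Function.comp_apply, evalCircuit_rawOut]
  have hr := r.2
  have hd : ((finProdFinEquiv (k, r) : Fin (m * (1 + 2 * ipLen E κ n))) : ℕ) /
      (1 + 2 * ipLen E κ n) = k := by
    rw [finProdFinEquiv_apply_val, Nat.add_mul_div_left _ _ (by omega), Nat.div_eq_of_lt hr,
      Nat.zero_add]
  have hm : ((finProdFinEquiv (k, r) : Fin (m * (1 + 2 * ipLen E κ n))) : ℕ) %
      (1 + 2 * ipLen E κ n) = r := by
    rw [finProdFinEquiv_apply_val, Nat.add_mul_mod_self_left, Nat.mod_eq_of_lt hr]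
  rcases evalArgs_out_lt E κ C (finProdFinEquiv (k, r)).2 with ⟨h0, h1, h2⟩ | ⟨h0, h1, h2⟩
  · rw [hm] at h0
    have hk : (⟨_, h1⟩ : Fin m) = k := Fin.ext hd
    rw [hk] at h2
    simp only [h2]
    rw [evalFinal_of_lt E κ C _ _ _ (evalArgs_phi_lt E κ C (C.rawOut_lt k))]
    have : r = Fin.castAdd (2 * ipLen E κ n) 0 := Fin.ext h0
    rw [this, pack, Fin.append_left]
  · rw [hm] at h0
    rw [hm, hd] at h1
    simp only [h1]
    have hrk : (r : ℕ) - 1 < 2 * ipLen E κ n := by omega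
    have e : r = Fin.natAdd 1 ⟨r - 1, hrk⟩ := Fin.ext (by simp only [Fin.val_natAdd]; omega)
    conv_rhs => rw [e, pack, Fin.append_right]
    obtain ⟨⟨s, t⟩, hst⟩ := finProdFinEquiv.surjective
      (⟨r - 1, hrk⟩ : Fin (2 * ipLen E κ n))
    rw [← hst]
    simp only [flat, Equiv.symm_apply_apply, unpairs]
    have hs := s.2
    have hk := k.2
    have h3 := wrL_ofFn (wrL (formsMem (evalArgs E κ C).S (evalArgs E κ C).w2 (evalForm E κ C)
      (2 * m) u) (evalArgs E κ C).O1 (List.ofFn (flat fun a => ys a.divNat a.modNat)))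
      (evalArgs E κ C).O2 (flat z) (finProdFinEquiv (⟨2 * k + s, by omega⟩, t))
    have hr1 : (r : ℕ) - 1 = t + ipLen E κ n * s := by
      have := congrArg Fin.val hst
      rw [finProdFinEquiv_apply_val] at this
      exact this.symm
    rw [hr1]
    simp only [flat, Equiv.symm_apply_apply, finProdFinEquiv_apply_val] at h3
    rw [← h3, evalFinal]
    congr 1
    ring

/-- The evaluated circuit runs as a subcircuit on the padded qubits, and the classical part
afterwards contributes the same distribution for all matrix units. The result factors into the
channel of `C` and an expectation over classical values. -/
theorem heisL_evalGates (pk : Bits (E.pkLen κ)) (e : Bits (E.evkLen κ)) (x x' : Bits n)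
    (y : Fin n → Fin 2 → Bits (E.ctLen κ))
    (K : Bits (m * (1 + 2 * ipLen E κ n)) → Bits (m * (1 + 2 * ipLen E κ n)) → ℂ) :
    heisL (evalCircuit E κ C).rawGates (obsK (evalCircuit E κ C).rawOut K)
      (mem (evalInput pk e x y)) (mem (evalInput pk e x' y)) =
    ∑ a, ∑ b, C.chan (Matrix.single x x' 1) a b *
      ∑ ys : Fin (2 * m) → Fin (2 * n) → Bits (E.ctLen κ),
        (∏ j : Fin (2 * m), ∏ i : Fin (2 * n),
          (E.encProb κ pk (evalForm E κ C j i) (ys j i) : ℂ)) *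
        ∑ z : Fin (2 * m) → Bits (ipLen E κ n),
          (∏ j, (E.evalProb κ (ipCircuit (2 * n)) e (Fin.append (pairs y) (ys j)) (z j) : ℂ)) *
          K (flat fun k => pack (a k) (unpairs z k)) (flat fun k => pack (b k) (unpairs z k)) := by
  classical
  obtain ⟨o1, o2, o3, o4, o5, o6⟩ := evalArgs_order E κ C
  have eN := evalArgs_N E κ C
  have eS := evalArgs_S E κ C
  have hinj := evalArgs_phi_injective E κ C
  set φ := (evalArgs E κ C).phi with hφ
  set M : Bits n → Mem := fun x => mem (evalInput pk e x y)
  have hM0 : ∀ x i, (evalArgs E κ C).N ≤ i → M x i = false := fun x i hi =>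
    mem_of_le _ (by rwa [← eN])
  have hMφ : ∀ x i, n ≤ i → M x (φ i) = false := fun x i hi =>
    hM0 x _ (by rw [hφ, evalArgs_phi_fresh E κ C hi]; omega)
  have hrest : ∀ x, rest n (M x ∘ φ) = x := by
    intro x
    funext i
    have h := mem_evalInput_pack pk e x y i (Fin.castAdd _ 0)
    rw [pack, Fin.append_left] at h
    rw [rest, Function.comp_apply, hφ, evalArgs_phi_input E κ C i.2]
    exact h
  have hkey : ∀ j i, φ j ≠ i ∨ E.pkLen κ + E.evkLen κ ≤ i := by
    intro j i
    rw [or_iff_not_imp_left, not_not]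
    rintro rfl
    rcases lt_or_ge j n with h | h
    · rw [hφ, evalArgs_phi_input E κ C h]; omega
    · rw [hφ, evalArgs_phi_fresh E κ C h]; omega
  have hblk : ∀ j (i : Fin n) (r : Fin (2 * E.ctLen κ)),
      φ j ≠ E.pkLen κ + E.evkLen κ + i * (1 + 2 * E.ctLen κ) + 1 + r := by
    intro j i r h
    have hr := r.2
    have := block_lt (r := 1 + r) (b := 1 + 2 * E.ctLen κ) i.2 (by omega)
    rcases lt_or_ge j n with hj | hj
    · rw [hφ, evalArgs_phi_input E κ C hj] at h
      have h1 : j * (1 + 2 * E.ctLen κ) = i * (1 + 2 * E.ctLen κ) + (1 + r) := by omega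
      have h2 := congrArg (· % (1 + 2 * E.ctLen κ)) h1
      simp only [Nat.mul_comm _ (1 + 2 * E.ctLen κ), Nat.mul_add_mod,
        Nat.mul_mod_right] at h2
      rw [Nat.mod_eq_of_lt (by omega)] at h2
      omega
    · rw [hφ, evalArgs_phi_fresh E κ C hj] at h
      omega
  have hext : ∀ (a u : Mem) i, (∀ j, φ j ≠ i) → Function.extend φ a u i = u i := fun a u i h =>
    Function.extend_apply' _ _ _ (by rintro ⟨j, hj⟩; exact h j hj)
  -- The evaluated circuit acts only on the leading wire of each register and on fresh wires; keys
  -- and ciphertexts are still in place afterwards.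
  have hin : ∀ x a, HoldsInput E κ pk e y (Function.extend φ a (M x)) := by
    intro x a
    refine ⟨fun i => ?_, fun i r => ?_⟩
    · rw [hext _ _ _ fun j => (hkey j i).resolve_right (by omega)]
      exact mem_evalInput_key pk e x y i
    · rw [hext _ _ _ fun j => hblk j i r]
      have h := mem_evalInput_pack pk e x y i (Fin.natAdd 1 r)
      rw [pack, Fin.append_right] at h
      rw [← h, Fin.val_natAdd, ← Nat.add_assoc]
  have hz : ∀ x (a : Mem), (∀ i, n + C.fresh ≤ i → a i = false) → ∀ i, (evalArgs E κ C).S ≤ i →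
      Function.extend φ a (M x) i = false := by
    intro x a ha i hi
    by_cases h : ∃ j, φ j = i
    · obtain ⟨j, rfl⟩ := h
      rw [hinj.extend_apply]
      refine ha j ?_
      by_contra h'
      have := evalArgs_phi_lt E κ C (not_le.1 h')
      rw [← hφ] at this
      omega
    · rw [hext _ _ _ fun j hj => h ⟨j, hj⟩]
      exact hM0 x i (by omega)
  have hout : ∀ k, ((evalCircuit E κ C).rawOut k < (evalArgs E κ C).S) ∨
      ((evalArgs E κ C).O2 ≤ (evalCircuit E κ C).rawOut k ∧
        (evalCircuit E κ C).rawOut k < (evalArgs E κ C).W2) := by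
    intro k
    rcases evalArgs_out_lt E κ C k.2 with ⟨_, h, e⟩ | ⟨_, e, h⟩
    · left
      rw [evalCircuit_rawOut]
      simp only [e]
      exact evalArgs_phi_lt E κ C (C.rawOut_lt _)
    · right
      rw [evalCircuit_rawOut]
      refine ⟨?_, h⟩
      simp only [e]
      omega
  rw [evalCircuit_rawGates, EvalArgs.gates, heisL_append]
  have hsub := heisL_subcircuit C hinj
    (heisL ((evalArgs E κ C).formsGates ++
      (callsGates (evalArgs E κ C).Re (evalArgs E κ C).J1 (evalArgs E κ C).src1
        (evalArgs E κ C).O1 (evalArgs E κ C).W1 ++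
      callsGates (evalArgs E κ C).Rv (2 * (evalArgs E κ C).m) (evalArgs E κ C).src2
        (evalArgs E κ C).O2 (evalArgs E κ C).W2)) (obsK (evalCircuit E κ C).rawOut K))
    (fun a b => ∑ ys : Fin (2 * m) → Fin (2 * n) → Bits (E.ctLen κ),
        (∏ j : Fin (2 * m), ∏ i : Fin (2 * n),
          (E.encProb κ pk (evalForm E κ C j i) (ys j i) : ℂ)) *
        ∑ z : Fin (2 * m) → Bits (ipLen E κ n),
          (∏ j, (E.evalProb κ (ipCircuit (2 * n)) e (Fin.append (pairs y) (ys j)) (z j) : ℂ)) *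
          K (flat fun k => pack (a k) (unpairs z k)) (flat fun k => pack (b k) (unpairs z k)))
    (M x) (M x') (hMφ x) (hMφ x') ?_
  · rw [hrest, hrest] at hsub
    exact hsub
  intro a b ha hb
  rw [heisL_evalTail E κ C (hin x a) (hin x' b) (hz x a ha) (hz x' b hb) _
    (tracedOn_obsK_of _ fun k => by
      have := hout k
      simp only [Set.mem_Ico]
      omega)
    (tracedOn_obsK_of _ fun k => by
      have := hout k
      simp only [Set.mem_Ico]
      omega)]
  -- Every wire outside `φ` carries the same bit on both sides, so discarding the wires of the whole
  -- evaluation imposes exactly the condition of discarding the non-output wires of `C`.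
  have hagree : ∀ ys z, (∀ j, (∀ k, (evalCircuit E κ C).rawOut k ≠ j) →
      evalFinal E κ C ys z (Function.extend φ a (M x)) j =
        evalFinal E κ C ys z (Function.extend φ b (M x')) j) ↔
      ∀ j, (∀ k, C.rawOut k ≠ j) → a j = b j := by
    intro ys z
    constructor
    · intro h j hj
      rcases lt_or_ge j (n + C.fresh) with hjl | hjl
      · have hS := evalArgs_phi_lt E κ C hjl
        rw [← hφ] at hS
        have h1 := h (φ j) fun k hk => by
          rcases evalArgs_out_lt E κ C k.2 with ⟨_, hk2, e⟩ | ⟨_, e, _⟩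
          · rw [evalCircuit_rawOut] at hk
            exact hj _ (hinj (e.symm.trans hk))
          · rw [evalCircuit_rawOut] at hk
            simp only at hk
            omega
        rwa [evalFinal_of_lt E κ C _ _ _ hS, evalFinal_of_lt E κ C _ _ _ hS, hinj.extend_apply,
          hinj.extend_apply] at h1
      · rw [ha j hjl, hb j hjl]
    · intro h j hj
      apply evalFinal_congr
      by_cases hjr : ∃ i, φ i = j
      · obtain ⟨i, rfl⟩ := hjr
        rw [hinj.extend_apply, hinj.extend_apply]
        refine h i fun k hk => ?_
        -- The qubit is the first entry of the `k`-th output register.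
        have hlt : (k : ℕ) * (1 + 2 * ipLen E κ n) < m * (1 + 2 * ipLen E κ n) :=
          Nat.mul_lt_mul_of_pos_right k.2 (by omega)
        refine hj ⟨k * (1 + 2 * ipLen E κ n), hlt⟩ ?_
        rcases evalArgs_out_lt E κ C hlt with ⟨_, h2, e⟩ | ⟨h2, _⟩
        · rw [evalCircuit_rawOut]
          simp only [e]
          rw [← hk]
          congr 2
          exact Fin.ext (Nat.mul_div_cancel _ (by omega))
        · exact absurd (Nat.mul_mod_left _ _) h2
      · rcases lt_or_ge j (E.pkLen κ + E.evkLen κ) with h1 | h1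
        · exact ((hin x a).1 ⟨j, h1⟩).trans ((hin x' b).1 ⟨j, h1⟩).symm
        rcases lt_or_ge j (evalArgs E κ C).N with h2 | h2
        · obtain ⟨t, rfl⟩ := Nat.exists_eq_add_of_le h1
          have hD : 0 < 1 + 2 * E.ctLen κ := by omega
          have ht : t / (1 + 2 * E.ctLen κ) < n :=
            Nat.div_lt_of_lt_mul (by rw [Nat.mul_comm]; omega)
          have hdm := Nat.div_add_mod t (1 + 2 * E.ctLen κ)
          have hm := Nat.mod_lt t hD
          have hm0 : t % (1 + 2 * E.ctLen κ) ≠ 0 := fun h0 => hjr ⟨t / (1 + 2 * E.ctLen κ), by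
            rw [hφ, evalArgs_phi_input E κ C ht, Nat.mul_comm]
            omega⟩
          have hr : t % (1 + 2 * E.ctLen κ) - 1 < 2 * E.ctLen κ := by omega
          have e1 : E.pkLen κ + E.evkLen κ + t = E.pkLen κ + E.evkLen κ +
              (t / (1 + 2 * E.ctLen κ)) * (1 + 2 * E.ctLen κ) + 1 +
                (t % (1 + 2 * E.ctLen κ) - 1) := by
            rw [Nat.mul_comm (t / _)]
            omega
          rw [e1]
          exact ((hin x a).2 ⟨_, ht⟩ ⟨_, hr⟩).trans ((hin x' b).2 ⟨_, ht⟩ ⟨_, hr⟩).symm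
        · rw [hext _ _ _ fun i hi => hjr ⟨i, hi⟩, hext _ _ _ fun i hi => hjr ⟨i, hi⟩, hM0 _ _ h2,
            hM0 _ _ h2]
  have hfin : ∀ ys z, obsK (evalCircuit E κ C).rawOut K
      (evalFinal E κ C ys z (Function.extend φ a (M x)))
      (evalFinal E κ C ys z (Function.extend φ b (M x'))) =
      if ∀ j, (∀ k, C.rawOut k ≠ j) → a j = b j then
        K (flat fun k => pack ((a ∘ C.rawOut) k) (unpairs z k))
          (flat fun k => pack ((b ∘ C.rawOut) k) (unpairs z k)) else 0 := by
    intro ys z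
    rw [obsK_apply]
    refine if_congr (hagree ys z) ?_ rfl
    rw [evalFinal_out, evalFinal_out]
    simp only [← hφ, hinj.extend_apply, Function.comp_apply]
  change (∑ ys, _ * ∑ z, _ * obsK (evalCircuit E κ C).rawOut K
      (evalFinal E κ C ys z (Function.extend φ a (M x)))
      (evalFinal E κ C ys z (Function.extend φ b (M x')))) = _
  simp only [hfin]
  split_ifs with h
  · rfl
  · simp

end Eval

/-! ### Pauli operators on the input of a stabilizer circuit -/

theorem QGate.IsStabilizer.raw {w : ℕ} {g : QGate w} (h : g.IsStabilizer) : g.raw.Stab := by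
  cases g <;> exact h

theorem QCircuit.IsStabilizer.raw {n m : ℕ} {C : QCircuit n m} (h : C.IsStabilizer) :
    ∀ g ∈ C.rawGates, g.Stab := by
  intro g hg
  obtain ⟨g', hg', rfl⟩ := List.mem_map.1 hg
  exact (h g' hg').raw

theorem signZ_mem {n w : ℕ} (k : Mem) (x : Bits n) (hw : n ≤ w) :
    signZ w k (mem x) = ∏ i : Fin n, sg (k (2 * i + 1) && x i) := by
  rw [signZ, ← Finset.prod_subset (Finset.range_subset_range.2 hw), Finset.prod_range]
  · exact Finset.prod_congr rfl fun i _ => by rw [mem_of_lt _ i.2]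
  · intro i _ hi
    rw [mem_of_le x (by simpa using hi)]
    simp

theorem sg_and_xor (s a b : Bool) : sg (s && a) * sg (s && b) = sg (s && xor a b) := by
  cases s <;> cases a <;> cases b <;> simp

/-- On discarded wires both assignments agree, so the signs of `Z` cancel and a common shift changes
nothing. Only the keys of the output wires survive. -/
theorem pauliF_obs {m w : ℕ} {out : Fin m → ℕ} (hinj : Function.Injective out)
    (hout : ∀ k, out k < w) (k : Mem) (a b : Bits m) :
    pauliF w k (obs out a b) = fun u v => (∏ j, sg (k (2 * out j + 1) && xor (a j) (b j))) *
      obs out (fun j => xor (a j) (k (2 * out j))) (fun j => xor (b j) (k (2 * out j))) u v := by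
  funext u v
  have hiff : ((∀ j, shiftX k u (out j) = a j) ∧ (∀ j, shiftX k v (out j) = b j) ∧
      (∀ i, (∀ j, out j ≠ i) → shiftX k u i = shiftX k v i)) ↔
      ((∀ j, u (out j) = xor (a j) (k (2 * out j))) ∧
        (∀ j, v (out j) = xor (b j) (k (2 * out j))) ∧ ∀ i, (∀ j, out j ≠ i) → u i = v i) := by
    refine and_congr (forall_congr' fun j => ?_) (and_congr (forall_congr' fun j => ?_)
      (forall_congr' fun i => imp_congr_right fun _ => ?_))
    · rw [shiftX_apply]; cases u (out j) <;> cases a j <;> cases k (2 * out j) <;> simp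
    · rw [shiftX_apply]; cases v (out j) <;> cases b j <;> cases k (2 * out j) <;> simp
    · rw [shiftX_apply, shiftX_apply]; cases u i <;> cases v i <;> cases k (2 * i) <;> simp
  rw [pauliF, obs, obs]
  by_cases h : (∀ j, u (out j) = xor (a j) (k (2 * out j))) ∧
        (∀ j, v (out j) = xor (b j) (k (2 * out j))) ∧ ∀ i, (∀ j, out j ≠ i) → u i = v i
  · rw [if_pos (hiff.2 h), if_pos h, mul_one, mul_one, signZ, signZ, ← Finset.prod_mul_distrib]
    have h1 : ∀ i, sg (k (2 * i + 1) && u i) * sg (k (2 * i + 1) && v i) =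
        sg (k (2 * i + 1) && xor (u i) (v i)) := fun i => sg_and_xor _ _ _
    simp only [h1]
    rw [← Finset.prod_subset (s₁ := Finset.univ.image out)]
    · rw [Finset.prod_image fun i _ j _ hij => hinj hij]
      refine Finset.prod_congr rfl fun j _ => ?_
      rw [h.1 j, h.2.1 j]
      cases a j <;> cases b j <;> cases k (2 * out j) <;> rfl
    · intro i hi
      obtain ⟨j, _, rfl⟩ := Finset.mem_image.1 hi
      exact Finset.mem_range.2 (hout j)
    · intro i _ hi
      rw [h.2.2 i fun j hj => hi (Finset.mem_image.2 ⟨j, Finset.mem_univ _, hj⟩)]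
      simp
  · rw [if_neg (mt hiff.1 h), if_neg h, mul_zero, mul_zero]

/-- A Pauli operator on the input of a stabilizer circuit amounts to a Pauli operator on its
output. -/
theorem QCircuit.IsStabilizer.chan_pauli {n m : ℕ} {C : QCircuit n m} (hC : C.IsStabilizer)
    {k : Mem} (hk : ∀ i, 2 * n ≤ i → k i = false) (x x' : Bits n) (a b : Bits m) :
    (∏ i : Fin n, sg (k (2 * i + 1) && xor (x i) (x' i))) *
      C.chan (Matrix.single (fun i : Fin n => xor (x i) (k (2 * i)))
        (fun i : Fin n => xor (x' i) (k (2 * i))) 1) a b =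
    (∏ j, sg (transport (C.rawGates.flatMap keyPairs) k (2 * C.rawOut j + 1) &&
        xor (a j) (b j))) * C.chan (Matrix.single x x' 1)
      (fun j => xor (a j) (transport (C.rawGates.flatMap keyPairs) k (2 * C.rawOut j)))
      (fun j => xor (b j) (transport (C.rawGates.flatMap keyPairs) k (2 * C.rawOut j))) := by
  have h := congrFun (congrFun (heisL_pauliF C.goodOn hC.raw k (obs C.rawOut a b)) (mem x)) (mem x')
  rw [pauliF_obs C.rawOut_injective C.rawOut_lt] at h
  -- The keys vanish beyond the input wires, so fresh wires stay in the state `|0⟩`.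
  have hs : ∀ x : Bits n, shiftX k (mem x) = mem fun i : Fin n => xor (x i) (k (2 * i)) := by
    intro x
    funext i
    rw [shiftX_apply]
    rcases lt_or_ge i n with hi | hi
    · rw [mem_of_lt _ hi, mem_of_lt _ hi]
    · rw [mem_of_le _ hi, mem_of_le _ hi, hk _ (by omega)]; rfl
  have hmul : ∀ (c : ℂ) (F : Mem → Mem → ℂ) (u v : Mem),
      heisL C.rawGates (fun u v => c * F u v) u v = c * heisL C.rawGates F u v := by
    intro c F u v
    have := heisL_sum (Finset.univ : Finset Unit) C.rawGates (fun _ => c) (fun _ => F) u v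
    simpa using this
  rw [hmul, pauliF, hs, hs, signZ_mem k x (Nat.le_add_right _ _),
    signZ_mem k x' (Nat.le_add_right _ _), ← Finset.prod_mul_distrib] at h
  simp only [sg_and_xor] at h
  rw [chan_single, chan_single]
  exact h.symm

/-! ## The composition of encryption, evaluation and decryption -/

theorem sum_comm_pair {M α β γ δ : Type} [AddCommMonoid M] [Fintype α] [Fintype β] [Fintype γ]
    [Fintype δ] (F : α → β → γ → δ → M) :
    ∑ a, ∑ b, ∑ c, ∑ d, F a b c d = ∑ c, ∑ d, ∑ a, ∑ b, F a b c d := by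
  have h : ∑ p : α × β, ∑ q : γ × δ, F p.1 p.2 q.1 q.2 =
      ∑ q : γ × δ, ∑ p : α × β, F p.1 p.2 q.1 q.2 := Finset.sum_comm
  simpa only [Fintype.sum_prod_type] using h

theorem sum_append {a b : ℕ} (F : Bits (a + b) → ℂ) :
    ∑ u, F u = ∑ k, ∑ c, F (Fin.append k c) := by
  rw [← (bitsAppendEquiv a b).sum_comp, Fintype.sum_prod_type]
  rfl

theorem QCircuit.sum_chan_mul {n m : ℕ} (C : QCircuit n m) (ρ : Op (Bits n))
    (K : Bits m → Bits m → ℂ) :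
    ∑ a, ∑ b, C.chan ρ a b * K a b =
      ∑ x, ∑ y, ρ x y * heisL C.rawGates (obsK C.rawOut K) (mem x) (mem y) := by
  simp only [chan_apply, heisL_obsK, Finset.sum_mul, Finset.mul_sum]
  rw [sum_comm_pair]
  refine Finset.sum_congr rfl fun _ _ => Finset.sum_congr rfl fun _ _ => Finset.sum_congr rfl
    fun _ _ => Finset.sum_congr rfl fun _ _ => ?_
  ring

/-- Concatenation as an equivalence. -/
def flatEquiv (n k : ℕ) : (Fin n → Bits k) ≃ Bits (n * k) where
  toFun := flat
  invFun := blocks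
  left_inv x := by funext i j; simp [flat, blocks]
  right_inv y := by
    funext i
    exact congrArg y (finProdFinEquiv.apply_symm_apply i)

@[simp] theorem blocks_flat {n k : ℕ} (x : Fin n → Bits k) : blocks (flat x) = x :=
  (flatEquiv n k).left_inv x

theorem prod_single_apply {ι α β : Type} [Fintype ι] [DecidableEq α] [DecidableEq β]
    (f c : ι → α) (g c' : ι → β) :
    ∏ i, Matrix.single (f i) (g i) (1 : ℂ) (c i) (c' i) = if f = c ∧ g = c' then 1 else 0 := by
  simp only [Matrix.single_apply, Finset.prod_ite_zero, Finset.prod_const_one, funext_iff,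
    ← forall_and, Finset.mem_univ, true_imp_iff]

/-- Summation against a product of sums of matrix units. -/
theorem sum_prod_single {ι Ω α : Type} [Fintype ι] [DecidableEq ι] [Fintype Ω] [Fintype α]
    [DecidableEq α] (w : ι → Ω → ℂ) (f g : ι → Ω → α) (G : (ι → α) → (ι → α) → ℂ) :
    ∑ c, ∑ c', (∏ i, (∑ ω, w i ω • Matrix.single (f i ω) (g i ω) (1 : ℂ)) (c i) (c' i)) * G c c' =
      ∑ ω : ι → Ω, (∏ i, w i (ω i)) * G (fun i => f i (ω i)) (fun i => g i (ω i)) := by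
  have h : ∀ c c', ∏ i, (∑ ω, w i ω • Matrix.single (f i ω) (g i ω) (1 : ℂ)) (c i) (c' i) =
      ∑ ω : ι → Ω, (∏ i, w i (ω i)) *
        if (fun i => f i (ω i)) = c ∧ (fun i => g i (ω i)) = c' then 1 else 0 := by
    intro c c'
    simp only [Matrix.sum_apply, Matrix.smul_apply, smul_eq_mul]
    rw [Fintype.prod_sum]
    refine Finset.sum_congr rfl fun ω _ => ?_
    rw [Finset.prod_mul_distrib, prod_single_apply]
  simp only [h, Finset.sum_mul]
  have h2 : ∀ c, (∑ c', ∑ ω : ι → Ω, ((∏ i, w i (ω i)) *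
      if (fun i => f i (ω i)) = c ∧ (fun i => g i (ω i)) = c' then 1 else 0) * G c c') =
      ∑ ω : ι → Ω, ∑ c', ((∏ i, w i (ω i)) *
      if (fun i => f i (ω i)) = c ∧ (fun i => g i (ω i)) = c' then 1 else 0) * G c c' :=
    fun c => Finset.sum_comm
  simp only [h2]
  rw [Finset.sum_comm]
  refine Finset.sum_congr rfl fun ω _ => ?_
  rw [Finset.sum_eq_single fun i => f i (ω i), Finset.sum_eq_single fun i => g i (ω i)]
  · simp
  · intro c' _ hc'
    simp [hc'.symm]
  · simp
  · intro c _ hc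
    simp [hc.symm]
  · simp

theorem sum_tensor_mul {a b : ℕ} (σ : Op (Bits a)) (ρ : Op (Bits b))
    (G : Bits (a + b) → Bits (a + b) → ℂ) :
    ∑ u, ∑ v, tensor σ ρ u v * G u v = ∑ k, ∑ k', ∑ c, ∑ c',
      σ k k' * ρ c c' * G (Fin.append k c) (Fin.append k' c') := by
  simp only [sum_append, tensor, Matrix.of_apply, takeBits_append, dropBits_append]
  refine Finset.sum_congr rfl fun k _ => Finset.sum_comm

theorem sum_classical {a b : ℕ} {σ : Op (Bits (a + b))} {x : Bits a} {w : Bits b → ℂ}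
    (hσ : ∀ x₁ x₂ e₁ e₂, σ (Fin.append x₁ e₁) (Fin.append x₂ e₂) =
      if x₁ = x ∧ x₂ = x ∧ e₁ = e₂ then w e₁ else 0) (G : Bits (a + b) → Bits (a + b) → ℂ) :
    ∑ k, ∑ k', σ k k' * G k k' = ∑ e, w e * G (Fin.append x e) (Fin.append x e) := by
  rw [sum_append, Finset.sum_eq_single x]
  · refine Finset.sum_congr rfl fun e _ => ?_
    rw [sum_append, Finset.sum_eq_single x, Finset.sum_eq_single e]
    · simp [hσ]
    · intro e' _ he
      rw [hσ, if_neg fun h => he h.2.2.symm, zero_mul]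
    · simp
    · intro x' _ hx
      refine Finset.sum_eq_zero fun e' _ => ?_
      rw [hσ, if_neg fun h => hx h.2.1, zero_mul]
    · simp
  · intro x' _ hx
    refine Finset.sum_eq_zero fun e' _ => ?_
    rw [sum_append]
    refine Finset.sum_eq_zero fun x'' _ => Finset.sum_eq_zero fun e'' _ => ?_
    rw [hσ, if_neg fun h => hx h.1, zero_mul]
  · simp

/-- If a map relabels both indices of each matrix unit by a common choice `ω`, up to a weight, then
its tensor power does the same with a separate choice for every factor. -/
theorem sum_tensorPow {Ω α β : Type} [Fintype Ω] [Fintype α] [DecidableEq α] [Fintype β]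
    [DecidableEq β] {n : ℕ} {Φ : Op α → Op β} (w : Ω → α → α → ℂ) (f : Ω → α → β)
    (hΦ : ∀ s s', Φ (Matrix.single s s' 1) = ∑ ω, w ω s s' • Matrix.single (f ω s) (f ω s') 1)
    (ρ : Op (Fin n → α)) (G : (Fin n → β) → (Fin n → β) → ℂ) :
    ∑ c, ∑ c', tensorPow n Φ ρ c c' * G c c' =
      ∑ ω : Fin n → Ω, ∑ x, ∑ x', ρ x x' * ((∏ i, w (ω i) (x i) (x' i)) *
        G (fun i => f (ω i) (x i)) (fun i => f (ω i) (x' i))) := by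
  have h1 : ∀ x x' : Fin n → α, ∑ c, ∑ c', (∏ i, Φ (Matrix.single (x i) (x' i) 1) (c i) (c' i)) *
      G c c' = ∑ ω : Fin n → Ω, (∏ i, w (ω i) (x i) (x' i)) *
        G (fun i => f (ω i) (x i)) (fun i => f (ω i) (x' i)) := by
    intro x x'
    simp only [hΦ]
    exact sum_prod_single (fun i ω => w ω (x i) (x' i)) (fun i ω => f ω (x i))
      (fun i ω => f ω (x' i)) G
  obtain ⟨r, hr⟩ : ∃ r : (Fin n → α) → (Fin n → α) → ℂ, ∀ x x', ρ x x' = r x x' :=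
    ⟨ρ, fun _ _ => rfl⟩
  simp only [tensorPow, Matrix.of_apply, Finset.sum_mul, mul_assoc, hr]
  rw [sum_comm_pair]
  simp only [← Finset.mul_sum, h1]
  simp only [Finset.mul_sum]
  refine (Finset.sum_congr rfl fun x _ => Finset.sum_comm).trans ?_
  rw [Finset.sum_comm]

theorem trace_classical {a b : ℕ} {σ : Op (Bits (a + b))} {x : Bits a} {w : Bits b → ℂ}
    (hσ : ∀ x₁ x₂ e₁ e₂, σ (Fin.append x₁ e₁) (Fin.append x₂ e₂) =
      if x₁ = x ∧ x₂ = x ∧ e₁ = e₂ then w e₁ else 0) : σ.trace = ∑ e, w e := by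
  have h := sum_classical hσ fun k k' => if k = k' then 1 else 0
  simpa [Matrix.trace] using h

/-! ### The whole process as a mixture of Pauli operators. -/

section Correctness

variable (E : ClassicalHE) (κ : ℕ) {n m : ℕ} (C : QCircuit n m)

/-- The functional that decryption computes. -/
def decK (sk : Bits (E.skLen κ)) (L : ℕ) (b b' : Bits m) (W W' : Bits (m * (1 + 2 * L))) : ℂ :=
  ∏ j, (scheme E).decChan κ sk (Matrix.single (blocks W j) (blocks W' j) 1) (b j) (b' j)

/-- The probabilities of the classical values in encryption. -/
def inputProb (pk : Bits (E.pkLen κ)) (k : Fin n → Bits 2)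
    (y : Fin n → Fin 2 → Bits (E.ctLen κ)) : ℝ :=
  ∏ i, (1 / 4 * ∏ s, E.encProb κ pk (k i s) (y i s))

theorem sum_encChan (pk : Bits (E.pkLen κ)) (ρ : Op (Bits n))
    (G : (Fin n → Bits (1 + 2 * E.ctLen κ)) → (Fin n → Bits (1 + 2 * E.ctLen κ)) → ℂ) :
    ∑ c, ∑ c', tensorPow n ((scheme E).encChan κ pk) ρ c c' * G c c' =
      ∑ k : Fin n → Bits 2, ∑ y : Fin n → Fin 2 → Bits (E.ctLen κ), (inputProb E κ pk k y : ℂ) *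
        ∑ x, ∑ x', ρ x x' * ((∏ i, sg (k i 1 && xor (x i) (x' i))) *
          G (fun i => pack (xor (x i) (k i 0)) (y i)) (fun i => pack (xor (x' i) (k i 0)) (y i))) := by
  refine (sum_tensorPow (Ω := Bits 2 × (Fin 2 → Bits (E.ctLen κ)))
    (fun ω s s' => 1 / 4 * (∏ j, (E.encProb κ pk (ω.1 j) (ω.2 j) : ℂ)) * sg (ω.1 1 && xor s s'))
    (fun ω s => pack (xor s (ω.1 0)) ω.2) (fun s s' => ?_) ρ G).trans ?_
  · rw [Fintype.sum_prod_type]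
    exact encChan_single E κ pk s s'
  rw [← (Equiv.arrowProdEquivProdArrow (Fin n) (fun _ => Bits 2)
    (fun _ => Fin 2 → Bits (E.ctLen κ))).symm.sum_comp, Fintype.sum_prod_type]
  refine Finset.sum_congr rfl fun k _ => Finset.sum_congr rfl fun y _ => ?_
  rw [Finset.mul_sum]
  refine Finset.sum_congr rfl fun x _ => ?_
  rw [Finset.mul_sum]
  refine Finset.sum_congr rfl fun x' _ => ?_
  rw [Finset.prod_mul_distrib, inputProb]
  push_cast
  rw [mul_assoc, mul_left_comm]
  rfl

/-- The memory with the keys of the input qubits. -/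
def keyMem (k : Fin n → Bits 2) : Mem := mem (pairs k)

theorem keyMem_apply (k : Fin n → Bits 2) (i : Fin n) (s : Fin 2) : keyMem k (2 * i + s) = k i s := by
  have hi := i.2
  have hs := s.2
  rw [keyMem, mem_of_lt _ (by omega : 2 * (i : ℕ) + s < 2 * n)]
  exact congrFun (congrFun (unpairs_pairs k) i) s

theorem keyMem_of_le (k : Fin n → Bits 2) {i : ℕ} (hi : 2 * n ≤ i) : keyMem k i = false :=
  mem_of_le _ hi

/-- The keys of the output qubits. -/
def outKey (k : Fin n → Bits 2) (j : ℕ) : Bool :=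
  transport (C.rawGates.flatMap keyPairs) (keyMem k) ((evalArgs E κ C).target j)

/-- The Pauli operator that remains after decryption with the keys `τ`. -/
def residual (k : Fin n → Bits 2) (τ : Fin (2 * m) → Bool) : Fin m → Bits 2 :=
  unpairs fun j => xor (τ j) (outKey E κ C k j)

/-- The probabilities of the classical values in evaluation and decryption. -/
def outputProb (pk : Bits (E.pkLen κ)) (sk : Bits (E.skLen κ)) (e : Bits (E.evkLen κ))
    (y : Fin n → Fin 2 → Bits (E.ctLen κ)) (ys : Fin (2 * m) → Fin (2 * n) → Bits (E.ctLen κ))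
    (z : Fin (2 * m) → Bits (ipLen E κ n)) (τ : Fin (2 * m) → Bool) : ℝ :=
  (∏ j : Fin (2 * m), ∏ i : Fin (2 * n), E.encProb κ pk (evalForm E κ C j i) (ys j i)) *
    ((∏ j, E.evalProb κ (ipCircuit (2 * n)) e (Fin.append (pairs y) (ys j)) (z j)) *
      ∏ j, E.decProb κ sk (z j) (τ j))

theorem outKey_eq (k : Fin n → Bits 2) (j : Fin m) (s : Fin 2) : outKey E κ C k (2 * j + s) =
    transport (C.rawGates.flatMap keyPairs) (keyMem k) (2 * C.rawOut j + s) := by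
  have h1 : (2 * (j : ℕ) + s) / 2 = j := by omega
  have h2 : (2 * (j : ℕ) + s) % 2 = s := by omega
  rw [outKey, EvalArgs.target, h1, h2, evalArgs_getD E κ C j j.2]

theorem prod_pairs {β : Type} [CommMonoid β] (f : Fin (2 * m) → β) :
    ∏ j, f j = ∏ k : Fin m, ∏ s : Fin 2, f ⟨2 * k + s, by omega⟩ := by
  rw [← (finCongr (Nat.mul_comm m 2)).prod_comp, ← finProdFinEquiv.prod_comp,
    Fintype.prod_prod_type]
  refine Finset.prod_congr rfl fun k _ => Finset.prod_congr rfl fun s _ => congrArg f (Fin.ext ?_)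
  simp only [finCongr_apply, Fin.val_cast, finProdFinEquiv_apply_val]
  ring

/-- `pairs` as an equivalence. -/
def pairsEquiv (m : ℕ) (β : Type) : (Fin m → Fin 2 → β) ≃ (Fin (2 * m) → β) :=
  ⟨pairs, unpairs, unpairs_pairs, pairs_unpairs⟩

/-- The input pad is moved through the circuit by `chan_pauli` and becomes the Pauli operator with
the true output keys. Decryption applies the one with the decrypted keys `τ`. Their product is the
residual operator. -/
theorem sum_decK (hC : C.IsStabilizer) (sk : Bits (E.skLen κ)) (k : Fin n → Bits 2)
    (z : Fin (2 * m) → Bits (ipLen E κ n)) (ρ : Op (Bits n)) (b b' : Bits m) :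
    ∑ x, ∑ x', ρ x x' * ((∏ i, sg (k i 1 && xor (x i) (x' i))) *
      ∑ a, ∑ a', C.chan (Matrix.single (fun i => xor (x i) (k i 0)) (fun i => xor (x' i) (k i 0)) 1)
        a a' * decK E κ sk (ipLen E κ n) b b' (flat fun j => pack (a j) (unpairs z j))
          (flat fun j => pack (a' j) (unpairs z j))) =
    ∑ τ : Fin (2 * m) → Bool, ((∏ j, E.decProb κ sk (z j) (τ j) : ℝ) : ℂ) *
      pauliOp (residual E κ C k τ) (C.chan ρ) b b' := by
  have h1 : ∀ a a' : Bits m, decK E κ sk (ipLen E κ n) b b' (flat fun j => pack (a j) (unpairs z j))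
      (flat fun j => pack (a' j) (unpairs z j)) =
      ∏ j, (∑ τ : Bits 2, ((∏ s, (E.decProb κ sk (unpairs z j s) (τ s) : ℂ)) *
        sg (τ 1 && xor (b j) (b' j))) •
        Matrix.single (xor (b j) (τ 0)) (xor (b' j) (τ 0)) (1 : ℂ)) (a j) (a' j) := by
    intro a a'
    rw [decK, blocks_flat, blocks_flat]
    refine Finset.prod_congr rfl fun j _ => ?_
    rw [decChan_single]
    simp only [Matrix.sum_apply, Matrix.smul_apply, Matrix.single_apply, smul_eq_mul]
    refine Finset.sum_congr rfl fun τ _ => ?_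
    cases a j <;> cases a' j <;> cases b j <;> cases b' j <;> cases τ 0 <;> simp
  have h2 : ∀ x x' : Bits n, ∑ a, ∑ a', C.chan (Matrix.single x x' 1) a a' *
      decK E κ sk (ipLen E κ n) b b' (flat fun j => pack (a j) (unpairs z j))
          (flat fun j => pack (a' j) (unpairs z j)) =
      ∑ τ : Fin m → Bits 2, (∏ j, ((∏ s, (E.decProb κ sk (unpairs z j s) (τ j s) : ℂ)) *
        sg (τ j 1 && xor (b j) (b' j)))) * C.chan (Matrix.single x x' 1)
          (fun j => xor (b j) (τ j 0)) (fun j => xor (b' j) (τ j 0)) := by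
    intro x x'
    have h := (sum_prod_single (ι := Fin m) (Ω := Bits 2) (α := Bool) (fun j τ => (∏ s, (E.decProb κ sk (unpairs z j s) (τ s) : ℂ)) *
        sg (τ 1 && xor (b j) (b' j))) (fun j τ => xor (b j) (τ 0)) (fun j τ => xor (b' j) (τ 0))
        fun a a' => C.chan (Matrix.single x x' 1) a a')
    refine Eq.trans ?_ h
    refine Finset.sum_congr rfl fun a _ => Finset.sum_congr rfl fun a' _ => ?_
    rw [h1, mul_comm]
  simp only [h2]
  rw [← (pairsEquiv m Bool).sum_comp]
  simp only [Finset.mul_sum]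
  have h3 : ∀ F : Bits n → Bits n → (Fin m → Bits 2) → ℂ,
      ∑ x, ∑ x', ∑ τ, F x x' τ = ∑ τ, ∑ x, ∑ x', F x x' τ := by
    intro F
    rw [Finset.sum_comm]
    refine (Finset.sum_congr rfl fun x _ => Finset.sum_comm).trans ?_
    rw [Finset.sum_comm]
    exact Finset.sum_congr rfl fun τ _ => Finset.sum_comm
  rw [h3]
  refine Finset.sum_congr rfl fun τ _ => ?_
  set K := transport (C.rawGates.flatMap keyPairs) (keyMem k)
  set a : Bits m := fun j => xor (b j) (τ j 0)
  set a' : Bits m := fun j => xor (b' j) (τ j 0)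
  have h4 : ∀ x x' : Bits n, (∏ i, sg (k i 1 && xor (x i) (x' i))) *
      C.chan (Matrix.single (fun i => xor (x i) (k i 0)) (fun i => xor (x' i) (k i 0)) 1) a a' =
      (∏ j, sg (K (2 * C.rawOut j + 1) && xor (a j) (a' j))) * C.chan (Matrix.single x x' 1)
        (fun j => xor (a j) (K (2 * C.rawOut j))) (fun j => xor (a' j) (K (2 * C.rawOut j))) := by
    intro x x'
    rw [← hC.chan_pauli fun i hi => keyMem_of_le k hi]
    have hk0 : ∀ i : Fin n, keyMem k (2 * i) = k i 0 := fun i => keyMem_apply k i 0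
    have hk1 : ∀ i : Fin n, keyMem k (2 * i + 1) = k i 1 := fun i => keyMem_apply k i 1
    simp only [hk0, hk1]
  have h5 : ∀ x x' : Bits n, ρ x x' * ((∏ i, sg (k i 1 && xor (x i) (x' i))) *
      ((∏ j, ((∏ s, (E.decProb κ sk (unpairs z j s) (τ j s) : ℂ)) *
        sg (τ j 1 && xor (b j) (b' j)))) * C.chan (Matrix.single (fun i => xor (x i) (k i 0))
          (fun i => xor (x' i) (k i 0)) 1) a a')) =
      (∏ j, ((∏ s, (E.decProb κ sk (unpairs z j s) (τ j s) : ℂ)) *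
        sg (τ j 1 && xor (b j) (b' j)))) *
      (∏ j, sg (K (2 * C.rawOut j + 1) && xor (a j) (a' j))) * (ρ x x' *
        C.chan (Matrix.single x x' 1)
        (fun j => xor (a j) (K (2 * C.rawOut j))) (fun j => xor (a' j) (K (2 * C.rawOut j)))) := by
    intro x x'
    rw [← mul_assoc (∏ i, sg (k i 1 && xor (x i) (x' i))), mul_comm (∏ i, sg (k i 1 && _)),
      mul_assoc, h4]
    ring
  simp only [h5, ← Finset.mul_sum]
  rw [← C.chan_eq_sum, pauliOp, Matrix.of_apply]
  have hr0 : ∀ j, residual E κ C k (pairs τ) j 0 = xor (τ j 0) (K (2 * C.rawOut j)) := fun j => by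
    have := outKey_eq E κ C k j 0
    have h := congrFun (congrFun (unpairs_pairs τ) j) 0
    rw [residual]
    simp only [unpairs] at h ⊢
    rw [h, this]
    rfl
  have hr1 : ∀ j, residual E κ C k (pairs τ) j 1 = xor (τ j 1) (K (2 * C.rawOut j + 1)) :=
    fun j => by
    have := outKey_eq E κ C k j 1
    have h := congrFun (congrFun (unpairs_pairs τ) j) 1
    rw [residual]
    simp only [unpairs] at h ⊢
    rw [h, this]
    rfl
  change _ = _ * ((∏ j, sg (residual E κ C k (pairs τ) j 1 && xor (b j) (b' j))) *
    C.chan ρ (fun j => xor (b j) (residual E κ C k (pairs τ) j 0))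
      (fun j => xor (b' j) (residual E κ C k (pairs τ) j 0)))
  simp only [hr0, hr1]
  rw [← mul_assoc]
  congr 1
  · rw [← Finset.prod_mul_distrib, prod_pairs]
    push_cast
    rw [← Finset.prod_mul_distrib]
    refine Finset.prod_congr rfl fun j _ => ?_
    have h6 : ∀ s : Fin 2, pairs τ ⟨2 * j + s, by omega⟩ = τ j s := fun s =>
      congrFun (congrFun (unpairs_pairs τ) j) s
    have h7 : xor (a j) (a' j) = xor (b j) (b' j) := by
      simp only [a, a']
      cases b j <;> cases b' j <;> cases τ j 0 <;> rfl
    rw [h7]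
    change _ = (∏ s : Fin 2, ((E.decProb κ sk (z ⟨2 * j + s, _⟩)
      (pairs τ ⟨2 * j + s, by omega⟩) : ℝ) : ℂ)) * _
    simp only [h6]
    rw [mul_assoc]
    congr 1
    cases τ j 1 <;> cases K (2 * C.rawOut j + 1) <;> cases xor (b j) (b' j) <;> simp
  · congr 1 <;> funext j <;> simp only [a, a', Bool.xor_assoc]

theorem sum_rearrange {α β γ δ : Type} [Fintype α] [Fintype β] [Fintype γ] [Fintype δ]
    (r S : α → α → ℂ) (D : α → α → β → β → ℂ) (P : γ → ℂ) (Q : γ → δ → ℂ)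
    (K : δ → β → β → ℂ) :
    ∑ x, ∑ x', r x x' * (S x x' * ∑ a, ∑ b, D x x' a b * ∑ ys, P ys * ∑ z, Q ys z * K z a b) =
      ∑ ys, P ys * ∑ z, Q ys z *
        ∑ x, ∑ x', r x x' * (S x x' * ∑ a, ∑ b, D x x' a b * K z a b) := by
  simp only [Finset.mul_sum]
  refine (Finset.sum_congr rfl fun x _ => Finset.sum_congr rfl fun x' _ => sum_comm_pair _).trans
    ((sum_comm_pair _).trans ?_)
  refine Finset.sum_congr rfl fun _ _ => Finset.sum_congr rfl fun _ _ => Finset.sum_congr rfl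
    fun _ _ => Finset.sum_congr rfl fun _ _ => Finset.sum_congr rfl fun _ _ =>
      Finset.sum_congr rfl fun _ _ => ?_
  ring

/-- Writing out encryption, evaluation and decryption leaves classical probabilities times residual
Pauli operators applied to the correct output. No approximation is made: the error of the scheme is
entirely the chance that the residual is nontrivial. -/
theorem process_apply (hC : C.IsStabilizer) (pk : Bits (E.pkLen κ)) (sk : Bits (E.skLen κ))
    (ρ : Op (Bits n)) (b b' : Bits m) :
    (scheme E).process κ C pk sk ρ b b' = ∑ e, ∑ k, ∑ y, ∑ ys, ∑ z, ∑ τ,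
      ((E.keyProb κ pk sk e * inputProb E κ pk k y * outputProb E κ C pk sk e y ys z τ : ℝ) : ℂ) *
        pauliOp (residual E κ C k τ) (C.chan ρ) b b' := by
  set σ : Op (Bits (E.pkLen κ + E.evkLen κ)) := (scheme E).evkState κ pk sk with hσ
  set Y : Op (Fin n → Bits (1 + 2 * E.ctLen κ)) := tensorPow n ((scheme E).encChan κ pk) ρ with hY
  -- Decryption is absorbed into the functional on the output of evaluation.
  have h1 : (scheme E).process κ C pk sk ρ b b' = ∑ A, ∑ A',
      (evalCircuit E κ C).chan (tensor σ (Y.submatrix blocks blocks)) A A' *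
        decK E κ sk (ipLen E κ n) b b' A A' := by
    have h : (scheme E).process κ C pk sk ρ b b' =
        ∑ a : Fin m → Bits (1 + 2 * ipLen E κ n), ∑ a' : Fin m → Bits (1 + 2 * ipLen E κ n),
          (evalCircuit E κ C).chan (tensor σ (Y.submatrix blocks blocks)) (flat a) (flat a') *
          ∏ j, (scheme E).decChan κ sk (Matrix.single (a j) (a' j) 1) (b j) (b' j) := rfl
    rw [h, ← (flatEquiv m (1 + 2 * ipLen E κ n)).sum_comp]
    refine Finset.sum_congr rfl fun a _ => ?_
    rw [← (flatEquiv m (1 + 2 * ipLen E κ n)).sum_comp]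
    refine Finset.sum_congr rfl fun a' _ => ?_
    change _ = _ * decK E κ sk (ipLen E κ n) b b' (flat a) (flat a')
    rw [decK, blocks_flat, blocks_flat]
    rfl
  rw [h1, QCircuit.sum_chan_mul]
  set G : Bits (E.pkLen κ + E.evkLen κ + n * (1 + 2 * E.ctLen κ)) →
      Bits (E.pkLen κ + E.evkLen κ + n * (1 + 2 * E.ctLen κ)) → ℂ := fun u v =>
    heisL (evalCircuit E κ C).rawGates (obsK (evalCircuit E κ C).rawOut
      (decK E κ sk (ipLen E κ n) b b')) (mem u) (mem v) with hG
  refine (sum_tensor_mul σ (Y.submatrix blocks blocks) G).trans ?_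
  have h2 : ∀ k k', (∑ c, ∑ c', σ k k' * (Y.submatrix blocks blocks) c c' *
      G (Fin.append k c) (Fin.append k' c')) = σ k k' * ∑ c, ∑ c', Y c c' *
        G (Fin.append k (flat c)) (Fin.append k' (flat c')) := by
    intro k k'
    rw [Finset.mul_sum, ← (flatEquiv n (1 + 2 * E.ctLen κ)).sum_comp]
    refine Finset.sum_congr rfl fun a _ => ?_
    rw [Finset.mul_sum, ← (flatEquiv n (1 + 2 * E.ctLen κ)).sum_comp]
    refine Finset.sum_congr rfl fun a' _ => ?_
    change σ k k' * Y (blocks (flat a)) (blocks (flat a')) *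
      G (Fin.append k (flat a)) (Fin.append k' (flat a')) = _
    rw [blocks_flat, blocks_flat, mul_assoc]
  refine (Finset.sum_congr rfl fun k _ => Finset.sum_congr rfl fun k' _ => h2 k k').trans ?_
  rw [sum_classical (evkState_scheme E κ pk sk) (fun k k' => ∑ c, ∑ c', Y c c' *
        G (Fin.append k (flat c)) (Fin.append k' (flat c')))]
  refine Finset.sum_congr rfl fun e _ => ?_
  refine (congrArg (fun t => (E.keyProb κ pk sk e : ℂ) * t)
    (sum_encChan E κ pk ρ (fun c c' => G (Fin.append (Fin.append pk e) (flat c))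
    (Fin.append (Fin.append pk e) (flat c'))))).trans ?_
  rw [Finset.mul_sum]
  refine Finset.sum_congr rfl fun k _ => ?_
  rw [Finset.mul_sum]
  refine Finset.sum_congr rfl fun y _ => ?_
  have h3 : ∀ x x' : Bits n, G (Fin.append (Fin.append pk e)
      (flat fun i => pack (xor (x i) (k i 0)) (y i))) (Fin.append (Fin.append pk e)
      (flat fun i => pack (xor (x' i) (k i 0)) (y i))) = _ := fun x x' =>
    heisL_evalGates E κ C pk e (fun i => xor (x i) (k i 0)) (fun i => xor (x' i) (k i 0)) y
      (decK E κ sk (ipLen E κ n) b b')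
  simp only [h3]
  refine (congrArg (fun t => (E.keyProb κ pk sk e : ℂ) * ((inputProb E κ pk k y : ℂ) * t))
    (sum_rearrange (fun x x' => ρ x x') (fun x x' : Bits n => ∏ i, sg (k i 1 && xor (x i) (x' i)))
      (fun x x' a a' => C.chan (Matrix.single (fun i => xor (x i) (k i 0))
        (fun i => xor (x' i) (k i 0)) 1) a a') _ _
      (fun (z : Fin (2 * m) → Bits (ipLen E κ n)) a a' => decK E κ sk (ipLen E κ n) b b'
        (flat fun j => pack (a j) (unpairs z j)) (flat fun j => pack (a' j) (unpairs z j))))).trans ?_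
  simp only [sum_decK E κ C hC sk k]
  simp only [Finset.mul_sum]
  refine Finset.sum_congr rfl fun ys _ => Finset.sum_congr rfl fun z _ => Finset.sum_congr rfl
    fun τ _ => ?_
  rw [outputProb]
  push_cast
  ring

end Correctness

/-! ## Correctness -/

theorem RandCircuit.prob_nonneg {n m : ℕ} (R : RandCircuit n m) (x : Bits n) (y : Bits m) :
    0 ≤ R.prob x y := by
  unfold RandCircuit.prob
  positivity

theorem RandCircuit.sum_prob {n m : ℕ} (R : RandCircuit n m) (x : Bits n) :
    ∑ y, R.prob x y = 1 := by
  have h := R.sum_prob_mul x (fun _ => 1)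
  simp only [mul_one, Finset.sum_const, Finset.card_univ, Fintype.card_pi, Fintype.card_bool,
    Finset.prod_const, Fintype.card_fin, nsmul_eq_mul] at h
  have h2 : ((∑ y, R.prob x y : ℝ) : ℂ) = 1 := by
    push_cast
    rw [h]
    push_cast
    field_simp
  exact_mod_cast h2

/-- The marginal of a product distribution. -/
theorem sum_prod_marginal {ι β : Type} [Fintype ι] [DecidableEq ι] [Fintype β] {w : ι → β → ℝ}
    (hw : ∀ i, ∑ b, w i b = 1) (j : ι) (g : β → ℝ) :
    ∑ f : ι → β, (∏ i, w i (f i)) * g (f j) = ∑ b, w j b * g b := by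
  have h : ∀ f : ι → β, (∏ i, w i (f i)) * g (f j) =
      ∏ i, (w i (f i) * if i = j then g (f i) else 1) := by
    intro f
    rw [Finset.prod_mul_distrib, Finset.prod_ite_eq' Finset.univ j, if_pos (Finset.mem_univ _)]
  simp only [h]
  rw [← Fintype.prod_sum fun i b => w i b * if i = j then g b else 1,
    Finset.prod_eq_single j]
  · simp
  · intro i _ hi
    simp [hi, hw]
  · simp

theorem sum_prod_eq_one {ι β : Type} [Fintype ι] [DecidableEq ι] [Fintype β] {w : ι → β → ℝ}
    (hw : ∀ i, ∑ b, w i b = 1) : ∑ f : ι → β, ∏ i, w i (f i) = 1 := by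
  rw [← Fintype.prod_sum]
  simp [hw]

theorem dot_add_of_zero {l : ℕ} (s k : Mem) (hk : ∀ i, l ≤ i → k i = false) (d : ℕ) :
    dot (l + d) s k = dot l s k := by
  induction d with
  | zero => rfl
  | succ d ih => rw [← Nat.add_assoc, dot, ih, hk _ (Nat.le_add_right _ _)]; simp

theorem dot_congr {l : ℕ} {s s' k k' : Mem} (hs : ∀ i < l, s i = s' i) (hk : ∀ i < l, k i = k' i) :
    dot l s k = dot l s' k' := by
  induction l with
  | zero => rfl
  | succ l ih =>
    rw [dot, dot, ih (fun i hi => hs i (by omega)) (fun i hi => hk i (by omega)), hs l (by omega),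
      hk l (by omega)]

/-! ### Failure probabilities and the error bound. -/

section Correct

variable (E : ClassicalHE) (κ : ℕ) {n m : ℕ} (C : QCircuit n m)

theorem keyProb_nonneg (pk : Bits (E.pkLen κ)) (sk : Bits (E.skLen κ)) (e : Bits (E.evkLen κ)) :
    0 ≤ E.keyProb κ pk sk e := RandCircuit.prob_nonneg _ _ _

theorem sum_encProb (pk : Bits (E.pkLen κ)) (b : Bool) : ∑ c, E.encProb κ pk b c = 1 :=
  RandCircuit.sum_prob _ _

theorem sum_evalProb {l : ℕ} (f : ArithCircuit l 1) (e : Bits (E.evkLen κ))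
    (c : Fin l → Bits (E.ctLen κ)) : ∑ c', E.evalProb κ f e c c' = 1 :=
  RandCircuit.sum_prob _ _

theorem sum_decProb {L : ℕ} (sk : Bits (E.skLen κ)) (c : Bits L) :
    ∑ b, E.decProb κ sk c b = 1 := by
  rw [← RandCircuit.sum_prob (E.dec κ L) (Fin.append sk c),
    ← (Equiv.funUnique (Fin 1) Bool).symm.sum_comp]
  rfl

theorem inputProb_nonneg (pk : Bits (E.pkLen κ)) (k : Fin n → Bits 2)
    (y : Fin n → Fin 2 → Bits (E.ctLen κ)) : 0 ≤ inputProb E κ pk k y :=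
  Finset.prod_nonneg fun _ _ => mul_nonneg (by norm_num)
    (Finset.prod_nonneg fun _ _ => RandCircuit.prob_nonneg _ _ _)

theorem outputProb_nonneg (pk : Bits (E.pkLen κ)) (sk : Bits (E.skLen κ)) (e : Bits (E.evkLen κ))
    (y : Fin n → Fin 2 → Bits (E.ctLen κ)) (ys : Fin (2 * m) → Fin (2 * n) → Bits (E.ctLen κ))
    (z : Fin (2 * m) → Bits (ipLen E κ n)) (τ : Fin (2 * m) → Bool) :
    0 ≤ outputProb E κ C pk sk e y ys z τ :=
  mul_nonneg (Finset.prod_nonneg fun _ _ => Finset.prod_nonneg fun _ _ =>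
    RandCircuit.prob_nonneg _ _ _) (mul_nonneg (Finset.prod_nonneg fun _ _ =>
      RandCircuit.prob_nonneg _ _ _) (Finset.prod_nonneg fun _ _ => RandCircuit.prob_nonneg _ _ _))

theorem inputProb_eq (pk : Bits (E.pkLen κ)) (k : Fin n → Bits 2)
    (y : Fin n → Fin 2 → Bits (E.ctLen κ)) : inputProb E κ pk k y =
      (1 / 4) ^ n * ∏ i, E.encProb κ pk (pairs k i) (pairs y i) := by
  rw [inputProb, Finset.prod_mul_distrib, Finset.prod_const, Finset.card_univ, Fintype.card_fin,
    prod_pairs]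
  refine congrArg _ (Finset.prod_congr rfl fun i _ => Finset.prod_congr rfl fun s _ => ?_)
  rw [show pairs k ⟨2 * i + s, _⟩ = k i s from congrFun (congrFun (unpairs_pairs k) i) s,
    show pairs y ⟨2 * i + s, _⟩ = y i s from congrFun (congrFun (unpairs_pairs y) i) s]

/-- The marginal law of the `j`-th decrypted key: the other evaluations are independent given `y`
and sum to `1`. -/
theorem sum_outputProb_mul (pk : Bits (E.pkLen κ)) (sk : Bits (E.skLen κ)) (e : Bits (E.evkLen κ))
    (y : Fin n → Fin 2 → Bits (E.ctLen κ)) (j : Fin (2 * m)) (g : Bool → ℝ) :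
    ∑ ys, ∑ z, ∑ τ, outputProb E κ C pk sk e y ys z τ * g (τ j) =
      ∑ c : Fin (2 * n) → Bits (E.ctLen κ), (∏ i : Fin (2 * n),
        E.encProb κ pk (evalForm E κ C j i) (c i)) *
        ∑ c', E.evalProb κ (ipCircuit (2 * n)) e (Fin.append (pairs y) c) c' *
          ∑ b, E.decProb κ sk c' b * g b := by
  have h1 : ∀ ys z, ∑ τ, outputProb E κ C pk sk e y ys z τ * g (τ j) =
      (∏ j : Fin (2 * m), ∏ i : Fin (2 * n), E.encProb κ pk (evalForm E κ C j i) (ys j i)) *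
      ((∏ j, E.evalProb κ (ipCircuit (2 * n)) e (Fin.append (pairs y) (ys j)) (z j)) *
        ∑ b, E.decProb κ sk (z j) b * g b) := by
    intro ys z
    rw [← sum_prod_marginal (fun i => sum_decProb E κ sk (z i)) j g, Finset.mul_sum, Finset.mul_sum]
    refine Finset.sum_congr rfl fun τ _ => ?_
    rw [outputProb]
    ring
  have h2 : ∀ ys, ∑ z, ∑ τ, outputProb E κ C pk sk e y ys z τ * g (τ j) =
      (∏ j : Fin (2 * m), ∏ i : Fin (2 * n), E.encProb κ pk (evalForm E κ C j i) (ys j i)) *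
      ∑ c', E.evalProb κ (ipCircuit (2 * n)) e (Fin.append (pairs y) (ys j)) c' *
        ∑ b, E.decProb κ sk c' b * g b := by
    intro ys
    simp only [h1]
    rw [← Finset.mul_sum, sum_prod_marginal (fun i => sum_evalProb E κ (ipCircuit (2 * n)) e
      (Fin.append (pairs y) (ys i))) j fun c' => ∑ b, E.decProb κ sk c' b * g b]
  simp only [h2]
  exact sum_prod_marginal (w := fun (j : Fin (2 * m)) (c : Fin (2 * n) → Bits (E.ctLen κ)) =>
    ∏ i : Fin (2 * n), E.encProb κ pk (evalForm E κ C j i) (c i))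
    (fun j => sum_prod_eq_one fun i : Fin (2 * n) => sum_encProb E κ pk (evalForm E κ C j i)) j
    fun c => ∑ c', E.evalProb κ (ipCircuit (2 * n)) e (Fin.append (pairs y) c) c' *
          ∑ b, E.decProb κ sk c' b * g b

theorem sum_outputProb (pk : Bits (E.pkLen κ)) (sk : Bits (E.skLen κ)) (e : Bits (E.evkLen κ))
    (y : Fin n → Fin 2 → Bits (E.ctLen κ)) :
    ∑ ys, ∑ z, ∑ τ, outputProb E κ C pk sk e y ys z τ = 1 := by
  simp only [outputProb, ← Finset.mul_sum]
  have h1 : ∀ z : Fin (2 * m) → Bits (ipLen E κ n),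
      ∑ τ : Fin (2 * m) → Bool, ∏ j, E.decProb κ sk (z j) (τ j) = 1 :=
    fun z => sum_prod_eq_one fun j => sum_decProb E κ sk (z j)
  have h2 : ∀ ys : Fin (2 * m) → Fin (2 * n) → Bits (E.ctLen κ),
      ∑ z : Fin (2 * m) → Bits (ipLen E κ n),
        ∏ j, E.evalProb κ (ipCircuit (2 * n)) e (Fin.append (pairs y) (ys j)) (z j) = 1 :=
    fun ys => sum_prod_eq_one fun j => sum_evalProb E κ _ e _
  simp only [h1, mul_one, h2]
  exact sum_prod_eq_one (w := fun (j : Fin (2 * m)) (c : Fin (2 * n) → Bits (E.ctLen κ)) =>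
    ∏ i : Fin (2 * n), E.encProb κ pk (evalForm E κ C j i) (c i))
    fun j => sum_prod_eq_one fun i : Fin (2 * n) => sum_encProb E κ pk (evalForm E κ C j i)

/-- There are `4 ^ n` keys, each with weight `(1 / 4) ^ n`. -/
theorem sum_inputProb (pk : Bits (E.pkLen κ)) :
    ∑ k : Fin n → Bits 2, ∑ y, inputProb E κ pk k y = 1 := by
  have h : ∀ k : Fin n → Bits 2, ∑ y, inputProb E κ pk k y = (1 / 4) ^ n := by
    intro k
    simp only [inputProb_eq, ← Finset.mul_sum]
    have h := (pairsEquiv n (Bits (E.ctLen κ))).sum_comp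
      (fun y => ∏ i, E.encProb κ pk (pairs k i) (y i))
    rw [sum_prod_eq_one fun i => sum_encProb E κ pk (pairs k i)] at h
    change _ * ∑ y, ∏ i, E.encProb κ pk (pairs k i) (pairsEquiv n (Bits (E.ctLen κ)) y i) = _
    rw [h, mul_one]
  simp only [h, Finset.sum_const, Finset.card_univ, Fintype.card_pi, Fintype.card_bool,
    Finset.prod_const, Fintype.card_fin, nsmul_eq_mul]
  push_cast
  rw [← mul_pow]
  norm_num

/-- The plaintexts under the encryptions that the `j`-th evaluation uses. -/
def evalPlain (k : Fin n → Bits 2) (j : ℕ) : Bits (2 * n + 2 * n) :=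
  Fin.append (pairs k) fun i => evalForm E κ C j i

/-- By `dot_formVec` the true output key is an inner product over the keys of all wires. The keys of
fresh wires are `0`, so the first `2 * n` coordinates suffice. -/
theorem eval_evalPlain (k : Fin n → Bits 2) {j : ℕ} (hj : j < 2 * m) :
    (ipCircuit (2 * n)).eval (evalPlain E κ C k j) 0 = outKey E κ C k j := by
  have ht := evalArgs_target_lt E κ C hj
  rw [evalArgs_w2] at ht
  rw [ipCircuit_eval, outKey, ← dot_formVec C.goodOn ht, Nat.mul_add,
    dot_add_of_zero _ _ fun i hi => keyMem_of_le k hi, dot_comm]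
  refine dot_congr (fun i hi => ?_) (fun i hi => ?_)
  · rw [mem_of_lt _ (by omega)]
    exact Fin.append_right (pairs k) (fun i : Fin (2 * n) => evalForm E κ C j i) ⟨i, hi⟩
  · rw [mem_of_lt _ (by omega), keyMem, mem_of_lt _ hi]
    exact Fin.append_left (pairs k) _ ⟨i, hi⟩

/-- The ciphertexts of the keys and of the coefficients are independent encryptions of the
plaintexts in `evalPlain`. A wrong `j`-th key is therefore a failure of homomorphic evaluation of
the inner product on these plaintexts, averaged over the pad. -/
theorem sum_fail (pk : Bits (E.pkLen κ)) (sk : Bits (E.skLen κ)) (j : Fin (2 * m)) :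
    ∑ e, ∑ k, ∑ y, ∑ ys, ∑ z, ∑ τ : Fin (2 * m) → Bool,
      (if τ j = outKey E κ C k j then 0 else
        E.keyProb κ pk sk e * inputProb E κ pk k y * outputProb E κ C pk sk e y ys z τ) =
    ∑ k, (1 / 4) ^ n * ∑ e, E.keyProb κ pk sk e *
      ∑ c : Fin (2 * n + 2 * n) → Bits (E.ctLen κ),
        (∏ i, E.encProb κ pk (evalPlain E κ C k j i) (c i)) *
        ∑ c', E.evalProb κ (ipCircuit (2 * n)) e c c' *
          E.decProb κ sk c' (!((ipCircuit (2 * n)).eval (evalPlain E κ C k j) 0)) := by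
  rw [Finset.sum_comm]
  refine Finset.sum_congr rfl fun k _ => ?_
  rw [Finset.mul_sum]
  refine Finset.sum_congr rfl fun e _ => ?_
  rw [eval_evalPlain E κ C k j.2]
  set K := outKey E κ C k j
  have h1 : ∀ y, (∑ ys, ∑ z, ∑ τ : Fin (2 * m) → Bool, if τ j = K then 0 else
      E.keyProb κ pk sk e * inputProb E κ pk k y * outputProb E κ C pk sk e y ys z τ) =
      E.keyProb κ pk sk e * inputProb E κ pk k y *
      ∑ c : Fin (2 * n) → Bits (E.ctLen κ), (∏ i : Fin (2 * n),
        E.encProb κ pk (evalForm E κ C j i) (c i)) *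
        ∑ c', E.evalProb κ (ipCircuit (2 * n)) e (Fin.append (pairs y) c) c' *
          E.decProb κ sk c' (!K) := by
    intro y
    have h := sum_outputProb_mul E κ C pk sk e y j fun b => if b = K then 0 else 1
    have h3 : ∀ c' : Bits (ipLen E κ n), (∑ b, E.decProb κ sk c' b * if b = K then 0 else 1) =
        E.decProb κ sk c' (!K) := by
      intro c'
      cases K <;> simp
    simp only [h3] at h
    rw [← h]
    simp only [Finset.mul_sum]
    refine Finset.sum_congr rfl fun ys _ => Finset.sum_congr rfl fun z _ =>
      Finset.sum_congr rfl fun τ _ => ?_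
    split_ifs <;> simp
  simp only [h1]
  rw [← (Fin.appendEquiv (α := Bits (E.ctLen κ)) (2 * n) (2 * n)).sum_comp, Fintype.sum_prod_type,
    ← (pairsEquiv n (Bits (E.ctLen κ))).sum_comp, Finset.mul_sum, Finset.mul_sum]
  refine Finset.sum_congr rfl fun y _ => ?_
  rw [inputProb_eq, Finset.mul_sum, Finset.mul_sum, Finset.mul_sum]
  refine Finset.sum_congr rfl fun c _ => ?_
  change _ = _ * (_ * ((∏ i, E.encProb κ pk (evalPlain E κ C k j i) (Fin.append (pairs y) c i)) *
    ∑ c', E.evalProb κ (ipCircuit (2 * n)) e (Fin.append (pairs y) c) c' *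
          E.decProb κ sk c' (!K)))
  rw [Fin.prod_univ_add]
  simp only [evalPlain, Fin.append_left, Fin.append_right]
  ring

/-- The outer factor `2` comes from the trace norm of a mixture, and `2 * m` from a union bound over
the output keys. -/
theorem evalError_le {d : ℕ} (hC : C.IsStabilizer) {ρ : Op (Bits n × Fin d)} (hρ : IsDensity ρ)
    {δ : ℝ} (hδ : ∀ μ, E.failProb κ (ipCircuit (2 * n)) μ ≤ δ) :
    (scheme E).evalError κ C ρ ≤ 2 * (2 * m * δ) := by
  have h1 : ∀ (pk : Bits (E.pkLen κ)) (sk : Bits (E.skLen κ)), traceNorm (withEnv (Fin d) ((scheme E).process κ C pk sk) ρ -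
      ((scheme E).evkState κ pk sk).trace • withEnv (Fin d) C.chan ρ) ≤
      2 * ∑ j : Fin (2 * m), ∑ k, (1 / 4) ^ n * ∑ e, E.keyProb κ pk sk e *
      ∑ c : Fin (2 * n + 2 * n) → Bits (E.ctLen κ),
        (∏ i, E.encProb κ pk (evalPlain E κ C k j i) (c i)) *
        ∑ c', E.evalProb κ (ipCircuit (2 * n)) e c c' *
          E.decProb κ sk c' (!((ipCircuit (2 * n)).eval (evalPlain E κ C k j) 0)) := by
    intro pk sk
    let Ω := Bits (E.evkLen κ) × (Fin n → Bits 2) × (Fin n → Fin 2 → Bits (E.ctLen κ)) ×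
      (Fin (2 * m) → Fin (2 * n) → Bits (E.ctLen κ)) × (Fin (2 * m) → Bits (ipLen E κ n)) ×
      (Fin (2 * m) → Bool)
    let q : Ω → ℝ := fun ω => E.keyProb κ pk sk ω.1 * inputProb E κ pk ω.2.1 ω.2.2.1 *
      outputProb E κ C pk sk ω.1 ω.2.2.1 ω.2.2.2.1 ω.2.2.2.2.1 ω.2.2.2.2.2
    let t : Ω → Fin m → Bits 2 := fun ω => residual E κ C ω.2.1 ω.2.2.2.2.2
    have hq : ∀ ω, 0 ≤ q ω := fun ω => mul_nonneg (mul_nonneg (keyProb_nonneg E κ _ _ _)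
      (inputProb_nonneg E κ _ _ _)) (outputProb_nonneg E κ C _ _ _ _ _ _ _)
    have hΦ : ∀ ρ, (scheme E).process κ C pk sk ρ = ∑ ω, (q ω : ℂ) • pauliOp (t ω) (C.chan ρ) := by
      intro ρ
      refine Matrix.ext fun b b' => (process_apply E κ C hC pk sk ρ b b').trans ?_
      simp only [Matrix.sum_apply, Matrix.smul_apply, smul_eq_mul, Ω, q, t, Fintype.sum_prod_type]
    have hT : ((scheme E).evkState κ pk sk).trace = ∑ ω, (q ω : ℂ) := by
      have hs : ∑ ω, q ω = ∑ e, E.keyProb κ pk sk e := by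
        simp only [Ω, q, Fintype.sum_prod_type, ← Finset.mul_sum, sum_outputProb, mul_one,
          sum_inputProb]
      rw [← Complex.ofReal_sum, hs]
      rw [Complex.ofReal_sum]
      exact trace_classical (evkState_scheme E κ pk sk)
    refine (traceNorm_mixture hq C hΦ hT hρ).trans ?_
    refine mul_le_mul_of_nonneg_left ?_ (by norm_num)
    -- A nontrivial residual means that at least one decrypted key is wrong.
    have h2 : ∀ ω, (if t ω = fun _ _ => false then 0 else q ω) ≤
        ∑ j, if ω.2.2.2.2.2 j = outKey E κ C ω.2.1 j then 0 else q ω := by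
      intro ω
      have hnn : ∀ j ∈ Finset.univ, 0 ≤
          if ω.2.2.2.2.2 j = outKey E κ C ω.2.1 j then 0 else q ω := fun j _ => by
        split_ifs
        · exact le_rfl
        · exact hq ω
      split_ifs with h
      · exact Finset.sum_nonneg hnn
      · obtain ⟨j, hj⟩ : ∃ j, ω.2.2.2.2.2 j ≠ outKey E κ C ω.2.1 j := by
          by_contra! h'
          refine h (funext fun k => funext fun s => ?_)
          simp only [t, residual, unpairs, h', bne_self_eq_false]
        refine le_trans ?_ (Finset.single_le_sum hnn (Finset.mem_univ j))
        rw [if_neg hj]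
    refine (Finset.sum_le_sum fun ω _ => h2 ω).trans ?_
    rw [Finset.sum_comm]
    refine Finset.sum_le_sum fun j _ => ?_
    rw [← sum_fail E κ C pk sk j]
    simp only [Ω, q, Fintype.sum_prod_type]
    exact le_rfl
  have h2 : (scheme E).evalError κ C ρ ≤ ∑ pk, ∑ sk,
      2 * ∑ j : Fin (2 * m), ∑ k, (1 / 4) ^ n * ∑ e, E.keyProb κ pk sk e *
      ∑ c : Fin (2 * n + 2 * n) → Bits (E.ctLen κ),
        (∏ i, E.encProb κ pk (evalPlain E κ C k j i) (c i)) *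
        ∑ c', E.evalProb κ (ipCircuit (2 * n)) e c c' *
          E.decProb κ sk c' (!((ipCircuit (2 * n)).eval (evalPlain E κ C k j) 0)) :=
    Finset.sum_le_sum fun pk _ => Finset.sum_le_sum fun sk _ => h1 pk sk
  refine h2.trans ?_
  have h3 : ∀ F : Bits (E.pkLen κ) → Bits (E.skLen κ) → Fin (2 * m) → (Fin n → Bits 2) → ℝ,
      ∑ pk, ∑ sk, 2 * ∑ j, ∑ k, (1 / 4) ^ n * F pk sk j k =
        2 * ∑ j, ∑ k, (1 / 4) ^ n * ∑ pk, ∑ sk, F pk sk j k := by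
    intro F
    simp only [Finset.mul_sum]
    rw [sum_comm_pair]
  refine (h3 _).trans_le (mul_le_mul_of_nonneg_left ?_ (by norm_num))
  have h5 : ∀ j : Fin (2 * m), ∑ k, (1 / 4) ^ n * E.failProb κ (ipCircuit (2 * n))
      (evalPlain E κ C k j) ≤ δ := by
    intro j
    refine (Finset.sum_le_sum fun k _ => mul_le_mul_of_nonneg_left (hδ _) (by positivity)).trans
      (le_of_eq ?_)
    simp only [Finset.sum_const, Finset.card_univ, Fintype.card_pi, Fintype.card_bool,
      Finset.prod_const, Fintype.card_fin, nsmul_eq_mul]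
    push_cast
    rw [← mul_assoc, ← mul_pow]
    norm_num
  refine (Finset.sum_le_sum fun j _ => h5 j).trans (le_of_eq ?_)
  simp

end Correct

theorem Negligible.mul_polynomial {ε : ℕ → ℝ} (h : Negligible ε) (p : Polynomial ℕ) :
    Negligible fun κ => ((p.eval κ : ℕ) : ℝ) * ε κ := by
  have := Asymptotics.SuperpolynomialDecay.polynomial_mul h (p.map (Nat.castRingHom ℝ))
  refine this.congr fun κ => ?_
  rw [Polynomial.eval_natCast_map]
  rfl

/-- Classical correctness speaks of one plaintext sequence, whereas all pads and all output keys
occur here. Since there are finitely many plaintexts for each `κ`, a worst one can be chosen, and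
its failure probability bounds all the others. -/
theorem homomorphicFor_stabilizer {E : ClassicalHE} (hE : E.Homomorphic) :
    (scheme E).HomomorphicFor stabilizerCircuits := by
  intro n m d C ρ hC ⟨p, hp⟩ hρ
  have hmax : ∀ κ, ∃ μ, ∀ μ', E.failProb κ (ipCircuit (2 * n κ)) μ' ≤
      E.failProb κ (ipCircuit (2 * n κ)) μ := fun κ => Finite.exists_max _
  choose μ hμ using hmax
  obtain ⟨ε, hε, hle⟩ := hE (fun κ => 2 * n κ + 2 * n κ) (fun κ => ipCircuit (2 * n κ)) μ
    -- The inner product circuit of length `2 * n` has size `8 * n + 1`, and `n` is at most the size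
    -- of the evaluated circuit.
    ⟨8 * p + 1, fun κ => by
      rw [ipCircuit_size]
      have := hp κ
      simp only [QCircuit.size] at this
      simp only [Polynomial.eval_add, Polynomial.eval_mul, Polynomial.eval_ofNat,
        Polynomial.eval_one]
      omega⟩
  refine ⟨fun κ => (((4 * p).eval κ : ℕ) : ℝ) * ε κ, hε.mul_polynomial _, fun κ => ?_⟩
  have hm : m κ ≤ p.eval κ := by
    refine le_trans ?_ (hp κ)
    have := Fintype.card_le_of_injective _ (C κ).out.injective
    simp only [Fintype.card_fin] at this
    exact this.trans (Nat.le_add_right _ _)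
  -- `ε` bounds a probability, so it is nonnegative, and `m` may be replaced by its polynomial
  -- bound.
  have h0 : 0 ≤ ε κ := by
    refine le_trans ?_ (hle κ)
    exact Finset.sum_nonneg fun pk _ => Finset.sum_nonneg fun sk _ => Finset.sum_nonneg fun e _ =>
      mul_nonneg (keyProb_nonneg E κ _ _ _) (Finset.sum_nonneg fun c _ => mul_nonneg
        (Finset.prod_nonneg fun _ _ => RandCircuit.prob_nonneg _ _ _)
        (Finset.sum_nonneg fun c' _ => mul_nonneg (RandCircuit.prob_nonneg _ _ _)
          (RandCircuit.prob_nonneg _ _ _)))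
  refine (evalError_le E κ (C κ) (hC κ) (hρ κ) fun μ' => (hμ κ μ').trans (hle κ)).trans ?_
  have hm' : (m κ : ℝ) ≤ ((p.eval κ : ℕ) : ℝ) := by exact_mod_cast hm
  simp only [Polynomial.eval_mul, Polynomial.eval_ofNat]
  push_cast
  nlinarith [mul_le_mul_of_nonneg_right hm' h0]

/-! ## Compactness -/

theorem length_flatMap_range_le {α : Type} {f : ℕ → List α} {b : ℕ} (n : ℕ)
    (h : ∀ i, (f i).length ≤ b) : ((List.range n).flatMap f).length ≤ n * b := by
  induction n with
  | zero => simp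
  | succ n ih =>
    rw [List.range_succ, List.flatMap_append, List.length_append, List.flatMap_cons,
      List.flatMap_nil, List.append_nil, Nat.succ_mul]
    have := h n
    omega

/-- The longest case is a Toffoli gate, with 21 gates; any constant would do. -/
theorem length_arithGates_le (o t : ℕ) (g : ArithGate) : (arithGates o t g).length ≤ 30 := by
  cases g with
  | const b => cases b <;> simp [arithGates]
  | add i j => simp only [arithGates, List.length_append]; split_ifs <;> simp
  | mul i j =>
    simp only [arithGates]
    split_ifs <;> simp [toffoli, cczGates, tdg]

theorem length_callGates_le (R : RawR) (src : ℕ → ℕ) (oOut oWork : ℕ) :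
    (callGates R src oOut oWork).length ≤
      (R.2.1 - R.1) + 2 * R.1 + 30 * R.2.2.1.length + R.2.2.2.length := by
  have h1 : (coinsGates R.1 (oWork + (R.2.1 - R.1))).length ≤ R.1 * 2 :=
    length_flatMap_range_le _ fun i => le_rfl
  have h2 : (allArithGates oWork R.2.1 R.2.2.1).length ≤ R.2.2.1.length * 30 :=
    length_flatMap_range_le _ fun i => length_arithGates_le _ _ _
  have h3 : (outGates oWork R.work R.2.2.2 oOut).length ≤ R.2.2.2.length * 1 :=
    length_flatMap_range_le _ fun i => by split_ifs <;> simp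
  simp only [callGates, List.length_append, copyGates, List.length_map, List.length_range]
  omega

/-- Two classical decryptions, each compiled with a constant number of gates per classical gate, and
four gates for the Pauli operator. -/
theorem size_decCircuit_le (E : ClassicalHE) (κ L : ℕ) :
    (decCircuit E κ (1 + 2 * L)).size ≤ 64 * (E.dec κ L).size + 10 := by
  have hL : (1 + 2 * L - 1) / 2 = L := by omega
  have hs : (E.dec κ L).size =
      E.skLen κ + L + (E.dec κ L).coins + (E.dec κ L).circuit.gates.length := rfl
  have h1 : (decCircuit E κ (1 + 2 * L)).fresh = 3 + 2 * (E.dec κ L).raw.work := by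
    have := congrArg (fun r : RawQ => r.2.1) (decCircuit_raw E κ (1 + 2 * L))
    rw [hL] at this
    exact this
  have h2 : (decCircuit E κ (1 + 2 * L)).gates.length =
      (decGates (E.dec κ L).raw (E.skLen κ) (1 + 2 * L)).length := by
    have := congrArg List.length (decCircuit_rawGates E κ (1 + 2 * L))
    rw [hL] at this
    rw [← this, QCircuit.rawGates, List.length_map]
  have h3 : (decGates (E.dec κ L).raw (E.skLen κ) (1 + 2 * L)).length ≤
      2 * ((E.skLen κ + L) + 2 * (E.dec κ L).coins +
        30 * (E.dec κ L).circuit.gates.length + 1) + 4 := by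
    rw [decGates, List.length_append]
    refine Nat.add_le_add (length_flatMap_range_le 2 fun j => ?_) le_rfl
    refine (length_callGates_le _ _ _ _).trans (le_of_eq ?_)
    simp only [RandCircuit.raw, List.length_ofFn, Nat.add_sub_cancel]
  rw [RandCircuit.work_raw] at h1
  rw [QCircuit.size]
  omega

/-- The ciphertexts to be decrypted come from the evaluation of inner products, to which the
classical compactness bound applies for every length. -/
theorem compact_scheme {E : ClassicalHE} (hE : E.Compact) : (scheme E).Compact := by
  obtain ⟨p, hp⟩ := hE
  refine ⟨64 * p + 10, fun κ n m C => (size_decCircuit_le E κ (ipLen E κ n)).trans ?_⟩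
  have : (E.dec κ (ipLen E κ n)).size ≤ p.eval κ := hp κ _ (ipCircuit (2 * n))
  simp only [Polynomial.eval_add, Polynomial.eval_mul, Polynomial.eval_ofNat]
  omega

/-! ## Security -/

open Classical in
/-- A circuit as the last part of a larger circuit. -/
theorem heisL_subcircuit_last {n m : ℕ} (C : QCircuit n m) {φ : ℕ → ℕ}
    (hφ : Function.Injective φ) (a b : Bits m) (u v : Mem)
    (hu : ∀ i, n ≤ i → u (φ i) = false) (hv : ∀ i, n ≤ i → v (φ i) = false) :
    heisL (C.rawGates.map (RGate.map φ)) (obs (fun k => φ (C.rawOut k)) a b) u v =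
      if ∀ i, (∀ j < n, φ j ≠ i) → u i = v i then
        C.chan (Matrix.single (rest n (u ∘ φ)) (rest n (v ∘ φ)) 1) a b else 0 := by
  have hext : ∀ (a u : Mem) (i : ℕ), Function.extend φ a u (φ i) = a i := fun a u i =>
    hφ.extend_apply a u i
  rw [heisL_map hφ]
  split_ifs with h
  · rw [QCircuit.chan_single, mem_rest (u := u ∘ φ) hu, mem_rest (u := v ∘ φ) hv]
    congr 1
    funext a' b'
    simp only [obs, hext]
    refine if_congr (and_congr_right fun _ => and_congr_right fun _ => ⟨fun h' j hj => ?_,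
      fun h' j hj => ?_⟩) rfl rfl
    · rw [← hext a' u j, ← hext b' v j]
      exact h' _ fun k hk => hj k (hφ hk)
    · by_cases hj' : ∃ i, φ i = j
      · obtain ⟨i, rfl⟩ := hj'
        rw [hext, hext]
        exact h' _ fun k hk => hj k (congrArg φ hk)
      · rw [Function.extend_apply' _ _ _ hj', Function.extend_apply' _ _ _ hj']
        exact h j fun i _ hi => hj' ⟨i, hi⟩
  · push Not at h
    obtain ⟨i, hi, hne⟩ := h
    have hi' : ¬ ∃ j, φ j = i := by
      rintro ⟨j, rfl⟩
      by_cases hj : j < n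
      · exact hi j hj rfl
      · exact hne ((hu j (by omega)).trans (hv j (by omega)).symm)
    have h0 := heisL_sum (∅ : Finset ℕ) C.rawGates (fun _ => 0) (fun _ _ _ => 0) (u ∘ φ) (v ∘ φ)
    simp only [Finset.sum_empty] at h0
    rw [← h0]
    congr 1
    funext a' b'
    rw [obs, if_neg]
    rintro ⟨-, -, h3⟩
    have := h3 i fun k hk => hi' ⟨_, hk⟩
    rw [Function.extend_apply' _ _ _ hi', Function.extend_apply' _ _ _ hi'] at this
    exact hne this

/-- The second part of the adversary outputs `o` on the encryption, with the key `k` and the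
ciphertexts `y` of its bits, of the first bit of `a` and `b`, or of `0` if `r` is false. -/
def attackK {c d : ℕ} (C : QCircuit (1 + 2 * c + d) 1) (r o : Bool) (k : Bits 2)
    (y : Fin 2 → Bits c) (a b : Bits (1 + d)) : ℂ :=
  if r then
    sg (k 1 && xor (a 0) (b 0)) * C.chan (Matrix.single
      (Fin.append (pack (xor (a 0) (k 0)) y) (dropBits a))
      (Fin.append (pack (xor (b 0) (k 0)) y) (dropBits b)) 1) (fun _ => o) fun _ => o
  else if a 0 = b 0 then
    C.chan (Matrix.single (Fin.append (pack (k 0) y) (dropBits a))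
      (Fin.append (pack (k 0) y) (dropBits b)) 1) (fun _ => o) fun _ => o
  else 0

theorem funext_append_pack {c d : ℕ} {w : Bits (1 + 2 * c + d)} {q : Bool} {y : Fin 2 → Bits c}
    {z : Bits d} (h0 : mem w 0 = q) (h1 : ∀ (j : Fin 2) (s : Fin c), mem w (1 + (j * c + s)) = y j s)
    (h2 : ∀ j : Fin d, mem w (1 + 2 * c + j) = z j) : w = Fin.append (pack q y) z := by
  funext i
  induction i using Fin.addCases with
  | right j =>
    rw [Fin.append_right, ← h2 j, mem_of_lt w (by omega)]
    rfl
  | left i =>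
    rw [Fin.append_left, pack]
    induction i using Fin.addCases with
    | left i =>
      rw [Fin.append_left, ← h0, mem_of_lt w (by omega)]
      exact congrArg w (Fin.ext (by simp))
    | right i =>
      rw [Fin.append_right]
      obtain ⟨⟨j, s⟩, rfl⟩ := finProdFinEquiv.surjective i
      have hlt := block_lt j.2 s.2
      rw [flat, Equiv.symm_apply_apply, ← h1 j s, mem_of_lt w (by omega)]
      refine congrArg w (Fin.ext ?_)
      simp only [Fin.val_castAdd, Fin.val_natAdd, finProdFinEquiv_apply_val]
      ring

/-- The two parts of the adversary, with the quantum part of the encryption in between. -/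
theorem heisL_attackTail {n c d : ℕ} (C₁ : QCircuit n (1 + d)) (C₂ : QCircuit (1 + 2 * c + d) 1)
    {φ₁ φ₂ : ℕ → ℕ} (h₁ : Function.Injective φ₁) (h₂ : Function.Injective φ₂) {xw zw q : ℕ}
    {r : Bool} (o : Bool) {k : Bits 2} {y : Fin 2 → Bits c} {x : Bits n} {M : Mem}
    (hM : ∀ i : Fin n, M (φ₁ i) = x i) (hM0 : ∀ i, n ≤ i → M (φ₁ i) = false)
    (hxw : ∀ i, φ₁ i ≠ xw) (hzw : ∀ i, φ₁ i ≠ zw) (hMx : M xw = k 0) (hMz : M zw = k 1)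
    (hzq : zw ≠ q) (hqt : r = true → q = φ₁ (C₁.rawOut 0))
    (hqf : r = false → (∀ i, φ₁ i ≠ q) ∧ M q = false) (hq : φ₂ 0 = q)
    (hy : ∀ (j : Fin 2) (s : Fin c), M (φ₂ (1 + (j * c + s))) = y j s)
    (hy' : ∀ (j : Fin 2) (s : Fin c) (i : ℕ), φ₁ i ≠ φ₂ (1 + (j * c + s)))
    (hd : ∀ j : Fin d, φ₂ (1 + 2 * c + j) = φ₁ (C₁.rawOut (Fin.natAdd 1 j)))
    (hf : ∀ i, 1 + 2 * c + d ≤ i → ∃ i', n + C₁.fresh ≤ i' ∧ φ₂ i = φ₁ i') :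
    heisL (C₁.rawGates.map (RGate.map φ₁) ++ (pauliGates xw zw q ++
      C₂.rawGates.map (RGate.map φ₂))) (obs (fun k => φ₂ (C₂.rawOut k)) (fun _ => o) fun _ => o)
      M M = ∑ a, ∑ b, C₁.chan (ketbra x) a b * attackK C₂ r o k y a b := by
  classical
  have hext : ∀ (a u : Mem) (i : ℕ), Function.extend φ₁ a u (φ₁ i) = a i := fun a u i =>
    h₁.extend_apply a u i
  have hext' : ∀ (a u : Mem) (j : ℕ), (∀ i, φ₁ i ≠ j) → Function.extend φ₁ a u j = u j :=
    fun a u j hj => Function.extend_apply' _ _ _ fun ⟨i, hi⟩ => hj i hi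
  have hx : rest n (M ∘ φ₁) = x := funext hM
  have hr : ∀ b : Bool, b = true ∨ b = false := by decide
  rw [heisL_append, heisL_subcircuit C₁ h₁ _ (attackK C₂ r o k y) M M hM0 hM0, hx]
  · rfl
  intro a b ha hb
  rw [heisL_append, heisL_pauli hzq _ _ _ (by rw [hext' _ _ _ hxw, hext' _ _ _ hxw])
    (by rw [hext' _ _ _ hzw, hext' _ _ _ hzw]), hext' _ _ _ hxw, hext' _ _ _ hzw, hMx, hMz]
  have hne : ∀ i, 1 ≤ i → φ₂ i ≠ q := fun i hi h => by
    have := h₂ (h.trans hq.symm)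
    omega
  have h0 : ∀ (a : Mem) (s : Bool), (∀ i, n + C₁.fresh ≤ i → a i = false) →
      ∀ i, 1 + 2 * c + d ≤ i → Function.update (Function.extend φ₁ a M) q s (φ₂ i) = false := by
    intro a s ha i hi
    obtain ⟨i', hi', e⟩ := hf i hi
    rw [Function.update_of_ne (hne i (by omega)), e, hext, ha i' hi']
  rw [heisL_subcircuit_last C₂ h₂ _ _ _ _ (h0 a _ ha) (h0 b _ hb)]
  have hrest : ∀ (a : Mem) (s : Bool),
      rest (1 + 2 * c + d) (Function.update (Function.extend φ₁ a M) q s ∘ φ₂) =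
        Fin.append (pack s y) (dropBits (a ∘ C₁.rawOut)) := by
    intro a s
    have hm : ∀ i < 1 + 2 * c + d, mem (rest (1 + 2 * c + d)
        (Function.update (Function.extend φ₁ a M) q s ∘ φ₂)) i =
        Function.update (Function.extend φ₁ a M) q s (φ₂ i) := fun i hi => mem_of_lt _ hi
    refine funext_append_pack ?_ (fun j s => ?_) fun j => ?_
    · rw [hm _ (by omega), hq, Function.update_self]
    · have hlt := block_lt j.2 s.2
      rw [hm _ (by omega), Function.update_of_ne (hne _ (by omega)), hext' _ _ _ (hy' j s), hy]
    · rw [hm _ (by omega), Function.update_of_ne (hne _ (by omega)), hd, hext]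
      rfl
  rw [hrest, hrest]
  -- The wires that the second part does not receive: all non-output wires of the first part and, if
  -- the message is replaced by `|0⟩`, the message qubit as well.
  have hcond : (∀ i, (∀ j < 1 + 2 * c + d, φ₂ j ≠ i) →
      Function.update (Function.extend φ₁ a M) q
        (xor (Function.extend φ₁ a M q) (k 0)) i =
      Function.update (Function.extend φ₁ b M) q
        (xor (Function.extend φ₁ b M q) (k 0)) i) ↔
      ∀ j, (∀ k, (r = true ∨ k ≠ 0) → C₁.rawOut k ≠ j) → a j = b j := by
    refine ⟨fun h j hj => ?_, fun h i hi => ?_⟩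
    · have hjq : φ₁ j ≠ q := by
        rintro rfl
        rcases hr r with hr | hr
        · exact hj 0 (.inl hr) (h₁ (hqt hr)).symm
        · exact (hqf hr).1 j rfl
      have := h (φ₁ j) fun i hi => by
        intro e
        rcases Nat.eq_zero_or_pos i with rfl | hi0
        · exact hjq (e.symm.trans hq)
        by_cases hi2 : i < 1 + 2 * c
        · obtain ⟨⟨j', s⟩, e'⟩ := finProdFinEquiv.surjective (⟨i - 1, by omega⟩ : Fin (2 * c))
          have e2 := congrArg Fin.val e'
          rw [finProdFinEquiv_apply_val] at e2
          refine hy' j' s j (e.symm.trans (congrArg φ₂ ?_))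
          simp only at e2
          rw [Nat.mul_comm]
          omega
        · have e2 := hd ⟨i - (1 + 2 * c), by omega⟩
          rw [show 1 + 2 * c + (i - (1 + 2 * c)) = i by omega] at e2
          refine hj _ (.inr ?_) (h₁ (e2.symm.trans e))
          intro h0
          have := congrArg Fin.val h0
          simp at this
      rwa [Function.update_of_ne hjq, Function.update_of_ne hjq, hext, hext] at this
    · have hiq : i ≠ q := fun e => hi 0 (by omega) (hq.trans e.symm)
      rw [Function.update_of_ne hiq, Function.update_of_ne hiq]
      by_cases hj : ∃ j, φ₁ j = i
      · obtain ⟨j, rfl⟩ := hj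
        rw [hext, hext]
        refine h j fun k hk e => ?_
        subst e
        induction k using Fin.addCases with
        | left k =>
          rw [Subsingleton.elim k 0] at *
          rcases hk with hk | hk
          · exact hiq (hqt hk).symm
          · exact hk rfl
        | right k => exact hi _ (by omega) (hd k)
      · rw [Function.extend_apply' _ _ _ hj, Function.extend_apply' _ _ _ hj]
  rw [if_congr hcond rfl rfl]
  rcases hr r with hr | hr <;> subst hr
  · have e : ∀ a : Mem, Function.extend φ₁ a M q = a (C₁.rawOut 0) := fun a => by
      rw [hqt rfl, hext]
    simp only [e, true_or, forall_const, attackK, if_true, Function.comp_apply]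
    split_ifs
    · rfl
    · exact mul_zero _
  · obtain ⟨hq1, hq2⟩ := hqf rfl
    have e : ∀ a : Mem, Function.extend φ₁ a M q = false := fun a => by
      rw [hext' _ _ _ hq1, hq2]
    simp only [e, attackK, Function.comp_apply, Bool.false_xor, Bool.xor_false,
      Bool.and_false, sg_false, one_mul, Bool.false_eq_true, if_false, false_or]
    by_cases h : ∀ j, (∀ k, C₁.rawOut k ≠ j) → a j = b j
    · rw [if_pos h]
      refine if_congr ⟨fun h' => ?_, fun h' j hj => ?_⟩ rfl rfl
      · exact h' _ fun k hk e => hk (C₁.rawOut_injective e)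
      · by_cases hj0 : C₁.rawOut 0 = j
        · rw [← hj0]; exact h'
        · refine h j fun k hk => ?_
          by_cases hk0 : k = 0
          · exact hj0 (hk0 ▸ hk)
          · exact hj k hk0 hk
    · rw [if_neg h, if_neg]
      exact fun h' => h fun j hj => h' j fun k _ => hj k

/-! ### Attacks on the classical scheme -/

/-- The data for an attack on the classical scheme: the lengths of public key, evaluation key and
ciphertexts, classical encryption, the two parts of an attack on the quantum scheme. -/
structure AttackArgs where
  p : ℕ
  e : ℕ
  c : ℕ
  Re : RawR
  R₁ : RawQ
  R₂ : RawQ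

namespace AttackArgs

/-- The data as a tuple. -/
def tuple (t : AttackArgs) : ℕ × ℕ × ℕ × RawR × RawQ × RawQ := (t.p, t.e, t.c, t.Re, t.R₁, t.R₂)

instance : Enc AttackArgs := ⟨fun t => Enc.enc t.tuple⟩

variable (t : AttackArgs)

/-- Length of the environment. -/
def d : ℕ := t.R₁.2.2.2.length - 1
/-- Number of input wires, and number of the first bit of the key. -/
def N : ℕ := t.p + t.e + t.c
/-- First wire of the ciphertext that is produced by the attack. -/
def O : ℕ := t.N + 3 + t.p
/-- First auxiliary wire of the encryption. -/
def W : ℕ := t.O + t.c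
/-- First auxiliary wire of the first part. -/
def F₁ : ℕ := t.W + t.Re.work
/-- First auxiliary wire of the second part. -/
def F₂ : ℕ := t.F₁ + t.R₁.2.1
/-- Number of all wires. -/
def total : ℕ := t.F₂ + t.R₂.2.1

/-- The wires of the first part. -/
def phi₁ (j : ℕ) : ℕ :=
  if j < t.p then j else if j < t.p + t.p then t.N + 3 + (j - t.p)
  else if j < t.p + (t.p + t.e) then j - t.p else t.F₁ + (j - (t.p + (t.p + t.e)))

/-- The output wires of the first part. -/
def out₁ (j : ℕ) : ℕ := t.phi₁ (t.R₁.2.2.2.getD j 0)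

/-- The wire of the qubit that is encrypted. -/
def q (r : Bool) : ℕ := bif r then t.out₁ 0 else t.N + 2

/-- The first wire of one of the two ciphertexts. -/
def slot (i : Bool) : ℕ := bif i then t.O else t.p + t.e

/-- The wires of the second part. -/
def phi₂ (r i : Bool) (j : ℕ) : ℕ :=
  if j = 0 then t.q r else if j < 1 + t.c then t.slot i + (j - 1)
  else if j < 1 + 2 * t.c then t.slot (!i) + (j - (1 + t.c))
  else if j < 1 + 2 * t.c + t.d then t.out₁ (1 + (j - (1 + 2 * t.c)))
  else t.F₂ + (j - (1 + 2 * t.c + t.d))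

/-- The input wires of the encryption. -/
def src (i : Bool) (j : ℕ) : ℕ := if j < t.p then j else bif i then t.N + 2 else t.N + 1

/-- The gates that use the attack on the quantum scheme. -/
def tail (r i : Bool) : List RGate :=
  t.R₁.2.2.1.map (RGate.map t.phi₁) ++ (pauliGates t.N (t.N + 1) (t.q r) ++
    t.R₂.2.2.1.map (RGate.map (t.phi₂ r i)))

/-- All gates. -/
def gates (r i : Bool) : List RGate :=
  -- The key bit in the position of the challenge is fixed to `1`, since for the value `0` the
  -- hybrid step changes nothing. The other key bit is random.
  .one .X (t.N + bif i then 1 else 0) :: (coinGates (t.N + bif i then 0 else 1) ++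
    -- The adversary expects the public key twice, as such and inside the evaluation key, so a copy
    -- is made.
    (copyGates t.p (fun j => j) (t.N + 3) ++ (callGates t.Re (t.src i) t.O t.W ++ t.tail r i)))

/-- The circuit of the attack. -/
def raw (r i : Bool) : RawQ :=
  (t.N, t.total - t.N, t.gates r i, [t.phi₂ r i (t.R₂.2.2.2.getD 0 0)])

end AttackArgs

namespace PF

variable {ξ : Type} [Enc ξ]

theorem attackTuple {h : ξ → AttackArgs} (hh : PF h) : PF (fun x => (h x).tuple) :=
  congr_enc hh fun _ => rfl

@[fun_prop]
theorem attackArgs_p {h : ξ → AttackArgs} (hh : PF h) : PF (fun x => (h x).p) := hh.attackTuple.fst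
@[fun_prop]
theorem attackArgs_e {h : ξ → AttackArgs} (hh : PF h) : PF (fun x => (h x).e) :=
  hh.attackTuple.snd.fst
@[fun_prop]
theorem attackArgs_c {h : ξ → AttackArgs} (hh : PF h) : PF (fun x => (h x).c) :=
  hh.attackTuple.snd.snd.fst
@[fun_prop]
theorem attackArgs_Re {h : ξ → AttackArgs} (hh : PF h) : PF (fun x => (h x).Re) :=
  hh.attackTuple.snd.snd.snd.fst
@[fun_prop]
theorem attackArgs_first {h : ξ → AttackArgs} (hh : PF h) : PF (fun x => (h x).R₁) :=
  hh.attackTuple.snd.snd.snd.snd.fst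
@[fun_prop]
theorem attackArgs_second {h : ξ → AttackArgs} (hh : PF h) : PF (fun x => (h x).R₂) :=
  hh.attackTuple.snd.snd.snd.snd.snd

theorem attackArgs {p e c : ξ → ℕ} {Re : ξ → RawR} {R₁ R₂ : ξ → RawQ} (hp : PF p) (he : PF e)
    (hc : PF c) (hRe : PF Re) (hR₁ : PF R₁) (hR₂ : PF R₂) :
    PF (fun x => AttackArgs.mk (p x) (e x) (c x) (Re x) (R₁ x) (R₂ x)) :=
  congr_enc (hp.prodMk (he.prodMk (hc.prodMk (hRe.prodMk (hR₁.prodMk hR₂))))) fun _ => rfl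

variable {h : ξ → AttackArgs}

@[fun_prop]
theorem attackArgs_N (hh : PF h) : PF (fun x => (h x).N) := by unfold AttackArgs.N; fun_prop
@[fun_prop]
theorem attackArgs_O (hh : PF h) : PF (fun x => (h x).O) := by unfold AttackArgs.O; fun_prop
@[fun_prop]
theorem attackArgs_W (hh : PF h) : PF (fun x => (h x).W) := by unfold AttackArgs.W; fun_prop
@[fun_prop]
theorem attackArgs_aux_first (hh : PF h) : PF (fun x => (h x).F₁) := by
  unfold AttackArgs.F₁; fun_prop
@[fun_prop]
theorem attackArgs_aux_second (hh : PF h) : PF (fun x => (h x).F₂) := by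
  unfold AttackArgs.F₂; fun_prop
@[fun_prop]
theorem attackArgs_phi {j : ξ → ℕ} (hh : PF h) (hj : PF j) : PF (fun x => (h x).phi₁ (j x)) := by
  unfold AttackArgs.phi₁; fun_prop
@[fun_prop]
theorem attackArgs_out {j : ξ → ℕ} (hh : PF h) (hj : PF j) : PF (fun x => (h x).out₁ (j x)) := by
  unfold AttackArgs.out₁; fun_prop
@[fun_prop]
theorem attackArgs_q (r : Bool) (hh : PF h) : PF (fun x => (h x).q r) := by
  unfold AttackArgs.q; fun_prop
@[fun_prop]
theorem attackArgs_slot (i : Bool) (hh : PF h) : PF (fun x => (h x).slot i) := by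
  unfold AttackArgs.slot; fun_prop
@[fun_prop]
theorem attackArgs_phi_second {j : ξ → ℕ} (r i : Bool) (hh : PF h) (hj : PF j) :
    PF (fun x => (h x).phi₂ r i (j x)) := by
  unfold AttackArgs.phi₂ AttackArgs.d; fun_prop

theorem attackArgs_raw (r i : Bool) : PF (fun t : AttackArgs => t.raw r i) := by
  have h1 : PF (fun t : AttackArgs => t.R₁.2.2.1.map (RGate.map t.phi₁)) :=
    map (f := fun (t : AttackArgs) g => RGate.map t.phi₁ g) (by fun_prop)
      (rgateMap (φ := fun x : AttackArgs × RGate => x.1.phi₁) (by fun_prop) (by fun_prop))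
  have h2 : PF (fun t : AttackArgs => t.R₂.2.2.1.map (RGate.map (t.phi₂ r i))) :=
    map (f := fun (t : AttackArgs) g => RGate.map (t.phi₂ r i) g) (by fun_prop)
      (rgateMap (φ := fun x : AttackArgs × RGate => x.1.phi₂ r i) (by fun_prop) (by fun_prop))
  have h3 : PF (fun t : AttackArgs => QHom.callGates t.Re (t.src i) t.O t.W) := by
    refine callGates (by fun_prop) ?_ (by fun_prop) (by fun_prop)
    unfold AttackArgs.src
    fun_prop
  have h4 : PF (fun t : AttackArgs => QHom.copyGates t.p (fun j => j) (t.N + 3)) :=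
    copyGates (by fun_prop) (by fun_prop) (by fun_prop)
  have h5 : PF (fun t : AttackArgs => t.total - t.N) := by
    unfold AttackArgs.total; fun_prop
  have h6 : PF (fun t : AttackArgs => t.gates r i) := by
    unfold AttackArgs.gates AttackArgs.tail
    fun_prop
  unfold AttackArgs.raw
  fun_prop

end PF

/-! ### Well-formedness of the attack circuit. -/

section Attack

variable {p e c d : ℕ} (Re : RandCircuit (p + 1) c) (C₁ : QCircuit (p + (p + e)) (1 + d))
  (C₂ : QCircuit (1 + 2 * c + d) 1) (r i : Bool)

/-- The data of an attack. -/
def attackArgs : AttackArgs := ⟨p, e, c, Re.raw, C₁.raw, C₂.raw⟩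

theorem attackArgs_d : (attackArgs Re C₁ C₂).d = d := by
  simp [AttackArgs.d, attackArgs, QCircuit.raw]

theorem attackArgs_eqs : (attackArgs Re C₁ C₂).N = p + e + c ∧
    (attackArgs Re C₁ C₂).O = p + e + c + 3 + p ∧
    (attackArgs Re C₁ C₂).W = (attackArgs Re C₁ C₂).O + c ∧
    (attackArgs Re C₁ C₂).F₁ = (attackArgs Re C₁ C₂).W + Re.raw.work ∧
    (attackArgs Re C₁ C₂).F₂ = (attackArgs Re C₁ C₂).F₁ + C₁.fresh ∧
    (attackArgs Re C₁ C₂).total = (attackArgs Re C₁ C₂).F₂ + C₂.fresh :=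
  ⟨rfl, rfl, rfl, rfl, rfl, rfl⟩

theorem attackArgs_phi (j : ℕ) : (attackArgs Re C₁ C₂).phi₁ j =
    if j < p then j else if j < p + p then p + e + c + 3 + (j - p)
    else if j < p + (p + e) then j - p else
      (attackArgs Re C₁ C₂).F₁ + (j - (p + (p + e))) := rfl

theorem attackArgs_phi_injective : Function.Injective (attackArgs Re C₁ C₂).phi₁ := by
  intro a b h
  obtain ⟨-, h2, h3, h4, -, -⟩ := attackArgs_eqs Re C₁ C₂
  rw [attackArgs_phi, attackArgs_phi] at h
  split_ifs at h <;> omega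

/-- The first part lives on the inputs other than the challenge, on the copied public key and on its
own fresh wires. It never touches the challenge, the pad, the spare zero wire or the ciphertext made
by the attack. -/
theorem attackArgs_phi_zone (j : ℕ) : (attackArgs Re C₁ C₂).phi₁ j < p + e ∨
    (p + e + c + 3 ≤ (attackArgs Re C₁ C₂).phi₁ j ∧
      (attackArgs Re C₁ C₂).phi₁ j < (attackArgs Re C₁ C₂).O) ∨
    ((attackArgs Re C₁ C₂).F₁ ≤ (attackArgs Re C₁ C₂).phi₁ j ∧
      (j < p + (p + e) + C₁.fresh →
        (attackArgs Re C₁ C₂).phi₁ j < (attackArgs Re C₁ C₂).F₂)) := by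
  obtain ⟨h1, h2, h3, h4, h5, h6⟩ := attackArgs_eqs Re C₁ C₂
  rw [attackArgs_phi]
  split_ifs <;> omega

theorem attackArgs_out (k : Fin (1 + d)) :
    (attackArgs Re C₁ C₂).out₁ k = (attackArgs Re C₁ C₂).phi₁ (C₁.rawOut k) := by
  have : (attackArgs Re C₁ C₂).R₁.2.2.2.getD k 0 = C₁.rawOut k := by
    simp [attackArgs, QCircuit.raw, List.getD_eq_getElem?_getD]
  rw [AttackArgs.out₁, this]

theorem attackArgs_q : (r = true ∧ (attackArgs Re C₁ C₂).q r =
      (attackArgs Re C₁ C₂).phi₁ (C₁.rawOut 0)) ∨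
    (r = false ∧ (attackArgs Re C₁ C₂).q r = p + e + c + 2) := by
  cases r
  · exact .inr ⟨rfl, rfl⟩
  · exact .inl ⟨rfl, attackArgs_out Re C₁ C₂ 0⟩

theorem attackArgs_slot : (i = true ∧ (attackArgs Re C₁ C₂).slot i = (attackArgs Re C₁ C₂).O ∧
      (attackArgs Re C₁ C₂).slot (!i) = p + e) ∨
    (i = false ∧ (attackArgs Re C₁ C₂).slot i = p + e ∧
      (attackArgs Re C₁ C₂).slot (!i) = (attackArgs Re C₁ C₂).O) := by
  cases i
  · exact .inr ⟨rfl, rfl, rfl⟩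
  · exact .inl ⟨rfl, rfl, rfl⟩

theorem attackArgs_phi_second (j : ℕ) :
    (j = 0 ∧ (attackArgs Re C₁ C₂).phi₂ r i j = (attackArgs Re C₁ C₂).q r) ∨
    (1 ≤ j ∧ j < 1 + c ∧
      (attackArgs Re C₁ C₂).phi₂ r i j = (attackArgs Re C₁ C₂).slot i + (j - 1)) ∨
    (1 + c ≤ j ∧ j < 1 + 2 * c ∧
      (attackArgs Re C₁ C₂).phi₂ r i j = (attackArgs Re C₁ C₂).slot (!i) + (j - (1 + c))) ∨
    (1 + 2 * c ≤ j ∧ ∃ h : j - (1 + 2 * c) < d, (attackArgs Re C₁ C₂).phi₂ r i j =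
      (attackArgs Re C₁ C₂).phi₁ (C₁.rawOut (Fin.natAdd 1 ⟨j - (1 + 2 * c), h⟩))) ∨
    (1 + 2 * c + d ≤ j ∧ (attackArgs Re C₁ C₂).phi₂ r i j =
      (attackArgs Re C₁ C₂).F₂ + (j - (1 + 2 * c + d))) := by
  have hc : (attackArgs Re C₁ C₂).c = c := rfl
  unfold AttackArgs.phi₂
  rw [hc, attackArgs_d]
  by_cases h1 : j = 0
  · exact .inl ⟨h1, if_pos h1⟩
  rw [if_neg h1]
  by_cases h2 : j < 1 + c
  · exact .inr (.inl ⟨by omega, h2, if_pos h2⟩)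
  rw [if_neg h2]
  by_cases h3 : j < 1 + 2 * c
  · exact .inr (.inr (.inl ⟨by omega, h3, if_pos h3⟩))
  rw [if_neg h3]
  by_cases h4 : j < 1 + 2 * c + d
  · refine .inr (.inr (.inr (.inl ⟨by omega, by omega, ?_⟩)))
    rw [if_pos h4, ← attackArgs_out]
    rfl
  · exact .inr (.inr (.inr (.inr ⟨by omega, if_neg h4⟩)))

/-- The message qubit, the two ciphertexts, the environment and the fresh wires of the second part
occupy disjoint zones. Within the outputs of the first part, distinctness comes from injectivity of
its output map. -/
theorem attackArgs_phi_second_injective :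
    Function.Injective ((attackArgs Re C₁ C₂).phi₂ r i) := by
  suffices h : ∀ a b, a < b →
      (attackArgs Re C₁ C₂).phi₂ r i a ≠ (attackArgs Re C₁ C₂).phi₂ r i b by
    intro a b hab
    rcases lt_trichotomy a b with hl | hl | hl
    · exact absurd hab (h a b hl)
    · exact hl
    · exact absurd hab.symm (h b a hl)
  intro a b hlt h
  obtain ⟨-, h2, h3, h4, h5, -⟩ := attackArgs_eqs Re C₁ C₂
  have hinj : ∀ k k', (attackArgs Re C₁ C₂).phi₁ (C₁.rawOut k) =
      (attackArgs Re C₁ C₂).phi₁ (C₁.rawOut k') → (k : ℕ) = k' := fun k k' h =>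
    congrArg Fin.val (C₁.rawOut_injective (attackArgs_phi_injective Re C₁ C₂ h))
  have hz := fun k => attackArgs_phi_zone Re C₁ C₂ (C₁.rawOut k)
  simp only [C₁.rawOut_lt, forall_const] at hz
  have hq := attackArgs_q Re C₁ C₂ r
  have hs := attackArgs_slot Re C₁ C₂ i
  have ha := attackArgs_phi_second Re C₁ C₂ r i a
  have hb := attackArgs_phi_second Re C₁ C₂ r i b
  rw [h] at ha
  generalize (attackArgs Re C₁ C₂).phi₂ r i b = v at ha hb
  clear h
  -- All pairs of zones; the message qubit against the environment is the only case that depends on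
  -- `r`.
  rcases ha with ⟨a1, ea⟩ | ⟨a1, a2, ea⟩ | ⟨a1, a2, ea⟩ | ⟨a1, a2, ea⟩ | ⟨a1, ea⟩ <;>
  rcases hb with ⟨b1, eb⟩ | ⟨b1, b2, eb⟩ | ⟨b1, b2, eb⟩ | ⟨b1, b2, eb⟩ | ⟨b1, eb⟩ <;>
  first
  | omega
  | have hza := hz 0; omega
  | have hza := hz (Fin.natAdd 1 ⟨_, a2⟩); omega
  | have hzb := hz (Fin.natAdd 1 ⟨_, b2⟩); omega
  | have := hinj _ _ (ea.symm.trans eb); simp only [Fin.val_natAdd] at this; omega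
  | rcases hq with ⟨-, hq⟩ | ⟨-, hq⟩
    · have := hinj _ _ (hq.symm.trans (ea.symm.trans eb))
      simp only [Fin.val_natAdd, Fin.val_zero] at this
      omega
    · have hzb := hz (Fin.natAdd 1 ⟨_, b2⟩)
      omega

theorem attackArgs_phi_mem {j : ℕ} (hj : j < p + (p + e) + C₁.fresh) :
    (attackArgs Re C₁ C₂).phi₁ j ∈ Set.Iio (attackArgs Re C₁ C₂).total \
      Set.Ico (attackArgs Re C₁ C₂).W (attackArgs Re C₁ C₂).F₁ := by
  obtain ⟨h1, h2, h3, h4, h5, h6⟩ := attackArgs_eqs Re C₁ C₂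
  have := attackArgs_phi_zone Re C₁ C₂ j
  simp only [Set.mem_sdiff, Set.mem_Iio, Set.mem_Ico]
  omega

theorem attackArgs_q_mem : (attackArgs Re C₁ C₂).q r ∈ Set.Iio (attackArgs Re C₁ C₂).total \
      Set.Ico (attackArgs Re C₁ C₂).W (attackArgs Re C₁ C₂).F₁ := by
  rcases attackArgs_q Re C₁ C₂ r with ⟨-, hq⟩ | ⟨-, hq⟩ <;> rw [hq]
  · exact attackArgs_phi_mem _ _ _ (C₁.rawOut_lt 0)
  · obtain ⟨h1, h2, h3, h4, h5, h6⟩ := attackArgs_eqs Re C₁ C₂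
    simp only [Set.mem_sdiff, Set.mem_Iio, Set.mem_Ico]
    omega

theorem attackArgs_phi_second_mem {j : ℕ} (hj : j < 1 + 2 * c + d + C₂.fresh) :
    (attackArgs Re C₁ C₂).phi₂ r i j ∈ Set.Iio (attackArgs Re C₁ C₂).total \
      Set.Ico (attackArgs Re C₁ C₂).W (attackArgs Re C₁ C₂).F₁ := by
  obtain ⟨h1, h2, h3, h4, h5, h6⟩ := attackArgs_eqs Re C₁ C₂
  have hs := attackArgs_slot Re C₁ C₂ i
  rcases attackArgs_phi_second Re C₁ C₂ r i j with ⟨a1, ea⟩ | ⟨a1, a2, ea⟩ | ⟨a1, a2, ea⟩ |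
    ⟨a1, a2, ea⟩ | ⟨a1, ea⟩ <;> rw [ea]
  · exact attackArgs_q_mem ..
  · simp only [Set.mem_sdiff, Set.mem_Iio, Set.mem_Ico]
    omega
  · simp only [Set.mem_sdiff, Set.mem_Iio, Set.mem_Ico]
    omega
  · exact attackArgs_phi_mem _ _ _ (C₁.rawOut_lt _)
  · simp only [Set.mem_sdiff, Set.mem_Iio, Set.mem_Ico]
    omega

theorem attackArgs_q_ne {j : ℕ} (hj : j < 2) :
    p + e + c + j ≠ (attackArgs Re C₁ C₂).q r := by
  obtain ⟨h1, h2, h3, h4, h5, h6⟩ := attackArgs_eqs Re C₁ C₂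
  have := attackArgs_phi_zone Re C₁ C₂ (C₁.rawOut 0)
  rcases attackArgs_q Re C₁ C₂ r with ⟨-, hq⟩ | ⟨-, hq⟩ <;> rw [hq] <;> omega

/-- The work wires of the attack's own encryption are avoided, so its garbage is traced out. -/
theorem goodOn_attackTail : GoodOn (Set.Iio (attackArgs Re C₁ C₂).total \
      Set.Ico (attackArgs Re C₁ C₂).W (attackArgs Re C₁ C₂).F₁)
      ((attackArgs Re C₁ C₂).tail r i) := by
  obtain ⟨h1, h2, h3, h4, h5, h6⟩ := attackArgs_eqs Re C₁ C₂
  refine GoodOn.append ?_ (GoodOn.append ?_ ?_)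
  · exact goodOn_map (attackArgs_phi_injective Re C₁ C₂)
      (fun j hj => attackArgs_phi_mem Re C₁ C₂ hj) C₁.goodOn
  · refine goodOn_pauli ?_ ?_ (attackArgs_q_mem ..) (attackArgs_q_ne Re C₁ C₂ r (j := 0) (by omega))
      (attackArgs_q_ne Re C₁ C₂ r (j := 1) (by omega)) <;>
    · simp only [Set.mem_sdiff, Set.mem_Iio, Set.mem_Ico]
      omega
  · exact goodOn_map (attackArgs_phi_second_injective Re C₁ C₂ r i)
      (fun j hj => attackArgs_phi_second_mem Re C₁ C₂ r i hj) C₂.goodOn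

theorem attackArgs_src_lt {j : ℕ} :
    (attackArgs Re C₁ C₂).src i j < (attackArgs Re C₁ C₂).O := by
  obtain ⟨h1, h2, h3, h4, h5, h6⟩ := attackArgs_eqs Re C₁ C₂
  have hp : (attackArgs Re C₁ C₂).p = p := rfl
  rw [AttackArgs.src, hp]
  cases i <;> simp only [cond_true, cond_false] <;> split_ifs <;> omega

theorem goodOn_attack :
    GoodOn (Set.Iio (attackArgs Re C₁ C₂).total) ((attackArgs Re C₁ C₂).gates r i) := by
  obtain ⟨h1, h2, h3, h4, h5, h6⟩ := attackArgs_eqs Re C₁ C₂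
  have hp : (attackArgs Re C₁ C₂).p = p := rfl
  refine GoodOn.append (gs := [_]) ?_ (GoodOn.append (goodOn_coin ?_) (GoodOn.append
    (goodOn_copy ?_ ?_ ?_) (GoodOn.append (goodOn_call Re (fun j _ => attackArgs_src_lt ..) h3.ge
      ?_ ?_ ?_) (GoodOn.mono Set.sdiff_subset (goodOn_attackTail Re C₁ C₂ r i)))))
  · rintro g hg
    rw [List.mem_singleton.1 hg]
    refine ⟨?_, trivial⟩
    cases i <;> simp only [RGate.On, cond_true, cond_false, Set.mem_Iio] <;> omega
  · cases i <;> simp only [cond_true, cond_false, Set.mem_Iio] <;> omega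
  · intro j hj
    simp only [Set.mem_Iio]; omega
  · intro j hj
    simp only [Set.mem_Iio]; omega
  · intro j hj; omega
  · intro j hj
    have := attackArgs_src_lt Re C₁ C₂ i (j := j)
    simp only [Set.mem_Iio]; omega
  · intro j hj
    simp only [Set.mem_Iio, Set.mem_Ico] at *; omega
  · intro j hj
    simp only [Set.mem_Iio, Set.mem_Ico] at *; omega

/-- The circuit of an attack on the classical scheme. -/
def attackCircuit : QCircuit (p + e + c) 1 :=
  QCircuit.ofRaw ((attackArgs Re C₁ C₂).total - (p + e + c)) ((attackArgs Re C₁ C₂).gates r i)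
    (fun k => (attackArgs Re C₁ C₂).phi₂ r i (C₂.rawOut k))
    (by
      obtain ⟨h1, h2, h3, h4, h5, h6⟩ := attackArgs_eqs Re C₁ C₂
      rw [Nat.add_sub_cancel' (by omega)]
      exact goodOn_attack Re C₁ C₂ r i)
    (fun k => by
      have := (attackArgs_phi_second_mem Re C₁ C₂ r i (C₂.rawOut_lt k)).1
      rw [Set.mem_Iio] at this
      omega)
    ((attackArgs_phi_second_injective Re C₁ C₂ r i).comp C₂.rawOut_injective)

theorem attackCircuit_raw : (attackCircuit Re C₁ C₂ r i).raw = (attackArgs Re C₁ C₂).raw r i := by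
  have h : (attackArgs Re C₁ C₂).R₂.2.2.2.getD 0 0 = C₂.rawOut 0 := by
    simp [attackArgs, QCircuit.raw, List.getD_eq_getElem?_getD]
  rw [attackCircuit, QCircuit.raw_ofRaw, AttackArgs.raw, h]
  rfl

end Attack

/-- The position of a ciphertext. -/
def slotIndex (i : Bool) : Fin 2 := bif i then 1 else 0

/-- The pair with `a` at a given position and `b` at the other one. -/
def slotPair {β : Type} (i : Bool) (a b : β) : Fin 2 → β := fun j => if j = slotIndex i then a else b

/-! ### The experiment that the attack simulates. -/

section Attack

variable {p e c d : ℕ} (Re : RandCircuit (p + 1) c) (C₁ : QCircuit (p + (p + e)) (1 + d))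
  (C₂ : QCircuit (1 + 2 * c + d) 1) (r i : Bool)

/-- The input of an attack with the two bits of the key. -/
def attackBase (pk : Bits p) (ev : Bits e) (ch : Bits c) (b : Bool) : Mem :=
  Function.update (Function.update (mem (Fin.append (Fin.append pk ev) ch))
    (p + e + c + bif i then 1 else 0) true) (p + e + c + bif i then 0 else 1) b

/-- The joint state of all wires of an attack before the first part of the adversary. -/
def attackMem (pk : Bits p) (ev : Bits e) (ch : Bits c) (b : Bool) (y : Bits c) : Mem :=
  wrL (wrL (attackBase i pk ev ch b) (p + e + c + 3) (List.ofFn pk)) (p + e + c + 3 + p)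
    (List.ofFn y)

variable (pk : Bits p) (ev : Bits e) (ch : Bits c) (b : Bool) (y : Bits c)

theorem attackMem_input {j : ℕ} (hj : j < p + e + c) :
    attackMem i pk ev ch b y j = Fin.append (Fin.append pk ev) ch ⟨j, hj⟩ := by
  rw [attackMem, wrL_of_lt _ _ (by omega), wrL_of_lt _ _ (by omega), attackBase,
    Function.update_of_ne (by omega), Function.update_of_ne (by omega), mem_of_lt]

theorem attackMem_pk (j : Fin p) : attackMem i pk ev ch b y j = pk j := by
  rw [attackMem_input _ _ _ _ _ _ (by omega)]
  exact (Fin.append_left (Fin.append pk ev) ch (Fin.castAdd e j)).trans (Fin.append_left ..)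

theorem attackMem_ev (j : Fin e) : attackMem i pk ev ch b y (p + j) = ev j := by
  rw [attackMem_input _ _ _ _ _ _ (by omega)]
  exact (Fin.append_left (Fin.append pk ev) ch (Fin.natAdd p j)).trans (Fin.append_right ..)

theorem attackMem_challenge (j : Fin c) : attackMem i pk ev ch b y (p + e + j) = ch j := by
  rw [attackMem_input _ _ _ _ _ _ (by omega)]
  exact Fin.append_right (Fin.append pk ev) ch j

theorem attackMem_key (j : Fin 2) :
    attackMem i pk ev ch b y (p + e + c + j) = slotPair i true b j := by
  rw [attackMem, wrL_of_lt _ _ (by omega), wrL_of_lt _ _ (by omega), attackBase]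
  fin_cases j <;> cases i <;> simp [slotPair, slotIndex]

theorem attackMem_zero : attackMem i pk ev ch b y (p + e + c + 2) = false := by
  rw [attackMem, wrL_of_lt _ _ (by omega), wrL_of_lt _ _ (by omega), attackBase,
    Function.update_of_ne (by cases i <;> simp), Function.update_of_ne (by cases i <;> simp),
    mem_of_le _ (by omega)]

theorem attackMem_copy (j : Fin p) : attackMem i pk ev ch b y (p + e + c + 3 + j) = pk j := by
  rw [attackMem, wrL_of_lt _ _ (by omega), wrL_ofFn]

theorem attackMem_enc (j : Fin c) : attackMem i pk ev ch b y (p + e + c + 3 + p + j) = y j := by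
  rw [attackMem, wrL_ofFn]

theorem attackMem_of_le {j : ℕ} (hj : p + e + c + 3 + p + c ≤ j) :
    attackMem i pk ev ch b y j = false := by
  rw [attackMem, wrL_ofFn_of_le _ _ _ hj, wrL_ofFn_of_le _ _ _ (by omega), attackBase,
    Function.update_of_ne (by cases i <;> simp <;> omega),
    Function.update_of_ne (by cases i <;> simp <;> omega), mem_of_le _ (by omega)]

/-- Up to the adversary everything is classical and equal on both sides: one random key bit `b` and
one encryption by the attack. For `i = false` it encrypts `b`; for `i = true` it encrypts `0`,
because position `0` has been replaced in the earlier hybrid step. -/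
theorem heisL_attackGates (F : Mem → Mem → ℂ) (hF : TracedOn
      (Set.Ico (attackArgs Re C₁ C₂).W (attackArgs Re C₁ C₂).F₁)
      (heisL ((attackArgs Re C₁ C₂).tail r i) F)) :
    heisL ((attackArgs Re C₁ C₂).gates r i) F (mem (Fin.append (Fin.append pk ev) ch))
      (mem (Fin.append (Fin.append pk ev) ch)) =
    1 / 2 * ∑ b : Bool, ∑ y : Bits c, (Re.prob (Fin.append pk fun _ => bif i then false else b) y : ℂ) *
      heisL ((attackArgs Re C₁ C₂).tail r i) F (attackMem i pk ev ch b y)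
        (attackMem i pk ev ch b y) := by
  obtain ⟨h1, h2, h3, h4, h5, h6⟩ := attackArgs_eqs Re C₁ C₂
  have hp : (attackArgs Re C₁ C₂).p = p := rfl
  have hR : (attackArgs Re C₁ C₂).Re = Re.raw := rfl
  have hM0 : ∀ j, p + e + c ≤ j → mem (Fin.append (Fin.append pk ev) ch) j = false :=
    fun j hj => mem_of_le _ hj
  rw [AttackArgs.gates, heisL_cons, heis_X, heisL_append, hp, hR, h1, hM0 _ (by omega),
    Bool.not_false]
  have hcoin : Function.update (mem (Fin.append (Fin.append pk ev) ch))
      (p + e + c + bif i then 1 else 0) true (p + e + c + bif i then 0 else 1) = false := by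
    rw [Function.update_of_ne (by cases i <;> simp), hM0 _ (by omega)]
  rw [heisL_coin _ _ _ _ hcoin hcoin]
  refine congrArg (1 / 2 * ·) (Finset.sum_congr rfl fun b _ => ?_)
  change heisL _ _ (attackBase i pk ev ch b) (attackBase i pk ev ch b) = _
  have hM1 : ∀ j, p + e + c + 3 ≤ j → attackBase i pk ev ch b j = false := fun j hj => by
    rw [attackBase, Function.update_of_ne (by cases i <;> simp <;> omega),
      Function.update_of_ne (by cases i <;> simp <;> omega), hM0 _ (by omega)]
  have hpk : ∀ j : Fin p, attackBase i pk ev ch b j = pk j := fun j => by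
    rw [attackBase, Function.update_of_ne (by omega), Function.update_of_ne (by omega),
      ← attackMem_pk i pk ev ch b ch j, attackMem_input _ _ _ _ _ _ (by omega), mem_of_lt]
  rw [heisL_append]
  have hcopy := heisL_copy pk (src := fun j => j) (o := p + e + c + 3) _ _ []
    (heisL (callGates Re.raw ((attackArgs Re C₁ C₂).src i) (attackArgs Re C₁ C₂).O
      (attackArgs Re C₁ C₂).W ++ (attackArgs Re C₁ C₂).tail r i) F) (fun j hj => by omega) hpk hpk
      hM1 hM1
  simp only [wrL_nil, List.length_nil, Nat.add_zero, List.nil_append] at hcopy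
  rw [hcopy, heisL_append]
  have hM2 : ∀ j, (attackArgs Re C₁ C₂).O ≤ j → wrL (attackBase i pk ev ch b) (p + e + c + 3) (List.ofFn pk) j = false := fun j hj => by
    rw [wrL_ofFn_of_le _ _ _ (by omega), hM1 _ (by omega)]
  have hsrc : ∀ j : Fin (p + 1), wrL (attackBase i pk ev ch b) (p + e + c + 3) (List.ofFn pk)
      ((attackArgs Re C₁ C₂).src i j) =
      (Fin.append pk fun _ => bif i then false else b : Bits (p + 1)) j := fun j => by
    have hlow : ∀ j, j < p + e + c + 3 → wrL (attackBase i pk ev ch b) (p + e + c + 3) (List.ofFn pk) j =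
        attackMem i pk ev ch b ch j := fun j hj => by
      rw [attackMem, wrL_of_lt _ _ (by omega : j < p + e + c + 3 + p)]
    rw [AttackArgs.src, hp, h1]
    induction j using Fin.addCases with
    | left j =>
      rw [Fin.append_left, if_pos (by simp), hlow _ (by simp; omega)]
      exact attackMem_pk ..
    | right j =>
      rw [Fin.append_right, if_neg (by simp)]
      cases i
      · exact (hlow (p + e + c + 1) (by omega)).trans (attackMem_key false pk ev ch b ch 1)
      · exact (hlow (p + e + c + 2) (by omega)).trans (attackMem_zero ..)
  rw [heisL_call Re _ _ _ _ (fun j _ => attackArgs_src_lt ..) h3.ge hsrc hsrc hM2 hM2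
    (by rw [← h4]; exact hF), h2]
  rfl

theorem attackArgs_phi_ciphertext (j : Fin 2) (s : Fin c) :
    (attackArgs Re C₁ C₂).phi₂ r i (1 + (j * c + s)) =
      (attackArgs Re C₁ C₂).slot (if j = 0 then i else !i) + s := by
  have := s.2
  fin_cases j <;> simp only [Fin.zero_eta, Fin.mk_one, if_true, one_ne_zero,
    if_false, Nat.zero_mul, Nat.one_mul, Nat.zero_add]
  · rcases attackArgs_phi_second Re C₁ C₂ r i (1 + s) with ⟨a1, ea⟩ | ⟨a1, a2, ea⟩ |
      ⟨a1, a2, ea⟩ | ⟨a1, a2, ea⟩ | ⟨a1, ea⟩ <;> omega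
  · rcases attackArgs_phi_second Re C₁ C₂ r i (1 + (c + s)) with ⟨a1, ea⟩ | ⟨a1, a2, ea⟩ |
      ⟨a1, a2, ea⟩ | ⟨a1, a2, ea⟩ | ⟨a1, ea⟩ <;> omega

/-- The attack plays the experiment with key bit `1` at the challenged position and a uniform bit at
the other one, the challenge serving as one ciphertext and its own encryption as the other. -/
theorem chan_attackCircuit (o : Bool) :
    (attackCircuit Re C₁ C₂ r i).chan (ketbra (Fin.append (Fin.append pk ev) ch))
      (fun _ => o) (fun _ => o) =
    1 / 2 * ∑ b : Bool, ∑ y : Bits c, (Re.prob (Fin.append pk fun _ => bif i then false else b) y : ℂ) *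
      ∑ a, ∑ a', C₁.chan (ketbra (Fin.append pk (Fin.append pk ev))) a a' *
        attackK C₂ r o (slotPair i true b) (slotPair i ch y) a a' := by
  obtain ⟨h1, h2, h3, h4, h5, h6⟩ := attackArgs_eqs Re C₁ C₂
  rw [ketbra, QCircuit.chan_single, attackCircuit, QCircuit.rawGates_ofRaw,
    QCircuit.rawOut_ofRaw, heisL_attackGates]
  · refine congrArg (1 / 2 * ·) (Finset.sum_congr rfl fun b _ => Finset.sum_congr rfl fun y _ =>
      congrArg (_ * ·) ?_)
    have hz := attackArgs_phi_zone Re C₁ C₂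
    have hs := attackArgs_slot Re C₁ C₂ i
    refine heisL_attackTail C₁ C₂ (attackArgs_phi_injective Re C₁ C₂)
      (attackArgs_phi_second_injective Re C₁ C₂ r i) o ?_ ?_ ?_ ?_ (attackMem_key i pk ev ch b y 0)
      (attackMem_key i pk ev ch b y 1) (attackArgs_q_ne Re C₁ C₂ r (j := 1) (by omega)) ?_ ?_ rfl
      ?_ ?_ ?_ ?_
    · intro j
      rw [attackArgs_phi]
      induction j using Fin.addCases with
      | left j =>
        rw [Fin.append_left, if_pos (by simp)]
        exact attackMem_pk ..
      | right j =>
        rw [Fin.append_right, if_neg (by simp)]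
        induction j using Fin.addCases with
        | left j =>
          rw [Fin.append_left, if_pos (by simp)]
          simp only [Fin.val_natAdd, Fin.val_castAdd, Nat.add_sub_cancel_left]
          exact attackMem_copy ..
        | right j =>
          rw [Fin.append_right, if_neg (by simp), if_pos (by simp)]
          simp only [Fin.val_natAdd, Nat.add_sub_cancel_left]
          exact attackMem_ev ..
    · intro j hj
      refine attackMem_of_le _ _ _ _ _ _ ?_
      rw [attackArgs_phi, if_neg (by omega), if_neg (by omega), if_neg (by omega)]
      omega
    · intro j
      have := hz j
      omega
    · intro j
      have := hz j
      omega
    · intro hr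
      rcases attackArgs_q Re C₁ C₂ r with ⟨-, hq⟩ | ⟨hr', -⟩
      · exact hq
      · rw [hr] at hr'; simp at hr'
    · intro hr
      rcases attackArgs_q Re C₁ C₂ r with ⟨hr', -⟩ | ⟨-, hq⟩
      · rw [hr] at hr'; simp at hr'
      · rw [hq]
        exact ⟨fun j => by have := hz j; omega, attackMem_zero ..⟩
    · intro j s
      rw [attackArgs_phi_ciphertext]
      fin_cases j <;> cases i
      · exact attackMem_challenge false pk ev ch b y s
      · exact attackMem_enc true pk ev ch b y s
      · exact attackMem_enc false pk ev ch b y s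
      · exact attackMem_challenge true pk ev ch b y s
    · intro j s k
      have := hz k
      have := s.2
      rw [attackArgs_phi_ciphertext]
      fin_cases j <;> rcases hs with ⟨-, hs, hs'⟩ | ⟨-, hs, hs'⟩ <;>
        simp only [Fin.zero_eta, Fin.mk_one, if_true, one_ne_zero, if_false, hs, hs'] <;> omega
    · intro j
      have := j.2
      rcases attackArgs_phi_second Re C₁ C₂ r i (1 + 2 * c + j) with ⟨a1, ea⟩ | ⟨a1, a2, ea⟩ |
        ⟨a1, a2, ea⟩ | ⟨a1, a2, ea⟩ | ⟨a1, ea⟩ <;> try omega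
      rw [ea]
      exact congrArg (fun k => (attackArgs Re C₁ C₂).phi₁ (C₁.rawOut (Fin.natAdd 1 k)))
        (Fin.ext (Nat.add_sub_cancel_left ..))
    · intro j hj
      rcases attackArgs_phi_second Re C₁ C₂ r i j with ⟨a1, ea⟩ | ⟨a1, a2, ea⟩ |
        ⟨a1, a2, ea⟩ | ⟨a1, a2, ea⟩ | ⟨a1, ea⟩ <;> try omega
      refine ⟨p + (p + e) + C₁.fresh + (j - (1 + 2 * c + d)), by omega, ?_⟩
      rw [ea, attackArgs_phi, if_neg (by omega), if_neg (by omega), if_neg (by omega)]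
      omega
  · refine ((tracedOn_obs _ _ _).mono fun j hj => ?_).heisL fun g hg =>
      ((goodOn_attackTail Re C₁ C₂ r i).on g hg).mono fun j hj => hj.2
    rintro ⟨k, rfl⟩
    exact (attackArgs_phi_second_mem Re C₁ C₂ r i (C₂.rawOut_lt k)).2 hj

end Attack

/-! ### The indistinguishability experiment as a sum over keys and ciphertexts. -/

theorem QCircuit.chan_tensor_ketbra {a b c m : ℕ} (C : QCircuit (a + (b + c)) m) (x : Bits a)
    {σ : Op (Bits (b + c))} {x' : Bits b} {w : Bits c → ℂ}
    (hσ : ∀ x₁ x₂ e₁ e₂, σ (Fin.append x₁ e₁) (Fin.append x₂ e₂) =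
      if x₁ = x' ∧ x₂ = x' ∧ e₁ = e₂ then w e₁ else 0) (u v : Bits m) :
    C.chan (tensor (ketbra x) σ) u v =
      ∑ e, w e * C.chan (ketbra (Fin.append x (Fin.append x' e))) u v := by
  rw [chan_eq_sum, sum_tensor_mul, Finset.sum_eq_single x, Finset.sum_eq_single x]
  · simp only [ketbra, Matrix.single_apply_same, one_mul]
    exact sum_classical hσ fun z z' =>
      C.chan (Matrix.single (Fin.append x z) (Fin.append x z') 1) u v
  · intro k _ hk
    simp [ketbra, Matrix.single, hk.symm]
  · simp
  · intro k _ hk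
    simp [ketbra, Matrix.single, hk.symm]
  · simp

theorem encChan_eq_sum (Q : QuantumHE) (κ : ℕ) (pk : Bits (Q.pkLen κ)) (ρ : Op Bool)
    (w w' : Bits (Q.ctLen κ)) :
    Q.encChan κ pk ρ w w' = ∑ s, ∑ s', ρ s s' * Q.encChan κ pk (Matrix.single s s' 1) w w' := by
  simp only [QuantumHE.encChan]
  rw [QCircuit.chan_eq_sum]
  simp only [QCircuit.chan_eq_sum _ (tensor _ (Matrix.submatrix (Matrix.single _ _ _) _ _)),
    Finset.mul_sum]
  rw [sum_comm_pair]
  refine Finset.sum_congr rfl fun x _ => Finset.sum_congr rfl fun y _ => ?_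
  rw [Finset.sum_eq_single (dropBits x 0), Finset.sum_eq_single (dropBits y 0)]
  · simp only [tensor, Matrix.of_apply, Matrix.submatrix_apply, Matrix.single_apply_same]
    ring
  · intro s _ hs
    simp [tensor, Matrix.single, hs]
  · simp
  · intro s _ hs
    simp [tensor, Matrix.single, hs]
  · simp

/-- Sums over the ciphertexts in the indistinguishability experiment. -/
theorem sum_challenge {l : ℕ} {Φ : Op Bool → Op (Bits (1 + 2 * l))}
    {P : Bits 2 → (Fin 2 → Bits l) → ℂ}
    (hΦ : ∀ ρ w w', Φ ρ w w' = ∑ s, ∑ s', ρ s s' * Φ (Matrix.single s s' 1) w w')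
    (hΦ' : ∀ s s', Φ (Matrix.single s s' 1) = ∑ k : Bits 2, ∑ y : Fin 2 → Bits l,
      (P k y * sg (k 1 && xor s s')) •
        Matrix.single (pack (xor s (k 0)) y) (pack (xor s' (k 0)) y) 1) (r : Bool) (ρ : Op Bool)
    (G : Bits (1 + 2 * l) → Bits (1 + 2 * l) → ℂ) :
    ∑ w, ∑ w', (if r then Φ ρ else ρ.trace • Φ (ketbra false)) w w' * G w w' =
      ∑ k : Bits 2, ∑ y, P k y * ∑ s, ∑ s', ρ s s' *
        if r then sg (k 1 && xor s s') * G (pack (xor s (k 0)) y) (pack (xor s' (k 0)) y)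
        else if s = s' then G (pack (k 0) y) (pack (k 0) y) else 0 := by
  have henc : ∀ s s', ∑ w, ∑ w', Φ (Matrix.single s s' 1) w w' * G w w' =
      ∑ k : Bits 2, ∑ y, P k y *
        (sg (k 1 && xor s s') * G (pack (xor s (k 0)) y) (pack (xor s' (k 0)) y)) := by
    intro s s'
    rw [hΦ']
    simp only [Matrix.sum_apply, Matrix.smul_apply, smul_eq_mul, Finset.sum_mul]
    rw [sum_comm_pair]
    refine Finset.sum_congr rfl fun k _ => Finset.sum_congr rfl fun y _ => ?_
    rw [Finset.sum_eq_single (pack (xor s (k 0)) y), Finset.sum_eq_single (pack (xor s' (k 0)) y)]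
    · rw [Matrix.single_apply_same]
      ring
    · intro b _ hb; simp [Matrix.single, Ne.symm hb]
    · simp
    · intro b _ hb; simp [Matrix.single, Ne.symm hb]
    · simp
  cases r
  · have h := henc false false
    simp only [Bool.false_xor, Bool.and_false, sg_false, one_mul] at h
    simp only [Bool.false_eq_true, if_false, Matrix.smul_apply, smul_eq_mul, mul_assoc,
      ← Finset.mul_sum]
    refine (congrArg (ρ.trace * ·) h).trans ?_
    simp only [Finset.mul_sum]
    refine Finset.sum_congr rfl fun k _ => Finset.sum_congr rfl fun y _ => ?_
    simp [Matrix.trace]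
    ring
  · simp only [if_true]
    have h : ∀ w w', Φ ρ w w' * G w w' =
        ∑ s, ∑ s', ρ s s' * (Φ (Matrix.single s s' 1) w w' * G w w') := by
      intro w w'
      rw [hΦ]
      simp only [Finset.sum_mul, mul_assoc]
    simp only [h]
    rw [sum_comm_pair]
    simp only [← Finset.mul_sum, henc]
    simp only [Finset.mul_sum]
    rw [sum_comm_pair]
    refine Finset.sum_congr rfl fun k _ => Finset.sum_congr rfl fun y _ =>
      Finset.sum_congr rfl fun s _ => Finset.sum_congr rfl fun s' _ => ?_
    ring

theorem sum_rotate {α β γ : Type} [Fintype α] [Fintype β] [Fintype γ] (F : α → β → γ → ℂ) :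
    ∑ a, ∑ b, ∑ c, F a b c = ∑ c, ∑ a, ∑ b, F a b c :=
  (Finset.sum_congr rfl fun _ _ => Finset.sum_comm).trans Finset.sum_comm

theorem sum_bits_one (F : Bits 1 → ℂ) : ∑ u, F u = ∑ s : Bool, F fun _ => s :=
  Fintype.sum_equiv (Equiv.funUnique (Fin 1) Bool) _ _ fun u =>
    congrArg F (funext fun i => congrArg u (Subsingleton.elim i _))

theorem sum_append_pair {a b : ℕ} (F : Bits (a + b) → Bits (a + b) → ℂ) :
    ∑ u, ∑ v, F u v = ∑ z, ∑ z', ∑ w, ∑ w', F (Fin.append w z) (Fin.append w' z') := by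
  rw [sum_comm_pair (F := fun z z' w w' => F (Fin.append w z) (Fin.append w' z')), sum_append]
  refine Finset.sum_congr rfl fun w _ => ?_
  simp only [sum_append]
  exact Finset.sum_comm

/-- The challenger acts only on the message qubit. Separating message from environment in the sums
turns the second part of the adversary into `attackK`, the functional that also describes the attack
circuit. -/
theorem QCircuit.chan_challenge {l d : ℕ} (C : QCircuit (1 + 2 * l + d) 1)
    {χ : Op Bool → Op (Bits (1 + 2 * l))} {P : Bits 2 → (Fin 2 → Bits l) → ℂ} {r : Bool}
    (hχ : ∀ (ρ : Op Bool) (G : Bits (1 + 2 * l) → Bits (1 + 2 * l) → ℂ),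
      ∑ w, ∑ w', χ ρ w w' * G w w' = ∑ k : Bits 2, ∑ y, P k y * ∑ s, ∑ s', ρ s s' *
        if r then sg (k 1 && xor s s') * G (pack (xor s (k 0)) y) (pack (xor s' (k 0)) y)
        else if s = s' then G (pack (k 0) y) (pack (k 0) y) else 0)
    (T : Op (Bits (1 + d))) (o : Bool) :
    C.chan ((withEnv (Bits d) χ (T.submatrix (fun z : Bool × Bits d => Fin.append (fun _ => z.1) z.2)
      (fun z => Fin.append (fun _ => z.1) z.2))).submatrix (fun u => (takeBits u, dropBits u))
        (fun u => (takeBits u, dropBits u))) (fun _ => o) (fun _ => o) =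
      ∑ k, ∑ y, P k y * ∑ a, ∑ a', T a a' * attackK C r o k y a a' := by
  rw [chan_eq_sum, sum_append_pair]
  simp only [withEnv, Matrix.submatrix_apply, Matrix.of_apply, takeBits_append, dropBits_append, hχ]
  rw [sum_comm_pair]
  simp only [← Finset.mul_sum]
  refine Finset.sum_congr rfl fun k _ => Finset.sum_congr rfl fun y _ => congrArg (P k y * ·) ?_
  rw [sum_append_pair]
  refine Finset.sum_congr rfl fun z _ => Finset.sum_congr rfl fun z' _ => ?_
  rw [sum_bits_one]
  refine Finset.sum_congr rfl fun s _ => ?_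
  rw [sum_bits_one]
  refine Finset.sum_congr rfl fun s' _ => congrArg (_ * ·) ?_
  have h : ∀ (s : Bool) (z : Bits d), (Fin.append (fun _ => s) z : Bits (1 + d)) 0 = s :=
    fun s z => Fin.append_left (fun _ : Fin 1 => s) z 0
  simp only [attackK, h, dropBits_append]

section Game

variable {E : ClassicalHE} {κ : ℕ}

/-- The probability that the second part of the adversary outputs `o`, for given keys and
ciphertexts of the key `k` of the quantum part. -/
def attackVal (A : (scheme E).Adversary) (κ : ℕ) (r o : Bool)
    (pk : Bits (E.pkLen κ)) (ev : Bits (E.evkLen κ)) (k : Bits 2)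
    (y : Fin 2 → Bits (E.ctLen κ)) : ℂ :=
  ∑ a, ∑ a', (A.first κ).chan (ketbra (Fin.append pk (Fin.append pk ev))) a a' *
    attackK (c := E.ctLen κ) (A.second κ) r o k y a a'

theorem sum_evkState (pk x₁ x₂ : Bits (E.pkLen κ)) (e₁ e₂ : Bits (E.evkLen κ)) :
    (∑ sk, (scheme E).evkState κ pk sk) (Fin.append x₁ e₁ : Bits (E.pkLen κ + E.evkLen κ))
      (Fin.append x₂ e₂ : Bits (E.pkLen κ + E.evkLen κ)) =
      if x₁ = pk ∧ x₂ = pk ∧ e₁ = e₂ then ((∑ sk, E.keyProb κ pk sk e₁ : ℝ) : ℂ) else 0 := by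
  refine (Matrix.sum_apply ..).trans ?_
  refine (Finset.sum_congr rfl fun sk _ => evkState_scheme E κ pk sk x₁ x₂ e₁ e₂).trans ?_
  change ∑ sk : Bits (E.skLen κ), _ = _
  split_ifs <;> simp

/-- The evaluation key register is diagonal, so the experiment is a classical average over keys,
pads and ciphertexts. Its terms `attackVal` also occur in the acceptance probability of the attacks,
which makes the two comparable. -/
theorem chan_challenge (A : (scheme E).Adversary) (pk : Bits (E.pkLen κ)) (r o : Bool) :
    (A.second κ).chan ((withEnv (Bits (A.envLen κ)) ((scheme E).challenge κ pk r)
      ((scheme E).messageState A κ pk)).submatrix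
        (fun u => (takeBits u, dropBits u)) (fun u => (takeBits u, dropBits u)))
        (fun _ => o) (fun _ => o) =
      ∑ e, ((∑ sk, E.keyProb κ pk sk e : ℝ) : ℂ) * ∑ k : Bits 2, ∑ y : Fin 2 → Bits (E.ctLen κ),
        (1 / 4 * ∏ j, (E.encProb κ pk (k j) (y j) : ℂ)) * attackVal A κ r o pk e k y := by
  have hmsg : ∀ a a', (A.first κ).chan (tensor (ketbra pk) (∑ sk, (scheme E).evkState κ pk sk))
      a a' = ∑ e, ((∑ sk, E.keyProb κ pk sk e : ℝ) : ℂ) *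
        (A.first κ).chan (ketbra (Fin.append pk (Fin.append pk e))) a a' :=
    QCircuit.chan_tensor_ketbra (a := E.pkLen κ) (b := E.pkLen κ) (c := E.evkLen κ) (A.first κ) pk
      (sum_evkState pk)
  refine (QCircuit.chan_challenge (l := E.ctLen κ) (A.second κ)
    (sum_challenge (encChan_eq_sum (scheme E) κ pk) (encChan_single E κ pk) r) _ o).trans ?_
  have h : ∀ (T : Op (Bits (1 + A.envLen κ))) (w : Bits (E.evkLen κ) → ℂ)
      (D : Bits (E.evkLen κ) → Op (Bits (1 + A.envLen κ)))
      (P : Bits 2 → (Fin 2 → Bits (E.ctLen κ)) → ℂ)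
      (K : Bits 2 → (Fin 2 → Bits (E.ctLen κ)) → Bits (1 + A.envLen κ) → Bits (1 + A.envLen κ) → ℂ),
      (∀ a a', T a a' = ∑ e, w e * D e a a') → ∑ k, ∑ y, P k y * ∑ a, ∑ a', T a a' * K k y a a' =
        ∑ e, w e * ∑ k, ∑ y, P k y * ∑ a, ∑ a', D e a a' * K k y a a' := by
    intro T w D P K hT
    simp only [hT, Finset.sum_mul, Finset.mul_sum]
    refine ((Finset.sum_congr rfl fun k _ => Finset.sum_congr rfl fun y _ => sum_rotate _).trans
      (sum_rotate _)).trans ?_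
    refine Finset.sum_congr rfl fun e _ => Finset.sum_congr rfl fun k _ =>
      Finset.sum_congr rfl fun y _ => Finset.sum_congr rfl fun a _ =>
      Finset.sum_congr rfl fun a' _ => ?_
    ring
  exact h _ _ _ _ _ hmsg

end Game

/-! ### Hybrid argument and quantum one-time pad. -/

theorem slotPair_true {β : Type} (a b : β) : slotPair true a b = slotPair false b a := by
  funext j
  fin_cases j <;> rfl

theorem sum_slotPair {β : Type} [Fintype β] (i : Bool) (F : (Fin 2 → β) → ℝ) :
    ∑ y, F y = ∑ a, ∑ b, F (slotPair i a b) := by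
  have h : ∑ y, F y = ∑ a, ∑ b, F (slotPair false a b) := by
    rw [← Fintype.sum_prod_type']
    refine Fintype.sum_equiv (finTwoArrowEquiv β) _ _ fun y => congrArg F ?_
    funext j
    fin_cases j <;> rfl
  cases i
  · exact h
  · simp only [slotPair_true]
    rw [h]
    exact Finset.sum_comm

theorem prod_slotPair {β γ : Type} (f : β → γ → ℝ) (i : Bool) (a b : β) (x y : γ) :
    ∏ j, f (slotPair i a b j) (slotPair i x y j) = f a x * f b y := by
  rw [Fin.prod_univ_two]
  cases i
  · rfl
  · exact mul_comm _ _

/-- The hybrid argument: first the bit at position 0 is replaced by 0, then the bit at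
position 1. -/
theorem hybrid (g : Bits 2 → Bits 2 → ℝ) :
    1 / 4 * ∑ k, g k k - 1 / 4 * ∑ k, g k (fun _ => false) = 1 / 2 * ∑ i : Bool,
      (1 / 2 * ∑ b : Bool, g (slotPair i true b) (slotPair i true (bif i then false else b)) -
        1 / 2 * ∑ b : Bool, g (slotPair i true b) (slotPair i false (bif i then false else b))) := by
  have h0 : (fun _ => false : Bits 2) = slotPair false false false := by
    funext j
    fin_cases j <;> rfl
  -- Terms whose replaced key bit is already `0` cancel; the remaining half, with that bit equal to
  -- `1`, is the right-hand side.
  rw [sum_slotPair false, sum_slotPair false, h0]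
  simp only [Fintype.sum_bool, slotPair_true, cond_true, cond_false]
  ring

/-- The quantum one-time pad. -/
theorem sum_attackK {c d : ℕ} (C : QCircuit (1 + 2 * c + d) 1) (o : Bool) (y : Fin 2 → Bits c)
    (a a' : Bits (1 + d)) :
    ∑ k, attackK C true o k y a a' = ∑ k, attackK C false o k y a a' := by
  have h : ∀ F : Bits 2 → ℂ, ∑ k, F k = ∑ x, ∑ z, F (slotPair false x z) := by
    intro F
    rw [← Fintype.sum_prod_type']
    refine Fintype.sum_equiv (finTwoArrowEquiv Bool) _ _ fun y => congrArg F ?_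
    funext j
    fin_cases j <;> rfl
  have h0 : ∀ x z : Bool, slotPair false x z 0 = x := fun _ _ => rfl
  have h1 : ∀ x z : Bool, slotPair false x z 1 = z := fun _ _ => rfl
  rw [h, h]
  simp only [attackK, if_true, Bool.false_eq_true, if_false, h0, h1, Fintype.sum_bool]
  -- Off the diagonal the two signs of the `Z` key cancel; on the diagonal the `X` key takes both
  -- values, so both experiments give the maximally mixed qubit.
  cases a 0 <;> cases a' 0 <;> simp
  ring

/-- The second part preserves the trace, so its two outcome probabilities add up to the trace of its
input. -/
theorem sum_attackK_false {c d : ℕ} (C : QCircuit (1 + 2 * c + d) 1) (k : Bits 2)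
    (y : Fin 2 → Bits c) (a a' : Bits (1 + d)) :
    ∑ o, attackK C false o k y a a' = if a = a' then 1 else 0 := by
  have htr : ∀ ρ, ∑ o, C.chan ρ (fun _ => o) (fun _ => o) = ρ.trace := fun ρ => by
    rw [← C.trace_chan ρ, Matrix.trace, sum_bits_one]
    rfl
  have ha : ∀ a : Bits (1 + d), a = Fin.append (fun _ => a 0) (dropBits a) := fun a => by
    conv_lhs => rw [← append_take_drop a]
    congr 1
    funext i
    rw [Subsingleton.elim i 0]
    rfl
  simp only [attackK, Bool.false_eq_true, if_false]
  by_cases h : a 0 = a' 0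
  · simp only [h, if_true, htr]
    by_cases h' : dropBits a = dropBits a'
    · rw [h', if_pos (by rw [ha a, ha a', h, h']), Matrix.trace_single_eq_same]
    · rw [if_neg (fun e => h' (by rw [e])), Matrix.trace_single_eq_of_ne]
      exact fun e => h' (append_eq_append_iff.1 e).2
  · simp only [h, if_false, Finset.sum_const_zero]
    rw [if_neg fun e => h (by rw [e])]

theorem sum_sum_mul {α γ : Type} [Fintype α] [Fintype γ] (D : α → α → ℂ) (K : γ → α → α → ℂ) :
    ∑ k, ∑ a, ∑ a', D a a' * K k a a' = ∑ a, ∑ a', D a a' * ∑ k, K k a a' := by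
  rw [← sum_rotate]
  simp only [← Finset.mul_sum]

/-! ### The winning probability. -/

section Game

variable {E : ClassicalHE} {κ : ℕ}

theorem sum_attackVal (A : (scheme E).Adversary) (o : Bool) (pk : Bits (E.pkLen κ))
    (ev : Bits (E.evkLen κ)) (y : Fin 2 → Bits (E.ctLen κ)) :
    ∑ k, attackVal A κ true o pk ev k y = ∑ k, attackVal A κ false o pk ev k y := by
  refine (sum_sum_mul ..).trans (Eq.trans ?_ (sum_sum_mul ..).symm)
  refine Finset.sum_congr rfl fun a _ => Finset.sum_congr rfl fun a' _ => congrArg (_ * ·) ?_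
  exact sum_attackK (c := E.ctLen κ) (A.second κ) o y a a'

theorem sum_attackVal_false (A : (scheme E).Adversary) (pk : Bits (E.pkLen κ))
    (ev : Bits (E.evkLen κ)) (k : Bits 2) (y : Fin 2 → Bits (E.ctLen κ)) :
    ∑ o, attackVal A κ false o pk ev k y = 1 := by
  refine (sum_sum_mul ..).trans ?_
  refine (Finset.sum_congr rfl fun a _ => Finset.sum_congr rfl fun a' _ => congrArg (_ * ·)
    (sum_attackK_false (c := E.ctLen κ) (A.second κ) k y a a')).trans ?_
  simp only [mul_ite, mul_one, mul_zero, Finset.sum_ite_eq, Finset.mem_univ, if_true]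
  refine (QCircuit.trace_chan (A.first κ) _).trans ?_
  exact Matrix.trace_single_eq_same _ _

theorem sum_keyProb (E : ClassicalHE) (κ : ℕ) : ∑ pk, ∑ sk, ∑ e, E.keyProb κ pk sk e = 1 := by
  have h := (E.keyGen κ).sum_prob (fun i => i.elim0)
  have h2 : ((∑ y, (E.keyGen κ).prob (fun i => i.elim0) y : ℝ) : ℂ) = 1 := by rw [h]; simp
  push_cast at h2
  rw [sum_append, sum_append] at h2
  unfold ClassicalHE.keyProb
  exact_mod_cast h2

/-- The probability of the output `o` for given keys, if the bits `μ` are encrypted instead of the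
key `k` of the quantum part. -/
def gameProb (A : (scheme E).Adversary) (r o : Bool) (pk : Bits (E.pkLen κ))
    (ev : Bits (E.evkLen κ)) (k μ : Bits 2) : ℝ :=
  ∑ y : Fin 2 → Bits (E.ctLen κ), (∏ j, E.encProb κ pk (μ j) (y j)) *
    (attackVal A κ r o pk ev k y).re

/-- The probability that the second part of the adversary outputs `o`, if `r` is chosen. -/
def outputVal (A : (scheme E).Adversary) (κ : ℕ) (r o : Bool) : ℝ :=
  ∑ pk, ∑ sk, ∑ e, E.keyProb κ pk sk e * (1 / 4 * ∑ k, gameProb A r o pk e k k)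

theorem winProb_eq (A : (scheme E).Adversary) :
    (scheme E).winProb A κ = ∑ r : Bool, 1 / 2 * outputVal A κ r r := by
  unfold QuantumHE.winProb outputVal
  refine Finset.sum_congr rfl fun r _ => congrArg (1 / 2 * ·)
    (Finset.sum_congr rfl fun pk _ => ?_)
  refine (congrArg Complex.re (chan_challenge A pk r r)).trans ?_
  rw [Finset.sum_comm, Complex.re_sum]
  refine Finset.sum_congr rfl fun e _ => ?_
  rw [Complex.re_ofReal_mul, ← Finset.sum_mul]
  refine congrArg (_ * ·) ?_
  rw [Complex.re_sum, Finset.mul_sum]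
  refine Finset.sum_congr rfl fun k _ => ?_
  rw [Complex.re_sum]
  refine Eq.trans ?_ (Finset.mul_sum ..).symm
  refine Finset.sum_congr rfl fun y _ => ?_
  have : (1 / 4 * ∏ j, (E.encProb κ pk (k j) (y j) : ℂ)) =
      ((1 / 4 * ∏ j, E.encProb κ pk (k j) (y j) : ℝ) : ℂ) := by push_cast; rfl
  rw [this, Complex.re_ofReal_mul, mul_assoc]

/-- The attack on the classical scheme at position `i`. -/
def attack (A : (scheme E).Adversary) (r i : Bool) (κ : ℕ) :
    QCircuit (E.pkLen κ + E.evkLen κ + E.ctLen κ) 1 :=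
  attackCircuit (E.enc κ) (A.first κ) (A.second κ) r i

/-- The challenge ciphertext and the attack's own encryption together form a pair of independent
encryptions, so acceptance is a game in which the encrypted bits and the pad need not coincide. -/
theorem acceptProb_attack (A : (scheme E).Adversary) (r i μ : Bool) :
    E.acceptProb κ (attack A r i κ) μ = ∑ pk, ∑ sk, ∑ e, E.keyProb κ pk sk e *
      (1 / 2 * ∑ b : Bool, gameProb A r true pk e (slotPair i true b)
        (slotPair i μ (bif i then false else b))) := by
  unfold ClassicalHE.acceptProb
  refine Finset.sum_congr rfl fun pk _ => Finset.sum_congr rfl fun sk _ =>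
    Finset.sum_congr rfl fun e _ => congrArg (E.keyProb κ pk sk e * ·) ?_
  have hp : ∀ ch, (attack A r i κ).prob (ketbra (Fin.append (Fin.append pk e) ch)) true =
      1 / 2 * ∑ b : Bool, ∑ y, E.encProb κ pk (bif i then false else b) y *
        (attackVal A κ r true pk e (slotPair i true b) (slotPair i ch y)).re := by
    intro ch
    refine (congrArg Complex.re (chan_attackCircuit (E.enc κ) (A.first κ) (A.second κ) r i pk e ch
      true)).trans ?_
    rw [show (1 / 2 : ℂ) = ((1 / 2 : ℝ) : ℂ) by push_cast; rfl, Complex.re_ofReal_mul,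
      Complex.re_sum]
    refine congrArg (1 / 2 * ·) (Finset.sum_congr rfl fun b _ => ?_)
    rw [Complex.re_sum]
    refine Finset.sum_congr rfl fun y _ => ?_
    rw [Complex.re_ofReal_mul]
    rfl
  simp only [hp, gameProb]
  simp only [sum_slotPair i, prod_slotPair, Finset.mul_sum]
  rw [Finset.sum_comm]
  refine Finset.sum_congr rfl fun b _ => Finset.sum_congr rfl fun ch _ =>
    Finset.sum_congr rfl fun y _ => ?_
  ring

/-- The distance between honest encryptions of the pad and encryptions of zeros telescopes through
the two hybrid steps. Each step contributes half an advantage, because only the value `1` of a key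
bit is affected. -/
theorem outputVal_sub (A : (scheme E).Adversary) (r : Bool) :
    outputVal A κ r true - ∑ pk, ∑ sk, ∑ e, E.keyProb κ pk sk e *
      (1 / 4 * ∑ k, gameProb A r true pk e k fun _ => false) =
    1 / 2 * ∑ i : Bool, (E.acceptProb κ (attack A r i κ) true -
      E.acceptProb κ (attack A r i κ) false) := by
  simp only [acceptProb_attack, outputVal, ← Finset.sum_sub_distrib, ← mul_sub]
  rw [Finset.sum_comm (γ := Bool), Finset.mul_sum]
  refine Finset.sum_congr rfl fun pk _ => ?_
  rw [Finset.sum_comm (γ := Bool), Finset.mul_sum]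
  refine Finset.sum_congr rfl fun sk _ => ?_
  rw [Finset.sum_comm (γ := Bool), Finset.mul_sum]
  refine Finset.sum_congr rfl fun e _ => ?_
  rw [← Finset.mul_sum]
  have h := hybrid (gameProb A r true pk e)
  simp only [← mul_sub, ← Finset.sum_sub_distrib] at h
  rw [h]
  ring

/-- When the encrypted bits do not depend on the pad, the average over the pad can be taken inside
and the one-time pad hides the choice of `r`. -/
theorem sum_gameProb (A : (scheme E).Adversary) (o : Bool) (pk : Bits (E.pkLen κ))
    (ev : Bits (E.evkLen κ)) (μ : Bits 2) :
    ∑ k, gameProb A true o pk ev k μ = ∑ k, gameProb A false o pk ev k μ := by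
  unfold gameProb
  rw [Finset.sum_comm, Finset.sum_comm (s := Finset.univ (α := Bits 2))]
  refine Finset.sum_congr rfl fun y _ => ?_
  rw [← Finset.mul_sum, ← Finset.mul_sum, ← Complex.re_sum, ← Complex.re_sum, sum_attackVal]

/-- For `r = false` the two outcomes exhaust all possibilities, so winning in that case can be
expressed by the probability of the output `1`. -/
theorem sum_outputVal (A : (scheme E).Adversary) : ∑ o, outputVal A κ false o = 1 := by
  unfold outputVal
  rw [Finset.sum_comm]
  refine Eq.trans ?_ (sum_keyProb E κ)
  refine Finset.sum_congr rfl fun pk _ => ?_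
  rw [Finset.sum_comm]
  refine Finset.sum_congr rfl fun sk _ => ?_
  rw [Finset.sum_comm]
  refine Finset.sum_congr rfl fun e _ => ?_
  rw [← Finset.mul_sum, ← Finset.mul_sum, Finset.sum_comm]
  have h : ∀ k, ∑ o, gameProb A false o pk e k k = 1 := by
    intro k
    unfold gameProb
    rw [Finset.sum_comm, ← sum_prod_eq_one fun j => sum_encProb E κ pk (k j)]
    refine Finset.sum_congr rfl fun y _ => ?_
    rw [← Finset.mul_sum, ← Complex.re_sum, sum_attackVal_false, Complex.one_re, mul_one]
  simp only [h]
  simp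

/-- Winning exceeds `1/2` by half the difference between the probabilities of output `1` for `r = 1`
and for `r = 0`. Both are close to the same value with encryptions of zeros, up to the advantages of
the two attacks for each `r`. -/
theorem winProb_le (A : (scheme E).Adversary) : (scheme E).winProb A κ ≤ 1 / 2 +
    ∑ r : Bool, ∑ i : Bool, |E.acceptProb κ (attack A r i κ) false -
      E.acceptProb κ (attack A r i κ) true| := by
  have h1 := outputVal_sub (κ := κ) A true
  have h2 := outputVal_sub (κ := κ) A false
  -- With encryptions of zeros the two experiments agree, so `h1` and `h2` now compare with the same
  -- number.
  simp only [sum_gameProb] at h1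
  have h3 := sum_outputVal (κ := κ) A
  rw [winProb_eq]
  simp only [Fintype.sum_bool] at *
  have habs : ∀ r i, |E.acceptProb κ (attack A r i κ) true - E.acceptProb κ (attack A r i κ) false| =
      |E.acceptProb κ (attack A r i κ) false - E.acceptProb κ (attack A r i κ) true| :=
    fun r i => abs_sub_comm _ _
  have e1 := le_abs_self
    (E.acceptProb κ (attack A true true κ) true - E.acceptProb κ (attack A true true κ) false)
  have e2 := le_abs_self
    (E.acceptProb κ (attack A true false κ) true - E.acceptProb κ (attack A true false κ) false)
  have e3 := neg_abs_le
    (E.acceptProb κ (attack A false true κ) true - E.acceptProb κ (attack A false true κ) false)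
  have e4 := neg_abs_le
    (E.acceptProb κ (attack A false false κ) true - E.acceptProb κ (attack A false false κ) false)
  simp only [habs] at e1 e2 e3 e4
  have a1 := abs_nonneg
    (E.acceptProb κ (attack A true true κ) false - E.acceptProb κ (attack A true true κ) true)
  have a2 := abs_nonneg
    (E.acceptProb κ (attack A true false κ) false - E.acceptProb κ (attack A true false κ) true)
  have a3 := abs_nonneg
    (E.acceptProb κ (attack A false true κ) false - E.acceptProb κ (attack A false true κ) true)
  have a4 := abs_nonneg
    (E.acceptProb κ (attack A false false κ) false - E.acceptProb κ (attack A false false κ) true)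
  linarith

theorem attack_poly (A : (scheme E).Adversary) (r i : Bool) :
    PolyTime Data.nat (fun κ => (attack A r i κ).code) := by
  refine PF.code ?_
  have h1 : PF (fun κ => (A.first κ).raw) := by
    have := A.first_poly
    simp only [← QCircuit.enc_raw] at this
    exact this
  have h2 : PF (fun κ => (A.second κ).raw) := by
    have := A.second_poly
    simp only [← QCircuit.enc_raw] at this
    exact this
  refine PF.congr_enc ((PF.attackArgs_raw r i).comp (PF.attackArgs (PF.pkLen E) (PF.evkLen E)
    (PF.ctLen E) (PF.enc_raw E) h1 h2)) fun κ => ?_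
  exact congrArg Enc.enc (attackCircuit_raw (E.enc κ) (A.first κ) (A.second κ) r i).symm

end Game

/-- The bound is a sum of four advantages of polynomial-time attacks on the classical scheme, one
for each `r` and each hybrid step. -/
theorem qIndCPA_scheme {E : ClassicalHE} (hE : E.QIndCPA) : (scheme E).QIndCPA := by
  intro A
  choose ε hε h using fun r i => hE (attack A r i) (attack_poly A r i)
  refine ⟨fun κ => ∑ r : Bool, ∑ i : Bool, ε r i κ, ?_, fun κ => (winProb_le A).trans ?_⟩
  · simp only [Fintype.sum_bool]
    exact ((hε _ _).add (hε _ _)).add ((hε _ _).add (hε _ _))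
  · exact add_le_add le_rfl
      (Finset.sum_le_sum fun r _ => Finset.sum_le_sum fun i _ => h r i κ)

end QHom

end

/-- If there is a fully homomorphic classical encryption scheme that is secure against quantum
adversaries, then there is a quantum homomorphic encryption scheme that is secure, compact and
homomorphic for Clifford circuits, also with preparations and measurements. -/
theorem theorem4p1
    (h : ∃ E : QHom.ClassicalHE, E.FullyHomomorphic ∧ E.QIndCPA) :
    ∃ Q : QHom.QuantumHE,
      Q.QIndCPA ∧ Q.Compact ∧ Q.HomomorphicFor QHom.stabilizerCircuits := by
  obtain ⟨E, ⟨hc, hh⟩, hs⟩ := h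
  exact ⟨QHom.scheme E, QHom.qIndCPA_scheme hs, QHom.compact_scheme hc, QHom.homomorphicFor_stabilizer hh⟩
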